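/- All graphs are finite and simple; $N[S]$ is the set of vertices in $S$ or with a neighbour in $S$. A *hole* is an induced cycle of length at least four; $G$ is *even-hole-free* if it has no hole of even length. A *short pyramid with apex $a$* in $G$ is an induced subgraph that is the union of a triangle $\{b_1,b_2,b_3\}$ not containing $a$ and three paths $R_i$ from $a$ to $b_i$, pairwise vertex-disjoint except for $a$, at least two of them of length at least two and one of length one. A vertex $a$ is *splendid* if $V(G)\setminus N[a]$ is connected, every vertex of $N(a)$ has a neighbour in $V(G)\setminus N[a]$, and $G$ has no short pyramid with apex $a$. $G$ *admits a full star cutset with centre $b$* if $V(G)\setminus N[b]$ is the union of two disjoint nonempty sets with no edges between them. **Extended tree line-graphs.** Let $T$ be a tree with bipartition $(A',B')$ and at least three leaves (vertices of degree one), such that for every $v\in V(T)$ at most one component of $T\setminus v$ contains no leaf of $T$ in $A'$, and at most one contains no leaf of $T$ in $B'$. The graph $H(T)$ obtained from the line graph of $T$ by adding an edge $ab$ on two new vertices, with $a$ adjacent to the edges of $T$ incident with a leaf in $A'$ and $b$ adjacent to those incident with a leaf in $B'$, is an *extended tree line-graph* with *cross-edge* $ab$. A *branch* of $T$ is a path with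 distinct ends, both of degree different from two in $T$, all of whose internal vertices have degree two in $T$. The *shape* of $T$ is the tree whose vertices are the vertices of $T$ of degree different from two, two of them adjacent if they are the ends of a branch of $T$. **Strip systems.** For $A,B,C\subseteq V(G)$ with $A,B\neq\emptyset$ and both disjoint from $C$, a *rung* of $(A,B,C)$ is an induced path of $G$ with ends $x\in A$, $y\in B$ and all internal vertices in $C$, such that if its length is positive then $x\notin B$ and $y\notin A$. $(A,B,C)$ is a *strip* if every vertex of $A\cup B\cup C$ lies in a rung. For a tree $J$ with at least three vertices, a *$J$-strip system* $M$ in $G$ consists of sets $M_{e}\subseteq V(G)$ $(e\in E(J))$ and $M_v\subseteq V(G)$ $(v\in V(J))$ such that: the sets $M_e$ are pairwise disjoint; $M_u\subseteq\bigcup_{uv\in E(J)}M_{uv}$; for $uv\in E(J)$, $(M_{uv}\cap M_u,\,M_{uv}\cap M_v,\,M_{uv}\setminus(M_u\cup M_v))$ is a strip; there are no edges between $M_{uv}$ and $M_{wx}$ if $uv,wx\in E(J)$ and $u,v,w,x$ are distinct; and if $uv,uw\in E(J)$ with $v\ne w$, then $M_u\cap M_{uv}$ is complete to $M_u\cap M_{uw}$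 and there are no other edges between $M_{uv}$ and $M_{uw}$. Let $V(M)=\bigcup_{e\in E(J)}M_e$. An edge $ab$ of $G$ is a *cross-edge* for $M$ with *partition* $(\alpha,\beta)$, where $(\alpha,\beta)$ is a partition of the set of leaves of $J$, if: $J$ has no vertex of degree two; every vertex of $J$ has at most one neighbour in $\alpha$ and at most one in $\beta$; $a,b\notin V(M)$; $N(a)\cap V(M)=\bigcup_{u\in\alpha}M_u$ and $N(b)\cap V(M)=\bigcup_{u\in\beta}M_u$. Let $ab$ be an edge of an even-hole-free graph $G$ that is the cross-edge of some extended tree line-graph that is an induced subgraph of $G$. Say that $(J,M)$ is *optimal for $ab$* if $J$ is the shape of a tree $T$ such that $H(T)$ is an extended tree line-graph and an induced subgraph of $G$ with cross-edge $ab$, and among all such $T$ this shape has the maximum number of edges; $M$ is a $J$-strip system in $G$ with cross-edge $ab$; and, subject to that, $V(M)$ is maximal under inclusion. Let $(\alpha,\beta)$ be the corresponding partition. Let $Z$ be the set of common neighbours of $a,b$. A vertex $y\in Z$ is *$a$-external* if there is a path from $y$ to $V(M)\setminus N[a]$ containing no neighbour of $a$ except $y$; *$b$-external* is defined similarly; and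 $y$ is *major* if it is both. Let $Y\subseteq Z$ be the set of major vertices. A *small subgraph* is a connected induced subgraph $F$ of $G\setminus(V(M)\cup Z\cup\{a,b\})$. **Theorem.** Let $G$ be even-hole-free, let $ab$ be an edge of $G$ where $a$ is splendid, and let $(J,M)$ be optimal for $ab$. Then - every vertex of $V(M)$ with a neighbour in $Z\setminus Y$ belongs to $M_t$ for some $t\in\beta$; and - for each edge $st$ of $J$ with $t\in\alpha$, $M_s\cap M_t=\emptyset$. Moreover, for every small subgraph $F$, let $X$ be the set of vertices in $V(M)$ with a neighbour in $V(F)$; then - if $G$ admits no full star cutset with centre $b$, then $a$ has no neighbour in $V(F)$; - if $V(F)$ is anticomplete to $\{b\}\cup(Z\setminus Y)$, then either $X\subseteq M_e$ for some $e\in E(J)$, or $X\subseteq M_t$ for some $t\in V(J)\setminus\alpha$; - if $b$ or some vertex of $Z\setminus Y$ has a neighbour in $V(F)$, then $X\subseteq M_t$ for some $t\in\beta$. -/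

import Mathlib

namespace TreeStrip

section Graphs

variable {V : Type*} (G : SimpleGraph V)

/-- `G` contains no hole of even length (a hole is an induced cycle of length at least four). -/
def EvenHoleFree : Prop :=
  ∀ n : ℕ, 4 ≤ n → Even n → IsEmpty (SimpleGraph.cycleGraph n ↪g G)

/-- The closed neighbourhood `N[v]`. -/
def closedNbhd (v : V) : Set V := {x | x = v ∨ G.Adj v x}

/-- Two sets of vertices with no edge between them. -/
def Anticomplete (P Q : Set V) : Prop := ∀ x ∈ P, ∀ y ∈ Q, ¬ G.Adj x y

/-- `C` is a cutset: its complement is the union of two disjoint nonempty sets, anticomplete to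
each other. -/
def IsCutset (C : Set V) : Prop :=
  ∃ P Q : Set V, P.Nonempty ∧ Q.Nonempty ∧ Disjoint P Q ∧ P ∪ Q = Cᶜ ∧ Anticomplete G P Q

/-- `G` admits a full star cutset with centre `v`. -/
def HasFullStarCutset (v : V) : Prop := IsCutset G (closedNbhd G v)

/-- A walk that is an induced path of `G`. -/
def IsInducedPath {x y : V} (p : G.Walk x y) : Prop :=
  p.IsPath ∧ ∀ u ∈ p.support, ∀ v ∈ p.support, G.Adj u v → s(u, v) ∈ p.edges

/-- `G` has an induced subgraph that is a short pyramid with apex `a`: the base is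
`{b 0, b 1, b 2}`, the constituent paths are `R 0, R 1, R 2`. -/
def HasShortPyramid (a : V) : Prop :=
  ∃ (b : Fin 3 → V) (R : ∀ i, G.Walk a (b i)),
    (∀ i, b i ≠ a) ∧
    (∀ i j, i ≠ j → G.Adj (b i) (b j)) ∧
    (∀ i, (R i).IsPath) ∧
    (∀ i j, i ≠ j → ∀ x ∈ (R i).support, x ∈ (R j).support → x = a) ∧
    (∃ i j, i ≠ j ∧ 2 ≤ (R i).length ∧ 2 ≤ (R j).length) ∧
    (∀ i j, ∀ x ∈ (R i).support, ∀ y ∈ (R j).support, G.Adj x y →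
      (∃ k, s(x, y) ∈ (R k).edges) ∨ (∃ k l, x = b k ∧ y = b l)) ∧
    (∃ i, (R i).length = 1)

/-- Splendid vertices. -/
structure Splendid (a : V) : Prop where
  connected : (G.induce (closedNbhd G a)ᶜ).Connected
  nbr : ∀ v, G.Adj a v → ∃ w, w ∉ closedNbhd G a ∧ G.Adj v w
  noShortPyramid : ¬ HasShortPyramid G a

/-- The set of common neighbours of `a` and `b`. -/
def commonNbrs (a b : V) : Set V := {z | G.Adj a z ∧ G.Adj b z}

/-- The vertices of `S` with a neighbour in `F`. -/
def attachments (S F : Set V) : Set V := {x | x ∈ S ∧ ∃ f ∈ F, G.Adj x f}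

end Graphs

section Trees

variable {U : Type*} (T : SimpleGraph U)

/-- A leaf: a vertex of degree one. -/
def IsLeaf (v : U) : Prop := (T.neighborSet v).ncard = 1

/-- A branch-vertex: a vertex of degree different from two. -/
def IsBranchVertex (v : U) : Prop := (T.neighborSet v).ncard ≠ 2

/-- There is a branch of `T` with (distinct) ends `u, v`. -/
def HasBranch (u v : U) : Prop :=
  u ≠ v ∧ IsBranchVertex T u ∧ IsBranchVertex T v ∧
    ∃ p : T.Walk u v, p.IsPath ∧ ∀ x ∈ p.support, x ≠ u → x ≠ v → ¬ IsBranchVertex T x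

/-- The shape of `T`: its vertices are the branch-vertices of `T`, two of them being adjacent if
they are the ends of a branch. -/
def shape : SimpleGraph {v : U // IsBranchVertex T v} :=
  SimpleGraph.fromRel fun u v => HasBranch T u.1 v.1

/-- The graph `H(T)` with respect to the bipartition `(A', A'ᶜ)` of `T`: the line graph of `T`
together with two new adjacent vertices `a = inr true` and `b = inr false`, where `a` is adjacent
to the leaf-edges whose leaf is in `A'`, and `b` to those whose leaf is not in `A'`. -/
def lineGraphWithCrossEdge (A' : Set U) : SimpleGraph (T.edgeSet ⊕ Bool) :=
  SimpleGraph.fromRel fun x y =>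
    match x, y with
    | .inl e, .inl f => ∃ v, v ∈ e.1 ∧ v ∈ f.1
    | .inl e, .inr true => ∃ v, v ∈ e.1 ∧ IsLeaf T v ∧ v ∈ A'
    | .inl e, .inr false => ∃ v, v ∈ e.1 ∧ IsLeaf T v ∧ v ∉ A'
    | .inr _, .inr _ => True
    | .inr _, .inl _ => False

/-- The conditions on the tree `T` and its bipartition `(A', A'ᶜ)` under which `H(T)` is an
extended tree line-graph: `T` has at least three leaves, and for every vertex `v`, at most one
component of `T \ v` contains no leaf of `T` from `A'`, and at most one contains no leaf of `T`
from the complement of `A'`. -/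
structure IsGoodTree (A' : Set U) : Prop where
  tree : T.IsTree
  bipartition : ∀ u v, T.Adj u v → (u ∈ A' ↔ v ∉ A')
  leaves : 3 ≤ {v | IsLeaf T v}.ncard
  left : ∀ v : U, {C : (T.induce ({v}ᶜ : Set U)).ConnectedComponent |
    ∀ x ∈ C.supp, ¬ (IsLeaf T x.1 ∧ x.1 ∈ A')}.Subsingleton
  right : ∀ v : U, {C : (T.induce ({v}ᶜ : Set U)).ConnectedComponent |
    ∀ x ∈ C.supp, ¬ (IsLeaf T x.1 ∧ x.1 ∉ A')}.Subsingleton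

/-- For some bipartition of the tree `T`, the graph `H(T)` is an extended tree line-graph, and it is
(isomorphic to) an induced subgraph of `G` in such a way that its cross-edge becomes `ab`. -/
def ContainsExtTreeLineGraph {V : Type*} (G : SimpleGraph V) (a b : V) : Prop :=
  ∃ A' : Set U, IsGoodTree T A' ∧
    ∃ f : lineGraphWithCrossEdge T A' ↪g G, f (Sum.inr true) = a ∧ f (Sum.inr false) = b

end Trees

section Strips

variable {V W : Type*}

/-- `v` lies in a rung of `(A, B, C)`: an induced path with ends `x ∈ A` and `y ∈ B`, all other
vertices in `C`, and, if it has positive length, with `x ∉ B` and `y ∉ A`. -/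
def InRung (G : SimpleGraph V) (A B C : Set V) (v : V) : Prop :=
  ∃ (x y : V) (p : G.Walk x y), IsInducedPath G p ∧ x ∈ A ∧ y ∈ B ∧
    (∀ z ∈ p.support, z ≠ x → z ≠ y → z ∈ C) ∧
    (0 < p.length → x ∉ B ∧ y ∉ A) ∧
    v ∈ p.support

/-- `(A, B, C)` is a strip (`A` and `B` may intersect). -/
structure IsStrip (G : SimpleGraph V) (A B C : Set V) : Prop where
  left_nonempty : A.Nonempty
  right_nonempty : B.Nonempty
  disjoint_left : Disjoint A C
  disjoint_right : Disjoint B C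
  rung : ∀ v ∈ A ∪ B ∪ C, InRung G A B C v

/-- The family of sets underlying a `J`-strip system, where `J` has vertex set `W`: `edge e` is
`M_e` (only used for edges `e` of `J`) and `node v` is `M_v`. -/
structure StripFamily (V W : Type*) where
  edge : Sym2 W → Set V
  node : W → Set V

/-- `V(M)`: the union of the sets `M_e`. -/
def StripFamily.verts (J : SimpleGraph W) (M : StripFamily V W) : Set V :=
  ⋃ e ∈ J.edgeSet, M.edge e

/-- `M` is a `J`-strip system in `G`. -/
structure IsStripSystem (G : SimpleGraph V) (J : SimpleGraph W) (M : StripFamily V W) :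
    Prop where
  tree : J.IsTree
  three_le : 3 ≤ Nat.card W
  disjoint : J.edgeSet.PairwiseDisjoint M.edge
  node_subset : ∀ u, M.node u ⊆ ⋃ v ∈ J.neighborSet u, M.edge s(u, v)
  strip : ∀ u v, J.Adj u v →
    IsStrip G (M.edge s(u, v) ∩ M.node u) (M.edge s(u, v) ∩ M.node v)
      (M.edge s(u, v) \ (M.node u ∪ M.node v))
  anticomplete : ∀ u v w x, J.Adj u v → J.Adj w x → u ≠ w → u ≠ x → v ≠ w → v ≠ x →
    Anticomplete G (M.edge s(u, v)) (M.edge s(w, x))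
  adj_iff : ∀ u v w, J.Adj u v → J.Adj u w → v ≠ w →
    ∀ x ∈ M.edge s(u, v), ∀ y ∈ M.edge s(u, w), (G.Adj x y ↔ x ∈ M.node u ∧ y ∈ M.node u)

/-- The edge `ab` of `G` is a cross-edge for `M` with partition `(α, β)`. -/
structure IsCrossEdge (G : SimpleGraph V) (J : SimpleGraph W) (M : StripFamily V W)
    (a b : V) (α β : Set W) : Prop where
  adj : G.Adj a b
  union : α ∪ β = {v | IsLeaf J v}
  disjoint : Disjoint α β
  degree_ne_two : ∀ v, (J.neighborSet v).ncard ≠ 2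
  three_le : 3 ≤ Nat.card W
  left : ∀ s, (J.neighborSet s ∩ α).Subsingleton
  right : ∀ s, (J.neighborSet s ∩ β).Subsingleton
  notMem : ∀ e ∈ J.edgeSet, a ∉ M.edge e ∧ b ∉ M.edge e
  adj_left : ∀ x ∈ M.verts J, (G.Adj a x ↔ ∃ u ∈ α, x ∈ M.node u)
  adj_right : ∀ x ∈ M.verts J, (G.Adj b x ↔ ∃ u ∈ β, x ∈ M.node u)

/-- `(J, M)` is optimal for `ab`, with corresponding partition `(α, β)`: `J` is the shape of a tree
`T` such that `H(T)` is an extended tree line-graph contained in `G` with cross-edge `ab`, and among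
all such trees it has the maximum number of edges; `M` is a `J`-strip system in `G` with cross-edge
`ab`, and subject to that `V(M)` is maximal under inclusion. -/
structure IsOptimal (G : SimpleGraph V) (a b : V) (J : SimpleGraph W) (M : StripFamily V W)
    (α β : Set W) : Prop where
  exists_tree : ∃ (n : ℕ) (T : SimpleGraph (Fin n)),
    ContainsExtTreeLineGraph T G a b ∧ Nonempty (J ≃g shape T)
  edges_max : ∀ (n : ℕ) (T : SimpleGraph (Fin n)), ContainsExtTreeLineGraph T G a b →
    (shape T).edgeSet.ncard ≤ J.edgeSet.ncard
  system : IsStripSystem G J M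
  crossEdge : IsCrossEdge G J M a b α β
  verts_max : ∀ (M' : StripFamily V W) (α' β' : Set W), IsStripSystem G J M' →
    IsCrossEdge G J M' a b α' β' → ¬ M.verts J ⊂ M'.verts J

/-- `y` is `c`-external relative to a set `S` (to be taken as `V(M)`): there is a path from `y` to
`S \ N[c]` containing no neighbour of `c` except `y`. -/
def IsExternal (G : SimpleGraph V) (S : Set V) (c y : V) : Prop :=
  ∃ x ∈ S \ closedNbhd G c, ∃ p : G.Walk y x, p.IsPath ∧ ∀ z ∈ p.support, G.Adj c z → z = y

/-- The set of major vertices relative to `S` (to be taken as `V(M)`). -/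
def majorVerts (G : SimpleGraph V) (S : Set V) (a b : V) : Set V :=
  {y | y ∈ commonNbrs G a b ∧ IsExternal G S a y ∧ IsExternal G S b y}

/-- `F` is (the vertex set of) a small subgraph, relative to `S` (to be taken as `V(M)`): a
connected induced subgraph of `G` containing none of `a`, `b`, the common neighbours of `a, b`, and
the vertices in `S`. -/
structure IsSmall (G : SimpleGraph V) (S : Set V) (a b : V) (F : Set V) : Prop where
  connected : (G.induce F).Connected
  disjoint : Disjoint F (commonNbrs G a b ∪ S)
  left_notMem : a ∉ F
  right_notMem : b ∉ F

end Strips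

end TreeStrip

open TreeStrip

/-! Put `h true = a`, `h false = b`, `L true = α`, `L false = β`. Inside the strip system the two
hubs play symmetric roles; the symmetry is broken only by `Nondeg`, which comes from the absence of
a short pyramid with apex `a`.

The engine is parity. One rung chosen from each strip gives a subdivided line graph of `J` together
with the hubs (`LineTree`). Three leaves in different directions at a vertex v of `J`, at most one
of them belonging to the other hub, yield a pyramid with base in M_v and apex a hub
(`LineTree.pyr`). In an even-hole-free graph all arms of a pyramid have the same parity. If a path
attaches to two arms otherwise than in two base vertices, and no proper subpath does, then comparing
the odd cycles through the base, through the apex and through the third arm leaves only two patterns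
of attachment (`Pyr.outcome`).

Call vertices of V(M) ∪ {a, b} related if they share some M_e or M_v, with the evident extension to
hubs (`Rel`). Pairwise related vertices of V(M) lie in a common M_e or M_v (`relJ_cases`). If a
connected set has two unrelated attachments, it contains a minimal path p with this property
(`Tight`), and there are three situations.

If p sees no hub, the pyramid lemma shows that at some v it sees all of M_v outside one strip vw,
and elsewhere only that strip, or exactly the corresponding vertices at w as well. Then p can be
added to the strip, against the maximality of V(M) (`tight_att_hub`).

If p sees exactly one hub, it leads from that hub either to exactly one node set M_v or to two
consecutive vertices of a suitable choice of rungs (`hubPath_attach`); otherwise the strip system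
could again be enlarged. In both cases p becomes a pendant edge of a larger tree, after subdividing
an edge in the second case. Subdividing further until every rung is a single vertex produces an
extended tree line-graph with cross-edge ab whose shape has too many edges (`hubPath_false`). Hence
the attachments of a connected set that sees one hub and not the other lie in a single M_t with t a
leaf of that hub (`hub_attachments`).

If a connected set sees some hub, but no vertex of it sees both hubs, its attachments still lie in a
single M_t with t a leaf (`single_leaf`). For otherwise a minimal path links two leaf nodes and sees
both hubs, and counting the hub neighbours along it by sectors gives contradictory parities
(`link_same_false`, `link_diff_false`).

The theorem follows by enlarging the given set. Since `a` is splendid, every common neighbour of `a`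
and `b` is a-external, so members of Z \ Y are not b-external; and any vertex other than `a` outside
V(M) can be joined through the non-neighbours of `a` to a vertex of V(M) that `a` does not see. In a
set also seeing `b`, such an attachment forces the leaf t into `β`. If there is no full star cutset
with centre `b`, the same escape is possible off N[b], and a small subgraph seeing `a` would have
escapes with incompatible ends. -/

namespace TreeStrip

/-! ### Induced paths as lists, and the parity of the cycles they close -/

section InducedLists

variable {V : Type*} (G : SimpleGraph V)

/-- The list `l` enumerates the vertices of an induced path of `G`, in order. -/
def IP : List V → Prop
  | [] => True
  | x :: l => x ∉ l ∧ (∀ y ∈ l, (G.Adj x y ↔ l.head? = some y)) ∧ IP l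

/-- `z` has a neighbour in the list `p`. -/
def Att (p : List V) (z : V) : Prop := ∃ f ∈ p, G.Adj f z

variable {G}

theorem IP.singleton (x : V) : IP G [x] := by simp [IP]

/-- All longer paths and cycles below are glued from pieces. Inducedness of a concatenation amounts
to that of the pieces together with the cross pairs, among which only the junction may be an edge.
-/
theorem IP.append_iff {l₁ l₂ : List V} : IP G (l₁ ++ l₂) ↔ IP G l₁ ∧ IP G l₂ ∧
    ∀ x ∈ l₁, ∀ y ∈ l₂, x ≠ y ∧ (G.Adj x y ↔ l₁.getLast? = some x ∧ l₂.head? = some y) := by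
  induction l₁ with
  | nil => simp [IP]
  | cons a l ih =>
    rw [List.cons_append, IP, IP, ih]
    rcases l with _ | ⟨c, l⟩
    · grind
    grind

theorem IP.reverse {l : List V} (h : IP G l) : IP G l.reverse := by
  induction l with
  | nil => simp [IP]
  | cons a l ih =>
    obtain ⟨h1, h2, h3⟩ := h
    rw [List.reverse_cons, IP.append_iff]
    refine ⟨ih h3, IP.singleton a, ?_⟩
    intro x hx y hy
    simp only [List.mem_reverse, List.mem_singleton] at hx hy
    subst hy
    have := h2 x hx
    simp only [List.getLast?_reverse, List.head?_cons, and_true]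
    rw [G.adj_comm]
    grind

theorem IP.reverse_iff {l : List V} : IP G l.reverse ↔ IP G l :=
  ⟨fun h => by simpa using h.reverse, IP.reverse⟩

theorem IP.nodup {l : List V} (h : IP G l) : l.Nodup := by
  induction l with
  | nil => simp
  | cons a l ih => exact List.nodup_cons.2 ⟨h.1, ih h.2.2⟩

theorem IP.left {l₁ l₂ : List V} (h : IP G (l₁ ++ l₂)) : IP G l₁ := (IP.append_iff.1 h).1

theorem IP.right {l₁ l₂ : List V} (h : IP G (l₁ ++ l₂)) : IP G l₂ := (IP.append_iff.1 h).2.1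

theorem IP.infix {l l' : List V} (h : IP G l') (hl : l <:+: l') : IP G l := by
  obtain ⟨s, t, rfl⟩ := hl
  exact h.left.right

theorem IP.tail {l : List V} (h : IP G l) : IP G l.tail := h.infix (List.tail_suffix l).isInfix

theorem IP.dropLast {l : List V} (h : IP G l) : IP G l.dropLast :=
  h.infix (List.dropLast_prefix l).isInfix

theorem IP.adj_index {l : List V} (h : IP G l) {i j : ℕ} (hi : i < l.length) (hj : j < l.length) :
    G.Adj l[i] l[j] ↔ i + 1 = j ∨ j + 1 = i := by
  induction l generalizing i j with
  | nil => simp at hi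
  | cons a l ih =>
    have key : ∀ (k : ℕ) (hk : k < l.length), l.head? = some l[k] ↔ k = 0 := by
      intro k hk
      have hnd := h.2.2.nodup
      rw [List.head?_eq_getElem?, List.getElem?_eq_some_iff]
      constructor
      · rintro ⟨h0, h1⟩
        exact ((List.Nodup.getElem_inj_iff hnd).1 h1).symm
      grind
    rcases i with _ | i <;> rcases j with _ | j
    · simp
    · have hj' : j < l.length := by simpa using hj
      simp only [List.getElem_cons_zero, List.getElem_cons_succ]
      rw [h.2.1 _ (List.getElem_mem hj'), key j hj']; omega
    · have hi' : i < l.length := by simpa using hi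
      simp only [List.getElem_cons_zero, List.getElem_cons_succ]
      rw [G.adj_comm, h.2.1 _ (List.getElem_mem hi'), key i hi']; omega
    · simp only [List.getElem_cons_succ]
      rw [ih h.2.2 (by simpa using hi) (by simpa using hj)]; omega

/-- The vertex `x` closes the path to an induced cycle. If the path has two vertices this is a
triangle, so the conclusion holds uniformly, with no separate treatment of short cycles. -/
theorem odd_cone (hG : EvenHoleFree G) {x : V} {l : List V} (hl : IP G l) (hx : x ∉ l)
    (h2 : 2 ≤ l.length)
    (hadj : ∀ y ∈ l, (G.Adj x y ↔ l.head? = some y ∨ l.getLast? = some y)) :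
    Odd (l.length + 1) := by
  by_contra hodd
  rw [Nat.not_odd_iff_even] at hodd
  -- An even number that is at least three is at least four, so the cycle is a genuine hole.
  have hn : 4 ≤ l.length + 1 := by grind
  refine (hG (l.length + 1) hn hodd).elim' ?_
  have hnd : (x :: l).Nodup := List.nodup_cons.2 ⟨hx, hl.nodup⟩
  let f : Fin (l.length + 1) → V := fun i => (x :: l)[i.1]'(by grind)
  have key : ∀ (k : ℕ) (hk : k < l.length), G.Adj x l[k] ↔ k = 0 ∨ k + 1 = l.length := by
    intro k hk
    rw [hadj _ (List.getElem_mem hk), List.head?_eq_getElem?, List.getLast?_eq_getElem?,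
      List.getElem?_eq_some_iff, List.getElem?_eq_some_iff]
    constructor
    · rintro (⟨h0, h1⟩ | ⟨h0, h1⟩)
      · left; exact ((List.Nodup.getElem_inj_iff hl.nodup).1 h1).symm
      · right; have := (List.Nodup.getElem_inj_iff hl.nodup).1 h1; omega
    grind
  refine ⟨⟨f, ?_⟩, ?_⟩
  · intro i j hij
    exact Fin.ext ((List.Nodup.getElem_inj_iff hnd).1 hij)
  · intro i j
    obtain ⟨i, hi⟩ := i
    obtain ⟨j, hj⟩ := j
    change G.Adj ((x :: l)[i]) ((x :: l)[j]) ↔ _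
    rw [SimpleGraph.cycleGraph_adj', Fin.sub_def, Fin.sub_def]
    rcases i with _ | i <;> rcases j with _ | j
    · simp
    · simp only [List.getElem_cons_zero, List.getElem_cons_succ]
      rw [key j (by omega)]
      have e1 : (l.length + 1 - (j+1) + 0) % (l.length + 1) = l.length - j := by
        rw [Nat.mod_eq_of_lt] <;> omega
      have e2 : (l.length + 1 - 0 + (j+1)) % (l.length + 1) = j + 1 := by simp_all
      simp only [e1, e2]; omega
    · simp only [List.getElem_cons_zero, List.getElem_cons_succ]
      rw [G.adj_comm, key i (by omega)]
      have e1 : (l.length + 1 - (i+1) + 0) % (l.length + 1) = l.length - i := by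
        rw [Nat.mod_eq_of_lt] <;> omega
      have e2 : (l.length + 1 - 0 + (i+1)) % (l.length + 1) = i + 1 := by simp_all
      simp only [e1, e2]; omega
    · simp only [List.getElem_cons_succ]
      rw [hl.adj_index (by omega) (by omega)]
      have e : ∀ a b : ℕ, a < l.length → b < l.length →
          ((l.length + 1 - (b+1) + (a+1)) % (l.length + 1) = 1 ↔ b + 1 = a) := by
        intro a b ha hb
        rcases le_or_gt b a with h | h
        · have : l.length + 1 - (b+1) + (a+1) = (a - b) + (l.length + 1) := by omega
          rw [this, Nat.add_mod_right, Nat.mod_eq_of_lt] <;> omega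
        · rw [Nat.mod_eq_of_lt] <;> omega
      grind

theorem mem_dropLast_or_getLast? {l : List V} {x : V} (h : x ∈ l) :
    x ∈ l.dropLast ∨ l.getLast? = some x := by
  rcases List.eq_nil_or_concat l with rfl | ⟨l', a, rfl⟩
  · simp at h
  grind

theorem mem_tail_or_head? {l : List V} {x : V} (h : x ∈ l) :
    x ∈ l.tail ∨ l.head? = some x := by
  rcases l with _ | ⟨a, l⟩
  · simp at h
  grind

/-- Two disjoint induced paths are joined at both ends. The conditions on `p.dropLast` and `p.tail`
say that each end of `Q` sees exactly one end of `p`; attachments to truncated paths are the form in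
which the minimality of `p` supplies this. -/
theorem odd_cycle (hG : EvenHoleFree G) {p Q : List V} (hp : IP G p) (hQ : IP G Q)
    (hd : ∀ f ∈ p, f ∉ Q) (hp1 : p ≠ []) (hQ2 : 2 ≤ Q.length)
    (hmid : ∀ z ∈ Q, Att G p z → Q.head? = some z ∨ Q.getLast? = some z)
    (hhead : ∀ z, Q.head? = some z → Att G p z ∧ ¬ Att G p.dropLast z)
    (hlast : ∀ z, Q.getLast? = some z → Att G p z ∧ ¬ Att G p.tail z) :
    Odd (p.length + Q.length) := by
  have hadj : ∀ f ∈ p, ∀ z ∈ Q, G.Adj f z ↔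
      (p.getLast? = some f ∧ Q.head? = some z) ∨ (p.head? = some f ∧ Q.getLast? = some z) := by
    intro f hf z hz
    constructor
    · intro h
      rcases hmid z hz ⟨f, hf, h⟩ with h1 | h1
      · left
        refine ⟨(mem_dropLast_or_getLast? hf).resolve_left fun h2 => ?_, h1⟩
        exact (hhead z h1).2 ⟨f, h2, h⟩
      · right
        refine ⟨(mem_tail_or_head? hf).resolve_left fun h2 => ?_, h1⟩
        exact (hlast z h1).2 ⟨f, h2, h⟩
    · rintro (⟨h1, h2⟩ | ⟨h1, h2⟩)
      · obtain ⟨⟨g, hg, hgz⟩, h3⟩ := hhead z h2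
        rcases mem_dropLast_or_getLast? hg with h4 | h4
        · exact (h3 ⟨g, h4, hgz⟩).elim
        grind
      · obtain ⟨⟨g, hg, hgz⟩, h3⟩ := hlast z h2
        rcases mem_tail_or_head? hg with h4 | h4
        · exact (h3 ⟨g, h4, hgz⟩).elim
        grind
  obtain ⟨x, p', rfl⟩ := List.exists_cons_of_ne_nil hp1
  have hlast' : (p' ++ Q).getLast? = Q.getLast? := by grind
  -- The first vertex of `p` is the cone vertex over the rest of the cycle.
  have h := odd_cone hG (x := x) (l := p' ++ Q) ?_ ?_ ?_ ?_
  · grind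
  · rw [IP.append_iff]
    refine ⟨hp.2.2, hQ, fun f hf z hz => ⟨fun h => hd f (by simp [hf]) (h ▸ hz), ?_⟩⟩
    rw [hadj f (by simp [hf]) z hz]
    have h1 : ¬ (x :: p').head? = some f := by
      simp only [List.head?_cons, Option.some.injEq]; rintro rfl; exact hp.1 hf
    grind
  · rw [List.mem_append]
    rintro (h | h)
    · exact hp.1 h
    grind
  · grind
  · intro y hy
    rw [List.mem_append] at hy
    rw [hlast']
    rcases hy with hy | hy
    · rw [hp.2.1 y hy]
      rcases p' with _ | ⟨c, p'⟩
      · simp at hy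
      grind
    · rw [hadj x (by simp) y hy]
      rcases p' with _ | ⟨c, p'⟩
      · simp
      · have h1 : (x :: c :: p').getLast? ≠ some x := by
          rw [List.getLast?_cons_cons]; exact fun h => hp.1 (List.mem_of_getLast? h)
        grind

theorem Att.mono {p q : List V} {z : V} (h : Att G p z) (hpq : ∀ f ∈ p, f ∈ q) : Att G q z := by
  obtain ⟨f, hf, h⟩ := h
  exact ⟨f, hpq f hf, h⟩

theorem Att.of_dropLast {p : List V} {z : V} (h : Att G p.dropLast z) : Att G p z :=
  h.mono fun _ => List.mem_of_mem_dropLast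

theorem Att.reverse_iff {p : List V} {z : V} : Att G p.reverse z ↔ Att G p z := by
  simp [Att]

theorem exists_first {P : V → Prop} {l : List V} (h : ∃ z ∈ l, P z) :
    ∃ u z v, l = u ++ z :: v ∧ P z ∧ ∀ y ∈ u, ¬ P y := by
  induction l with
  | nil => simp at h
  | cons a l ih =>
    by_cases ha : P a
    · exact ⟨[], a, l, rfl, ha, by simp⟩
    · obtain ⟨u, z, v, rfl, h1, h2⟩ := ih (by grind)
      grind

theorem exists_last {P : V → Prop} {l : List V} (h : ∃ z ∈ l, P z) :
    ∃ u z v, l = u ++ z :: v ∧ P z ∧ ∀ y ∈ v, ¬ P y := by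
  obtain ⟨u, z, v, h1, h2, h3⟩ := exists_first (P := P) (l := l.reverse) (by simpa using h)
  refine ⟨v.reverse, z, u.reverse, ?_, h2, by simpa using h3⟩
  grind

end InducedLists

/-! ### Parities of the cycles formed by a pyramid and a path -/

section Pyramids

variable {V : Type*} {G : SimpleGraph V}

/-- Three induced paths from the triangle of their first vertices to the neighbourhood of the
apex `c`, with no other edges between them. -/
structure Pyr (G : SimpleGraph V) (c : V) (S : Fin 3 → List V) : Prop where
  ip : ∀ i, IP G (S i)
  ne : ∀ i, S i ≠ []
  notMem : ∀ i, c ∉ S i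
  apex : ∀ i, ∀ z ∈ S i, G.Adj c z ↔ (S i).getLast? = some z
  cross : ∀ i j, i ≠ j → ∀ x ∈ S i, ∀ y ∈ S j,
    x ≠ y ∧ (G.Adj x y ↔ (S i).head? = some x ∧ (S j).head? = some y)

theorem IP.getLast?_append_cons {u v : List V} {x : V} :
    (u ++ x :: v).getLast? = (x :: v).getLast? :=
  List.getLast?_append_of_ne_nil _ (by simp)

theorem IP.head?_eq_of_append {u v : List V} {x z : V} (h : IP G (u ++ x :: v)) (hz : z ∈ x :: v)
    (hh : (u ++ x :: v).head? = some z) : u = [] ∧ z = x := by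
  rcases u with _ | ⟨a, u⟩
  · grind
  · simp only [List.cons_append, List.head?_cons, Option.some.injEq] at hh
    subst hh
    exact absurd (List.mem_append_right u hz) h.1

theorem IP.getLast?_eq_of_append {u v : List V} {x z : V} (h : IP G (u ++ x :: v))
    (hz : z ∈ u ++ [x]) (hh : (u ++ x :: v).getLast? = some z) : v = [] ∧ z = x := by
  have h1 := IP.head?_eq_of_append (u := v.reverse) (v := u.reverse) (x := x) (z := z)
    (by simpa using h.reverse) (by grind) (by grind)
  simpa using h1

theorem IP.adj_split {u v : List V} {x y z : V} (h : IP G (u ++ x :: v))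
    (hy : y ∈ u ++ [x]) (hz : z ∈ v) : G.Adj y z ↔ y = x ∧ v.head? = some z := by
  have : u ++ x :: v = (u ++ [x]) ++ v := by simp
  rw [this, IP.append_iff] at h
  grind

namespace Pyr

variable {c : V} {S : Fin 3 → List V}

/-- Two arms and the apex form an odd cycle, so all three arms have the same parity. The lists do
not contain the apex, which accounts for the extra one. -/
theorem odd_len (hG : EvenHoleFree G) (hS : Pyr G c S) {i j : Fin 3} (hij : i ≠ j) :
    Odd ((S i).length + (S j).length + 1) := by
  have h1 := List.length_pos_of_ne_nil (hS.ne i)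
  have h2 := List.length_pos_of_ne_nil (hS.ne j)
  have h := odd_cone hG (x := c) (l := (S i).reverse ++ S j) ?_ ?_ ?_ ?_
  · simpa using h
  · rw [IP.append_iff]
    refine ⟨(hS.ip i).reverse, hS.ip j, fun x hx y hy => ?_⟩
    have := hS.cross i j hij x (by simpa using hx) y hy
    simpa using this
  · simp [hS.notMem]
  · simp; omega
  · intro y hy
    simp only [List.mem_append, List.mem_reverse] at hy
    have e1 : ((S i).reverse ++ S j).head? = (S i).getLast? := by grind
    have e2 : ((S i).reverse ++ S j).getLast? = (S j).getLast? := by grind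
    rw [e1, e2]
    rcases hy with hy | hy
    · rw [hS.apex i y hy]
      refine ⟨Or.inl, fun h => h.resolve_right fun h => ?_⟩
      exact (hS.cross i j hij y hy y (List.mem_of_getLast? h)).1 rfl
    · rw [hS.apex j y hy]
      refine ⟨Or.inr, fun h => h.resolve_left fun h => ?_⟩
      exact (hS.cross i j hij y (List.mem_of_getLast? h) y hy).1 rfl

variable {p : List V}

/-- The cycle passes through the base edge between the two arms, and so uses the segments of the
arms before their first attachments. -/
theorem odd_inner (hG : EvenHoleFree G) (hS : Pyr G c S) (hp : IP G p) (hp0 : p ≠ [])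
    (hpS : ∀ i, ∀ f ∈ p, f ∉ S i) {i j : Fin 3} (hij : i ≠ j)
    {u₁ v₁ u₂ v₂ : List V} {x y : V} (h1 : S i = u₁ ++ x :: v₁) (h2 : S j = u₂ ++ y :: v₂)
    (hx : Att G p x) (hx' : ¬ Att G p.tail x) (hy : Att G p y) (hy' : ¬ Att G p.dropLast y)
    (hu₁ : ∀ z ∈ u₁, ¬ Att G p z) (hu₂ : ∀ z ∈ u₂, ¬ Att G p z) :
    Odd (p.length + (u₁.length + u₂.length + 2)) := by
  have ipi := hS.ip i
  have ipj := hS.ip j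
  have h := odd_cycle hG (p := p) (Q := (u₂ ++ [y]).reverse ++ (u₁ ++ [x])) hp ?_ ?_ hp0 ?_ ?_ ?_ ?_
  · grind
  · rw [IP.append_iff]
    rw [h1] at ipi; rw [h2] at ipj
    refine ⟨IP.reverse (ipj.infix ⟨[], v₂, by simp⟩), ipi.infix ⟨[], v₁, by simp⟩, ?_⟩
    intro a ha b hb
    have := hS.cross j i hij.symm a (by grind) b
      (by grind)
    rw [h1, h2] at this
    rw [List.getLast?_reverse]
    simpa using this
  · grind
  · simp; omega
  · grind
  · grind
  grind

/-- The counterpart of `odd_inner` through the apex, along the segments behind the last attachments.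
If both attachments were base vertices, the base edge would be a chord; `hu` excludes this. -/
theorem odd_outer (hG : EvenHoleFree G) (hS : Pyr G c S) (hp : IP G p) (hp0 : p ≠ [])
    (hpS : ∀ i, ∀ f ∈ p, f ∉ S i) (hpc : c ∉ p) (hc : ¬ Att G p c) {i j : Fin 3} (hij : i ≠ j)
    {u₁ v₁ u₂ v₂ : List V} {x y : V} (h1 : S i = u₁ ++ x :: v₁) (h2 : S j = u₂ ++ y :: v₂)
    (hx : Att G p x) (hx' : ¬ Att G p.tail x) (hy : Att G p y) (hy' : ¬ Att G p.dropLast y)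
    (hv₁ : ∀ z ∈ v₁, ¬ Att G p z) (hv₂ : ∀ z ∈ v₂, ¬ Att G p z) (hu : ¬ (u₁ = [] ∧ u₂ = [])) :
    Odd (p.length + (v₁.length + v₂.length + 3)) := by
  have ipi := hS.ip i
  have ipj := hS.ip j
  rw [h1] at ipi; rw [h2] at ipj
  have hi : ∀ z ∈ x :: v₁, z ∈ S i := fun z hz => by grind
  have hj : ∀ z ∈ y :: v₂, z ∈ S j := fun z hz => by grind
  have h := odd_cycle hG (p := p) (Q := (y :: v₂) ++ (c :: (x :: v₁).reverse)) hp ?_ ?_ hp0 ?_ ?_ ?_ ?_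
  · grind
  · rw [IP.append_iff]
    refine ⟨ipj.right, ⟨?_, ?_, ipi.right.reverse⟩, ?_⟩
    · intro hc; exact hS.notMem i (hi c (List.mem_reverse.1 hc))
    · intro z hz
      have hz' := hi z (List.mem_reverse.1 hz)
      rw [hS.apex i z hz', h1, IP.getLast?_append_cons, List.head?_reverse]
    · intro a ha b hb
      have ha' := hj a ha
      rcases List.mem_cons.1 hb with rfl | hb
      · refine ⟨fun h => hS.notMem j (h ▸ ha'), ?_⟩
        rw [G.adj_comm, hS.apex j a ha', h2, IP.getLast?_append_cons]; simp
      · have hb' : b ∈ x :: v₁ := List.mem_reverse.1 hb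
        have hcr := hS.cross j i hij.symm a ha' b (hi b hb')
        refine ⟨hcr.1, ?_⟩
        rw [hcr.2]
        constructor
        · rintro ⟨h3, h4⟩
          rw [h2] at h3; rw [h1] at h4
          exact absurd ⟨(IP.head?_eq_of_append ipi hb' h4).1, (IP.head?_eq_of_append ipj ha h3).1⟩ hu
        · rintro ⟨_, h4⟩
          simp only [List.head?_cons, Option.some.injEq] at h4
          exact absurd (hi b hb') (h4 ▸ hS.notMem i)
  · grind
  · simp; omega
  · grind
  · grind
  grind

/-- The vertices `x, y` may lie on the same path, provided that they are not consecutive. -/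
theorem odd_mix_aux (hG : EvenHoleFree G) (hS : Pyr G c S) (hp : IP G p) (hp0 : p ≠ [])
    (hpS : ∀ i, ∀ f ∈ p, f ∉ S i) (hpc : c ∉ p) (hc : ¬ Att G p c) {i j l : Fin 3}
    (hil : i ≠ l) (hjl : j ≠ l)
    {u₁ v₁ u₂ v₂ : List V} {x y : V} (h1 : S i = u₁ ++ x :: v₁) (h2 : S j = u₂ ++ y :: v₂)
    (hx : Att G p x) (hx' : ¬ Att G p.tail x) (hy : Att G p y) (hy' : ¬ Att G p.dropLast y)
    (hu₁ : ∀ z ∈ u₁, ¬ Att G p z) (hv₂ : ∀ z ∈ v₂, ¬ Att G p z) (hl : ∀ z ∈ S l, ¬ Att G p z)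
    (hv₁ : v₁ ≠ []) (hu₂ : u₂ ≠ [])
    (hcross : ∀ a ∈ y :: v₂, ∀ b ∈ u₁ ++ [x], a ≠ b ∧ ¬ G.Adj a b) :
    Odd (p.length + (v₂.length + (S l).length + u₁.length + 3)) := by
  have ipi := hS.ip i
  have ipj := hS.ip j
  rw [h1] at ipi; rw [h2] at ipj
  have hi : ∀ z ∈ u₁ ++ [x], z ∈ S i := fun z hz => by grind
  have hj : ∀ z ∈ y :: v₂, z ∈ S j := fun z hz => by grind
  have hlne : (S l).reverse ≠ [] := by simpa using hS.ne l
  have h := odd_cycle hG (p := p) (Q := (y :: v₂) ++ (c :: ((S l).reverse ++ (u₁ ++ [x])))) hp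
    ?_ ?_ hp0 ?_ ?_ ?_ ?_
  · grind
  · rw [IP.append_iff]
    refine ⟨ipj.right, ⟨?_, ?_, ?_⟩, ?_⟩
    · intro hc
      rcases List.mem_append.1 hc with h | h
      · exact hS.notMem l (by simpa using h)
      · exact hS.notMem i (hi c h)
    · intro z hz
      rw [List.head?_append_of_ne_nil _ hlne, List.head?_reverse]
      rcases List.mem_append.1 hz with h | h
      · exact hS.apex l z (by simpa using h)
      · rw [hS.apex i z (hi z h), h1]
        constructor
        · intro h3; exact absurd (IP.getLast?_eq_of_append ipi h h3).1 hv₁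
        · intro h3
          exact absurd rfl (hS.cross i l hil z (hi z h) z (List.mem_of_getLast? h3)).1
    · rw [IP.append_iff]
      refine ⟨(hS.ip l).reverse, ipi.infix ⟨[], v₁, by simp⟩, ?_⟩
      intro a ha b hb
      have := hS.cross l i hil.symm a (by simpa using ha) b (hi b hb)
      rw [h1] at this
      simpa using this
    · intro a ha b hb
      have ha' := hj a ha
      rcases List.mem_cons.1 hb with rfl | hb
      · refine ⟨fun h => hS.notMem j (h ▸ ha'), ?_⟩
        rw [G.adj_comm, hS.apex j a ha', h2, IP.getLast?_append_cons]; simp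
      · have hcb : c ≠ b := by
          rintro rfl
          rcases List.mem_append.1 hb with h | h
          · exact hS.notMem l (by simpa using h)
          · exact hS.notMem i (hi c h)
        simp only [List.head?_cons, Option.some.injEq, hcb, and_false, iff_false]
        rcases List.mem_append.1 hb with hb | hb
        · have hcr := hS.cross j l hjl a ha' b (by simpa using hb)
          refine ⟨hcr.1, ?_⟩
          rw [hcr.2, h2]
          rintro ⟨h3, _⟩
          exact hu₂ (IP.head?_eq_of_append ipj ha h3).1
        grind
  · grind
  · simp; omega
  · grind
  · grind
  grind

/-- The cycle climbs arm `j` from `y` to the apex, descends the whole of arm `l`, crosses the base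
and climbs arm `i` to `x`. It has no chord because `x` is not next to the apex (`hv₁`) and `y` is
not in the base (`hu₂`). -/
theorem odd_mix (hG : EvenHoleFree G) (hS : Pyr G c S) (hp : IP G p) (hp0 : p ≠ [])
    (hpS : ∀ i, ∀ f ∈ p, f ∉ S i) (hpc : c ∉ p) (hc : ¬ Att G p c) {i j l : Fin 3}
    (hij : i ≠ j) (hil : i ≠ l) (hjl : j ≠ l)
    {u₁ v₁ u₂ v₂ : List V} {x y : V} (h1 : S i = u₁ ++ x :: v₁) (h2 : S j = u₂ ++ y :: v₂)
    (hx : Att G p x) (hx' : ¬ Att G p.tail x) (hy : Att G p y) (hy' : ¬ Att G p.dropLast y)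
    (hu₁ : ∀ z ∈ u₁, ¬ Att G p z) (hv₂ : ∀ z ∈ v₂, ¬ Att G p z) (hl : ∀ z ∈ S l, ¬ Att G p z)
    (hv₁ : v₁ ≠ []) (hu₂ : u₂ ≠ []) :
    Odd (p.length + (v₂.length + (S l).length + u₁.length + 3)) := by
  refine odd_mix_aux hG hS hp hp0 hpS hpc hc hil hjl h1 h2 hx hx' hy hy' hu₁ hv₂ hl hv₁ hu₂ ?_
  intro a ha b hb
  have ha' : a ∈ S j := by grind
  have hb' : b ∈ S i := by grind
  have hcr := hS.cross j i hij.symm a ha' b hb'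
  refine ⟨hcr.1, ?_⟩
  rw [hcr.2]
  rintro ⟨h3, _⟩
  rw [h2] at h3
  have ipj := hS.ip j
  rw [h2] at ipj
  exact hu₂ (IP.head?_eq_of_append ipj ha h3).1

/-- This is the mixed cycle for two attachments of one vertex on the same arm. The segment `m` is
bypassed, so it does not matter whether `f` sees vertices of it; it only has to be nonempty, to keep
`x` and `y` nonadjacent. -/
theorem odd_self (hG : EvenHoleFree G) (hS : Pyr G c S) {f : V}
    (hpS : ∀ i, f ∉ S i) (hpc : c ≠ f) (hc : ¬ G.Adj f c) {j l : Fin 3} (hjl : j ≠ l)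
    {u m v : List V} {x y : V} (h : S j = u ++ x :: (m ++ y :: v)) (hm : m ≠ [])
    (hx : G.Adj f x) (hy : G.Adj f y)
    (hu : ∀ z ∈ u, ¬ G.Adj f z) (hv : ∀ z ∈ v, ¬ G.Adj f z) (hl : ∀ z ∈ S l, ¬ G.Adj f z) :
    Odd (v.length + (S l).length + u.length + 4) := by
  have ipj := hS.ip j
  have h2 : S j = (u ++ x :: m) ++ y :: v := by rw [h]; simp
  have := odd_mix_aux hG hS (p := [f]) (IP.singleton f) (by simp) (by simpa using hpS)
    (by simpa using hpc) (by simpa [Att] using hc) hjl hjl h h2 (by tauto)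
    (by simp [Att]) (by tauto) (by simp [Att]) (by simpa [Att] using hu)
    (by simpa [Att] using hv) (by simpa [Att] using hl) (by simp) (by simp) ?_
  · grind
  · intro a ha b hb
    rw [h] at ipj
    have hnd := ipj.nodup
    have hav : a ∈ m ++ y :: v := by grind
    refine ⟨?_, ?_⟩
    · grind
    · rw [G.adj_comm, ipj.adj_split hb hav]
      rintro ⟨_, h3⟩
      have ip2 : IP G (m ++ y :: v) := by
        have e : u ++ x :: (m ++ y :: v) = (u ++ [x]) ++ (m ++ y :: v) := by simp
        rw [e] at ipj; exact ipj.right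
      exact hm (IP.head?_eq_of_append ip2 ha h3).1

end Pyr

end Pyramids

/-! ### The two ways a minimal path attaches to a pyramid -/

section PyramidOutcome

variable {V : Type*} {G : SimpleGraph V}

/-- The list `l` is met by `p`, only at its first vertex. -/
def OnlyBase (G : SimpleGraph V) (p l : List V) : Prop :=
  (∃ z ∈ l, Att G p z) ∧ ∀ z ∈ l, Att G p z → l.head? = some z

/-- The list `l` is met by `p`, only at its last vertex. -/
def OnlyEnd (G : SimpleGraph V) (p l : List V) : Prop :=
  (∃ z ∈ l, Att G p z) ∧ ∀ z ∈ l, Att G p z → l.getLast? = some z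

/-- Exactly two vertices of `l` have neighbours in `p`, and they are consecutive. -/
def PairAtt (G : SimpleGraph V) (p l : List V) : Prop :=
  ∃ u x y v, l = u ++ x :: y :: v ∧ Att G p x ∧ Att G p y ∧ (∀ z ∈ u, ¬ Att G p z) ∧
    ∀ z ∈ v, ¬ Att G p z

/-- The two ways in which a minimal path can attach to a pyramid. -/
def PyrOutcome (G : SimpleGraph V) (S : Fin 3 → List V) (p : List V) : Prop :=
  (∃ i, (∃ z ∈ S i, Att G p z ∧ (S i).head? ≠ some z) ∧ ∀ j, j ≠ i → OnlyBase G p (S j)) ∨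
  ∃ i j l : Fin 3, i ≠ j ∧ i ≠ l ∧ j ≠ l ∧ OnlyEnd G p (S i) ∧
    (2 ≤ (S i).length → PairAtt G p (S j)) ∧ (∃ z ∈ S j, Att G p z) ∧ ∀ z ∈ S l, ¬ Att G p z

theorem exists_third {i j : Fin 3} (hij : i ≠ j) : ∃ l, i ≠ l ∧ j ≠ l := by
  revert i j; decide

theorem OnlyBase.reverse_iff {p l : List V} : OnlyBase G p.reverse l ↔ OnlyBase G p l := by
  simp only [OnlyBase, Att.reverse_iff]

theorem PyrOutcome.reverse {S : Fin 3 → List V} {p : List V} (h : PyrOutcome G S p.reverse) :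
    PyrOutcome G S p := by
  simpa only [PyrOutcome, OnlyBase, OnlyEnd, PairAtt, Att.reverse_iff] using h

theorem att_tail_or_dropLast {p : List V} {z : V} (h2 : 2 ≤ p.length) (h : Att G p z) :
    Att G p.tail z ∨ Att G p.dropLast z := by
  obtain ⟨f, hf, h⟩ := h
  rcases p with _ | ⟨x, _ | ⟨y, p⟩⟩
  · simp at h2
  · simp at h2
  · rcases List.mem_cons.1 hf with rfl | hf
    · tauto
    · exact Or.inl ⟨f, by simpa using hf, h⟩

namespace Pyr

variable {c : V} {S : Fin 3 → List V} {p : List V}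

/-- Suppose the end of arm `i` is its only attachment and the arm has a second vertex. The inner and
outer cycles together forbid that arm `j` has a single attachment, and `odd_self` forbids a gap
between its first and last attachments. -/
theorem two_arms_aux (hG : EvenHoleFree G) (hS : Pyr G c S) (hp : IP G p) (hp0 : p ≠ [])
    (hpS : ∀ i, ∀ f ∈ p, f ∉ S i) (hpc : c ∉ p) (hc : ¬ Att G p c) {i j l : Fin 3}
    (hij : i ≠ j) (hjl : j ≠ l)
    (hi : ∀ z ∈ S i, Att G p z → ¬ Att G p.tail z)
    (hj : ∀ z ∈ S j, Att G p z → ¬ Att G p.dropLast z)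
    (hl : ∀ z ∈ S l, ¬ Att G p z)
    {u₁ v₁ : List V} {x₁ : V} (h1 : S i = u₁ ++ x₁ :: v₁)
    (hx₁ : Att G p x₁) (hu₁ : ∀ z ∈ u₁, ¬ Att G p z) (hmj : ∃ z ∈ S j, Att G p z)
    (hv : v₁ = []) (hb : ¬ (OnlyBase G p (S i) ∧ OnlyBase G p (S j))) :
    OnlyEnd G p (S i) ∧ (2 ≤ (S i).length → PairAtt G p (S j)) := by
  subst hv
  have hlen := hS.odd_len hG hjl
  have hlen' := hS.odd_len hG hij
  refine ⟨⟨⟨x₁, by simp [h1], hx₁⟩, fun z hz ha => ?_⟩, fun h2 => ?_⟩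
  · grind
  obtain ⟨u₂, x₂, v₂, e2, hx₂, hu₂⟩ := exists_first hmj
  obtain ⟨w₂, y₂, d₂, e3, hy₂, hd₂⟩ := exists_last hmj
  have mi : x₁ ∈ S i := by simp [h1]
  have m2 : x₂ ∈ S j := by simp [e2]
  have m3 : y₂ ∈ S j := by simp [e3]
  have hu₁ne : u₁ ≠ [] := by grind
  have o1 := hS.odd_inner hG hp hp0 hpS hij h1 e2 hx₁ (hi _ mi hx₁) hx₂ (hj _ m2 hx₂) hu₁ hu₂
  have o2 := hS.odd_outer hG hp hp0 hpS hpc hc hij h1 e3 hx₁ (hi _ mi hx₁) hy₂ (hj _ m3 hy₂)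
    (by simp) hd₂ (fun h => hu₁ne h.1)
  have l1 : (S i).length = u₁.length + 1 := by rw [h1]; simp
  rw [l1] at hlen'
  simp only [List.length_nil] at o2
  have hlt : u₂.length ≤ w₂.length := by
    by_contra hlt
    push Not at hlt
    have e : u₂ ++ x₂ :: v₂ = w₂ ++ y₂ :: d₂ := by rw [← e2, e3]
    have : y₂ ∈ u₂ := by
      have h4 := congrArg (fun l : List V => l[w₂.length]?) e
      grind
    grind
  have e : u₂ ++ x₂ :: v₂ = w₂ ++ y₂ :: d₂ := by rw [← e2, e3]
  obtain ⟨m, hm⟩ : ∃ m, w₂ = u₂ ++ x₂ :: m := by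
    rcases List.append_eq_append_iff.1 e with ⟨as, h5, h6⟩ | ⟨as, h5, h6⟩
    · rcases as with _ | ⟨q, as⟩
      · grind
      grind
    grind
  subst hm
  have e4 : S j = u₂ ++ x₂ :: (m ++ y₂ :: d₂) := by rw [e3]; simp
  rcases m with _ | ⟨q, m⟩
  · exact ⟨u₂, x₂, y₂, d₂, by simpa using e4, hx₂, hy₂, hu₂, hd₂⟩
  -- A gap remains. All attachments on arm `j` see only the last vertex `f` of the path, so
  -- `odd_self` applies to `f`, with the unmet arm `l`.
  · exfalso
    obtain ⟨p', f, rfl⟩ : ∃ p' f, p = p' ++ [f] :=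
      ⟨p.dropLast, p.getLast hp0, (List.dropLast_append_getLast hp0).symm⟩
    have key : ∀ z ∈ S j, Att G (p' ++ [f]) z → G.Adj f z := by
      intro z hz ha
      have h7 := hj z hz ha
      obtain ⟨g, hg, h8⟩ := ha
      rcases List.mem_append.1 hg with hg | hg
      · exact absurd ⟨g, by simpa using hg, h8⟩ h7
      grind
    have key2 : ∀ z, ¬ Att G (p' ++ [f]) z → ¬ G.Adj f z := fun z h h' => h ⟨f, by simp, h'⟩
    have o3 := hS.odd_self hG (f := f) (fun i => hpS i f (by simp)) (by grind)
      (fun h => hc ⟨f, by simp, h⟩) hjl e4 (by simp) (key _ m2 hx₂) (key _ m3 hy₂)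
      (fun z hz => key2 z (hu₂ z hz)) (fun z hz => key2 z (hd₂ z hz))
      (fun z hz => key2 z (hl z hz))
    grind

/-- If on one arm the first attachment is the end of the arm, `two_arms_aux` applies, possibly to
the reversed path. Otherwise consider the inner, the outer and the two mixed cycles. In the sum of
their lengths each segment occurs an even number of times and the constants add up to eleven, yet
four odd numbers have an even sum. If one arm is met in its base vertex only, a mixed cycle is
missing and the equal parity of the arms replaces it. -/
theorem two_arms (hG : EvenHoleFree G) (hS : Pyr G c S) (hp : IP G p) (hp0 : p ≠ [])
    (hpS : ∀ i, ∀ f ∈ p, f ∉ S i) (hpc : c ∉ p) (hc : ¬ Att G p c) {i j l : Fin 3}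
    (hij : i ≠ j) (hil : i ≠ l) (hjl : j ≠ l)
    (hi : ∀ z ∈ S i, Att G p z → ¬ Att G p.tail z)
    (hj : ∀ z ∈ S j, Att G p z → ¬ Att G p.dropLast z)
    (hl : ∀ z ∈ S l, ¬ Att G p z) (hmi : ∃ z ∈ S i, Att G p z) (hmj : ∃ z ∈ S j, Att G p z)
    (hb : ¬ (OnlyBase G p (S i) ∧ OnlyBase G p (S j))) : PyrOutcome G S p := by
  obtain ⟨u₁, x₁, v₁, e1, hx₁, hu₁⟩ := exists_first hmi
  obtain ⟨u₂, x₂, v₂, e2, hx₂, hu₂⟩ := exists_first hmj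
  have hp' : IP G p.reverse := hp.reverse
  have hp0' : p.reverse ≠ [] := by simpa using hp0
  have hpS' : ∀ i, ∀ f ∈ p.reverse, f ∉ S i := fun i f hf => hpS i f (List.mem_reverse.1 hf)
  have hpc' : c ∉ p.reverse := by simpa using hpc
  have hc' : ¬ Att G p.reverse c := by rwa [Att.reverse_iff]
  by_cases hv₁ : v₁ = []
  · obtain ⟨h1, h2⟩ := hS.two_arms_aux hG hp hp0 hpS hpc hc hij hjl hi hj hl e1 hx₁ hu₁ hmj
      hv₁ hb
    exact Or.inr ⟨i, j, l, hij, hil, hjl, h1, h2, hmj, hl⟩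
  by_cases hv₂ : v₂ = []
  · have := hS.two_arms_aux hG hp' hp0' hpS' hpc' hc' hij.symm hil
      (by simpa only [Att.reverse_iff, List.tail_reverse] using hj)
      (by simpa only [Att.reverse_iff, List.dropLast_reverse] using hi)
      (by simpa only [Att.reverse_iff] using hl) e2 (by simpa only [Att.reverse_iff] using hx₂)
      (by simpa only [Att.reverse_iff] using hu₂) (by simpa only [Att.reverse_iff] using hmi) hv₂
      (by rw [OnlyBase.reverse_iff, OnlyBase.reverse_iff]; tauto)
    exact PyrOutcome.reverse (Or.inr ⟨j, i, l, hij.symm, hjl, hil, this.1, this.2,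
      by simpa only [Att.reverse_iff] using hmi, by simpa only [Att.reverse_iff] using hl⟩)
  exfalso
  obtain ⟨w₁, y₁, d₁, f1, hy₁, hd₁⟩ := exists_last hmi
  obtain ⟨w₂, y₂, d₂, f2, hy₂, hd₂⟩ := exists_last hmj
  have mx1 : x₁ ∈ S i := by simp [e1]
  have my1 : y₁ ∈ S i := by simp [f1]
  have mx2 : x₂ ∈ S j := by simp [e2]
  have my2 : y₂ ∈ S j := by simp [f2]
  have base : ∀ (m : Fin 3) (w d : List V) (y : V), S m = w ++ y :: d → Att G p y →
      (∀ z ∈ d, ¬ Att G p z) → w = [] → OnlyBase G p (S m) := by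
    rintro m _ d y e hy hd rfl
    refine ⟨⟨y, by simp [e], hy⟩, fun z hz ha => ?_⟩
    grind
  have hw : ¬ (w₁ = [] ∧ w₂ = []) := fun h => hb ⟨base i w₁ d₁ y₁ f1 hy₁ hd₁ h.1,
    base j w₂ d₂ y₂ f2 hy₂ hd₂ h.2⟩
  have q1 : w₁ = [] → u₁ = [] := by
    rintro rfl
    by_contra hne
    obtain ⟨q, u, rfl⟩ := List.exists_cons_of_ne_nil hne
    grind
  have q2 : w₂ = [] → u₂ = [] := by
    rintro rfl
    by_contra hne
    obtain ⟨q, u, rfl⟩ := List.exists_cons_of_ne_nil hne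
    grind
  have o1 := hS.odd_inner hG hp hp0 hpS hij e1 e2 hx₁ (hi _ mx1 hx₁) hx₂ (hj _ mx2 hx₂) hu₁ hu₂
  have o2 := hS.odd_outer hG hp hp0 hpS hpc hc hij f1 f2 hy₁ (hi _ my1 hy₁) hy₂ (hj _ my2 hy₂)
    hd₁ hd₂ hw
  have o3 : w₂ ≠ [] → Odd (p.length + (d₂.length + (S l).length + u₁.length + 3)) := fun h =>
    hS.odd_mix hG hp hp0 hpS hpc hc hij hil hjl e1 f2 hx₁ (hi _ mx1 hx₁) hy₂ (hj _ my2 hy₂)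
      hu₁ hd₂ hl hv₁ h
  have o4 : w₁ ≠ [] → Odd (p.length + (d₁.length + (S l).length + u₂.length + 3)) := fun h => by
    have := hS.odd_mix hG hp' hp0' hpS' hpc' hc' hij.symm hjl hil e2 f1
      (by rwa [Att.reverse_iff])
      (by rw [List.tail_reverse, Att.reverse_iff]; grind)
      (by rwa [Att.reverse_iff])
      (by rw [List.dropLast_reverse, Att.reverse_iff]; grind)
      (by simpa only [Att.reverse_iff] using hu₂) (by simpa only [Att.reverse_iff] using hd₁)
      (by simpa only [Att.reverse_iff] using hl) hv₂ h
    simpa using this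
  have p1 := hS.odd_len hG hij
  have p2 := hS.odd_len hG hil
  grind

/-- If two arms were met off the base, the outer cycles for all three pairs of arms would exist. The
lengths behind the last attachments would then have pairwise different parities, which is impossible
for three numbers. -/
theorem single_outcome (hG : EvenHoleFree G) (hS : Pyr G c S) {f : V}
    (hpS : ∀ i, f ∉ S i) (hpc : c ≠ f) (hc : ¬ G.Adj f c)
    (hm : ∀ i, ∃ z ∈ S i, Att G [f] z) (hb : ∃ i, ¬ OnlyBase G [f] (S i)) :
    PyrOutcome G S [f] := by
  obtain ⟨i, hi⟩ := hb
  refine Or.inl ⟨i, ?_, fun j hj => ?_⟩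
  · by_contra hcon
    push Not at hcon
    tauto
  by_contra hjb
  obtain ⟨l, hli, hlj⟩ := exists_third hj.symm
  have key : ∀ m : Fin 3, ∃ w y d, S m = w ++ y :: d ∧ Att G [f] y ∧
      (∀ z ∈ d, ¬ Att G [f] z) ∧ (w = [] → OnlyBase G [f] (S m)) := by
    intro m
    obtain ⟨w, y, d, e, hy, hd⟩ := exists_last (hm m)
    refine ⟨w, y, d, e, hy, hd, ?_⟩
    rintro rfl
    refine ⟨⟨y, by simp [e], hy⟩, fun z hz ha => ?_⟩
    grind
  choose w y d e hy hd hw using key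
  have o : ∀ m n : Fin 3, m ≠ n → ¬ (w m = [] ∧ w n = []) →
      Odd (1 + ((d m).length + (d n).length + 3)) := fun m n hmn hh =>
    hS.odd_outer hG (p := [f]) (IP.singleton f) (by simp) (by simpa using hpS)
      (by simpa using hpc) (by simpa [Att] using hc) hmn (e m) (e n) (hy m) (by simp [Att])
      (hy n) (by simp [Att]) (hd m) (hd n) hh
  have o2 := o i l hli (fun h => hi (hw i h.1))
  grind

/-- When the third arm is not met, the outer cycle and the mixed cycle through that arm cannot both
be odd. So the mixed cycle does not exist, which means that arm `j` is a single vertex: its base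
vertex is also its end, and the second outcome holds. -/
theorem base_arm (hG : EvenHoleFree G) (hS : Pyr G c S) (hp : IP G p) (hp0 : p ≠ [])
    (hpS : ∀ i, ∀ f ∈ p, f ∉ S i) (hpc : c ∉ p) (hc : ¬ Att G p c) {i j l : Fin 3}
    (hij : i ≠ j) (hil : i ≠ l) (hjl : j ≠ l)
    (hi : ∀ z ∈ S i, Att G p z → (S i).head? ≠ some z → ¬ Att G p.tail z)
    (hmi : ∃ z ∈ S i, Att G p z ∧ (S i).head? ≠ some z)
    (hj : OnlyBase G p (S j)) (hj' : ∀ z ∈ S j, ¬ Att G p.dropLast z)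
    (hl : ∀ z ∈ S l, Att G p z → (S l).head? = some z) : PyrOutcome G S p := by
  by_cases hlm : ∃ z ∈ S l, Att G p z
  · refine Or.inl ⟨i, hmi, fun m hm => ?_⟩
    have : m = j ∨ m = l := by grind
    rcases this with rfl | rfl
    · exact hj
    · exact ⟨hlm, hl⟩
  push Not at hlm
  obtain ⟨y₂, v₂, e2⟩ := List.exists_cons_of_ne_nil (hS.ne j)
  have hy₂ : Att G p y₂ := by
    obtain ⟨⟨z, hz, ha⟩, h⟩ := hj
    grind
  have hv₂ : ∀ z ∈ v₂, ¬ Att G p z := by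
    intro z hz ha
    have h3 := hj.2 z (by simp [e2, hz]) ha
    have := hS.ip j
    rw [e2] at this h3
    simp at h3
    exact this.1 (h3 ▸ hz)
  obtain ⟨z₁, hz₁, ha₁, hn₁⟩ := hmi
  obtain ⟨w₁, y₁, d₁, f1, hy₁, hd₁⟩ := exists_last ⟨z₁, hz₁, ha₁⟩
  have hw₁ : w₁ ≠ [] := by grind
  have my1 : y₁ ∈ S i := by simp [f1]
  have hn : (S i).head? ≠ some y₁ := by
    intro h
    have := hS.ip i
    rw [f1] at this h
    exact hw₁ (this.head?_eq_of_append (by simp) h).1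
  have hy₂d : ¬ Att G p.dropLast y₂ := hj' _ (by simp [e2])
  have o1 := hS.odd_outer hG hp hp0 hpS hpc hc hij f1 (u₂ := []) e2 hy₁
    (hi _ my1 hy₁ hn) hy₂ hy₂d hd₁ hv₂ (fun h => hw₁ h.1)
  have hv : v₂ = [] := by
    by_contra hv
    have o2 := hS.odd_mix hG hp.reverse (by simpa using hp0)
      (fun i f hf => hpS i f (List.mem_reverse.1 hf)) (by simpa using hpc)
      (by rwa [Att.reverse_iff]) hij.symm hjl hil (u₁ := []) e2 f1
      (by rwa [Att.reverse_iff]) (by rwa [List.tail_reverse, Att.reverse_iff])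
      (by rwa [Att.reverse_iff])
      (by rw [List.dropLast_reverse, Att.reverse_iff]; grind)
      (by simp) (by simpa only [Att.reverse_iff] using hd₁)
      (by simpa only [Att.reverse_iff] using hlm) hv hw₁
    have p1 := hS.odd_len hG hjl
    grind
  subst hv
  refine Or.inr ⟨j, i, l, hij.symm, hjl, hil, ⟨hj.1, fun z hz ha => ?_⟩, fun h => ?_,
    ⟨z₁, hz₁, ha₁⟩, hlm⟩
  · grind
  grind

/-- How a path attaches to a pyramid if it attaches to it in an essential way, but no proper
subpath does. -/
theorem outcome (hG : EvenHoleFree G) (hS : Pyr G c S) (hp : IP G p) (hp0 : p ≠ [])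
    (hpS : ∀ i, ∀ f ∈ p, f ∉ S i) (hpc : c ∉ p) (hc : ¬ Att G p c)
    (hnon : ∃ i j, i ≠ j ∧ ∃ x ∈ S i, ∃ y ∈ S j, Att G p x ∧ Att G p y ∧
      ¬ ((S i).head? = some x ∧ (S j).head? = some y))
    (htail : ∀ i j, i ≠ j → ∀ x ∈ S i, ∀ y ∈ S j, Att G p.tail x → Att G p.tail y →
      (S i).head? = some x ∧ (S j).head? = some y)
    (hdrop : ∀ i j, i ≠ j → ∀ x ∈ S i, ∀ y ∈ S j, Att G p.dropLast x → Att G p.dropLast y →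
      (S i).head? = some x ∧ (S j).head? = some y) : PyrOutcome G S p := by
  obtain ⟨i, j, hij, x, hx, y, hy, hax, hay, hxn⟩ : ∃ i j, i ≠ j ∧ ∃ x ∈ S i, ∃ y ∈ S j,
      Att G p x ∧ Att G p y ∧ (S i).head? ≠ some x := by grind
  obtain ⟨l, hil, hjl⟩ := exists_third hij
  have hib : ¬ OnlyBase G p (S i) := fun h => hxn (h.2 x hx hax)
  -- For a single vertex the truncated paths are empty, so all conditions on which end is seen hold
  -- trivially.
  by_cases hp1 : p.length = 1
  · obtain ⟨f, rfl⟩ := List.length_eq_one_iff.1 hp1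
    by_cases hl : ∃ z ∈ S l, Att G [f] z
    · refine hS.single_outcome hG (fun i => hpS i f (by simp)) (by simpa using hpc)
        (by simpa [Att] using hc) (fun m => ?_) ⟨i, hib⟩
      grind
    · push Not at hl
      exact hS.two_arms hG hp hp0 hpS hpc hc hij hil hjl (by simp [Att]) (by simp [Att]) hl
        ⟨x, hx, hax⟩ ⟨y, hy, hay⟩ (fun h => hib h.1)
  have hp2 : 2 ≤ p.length := by have := List.length_pos_of_ne_nil hp0; omega
  -- the main part, for paths oriented from `x` to `y`
  have main : ∀ p : List V, IP G p → 2 ≤ p.length → (∀ i, ∀ f ∈ p, f ∉ S i) → c ∉ p →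
      ¬ Att G p c → Att G p x → Att G p y → ¬ Att G p.tail x →
      (∀ i j, i ≠ j → ∀ x ∈ S i, ∀ y ∈ S j, Att G p.tail x → Att G p.tail y →
      (S i).head? = some x ∧ (S j).head? = some y) →
      (∀ i j, i ≠ j → ∀ x ∈ S i, ∀ y ∈ S j, Att G p.dropLast x → Att G p.dropLast y →
      (S i).head? = some x ∧ (S j).head? = some y) → PyrOutcome G S p := by
    clear hp hp0 hpS hpc hc hnon htail hdrop hax hay hib hp1 hp2
    intro p hp hp2 hpS hpc hc hax hay hxt htail hdrop
    have hp0 : p ≠ [] := by grind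
    have hxd := (att_tail_or_dropLast hp2 hax).resolve_left hxt
    have hdropi : ∀ m, m ≠ i → ∀ z ∈ S m, ¬ Att G p.dropLast z := fun m hm z hz ha =>
      hxn (hdrop i m hm.symm x hx z hz hxd ha).1
    have hyt := (att_tail_or_dropLast hp2 hay).resolve_right (hdropi j hij.symm y hy)
    -- The part `p.dropLast` sees nothing on arms other than `i`. If another arm is met off its
    -- base, then `p.tail` sees nothing on the remaining arms, and two arms are involved; otherwise
    -- the other arms are met in base vertices at most.
    by_cases hex : ∃ m, m ≠ i ∧ ∃ z ∈ S m, Att G p z ∧ (S m).head? ≠ some z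
    · obtain ⟨m, hm, z, hz, haz, hzn⟩ := hex
      have hzt := (att_tail_or_dropLast hp2 haz).resolve_right (hdropi m hm z hz)
      have htm : ∀ n, n ≠ m → ∀ w ∈ S n, ¬ Att G p.tail w := fun n hn w hw ha =>
        hzn (htail m n hn.symm z hz w hw hzt ha).1
      obtain ⟨n, hni, hnm⟩ := exists_third hm.symm
      refine hS.two_arms hG hp hp0 hpS hpc hc hm.symm hni hnm (fun w hw _ => htm i hm.symm w hw)
        (fun w hw _ => hdropi m hm w hw) (fun w hw ha => ?_) ⟨x, hx, hax⟩ ⟨z, hz, haz⟩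
        (fun h => hxn (h.1.2 x hx hax))
      exact (att_tail_or_dropLast hp2 ha).elim (htm n hnm.symm w hw) (hdropi n hni.symm w hw)
    · push Not at hex
      exact hS.base_arm hG hp hp0 hpS hpc hc hij hil hjl
        (fun z hz _ hzn ha => hzn (htail i j hij z hz y hy ha hyt).1) ⟨x, hx, hax, hxn⟩
        ⟨⟨y, hy, hay⟩, hex j hij.symm⟩ (hdropi j hij.symm) (hex l hil.symm)
  -- Up to reversal, `x` is seen by the first vertex of the path only.
  by_cases hxt : Att G p.tail x
  · have hyt : ¬ Att G p.tail y := fun h => hxn (htail i j hij x hx y hy hxt h).1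
    have hyd := (att_tail_or_dropLast hp2 hay).resolve_left hyt
    have hxd : ¬ Att G p.dropLast x := fun h => hxn (hdrop i j hij x hx y hy h hyd).1
    refine PyrOutcome.reverse (main p.reverse hp.reverse (by simpa using hp2)
      (fun i f hf => hpS i f (List.mem_reverse.1 hf)) (by simpa using hpc)
      (by rwa [Att.reverse_iff]) (by rwa [Att.reverse_iff]) (by rwa [Att.reverse_iff]) ?_ ?_ ?_)
    · rwa [List.tail_reverse, Att.reverse_iff]
    · simpa only [List.tail_reverse, Att.reverse_iff] using hdrop
    · simpa only [List.dropLast_reverse, Att.reverse_iff] using htail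
  · exact main p hp hp2 hpS hpc hc hax hay hxt htail hdrop

end Pyr

end PyramidOutcome

/-! ### Moving in a tree: the next vertex towards a target -/

section TreeNavigation

variable {W : Type*} (J : SimpleGraph W)

open Classical in
/-- The neighbour of `v` that is closer to `x` (in a tree, if `x ≠ v`). -/
noncomputable def nx (v x : W) : W :=
  if h : ∃ u, J.Adj v u ∧ J.dist u x + 1 = J.dist v x then h.choose else v

variable {J}

theorem nx_spec (hJ : J.IsTree) {v x : W} (h : x ≠ v) :
    J.Adj v (nx J v x) ∧ J.dist (nx J v x) x + 1 = J.dist v x := by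
  have hex : ∃ u, J.Adj v u ∧ J.dist u x + 1 = J.dist v x := by
    obtain ⟨p, hp, hl⟩ := hJ.connected.exists_path_of_dist v x
    rcases p with _ | ⟨h1, p⟩
    · grind
    · rename_i u
      refine ⟨u, h1, ?_⟩
      have h2 := SimpleGraph.dist_le p
      simp only [SimpleGraph.Walk.length_cons] at hl
      rcases hJ.dist_eq_dist_add_one_of_adj x h1 with h3 | h3 <;>
        rw [J.dist_comm (u := x), J.dist_comm (u := x)] at h3 <;> omega
  rw [nx, dif_pos hex]
  grind

theorem nx_adj (hJ : J.IsTree) {v x : W} (h : x ≠ v) : J.Adj v (nx J v x) := (nx_spec hJ h).1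

theorem nx_dist (hJ : J.IsTree) {v x : W} (h : x ≠ v) :
    J.dist (nx J v x) x + 1 = J.dist v x := (nx_spec hJ h).2

/-- Shortest paths from the two neighbours to `x` avoid `v`. Putting `v` in front gives two paths of
the tree with the same ends, which coincide. -/
theorem closer_unique (hJ : J.IsTree) {v x u u' : W} (h : J.Adj v u) (h' : J.Adj v u')
    (hu : J.dist u x + 1 = J.dist v x) (hu' : J.dist u' x + 1 = J.dist v x) : u = u' := by
  classical
  obtain ⟨p, hp, hl⟩ := hJ.connected.exists_path_of_dist u x
  obtain ⟨p', hp', hl'⟩ := hJ.connected.exists_path_of_dist u' x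
  have key : ∀ {w : W} (q : J.Walk w x), q.IsPath → q.length = J.dist w x →
      J.dist w x + 1 = J.dist v x → v ∉ q.support := by
    intro w q _ hq hd hv
    have h1 := SimpleGraph.dist_le (q.dropUntil v hv)
    have h2 := q.length_dropUntil_le_length hv
    omega
  have c1 : (SimpleGraph.Walk.cons h p).IsPath := hp.cons (key p hp hl hu)
  have c2 : (SimpleGraph.Walk.cons h' p').IsPath := hp'.cons (key p' hp' hl' hu')
  have := congrArg (fun q => q.1.snd) ((hJ.isAcyclic.subsingleton_path _ _).elim ⟨_, c1⟩ ⟨_, c2⟩)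
  simpa using this

theorem nx_unique (hJ : J.IsTree) {v x u : W} (h : J.Adj v u)
    (hu : J.dist u x + 1 = J.dist v x) : nx J v x = u := by
  have hx : x ≠ v := by grind
  exact closer_unique hJ (nx_adj hJ hx) h (nx_dist hJ hx) hu

theorem nx_self (v : W) : nx J v v = v := by
  rw [nx, dif_neg]; simp

theorem dist_of_ne_nx (hJ : J.IsTree) {v x u : W} (h : J.Adj v u) (hu : u ≠ nx J v x) :
    J.dist u x = J.dist v x + 1 := by
  rcases hJ.dist_eq_dist_add_one_of_adj x h with h3 | h3 <;>
    rw [J.dist_comm (u := x), J.dist_comm (u := x)] at h3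
  · exact absurd (nx_unique hJ h h3.symm).symm hu
  · exact h3

theorem nx_of_adj (hJ : J.IsTree) {v u : W} (h : J.Adj v u) : nx J v u = u := by
  apply nx_unique hJ h
  rw [SimpleGraph.dist_self, SimpleGraph.dist_eq_one_iff_adj.2 h]

theorem nx_back (hJ : J.IsTree) {v x u : W} (h : J.Adj v u) (hu : u ≠ nx J v x) :
    nx J u x = v := nx_unique hJ h.symm (dist_of_ne_nx hJ h hu).symm

theorem nx_nx_ne (hJ : J.IsTree) {v x : W} (hx : x ≠ v) : nx J (nx J v x) x ≠ v := by
  intro h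
  have h1 := nx_dist hJ hx
  by_cases h2 : x = nx J v x
  · rw [← h2, nx_self] at h; exact hx h
  · have := nx_dist hJ h2
    grind

theorem ne_of_nx_eq {v x u : W} (h : J.Adj v u) (hx : nx J v x = u) : x ≠ v := by
  rintro rfl; rw [nx_self] at hx; exact h.ne hx

/-- Moving one end towards the other does not change the second vertex at the other end. -/
theorem nx_pred (hJ : J.IsTree) {v x : W} (hx : x ≠ v) (h : nx J v x ≠ x) :
    nx J x (nx J v x) = nx J x v := by
  symm
  apply nx_unique hJ (nx_adj hJ h)
  have h1 := nx_dist hJ hx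
  have h2 := nx_dist hJ h
  have h3 := nx_adj hJ hx
  have h4 : J.dist (nx J x (nx J v x)) v ≤ J.dist (nx J x (nx J v x)) (nx J v x) + 1 := by
    have := hJ.connected.dist_triangle (u := nx J x (nx J v x)) (v := nx J v x) (w := v)
    rwa [SimpleGraph.dist_eq_one_iff_adj.2 h3.symm] at this
  have h5 : J.dist x v ≤ J.dist (nx J x (nx J v x)) v + 1 := by
    have := hJ.connected.dist_triangle (u := x) (v := nx J x (nx J v x)) (w := v)
    rw [SimpleGraph.dist_eq_one_iff_adj.2 (nx_adj hJ h)] at this; omega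
  rw [J.dist_comm (u := nx J v x) (v := x)] at h1
  rw [J.dist_comm (u := v) (v := x)] at h1
  omega

/-- If `x` separates `v` from `t`, then the path from `v` to `t` starts towards `x`. -/
theorem nx_btw (hJ : J.IsTree) {v x t : W} (hvx : x ≠ v) (h : nx J x v ≠ nx J x t) :
    nx J v t = nx J v x ∧ J.dist v t = J.dist v x + J.dist x t := by
  induction hn : J.dist v x using Nat.strong_induction_on generalizing v with
  | _ n ih =>
  subst hn
  have ha := nx_adj hJ hvx
  have hd := nx_dist hJ hvx
  by_cases hvn : nx J v x = x
  · rw [hvn] at ha hd ⊢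
    rw [nx_of_adj hJ ha.symm] at h
    have h1 := dist_of_ne_nx hJ ha.symm h
    refine ⟨nx_unique hJ ha h1.symm, ?_⟩
    grind
  · have h1 := nx_pred hJ hvx hvn
    obtain ⟨h2, h3⟩ := ih _ (by omega) (v := nx J v x) (Ne.symm hvn) (by rwa [h1]) rfl
    have h4 : v ≠ nx J (nx J v x) t := by rw [h2]; exact (nx_nx_ne hJ hvx).symm
    have h5 := dist_of_ne_nx hJ ha.symm h4
    exact ⟨nx_unique hJ ha h5.symm, by omega⟩

end TreeNavigation

/-! ### Subdivided line graphs of trees, and the pyramids in them -/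

section LineTrees

variable {V W : Type*} {G : SimpleGraph V} {J : SimpleGraph W}

/-- A system of induced paths, one for each edge of the tree `J`, together with two hubs `h true`
and `h false`, that induce a subdivided line graph of `J` with a cross-edge: the hub `h c` is
adjacent to the ends of those paths that belong to the leaves in `L c`. -/
structure LineTree (G : SimpleGraph V) (J : SimpleGraph W) (h : Bool → V) (L : Bool → Set W)
    (ℓ : W → W → List V) : Prop where
  tree : J.IsTree
  leaf : ∀ c, ∀ t ∈ L c, ∀ u v, J.Adj t u → J.Adj t v → u = v
  disj : ∀ c, ∀ t ∈ L c, t ∉ L (!c)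
  ne : ∀ u v, J.Adj u v → ℓ u v ≠ []
  ip : ∀ u v, J.Adj u v → IP G (ℓ u v)
  rev : ∀ u v, J.Adj u v → ℓ v u = (ℓ u v).reverse
  disjoint : ∀ u v w x, J.Adj u v → J.Adj w x → s(u, v) ≠ s(w, x) → ∀ z ∈ ℓ u v, z ∉ ℓ w x
  adj : ∀ u v w, J.Adj u v → J.Adj u w → v ≠ w → ∀ x ∈ ℓ u v, ∀ y ∈ ℓ u w,
    (G.Adj x y ↔ (ℓ u v).head? = some x ∧ (ℓ u w).head? = some y)
  anti : ∀ u v w x, J.Adj u v → J.Adj w x → u ≠ w → u ≠ x → v ≠ w → v ≠ x →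
    ∀ y ∈ ℓ u v, ∀ z ∈ ℓ w x, ¬ G.Adj y z
  hubs : ∀ c, G.Adj (h c) (h (!c))
  hub_notMem : ∀ c u v, J.Adj u v → h c ∉ ℓ u v
  hub : ∀ c u v, J.Adj u v → ∀ x ∈ ℓ u v, (G.Adj (h c) x ↔
    (u ∈ L c ∧ (ℓ u v).head? = some x) ∨ (v ∈ L c ∧ (ℓ u v).getLast? = some x))

/-- Auxiliary definition for `pl`. -/
noncomputable def plAux (J : SimpleGraph W) (ℓ : W → W → List V) : ℕ → W → W → List V
  | 0, _, _ => []
  | n + 1, v, x => ℓ v (nx J v x) ++ plAux J ℓ n (nx J v x) x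

/-- The concatenation of the lists `ℓ` along the path of the tree `J` from `v` to `x`. -/
noncomputable def pl (J : SimpleGraph W) (ℓ : W → W → List V) (v x : W) : List V :=
  plAux J ℓ (J.dist v x) v x

theorem pl_self (ℓ : W → W → List V) (v : W) : pl J ℓ v v = [] := by
  rw [pl, SimpleGraph.dist_self]; rfl

theorem pl_cons (hJ : J.IsTree) (ℓ : W → W → List V) {v x : W} (h : x ≠ v) :
    pl J ℓ v x = ℓ v (nx J v x) ++ pl J ℓ (nx J v x) x := by
  rw [pl, pl, ← nx_dist hJ h, plAux]

theorem pl_adj (hJ : J.IsTree) (ℓ : W → W → List V) {v x : W} (h : J.Adj v x) :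
    pl J ℓ v x = ℓ v x := by
  rw [pl_cons hJ ℓ h.ne', nx_of_adj hJ h, pl_self, List.append_nil]

theorem pl_append (hJ : J.IsTree) (ℓ : W → W → List V) {v x t : W}
    (h : x ≠ v → x ≠ t → nx J x v ≠ nx J x t) : pl J ℓ v t = pl J ℓ v x ++ pl J ℓ x t := by
  by_cases hvx : x = v
  · rw [hvx, pl_self, List.nil_append]
  by_cases hxt : x = t
  · rw [hxt, pl_self, List.append_nil]
  replace h := h hvx hxt
  induction hn : J.dist v x using Nat.strong_induction_on generalizing v with
  | _ n ih =>
  subst hn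
  have hd := nx_dist hJ hvx
  obtain ⟨h2, h3⟩ := nx_btw hJ hvx h
  have hvt : t ≠ v := by grind
  rw [pl_cons hJ ℓ hvt, pl_cons hJ ℓ hvx, h2, List.append_assoc]
  congr 1
  by_cases hvn : nx J v x = x
  · rw [hvn, pl_self, List.nil_append]
  · have h1 := nx_pred hJ hvx hvn
    grind

theorem pl_concat (hJ : J.IsTree) (ℓ : W → W → List V) {v x t : W} (h : J.Adj x t)
    (ht : x ≠ v → t ≠ nx J x v) : pl J ℓ v t = pl J ℓ v x ++ ℓ x t := by
  rw [pl_append hJ ℓ (x := x), pl_adj hJ ℓ h]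
  intro h1 _
  rw [nx_of_adj hJ h]; grind

/-- `z` lies in the branch at `v` starting with the neighbour `u` of `v`. -/
def InBranch (J : SimpleGraph W) (ℓ : W → W → List V) (v u : W) (z : V) : Prop :=
  ∃ y, y ≠ v ∧ nx J v y = u ∧ z ∈ ℓ (nx J y v) y

theorem inBranch_of_mem_pl (hJ : J.IsTree) {ℓ : W → W → List V} {v x : W} {z : V}
    (hz : z ∈ pl J ℓ v x) : x ≠ v ∧ InBranch J ℓ v (nx J v x) z := by
  have hxv : x ≠ v := by rintro rfl; simp [pl_self] at hz
  refine ⟨hxv, ?_⟩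
  induction hn : J.dist v x using Nat.strong_induction_on generalizing v with
  | _ n ih =>
  subst hn
  have ha := nx_adj hJ hxv
  have hd := nx_dist hJ hxv
  rw [pl_cons hJ ℓ hxv, List.mem_append] at hz
  rcases hz with hz | hz
  · exact ⟨nx J v x, ha.ne', nx_of_adj hJ ha, by rwa [nx_of_adj hJ ha.symm]⟩
  · have hne : x ≠ nx J v x := by
      intro h; rw [← h, pl_self] at hz; simp at hz
    obtain ⟨y, hy, hy1, hy2⟩ := ih _ (by omega) hz hne rfl
    have hv : v ≠ nx J (nx J v x) y := by
      rw [hy1]; exact (nx_nx_ne hJ hxv).symm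
    have h1 := nx_back hJ ha.symm hv
    have hyv : y ≠ v := by rintro rfl; rw [nx_self] at h1; exact ha.ne h1
    refine ⟨y, hyv, h1, ?_⟩
    have := nx_pred hJ hyv (by grind)
    grind

namespace LineTree

variable {h : Bool → V} {L : Bool → Set W} {ℓ : W → W → List V}

theorem head_last (H : LineTree G J h L ℓ) {u v : W} (huv : J.Adj u v) :
    (ℓ v u).head? = (ℓ u v).getLast? := by
  rw [H.rev u v huv, List.head?_reverse]

theorem mem_comm (H : LineTree G J h L ℓ) {u v : W} (huv : J.Adj u v) {z : V} :
    z ∈ ℓ v u ↔ z ∈ ℓ u v := by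
  rw [H.rev u v huv, List.mem_reverse]

/-- Tree edges in different directions at `v` can share no vertex but `v`, so adjacency between the
two branches happens only between the two rung ends at `v`. -/
theorem branch_cross (H : LineTree G J h L ℓ) {v u u' : W} (hu : u ≠ u')
    {z z' : V} (hz : InBranch J ℓ v u z) (hz' : InBranch J ℓ v u' z') :
    z ≠ z' ∧ (G.Adj z z' ↔ (ℓ v u).head? = some z ∧ (ℓ v u').head? = some z') := by
  have hJ := H.tree
  obtain ⟨y, hyv, hy, hzy⟩ := hz
  obtain ⟨y', hyv', hy', hzy'⟩ := hz'
  have ay : J.Adj (nx J y v) y := (nx_adj hJ hyv.symm).symm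
  have ay' : J.Adj (nx J y' v) y' := (nx_adj hJ hyv'.symm).symm
  have e1 : y ≠ y' := by grind
  have step : ∀ {y : W}, y ≠ v → nx J y v ≠ v → nx J v (nx J y v) = nx J v y := fun h1 h2 =>
    nx_pred hJ h1.symm h2
  have e2 : y ≠ nx J y' v := by grind
  have e3 : y' ≠ nx J y v := by grind
  have e4 : nx J y v = nx J y' v → nx J y v = v := by grind
  have key : ∀ {y : W} {u : W}, y ≠ v → nx J v y = u → nx J y v = v → y = u := by
    intro y u h1 h2 h3
    have := nx_adj hJ h1.symm
    rw [h3] at this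
    rw [← h2, nx_of_adj hJ this.symm]
  have hne : s(nx J y v, y) ≠ s(nx J y' v, y') := by grind
  refine ⟨fun h => H.disjoint _ _ _ _ ay ay' hne z hzy (h ▸ hzy'), ?_⟩
  have edge : ∀ {y u : W} {z : V}, y ≠ v → nx J v y = u → z ∈ ℓ (nx J y v) y →
      (ℓ v u).head? = some z → nx J y v = v := by
    intro y u z h1 h2 h3 h4
    by_contra h5
    have h6 := nx_adj hJ h1
    rw [h2] at h6
    refine H.disjoint _ _ _ _ (nx_adj hJ h1.symm).symm h6 ?_ z h3 (List.mem_of_head? h4)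
    grind
  -- The two tree edges meet exactly when both have `v` as their near end.
  by_cases h4 : nx J y v = nx J y' v
  · have h5 := e4 h4
    have h6 : nx J y' v = v := h4 ▸ h5
    have h7 := key hyv hy h5
    have h8 := key hyv' hy' h6
    rw [h5] at ay hzy; rw [h6] at ay' hzy'
    subst h7; subst h8
    exact H.adj v y y' ay ay' e1 z hzy z' hzy'
  · refine iff_of_false (H.anti _ _ _ _ ay ay' h4 (Ne.symm e3) e2 e1 z hzy z' hzy') ?_
    grind

theorem inBranch_adj (H : LineTree G J h L ℓ) {v u : W} (huv : J.Adj v u) {z : V}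
    (hz : z ∈ ℓ v u) : InBranch J ℓ v u z :=
  ⟨u, huv.ne', nx_of_adj H.tree huv, by rwa [nx_of_adj H.tree huv.symm]⟩

theorem pl_ne_nil (H : LineTree G J h L ℓ) {v x : W} (hx : x ≠ v) : pl J ℓ v x ≠ [] := by
  rw [pl_cons H.tree ℓ hx]
  simp [H.ne _ _ (nx_adj H.tree hx)]

theorem pl_head (H : LineTree G J h L ℓ) {v x : W} (hx : x ≠ v) :
    (pl J ℓ v x).head? = (ℓ v (nx J v x)).head? := by
  rw [pl_cons H.tree ℓ hx, List.head?_append_of_ne_nil _ (H.ne _ _ (nx_adj H.tree hx))]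

theorem pl_ip (H : LineTree G J h L ℓ) (v x : W) : IP G (pl J ℓ v x) := by
  induction hn : J.dist v x using Nat.strong_induction_on generalizing v with
  | _ n ih =>
  subst hn
  by_cases hxv : x = v
  · rw [hxv, pl_self]; trivial
  have hJ := H.tree
  have ha := nx_adj hJ hxv
  have hd := nx_dist hJ hxv
  rw [pl_cons hJ ℓ hxv, IP.append_iff]
  refine ⟨H.ip _ _ ha, ih _ (by omega) _ rfl, fun z hz z' hz' => ?_⟩
  obtain ⟨h1, h2⟩ := inBranch_of_mem_pl hJ hz'
  have := H.branch_cross (nx_nx_ne hJ hxv).symm (H.inBranch_adj ha.symm ((H.mem_comm ha).2 hz)) h2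
  rwa [H.head_last ha, ← H.pl_head h1] at this

theorem pl_cross (H : LineTree G J h L ℓ) {v x x' : W} (hne : nx J v x ≠ nx J v x')
    {z z' : V} (hz : z ∈ pl J ℓ v x) (hz' : z' ∈ pl J ℓ v x') : z ≠ z' ∧
    (G.Adj z z' ↔ (pl J ℓ v x).head? = some z ∧ (pl J ℓ v x').head? = some z') := by
  obtain ⟨h1, h2⟩ := inBranch_of_mem_pl H.tree hz
  obtain ⟨h3, h4⟩ := inBranch_of_mem_pl H.tree hz'
  have := H.branch_cross hne h2 h4
  rwa [← H.pl_head h1, ← H.pl_head h3] at this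

theorem pl_reverse (H : LineTree G J h L ℓ) (v x : W) : pl J ℓ x v = (pl J ℓ v x).reverse := by
  induction hn : J.dist v x using Nat.strong_induction_on generalizing v with
  | _ n ih =>
  subst hn
  by_cases hxv : x = v
  · rw [hxv, pl_self]; rfl
  have hJ := H.tree
  have ha := nx_adj hJ hxv
  have hd := nx_dist hJ hxv
  rw [pl_cons hJ ℓ hxv, List.reverse_append, ← ih _ (by omega) _ rfl, ← H.rev _ _ ha]
  exact pl_concat hJ ℓ ha.symm fun h => (nx_nx_ne hJ hxv).symm

theorem hub_notMem_pl (H : LineTree G J h L ℓ) (c : Bool) (v x : W) : h c ∉ pl J ℓ v x := by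
  intro hm
  obtain ⟨_, y, h1, _, h2⟩ := inBranch_of_mem_pl H.tree hm
  exact H.hub_notMem c _ _ (nx_adj H.tree h1.symm).symm h2

/-- Inner vertices of a tree path are not leaves and its start `v` is not in `L c`; hence a hub can
see the path only at its far end. -/
theorem hub_pl (H : LineTree G J h L ℓ) {c : Bool} {v x : W} (hv : v ∉ L c) {z : V}
    (hz : z ∈ pl J ℓ v x) : G.Adj (h c) z ↔ x ∈ L c ∧ (pl J ℓ v x).getLast? = some z := by
  have hJ := H.tree
  have hxv := (inBranch_of_mem_pl hJ hz).1
  induction hn : J.dist v x using Nat.strong_induction_on generalizing v with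
  | _ n ih =>
  subst hn
  have ha := nx_adj hJ hxv
  have hd := nx_dist hJ hxv
  have hip := H.pl_ip v x
  rw [pl_cons hJ ℓ hxv] at hz hip ⊢
  by_cases hx : nx J v x = x
  · rw [hx, pl_self, List.append_nil] at hz ⊢
    rw [H.hub c _ _ (hx ▸ ha) z hz]; simp [hv]
  · have hne := H.pl_ne_nil (Ne.symm hx)
    rw [List.getLast?_append_of_ne_nil _ hne]
    have hL : nx J v x ∉ L c := fun hL =>
      nx_nx_ne hJ hxv (H.leaf c _ hL _ _ (nx_adj hJ (Ne.symm hx)) ha.symm)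
    rcases List.mem_append.1 hz with hz | hz
    · refine iff_of_false ?_ ?_
      · rw [H.hub c _ _ ha z hz]; tauto
      · rintro ⟨_, h⟩
        exact ((IP.append_iff.1 hip).2.2 z hz z (List.mem_of_getLast? h)).1 rfl
    grind

/-- The arm of a pyramid with apex `h i` obtained from the path of the tree from `v` to a leaf
`t` in `L c`. -/
noncomputable def _root_.TreeStrip.arm (J : SimpleGraph W) (ℓ : W → W → List V) (h : Bool → V) (i : Bool)
    (v t : W) (c : Bool) : List V :=
  if c = i then pl J ℓ v t else pl J ℓ v t ++ [h c]

theorem _root_.TreeStrip.mem_arm {i c : Bool} {v t : W} {z : V} : z ∈ arm J ℓ h i v t c ↔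
    z ∈ pl J ℓ v t ∨ (c ≠ i ∧ z = h c) := by
  unfold arm; grind

/-- Three leaves in different branches at `v` give a pyramid with apex `h i`. -/
theorem pyr (H : LineTree G J h L ℓ) {i : Bool} {v : W} {t : Fin 3 → W} {c : Fin 3 → Bool}
    (hv : ∀ c, v ∉ L c) (ht : ∀ j, t j ∈ L (c j))
    (hne : ∀ j k, j ≠ k → nx J v (t j) ≠ nx J v (t k))
    (hc : ∀ j k, j ≠ k → c j = i ∨ c k = i) :
    Pyr G (h i) fun j => arm J ℓ h i v (t j) (c j) := by
  have htv : ∀ j, t j ≠ v := fun j h => hv _ (h ▸ ht j)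
  have hne0 : ∀ j, pl J ℓ v (t j) ≠ [] := fun j => H.pl_ne_nil (htv j)
  have hnot : ∀ {b : Bool}, b ≠ i → b = !i := by simp_all
  have hhead : ∀ j, (arm J ℓ h i v (t j) (c j)).head? = (pl J ℓ v (t j)).head? := by
    intro j; unfold arm; split
    · rfl
    · rw [List.head?_append_of_ne_nil _ (hne0 j)]
  have hL : ∀ {j b}, b ≠ c j → t j ∉ L b := by
    intro j b hb
    have := H.disj _ _ (ht j)
    have : b = !c j := by revert hb; cases b <;> cases c j <;> simp
    grind
  -- At most one arm is prolonged by the other hub. The remaining arms end in leaves of `L i`, and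
  -- this says that `h (!i)` sees nothing on them.
  have hhh : ∀ j z, z ∈ pl J ℓ v (t j) → c j = i → (h (!i)) ≠ z ∧ ¬ G.Adj (h (!i)) z := by
    intro j z hz hcj
    refine ⟨fun he => H.hub_notMem_pl _ _ _ (he ▸ hz), ?_⟩
    rw [H.hub_pl (hv _) hz]
    rintro ⟨h1, _⟩
    exact hL (by simp [hcj]) h1
  refine ⟨fun j => ?_, fun j => ?_, fun j => ?_, fun j z hz => ?_, fun j k hjk x hx y hy => ?_⟩
  · unfold arm; split
    · exact H.pl_ip _ _
    · rw [IP.append_iff]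
      refine ⟨H.pl_ip _ _, IP.singleton _, fun x hx y hy => ?_⟩
      rw [List.mem_singleton] at hy; subst hy
      refine ⟨fun he => H.hub_notMem_pl _ _ _ (he ▸ hx), ?_⟩
      rw [G.adj_comm, H.hub_pl (hv _) hx]; simp [ht]
  · unfold arm; split
    · exact hne0 j
    · simp
  · rw [mem_arm]
    rintro (h1 | ⟨h1, h2⟩)
    · exact H.hub_notMem_pl _ _ _ h1
    · rw [hnot h1] at h2
      exact (H.hubs i).ne h2
  · rw [mem_arm] at hz
    unfold arm
    split
    · rename_i hci
      rw [H.hub_pl (hv _) (hz.resolve_right fun h => h.1 hci), ← hci]; simp [ht]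
    · rename_i hci
      rw [List.getLast?_concat]
      rcases hz with hz | ⟨_, rfl⟩
      · refine iff_of_false ?_ ?_
        · rw [H.hub_pl (hv _) hz]
          rintro ⟨h1, _⟩
          exact hL (Ne.symm hci) h1
        · rintro he
          simp only [Option.some.injEq] at he
          exact H.hub_notMem_pl _ _ _ (he ▸ hz)
      · have := H.hubs i
        rw [← hnot hci] at this
        simp [this]
  · rw [hhead, hhead]
    rw [mem_arm] at hx hy
    have hub_ne : ∀ k, (pl J ℓ v (t k)).head? ≠ some (h (!i)) := fun k he =>
      H.hub_notMem_pl _ _ _ (List.mem_of_head? he)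
    rcases hx with hx | ⟨hxi, rfl⟩ <;> rcases hy with hy | ⟨hyi, rfl⟩
    · exact H.pl_cross (hne j k hjk) hx hy
    · have := hhh j x hx ((hc j k hjk).resolve_right hyi)
      rw [hnot hyi]
      exact ⟨this.1.symm, iff_of_false (fun h => this.2 h.symm) fun h => hub_ne k h.2⟩
    · have := hhh k y hy ((hc j k hjk).resolve_left hxi)
      rw [hnot hxi]
      grind
    grind

end LineTree

end LineTrees

/-! ### Passing between walks and lists; minimal paths -/

section PathLists

variable {V : Type*} {G : SimpleGraph V}

theorem IsInducedPath.ip {x y : V} {p : G.Walk x y} (hp : IsInducedPath G p) :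
    IP G p.support := by
  obtain ⟨hp, hi⟩ := hp
  induction p with
  | nil => exact IP.singleton _
  | @cons u v w hadj q ih =>
    rw [SimpleGraph.Walk.cons_isPath_iff] at hp
    rw [SimpleGraph.Walk.support_cons]
    refine ⟨hp.2, fun z hz => ?_, ih hp.1 fun a ha b hb hab => ?_⟩
    · have hh : q.support.head? = some v := by cases q <;> simp
      rw [hh]
      constructor
      · intro huz
        have := hi u (by simp) z (by simp [hz]) huz
        rw [SimpleGraph.Walk.edges_cons, List.mem_cons] at this
        rcases this with h | h
        · grind
        · exact absurd (q.fst_mem_support_of_mem_edges h) hp.2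
      grind
    · have := hi a (by simp [ha]) b (by simp [hb]) hab
      rw [SimpleGraph.Walk.edges_cons, List.mem_cons] at this
      grind

theorem IP.exists_walk {l : List V} {x y : V} (hl : IP G l) (hx : l.head? = some x)
    (hy : l.getLast? = some y) : ∃ p : G.Walk x y, IsInducedPath G p ∧ p.support = l := by
  induction l generalizing x with
  | nil => simp at hx
  | cons a l ih =>
    simp only [List.head?_cons, Option.some.injEq] at hx
    subst hx
    rcases l with _ | ⟨b, l⟩
    · simp only [List.getLast?_singleton, Option.some.injEq] at hy
      subst hy
      exact ⟨SimpleGraph.Walk.nil, ⟨by simp, by simp⟩, by simp⟩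
    · obtain ⟨p, hp, hs⟩ := ih hl.2.2 (x := b) rfl (by grind)
      have hab : G.Adj a b := (hl.2.1 b (by simp)).2 rfl
      refine ⟨SimpleGraph.Walk.cons hab p, ⟨hp.1.cons (hs ▸ hl.1), ?_⟩, by simp [hs]⟩
      intro u hu v hv huv
      have key : ∀ z ∈ p.support, G.Adj a z → z = b := fun z hz haz => by
        have := (hl.2.1 z (hs ▸ hz)).1 haz
        grind
      rw [SimpleGraph.Walk.support_cons, List.mem_cons] at hu hv
      rw [SimpleGraph.Walk.edges_cons, List.mem_cons]
      rcases hu with rfl | hu <;> rcases hv with rfl | hv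
      · exact absurd huv (SimpleGraph.irrefl _)
      · grind
      · left; rw [key u hu huv.symm, Sym2.eq_swap]
      · exact Or.inr (hp.2 u hu v hv huv)

/-- Induction along a walk. The new first vertex either already lies on the path, which is cut
there, or is joined to its last neighbour on the path, which keeps the path induced. -/
theorem exists_ip_of_reachable {F : Set V} {f g : F} (h : (G.induce F).Reachable f g) :
    ∃ p : List V, IP G p ∧ (∀ z ∈ p, z ∈ F) ∧ p.head? = some f.1 ∧ p.getLast? = some g.1 := by
  obtain ⟨w⟩ := h
  induction w with
  | @nil u => exact ⟨[u.1], IP.singleton _, by simp, by simp, by simp⟩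
  | @cons u v w hadj q ih =>
    obtain ⟨p, hp, hF, hh, hl⟩ := ih
    by_cases hu : u.1 ∈ p
    · obtain ⟨s, t, rfl⟩ := List.append_of_mem hu
      refine ⟨u.1 :: t, hp.right, fun z hz => hF z (List.mem_append_right _ hz), rfl, ?_⟩
      grind
    · obtain ⟨s, z, t, rfl, hz, ht⟩ := exists_last (P := fun z => G.Adj u.1 z)
        ⟨v.1, List.mem_of_head? hh, hadj⟩
      refine ⟨u.1 :: z :: t, ⟨fun h => hu (List.mem_append_right _ h), fun y hy => ?_,
        hp.right⟩, ?_, rfl, ?_⟩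
      · grind
      · grind
      grind

/-- The property is arbitrary, because minimal paths are needed for three different purposes: for
unrelated pairs, for joining a vertex to a hub, and for joining two leaf nodes. -/
theorem exists_minimal_list {F : Set V} {P : List V → Prop}
    (h : ∃ p : List V, IP G p ∧ (∀ z ∈ p, z ∈ F) ∧ P p) :
    ∃ p : List V, IP G p ∧ (∀ z ∈ p, z ∈ F) ∧ P p ∧
      ∀ q : List V, IP G q → (∀ z ∈ q, z ∈ p) → q.length < p.length → ¬ P q := by
  classical
  have hex : ∃ n, ∃ p : List V, IP G p ∧ (∀ z ∈ p, z ∈ F) ∧ P p ∧ p.length = n := by simp_all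
  obtain ⟨p, h1, h2, h3, h4⟩ := Nat.find_spec hex
  refine ⟨p, h1, h2, h3, fun q hq hqp hl hP => ?_⟩
  rw [h4] at hl
  exact Nat.find_min hex hl ⟨q, hq, fun z hz => h2 z (hqp z hz), hP, rfl⟩

end PathLists

/-! ### Beyond a vertex, and edges named by their far ends -/

section MoreTrees

variable {W : Type*} {J : SimpleGraph W}

/-- `t` equals `x`, or lies beyond `x` when seen from `v`. -/
def Beyond (J : SimpleGraph W) (v x t : W) : Prop := t = x ∨ nx J x v ≠ nx J x t

theorem Beyond.pl_eq {V : Type*} (hJ : J.IsTree) {v x t : W} (h : Beyond J v x t)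
    (ℓ : W → W → List V) : pl J ℓ v t = pl J ℓ v x ++ pl J ℓ x t :=
  pl_append hJ ℓ fun _ h2 => h.resolve_left h2.symm

theorem Beyond.nx_eq (hJ : J.IsTree) {v x t : W} (hx : x ≠ v) (h : Beyond J v x t) :
    nx J v t = nx J v x := by
  rcases h with rfl | h
  · rfl
  · exact (nx_btw hJ hx h).1

theorem Beyond.dist_eq (hJ : J.IsTree) {v x t : W} (hx : x ≠ v) (h : Beyond J v x t) :
    J.dist v t = J.dist v x + J.dist x t := by
  rcases h with rfl | h
  · simp
  · exact (nx_btw hJ hx h).2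

theorem Beyond.ne {v x t : W} (hx : x ≠ v) (h : Beyond J v x t) : t ≠ v := by
  rintro rfl
  rcases h with rfl | h
  · exact hx rfl
  · exact h rfl

theorem Beyond.nx_back (hJ : J.IsTree) {v x t : W} (h : Beyond J v x t) (ht : t ≠ x) :
    nx J t v = nx J t x := by
  have h1 := h.resolve_left ht
  exact (nx_btw hJ ht.symm h1.symm).1

theorem Beyond.step (hJ : J.IsTree) {v x t u : W} (h : Beyond J v x t) (hu : J.Adj t u)
    (hne : u ≠ nx J t v) : Beyond J v x u := by
  by_cases ht : t = x
  · subst ht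
    right; rw [nx_of_adj hJ hu]; exact hne.symm
  · right
    rw [h.nx_back hJ ht] at hne
    rw [(nx_btw hJ ht (t := u) (by rw [nx_of_adj hJ hu]; exact hne.symm)).1]
    exact h.resolve_left ht

/-- The far end of an edge, seen from `v`. -/
theorem exists_far (hJ : J.IsTree) (v : W) {e : Sym2 W} (he : e ∈ J.edgeSet) :
    ∃ y, y ≠ v ∧ e = s(nx J y v, y) := by
  induction e with
  | _ a b =>
  have hab : J.Adj a b := he
  by_cases h : nx J a v = b
  · have hva : v ≠ a := by rintro rfl; rw [nx_self] at h; exact hab.ne h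
    grind
  · have := nx_back hJ hab (Ne.symm h)
    refine ⟨b, ?_, by rw [this]⟩
    rintro rfl
    rw [nx_self] at this; simp_all

theorem far_unique (hJ : J.IsTree) {v y y' : W} (hy : y ≠ v) (hy' : y' ≠ v)
    (h : s(nx J y v, y) = s(nx J y' v, y')) : y = y' := by
  rw [Sym2.eq_iff] at h
  rcases h with ⟨_, h⟩ | ⟨h1, h2⟩
  · exact h
  · have a := nx_dist hJ hy.symm
    have b := nx_dist hJ hy'.symm
    grind

theorem branch_edges_meet (hJ : J.IsTree) {v y y' w : W} (hy : y ≠ v) (hy' : y' ≠ v)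
    (hne : nx J v y ≠ nx J v y') (h : w ∈ s(nx J y v, y)) (h' : w ∈ s(nx J y' v, y')) :
    w = v := by
  by_contra hw
  have key : ∀ {y : W}, y ≠ v → w ∈ s(nx J y v, y) → nx J v w = nx J v y := by
    intro y hy h
    rcases Sym2.mem_iff.1 h with rfl | rfl
    · exact nx_pred hJ hy.symm hw
    · rfl
  grind

theorem mem_far_edge_self (hJ : J.IsTree) {v y : W} (hy : y ≠ v) (h : v ∈ s(nx J y v, y)) :
    nx J y v = v ∧ y = nx J v y := by
  rcases Sym2.mem_iff.1 h with h | h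
  · refine ⟨h.symm, ?_⟩
    have := nx_adj hJ hy.symm
    rw [← h] at this
    exact (nx_of_adj hJ this.symm).symm
  grind

theorem far_edge_mem (hJ : J.IsTree) {v y : W} (hy : y ≠ v) :
    s(nx J y v, y) ∈ J.edgeSet := (nx_adj hJ hy.symm).symm

end MoreTrees

/-! ### Strip systems with a cross-edge and selections of rungs -/

section Context

variable {V W : Type*} {G : SimpleGraph V} {J : SimpleGraph W} {M : StripFamily V W}
  {h : Bool → V} {L : Bool → Set W} {p : List V} {ℓ : W → W → List V} {i : Bool}

/-- A strip system with cross-edge `h true`, `h false` in an even-hole-free graph; the leaves in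
`L c` belong to `h c`. -/
structure CrossSystem (G : SimpleGraph V) (J : SimpleGraph W) (M : StripFamily V W)
    (h : Bool → V) (L : Bool → Set W) : Prop where
  ehf : EvenHoleFree G
  finite : Finite W
  sys : IsStripSystem G J M
  hubs : ∀ c, G.Adj (h c) (h (!c))
  isLeaf : ∀ c, ∀ t ∈ L c, IsLeaf J t
  leaf_mem : ∀ t, IsLeaf J t → ∃ c, t ∈ L c
  disj : ∀ c, ∀ t ∈ L c, t ∉ L (!c)
  deg : ∀ v, (J.neighborSet v).ncard ≠ 2
  one : ∀ c s, (J.neighborSet s ∩ L c).Subsingleton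
  hub_notMem : ∀ c, h c ∉ M.verts J
  hub : ∀ c, ∀ x ∈ M.verts J, (G.Adj (h c) x ↔ ∃ u ∈ L c, x ∈ M.node u)

/-- A choice of a rung for each edge of the tree. -/
structure Selection (G : SimpleGraph V) (J : SimpleGraph W) (M : StripFamily V W)
    (ℓ : W → W → List V) : Prop where
  ne : ∀ u v, J.Adj u v → ℓ u v ≠ []
  ip : ∀ u v, J.Adj u v → IP G (ℓ u v)
  rev : ∀ u v, J.Adj u v → ℓ v u = (ℓ u v).reverse
  sub : ∀ u v, J.Adj u v → ∀ z ∈ ℓ u v, z ∈ M.edge s(u, v)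
  node : ∀ u v, J.Adj u v → ∀ z ∈ ℓ u v, (z ∈ M.node u ↔ (ℓ u v).head? = some z)

/-- The list `l` is a rung of the strip at `uv`. -/
structure IsRung (G : SimpleGraph V) (M : StripFamily V W) (u v : W) (l : List V) : Prop where
  ne : l ≠ []
  ip : IP G l
  sub : ∀ z ∈ l, z ∈ M.edge s(u, v)
  fst : ∀ z ∈ l, (z ∈ M.node u ↔ l.head? = some z)
  snd : ∀ z ∈ l, (z ∈ M.node v ↔ l.getLast? = some z)

theorem IsRung.reverse {u v : W} {l : List V} (hl : IsRung G M u v l) :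
    IsRung G M v u l.reverse := by
  refine ⟨by simpa using hl.ne, hl.ip.reverse, fun z hz => ?_, fun z hz => ?_, fun z hz => ?_⟩
  · rw [Sym2.eq_swap]; exact hl.sub z (by simpa using hz)
  · rw [List.head?_reverse]; exact hl.snd z (by simpa using hz)
  · rw [List.getLast?_reverse]; exact hl.fst z (by simpa using hz)

theorem Selection.isRung {ℓ : W → W → List V} (hℓ : Selection G J M ℓ) {u v : W}
    (huv : J.Adj u v) : IsRung G M u v (ℓ u v) :=
  ⟨hℓ.ne u v huv, hℓ.ip u v huv, hℓ.sub u v huv, hℓ.node u v huv, fun z hz => by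
    have := hℓ.node v u huv.symm z (by rw [hℓ.rev u v huv]; simpa using hz)
    rwa [hℓ.rev u v huv, List.head?_reverse] at this⟩

/-- A rung is chosen for one orientation of each edge and reversed for the other. -/
theorem exists_orientation (W : Type*) : ∃ o : W → W → Prop, ∀ u v, u ≠ v → (o u v ↔ ¬ o v u) := by
  refine ⟨WellOrderingRel, fun u v huv => ⟨fun h1 h2 => asymm h1 h2, fun h1 => ?_⟩⟩
  rcases trichotomous_of WellOrderingRel u v with h2 | h2 | h2
  · exact h2
  · grind
  grind

namespace CrossSystem

theorem mem_verts_of_edge {z : V} {e : Sym2 W} (he : e ∈ J.edgeSet) (hz : z ∈ M.edge e) :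
    z ∈ M.verts J := Set.mem_biUnion he hz

theorem mem_edge_unique (C : CrossSystem G J M h L) {z : V} {e f : Sym2 W} (he : e ∈ J.edgeSet)
    (hf : f ∈ J.edgeSet) (hz : z ∈ M.edge e) (hz' : z ∈ M.edge f) : e = f := by
  by_contra hne
  exact Set.disjoint_left.1 (C.sys.disjoint he hf hne) hz hz'

theorem node_mem_edge (C : CrossSystem G J M h L) {z : V} {e : Sym2 W} (he : e ∈ J.edgeSet)
    (hz : z ∈ M.edge e) {w : W} (hw : z ∈ M.node w) : w ∈ e := by
  have := C.sys.node_subset w hw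
  simp only [Set.mem_iUnion, SimpleGraph.mem_neighborSet] at this
  obtain ⟨u, hu, hzu⟩ := this
  rw [C.mem_edge_unique he hu hz hzu]
  grind

theorem node_mem_verts (C : CrossSystem G J M h L) {z : V} {w : W} (hw : z ∈ M.node w) :
    z ∈ M.verts J := by
  have := C.sys.node_subset w hw
  simp only [Set.mem_iUnion, SimpleGraph.mem_neighborSet] at this
  obtain ⟨u, hu, hzu⟩ := this
  exact mem_verts_of_edge hu hzu

theorem exists_edge_of_node (C : CrossSystem G J M h L) {z : V} {w : W} (hw : z ∈ M.node w) :
    ∃ u, J.Adj w u ∧ z ∈ M.edge s(w, u) := by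
  have := C.sys.node_subset w hw
  simp_all

theorem leaf_unique (C : CrossSystem G J M h L) {c : Bool} {t : W} (ht : t ∈ L c) {u v : W}
    (hu : J.Adj t u) (hv : J.Adj t v) : u = v := by
  have := C.isLeaf c t ht
  rw [IsLeaf, Set.ncard_eq_one] at this
  obtain ⟨a, ha⟩ := this
  have h1 : u ∈ J.neighborSet t := hu
  have h2 : v ∈ J.neighborSet t := hv
  grind

theorem disj' (C : CrossSystem G J M h L) {c d : Bool} {t : W} (ht : t ∈ L c) (ht' : t ∈ L d) :
    c = d := by
  by_contra hne
  have : d = !c := by revert hne; cases c <;> cases d <;> simp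
  exact C.disj c t ht (this ▸ ht')

/-- A vertex that is not a leaf has two neighbours different from a given one. -/
theorem exists_two (C : CrossSystem G J M h L) {v u : W} (hv : ∀ c, v ∉ L c) (hu : J.Adj v u) :
    ∃ u₁ u₂, J.Adj v u₁ ∧ J.Adj v u₂ ∧ u₁ ≠ u ∧ u₂ ≠ u ∧ u₁ ≠ u₂ := by
  have := C.finite
  have h1 : (J.neighborSet v).ncard ≠ 1 := fun h1 => by
    obtain ⟨c, hc⟩ := C.leaf_mem v h1
    exact hv c hc
  have h2 := C.deg v
  have h3 : (J.neighborSet v \ {u}).ncard + 1 = (J.neighborSet v).ncard :=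
    Set.ncard_sdiff_singleton_add_one hu (Set.toFinite _)
  obtain ⟨a, ha, b, hb, hab⟩ := (Set.one_lt_ncard (Set.toFinite _)).1
    (show 1 < (J.neighborSet v \ {u}).ncard by omega)
  exact ⟨a, b, ha.1, hb.1, ha.2, hb.2, hab⟩

theorem exists_nonleaf_nbr (C : CrossSystem G J M h L) {v u : W} (hv : ∀ c, v ∉ L c)
    (hu : J.Adj v u) (c : Bool) : ∃ u', J.Adj v u' ∧ u' ≠ u ∧ u' ∉ L c := by
  obtain ⟨u₁, u₂, h1, h2, h3, h4, h5⟩ := C.exists_two hv hu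
  by_cases h6 : u₁ ∈ L c
  · exact ⟨u₂, h2, h4, fun h7 => h5 (C.one c v ⟨h1, h6⟩ ⟨h2, h7⟩)⟩
  grind

theorem not_leaf_of_two (C : CrossSystem G J M h L) {v u u' : W} (hu : J.Adj v u)
    (hu' : J.Adj v u') (hne : u ≠ u') (c : Bool) : v ∉ L c :=
  fun hv => hne (C.leaf_unique hv hu hu')

/-- Paths can be extended to leaves of a prescribed kind. -/
theorem exists_leaf_beyond (C : CrossSystem G J M h L) {v x : W} (hx : x ≠ v) (c : Bool)
    (hxL : x ∉ L (!c)) : ∃ t ∈ L c, Beyond J v x t := by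
  have hJ := C.sys.tree
  have := C.finite
  -- Take a farthest vertex beyond `x` outside `L (!c)`. If it is not in `L c` it is no leaf, so it
  -- has a neighbour farther from `v`; as at most one neighbour lies in `L (!c)`, that neighbour can
  -- be chosen outside it, against maximality.
  obtain ⟨t, ⟨ht1, ht2⟩, hmax⟩ := Set.exists_max_image {t | Beyond J v x t ∧ t ∉ L (!c)}
    (fun t => J.dist v t) (Set.toFinite _) ⟨x, Or.inl rfl, hxL⟩
  refine ⟨t, ?_, ht1⟩
  by_contra htc
  have htv := ht1.ne hx
  have ha := nx_adj hJ htv.symm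
  obtain ⟨u, hu1, hu2, hu3⟩ := C.exists_nonleaf_nbr (v := t) (u := nx J t v)
    (fun d => by
      by_cases hd : d = c
      · rwa [hd]
      · have : d = !c := by revert hd; cases c <;> cases d <;> simp
        rwa [this]) ha (!c)
  have h1 := dist_of_ne_nx hJ hu1 hu2
  have h2 := hmax u ⟨ht1.step hJ hu1 hu2, hu3⟩
  rw [J.dist_comm (u := u), J.dist_comm (u := t)] at h1
  omega

/-- The clause about positive length in the definition of a rung is what makes the first vertex the
only one in M_u and the last the only one in M_v; for length zero both are the same vertex. -/
theorem inRung_isRung {u v : W} {z : V} (hz : InRung G (M.edge s(u, v) ∩ M.node u)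
    (M.edge s(u, v) ∩ M.node v) (M.edge s(u, v) \ (M.node u ∪ M.node v)) z) :
    ∃ l, IsRung G M u v l ∧ z ∈ l := by
  obtain ⟨x, y, p, hp, hx, hy, hC, hlen, hz⟩ := hz
  have e1 : p.support.head? = some x := by cases p <;> simp
  have e2 : p.support.getLast? = some y := by
    rw [List.getLast?_eq_some_getLast p.support_ne_nil, p.getLast_support]
  refine ⟨p.support, ⟨p.support_ne_nil, hp.ip, fun w hw => ?_, fun w hw => ?_, fun w hw => ?_⟩, hz⟩
  · by_cases h1 : w = x
    · exact h1 ▸ hx.1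
    grind
  · rw [e1, Option.some.injEq]
    grind
  · rw [e2, Option.some.injEq]
    grind

theorem IsRung.inRung {u v : W} {l : List V} (hl : IsRung G M u v l) {z : V} (hz : z ∈ l) :
    InRung G (M.edge s(u, v) ∩ M.node u)
    (M.edge s(u, v) ∩ M.node v) (M.edge s(u, v) \ (M.node u ∪ M.node v)) z := by
  obtain ⟨x, l', rfl⟩ := List.exists_cons_of_ne_nil hl.ne
  have hx : (x :: l').head? = some x := rfl
  have hy : (x :: l').getLast? = some ((x :: l').getLast (by simp)) :=
    List.getLast?_eq_some_getLast _
  set y := (x :: l').getLast (by simp) with hy'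
  have hym : y ∈ x :: l' := List.getLast_mem _
  obtain ⟨p, hp, hs⟩ := hl.ip.exists_walk hx hy
  have mx := hl.fst x (by simp)
  have my := hl.snd y hym
  refine ⟨x, y, p, hp, ⟨hl.sub x (by simp), mx.2 hx⟩, ⟨hl.sub y hym, my.2 hy⟩, ?_, ?_, hs ▸ hz⟩
  · intro w hw h1 h2
    rw [hs] at hw
    refine ⟨hl.sub w hw, ?_⟩
    rintro (h3 | h3)
    · have := (hl.fst w hw).1 h3
      grind
    · have := (hl.snd w hw).1 h3
      grind
  · intro hlen
    have hxy : x ≠ y := by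
      intro hxy
      obtain ⟨hpp, -⟩ := hp
      clear_value y
      subst hxy
      rw [SimpleGraph.Walk.isPath_iff_nil] at hpp
      grind
    constructor
    · rintro ⟨_, h3⟩
      have := (hl.snd x (by simp)).1 h3
      grind
    · rintro ⟨_, h3⟩
      have := (hl.fst y hym).1 h3
      grind

theorem exists_rung (C : CrossSystem G J M h L) {u v : W} (huv : J.Adj u v) {z : V}
    (hz : z ∈ M.edge s(u, v)) : ∃ l, IsRung G M u v l ∧ z ∈ l := by
  refine inRung_isRung ((C.sys.strip u v huv).rung z ?_)
  grind

theorem exists_node_mem (C : CrossSystem G J M h L) {u v : W} (huv : J.Adj u v) :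
    ∃ z, z ∈ M.edge s(u, v) ∧ z ∈ M.node u := (C.sys.strip u v huv).left_nonempty

theorem exists_selection (C : CrossSystem G J M h L) : ∃ ℓ, Selection G J M ℓ := by
  classical
  have key : ∀ u v, ∃ l, J.Adj u v → IsRung G M u v l := by
    intro u v
    by_cases huv : J.Adj u v
    · obtain ⟨z, hz, _⟩ := C.exists_node_mem huv
      obtain ⟨l, hl, _⟩ := C.exists_rung huv hz
      grind
    simp_all
  choose R hR using key
  obtain ⟨o, ho⟩ := exists_orientation W
  have main : ∀ u v, J.Adj u v →
      IsRung G M u v (if o u v then R u v else (R v u).reverse) := by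
    intro u v huv
    split
    · exact hR u v huv
    · exact (hR v u huv.symm).reverse
  refine ⟨fun u v => if o u v then R u v else (R v u).reverse, fun u v huv => (main u v huv).ne,
    fun u v huv => (main u v huv).ip, fun u v huv => ?_, fun u v huv => (main u v huv).sub,
    fun u v huv => (main u v huv).fst⟩
  by_cases h1 : o u v
  · have h2 := (ho u v huv.ne).1 h1
    simp [h1, h2]
  · have h2 := (ho v u huv.ne').2 h1
    simp [h1, h2]

/-- A selection can be changed at one edge, so as to pass through a given vertex. -/
theorem exists_selection_through (_C : CrossSystem G J M h L) {ℓ : W → W → List V}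
    (hℓ : Selection G J M ℓ) {u v : W} (huv : J.Adj u v) {l : List V} (hl : IsRung G M u v l) :
    ∃ ℓ', Selection G J M ℓ' ∧ ℓ' u v = l ∧
      ∀ w x, s(w, x) ≠ s(u, v) → ℓ' w x = ℓ w x := by
  classical
  have main : ∀ w x, J.Adj w x → IsRung G M w x
      (if w = u ∧ x = v then l else if w = v ∧ x = u then l.reverse else ℓ w x) := by
    intro w x hwx
    split
    · grind
    split
    · rename_i h1; rw [h1.1, h1.2]; exact hl.reverse
    · exact hℓ.isRung hwx
  refine ⟨fun w x => if w = u ∧ x = v then l else if w = v ∧ x = u then l.reverse else ℓ w x,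
    ⟨fun u v huv => (main u v huv).ne, fun u v huv => (main u v huv).ip, fun w x hwx => ?_,
    fun u v huv => (main u v huv).sub, fun u v huv => (main u v huv).fst⟩, by simp, ?_⟩
  · by_cases h1 : w = u ∧ x = v
    · obtain ⟨rfl, rfl⟩ := h1
      have : ¬ (x = w ∧ w = x) := fun h => huv.ne h.2
      simp [this]
    by_cases h2 : w = v ∧ x = u
    · grind
    · have h3 : ¬ (x = u ∧ w = v) := fun h => h2 ⟨h.2, h.1⟩
      have h4 : ¬ (x = v ∧ w = u) := fun h => h1 ⟨h.2, h.1⟩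
      simp only [h1, h2, h3, h4, if_false]
      exact hℓ.rev w x hwx
  grind

theorem lineTree (C : CrossSystem G J M h L) {ℓ : W → W → List V} (hℓ : Selection G J M ℓ) :
    LineTree G J h L ℓ where
  tree := C.sys.tree
  leaf c t ht u v hu hv := C.leaf_unique ht hu hv
  disj := C.disj
  ne := hℓ.ne
  ip := hℓ.ip
  rev := hℓ.rev
  disjoint u v w x huv hwx hne z hz hz' :=
    hne (C.mem_edge_unique huv hwx (hℓ.sub u v huv z hz) (hℓ.sub w x hwx z hz'))
  adj u v w huv huw hvw x hx y hy := by
    rw [C.sys.adj_iff u v w huv huw hvw x (hℓ.sub u v huv x hx) y (hℓ.sub u w huw y hy),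
      hℓ.node u v huv x hx, hℓ.node u w huw y hy]
  anti u v w x huv hwx h1 h2 h3 h4 y hy z hz :=
    C.sys.anticomplete u v w x huv hwx h1 h2 h3 h4 y (hℓ.sub u v huv y hy) z (hℓ.sub w x hwx z hz)
  hubs := C.hubs
  hub_notMem c u v huv hm := C.hub_notMem c (mem_verts_of_edge huv (hℓ.sub u v huv _ hm))
  hub c u v huv x hx := by
    have hr := hℓ.isRung huv
    rw [C.hub c x (mem_verts_of_edge huv (hr.sub x hx)), ← hr.fst x hx, ← hr.snd x hx]
    constructor
    · rintro ⟨w, hw, hxw⟩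
      rcases Sym2.mem_iff.1 (C.node_mem_edge huv (hr.sub x hx) hxw) with rfl | rfl
      · grind
      grind
    grind

end CrossSystem

/-- `x` and `y` belong to a common `M_e` or to a common `M_v`. -/
def RelJ (J : SimpleGraph W) (M : StripFamily V W) (x y : V) : Prop :=
  (∃ e ∈ J.edgeSet, x ∈ M.edge e ∧ y ∈ M.edge e) ∨ ∃ w, x ∈ M.node w ∧ y ∈ M.node w

/-- The extension of `RelJ` to the hubs. -/
def Rel (J : SimpleGraph W) (M : StripFamily V W) (h : Bool → V) (L : Bool → Set W) (x y : V) :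
    Prop :=
  RelJ J M x y ∨ (∃ c, x = h c ∧ (y = h c ∨ ∃ t ∈ L c, y ∈ M.node t)) ∨
    ∃ c, y = h c ∧ ∃ t ∈ L c, x ∈ M.node t

theorem RelJ.symm {x y : V} (hxy : RelJ J M x y) : RelJ J M y x := by
  rcases hxy with ⟨e, he, h1, h2⟩ | ⟨w, h1, h2⟩
  · exact Or.inl ⟨e, he, h2, h1⟩
  tauto

theorem Rel.symm {x y : V} (hxy : Rel J M h L x y) : Rel J M h L y x := by
  rcases hxy with h1 | ⟨c, h1, h2 | h2⟩ | ⟨c, h1, h2⟩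
  · exact Or.inl h1.symm
  · exact Or.inr (Or.inl ⟨c, h2, Or.inl h1⟩)
  · tauto
  · exact Or.inr (Or.inl ⟨c, h1, Or.inr h2⟩)

/-- The vertices of the strip system and the hubs. -/
def Core (J : SimpleGraph W) (M : StripFamily V W) (h : Bool → V) (x : V) : Prop :=
  x ∈ M.verts J ∨ ∃ c, x = h c

/-- An induced path outside the strip system that has two unrelated attachments, while its
proper subpaths do not. -/
structure Tight (G : SimpleGraph V) (J : SimpleGraph W) (M : StripFamily V W) (h : Bool → V)
    (L : Bool → Set W) (p : List V) : Prop where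
  ip : IP G p
  ne : p ≠ []
  out : ∀ f ∈ p, ¬ Core J M h f
  non : ∃ x y, Core J M h x ∧ Core J M h y ∧ Att G p x ∧ Att G p y ∧ ¬ Rel J M h L x y
  tail : ∀ x y, Core J M h x → Core J M h y → Att G p.tail x → Att G p.tail y → Rel J M h L x y
  drop : ∀ x y, Core J M h x → Core J M h y → Att G p.dropLast x → Att G p.dropLast y →
    Rel J M h L x y

theorem Tight.reverse {p : List V} (hp : Tight G J M h L p) : Tight G J M h L p.reverse where
  ip := hp.ip.reverse
  ne := by simpa using hp.ne
  out f hf := hp.out f (List.mem_reverse.1 hf)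
  non := by simpa only [Att.reverse_iff] using hp.non
  tail := by simpa only [List.tail_reverse, Att.reverse_iff] using hp.drop
  drop := by simpa only [List.dropLast_reverse, Att.reverse_iff] using hp.tail

/-- The path is shortest with an unrelated pair of attachments. The pair may involve a hub, so
minimality also restricts where the hubs are seen. -/
theorem exists_tight {F : Set V} (hF : (G.induce F).Connected) (hout : ∀ f ∈ F, ¬ Core J M h f)
    {x y : V} (hx : Core J M h x) (hy : Core J M h y) {f g : V} (hf : f ∈ F) (hg : g ∈ F)
    (hfx : G.Adj f x) (hgy : G.Adj g y) (hxy : ¬ Rel J M h L x y) :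
    ∃ p, Tight G J M h L p ∧ ∀ z ∈ p, z ∈ F := by
  obtain ⟨p, h1, h2, h3, h4⟩ := exists_minimal_list (G := G) (F := F)
    (P := fun p => ∃ x y, Core J M h x ∧ Core J M h y ∧ Att G p x ∧ Att G p y ∧
      ¬ Rel J M h L x y) (by
      obtain ⟨p, h1, h2, h3, h4⟩ := exists_ip_of_reachable (hF.preconnected ⟨f, hf⟩ ⟨g, hg⟩)
      exact ⟨p, h1, h2, x, y, hx, hy, ⟨f, List.mem_of_head? h3, hfx⟩,
        ⟨g, List.mem_of_getLast? h4, hgy⟩, hxy⟩)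
  have hne : p ≠ [] := by
    rintro rfl
    obtain ⟨x, y, _, _, ⟨f, hf, _⟩, _⟩ := h3
    simp at hf
  have hlen := List.length_pos_of_ne_nil hne
  refine ⟨p, ⟨h1, hne, fun f hf => hout f (h2 f hf), h3, ?_, ?_⟩, h2⟩
  · intro x y hx hy hax hay
    by_contra hr
    exact h4 p.tail h1.tail (fun z hz => List.mem_of_mem_tail hz)
      (by grind) ⟨x, y, hx, hy, hax, hay, hr⟩
  · intro x y hx hy hax hay
    by_contra hr
    exact h4 p.dropLast h1.dropLast (fun z hz => List.mem_of_mem_dropLast hz)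
      (by grind) ⟨x, y, hx, hy, hax, hay, hr⟩

/-- An unrelated pair is attached through opposite ends of a tight path. -/
theorem Tight.ends {p : List V} (hp : Tight G J M h L p) {x y : V} (hx : Core J M h x)
    (hy : Core J M h y) (hax : Att G p x) (hay : Att G p y) (hxy : ¬ Rel J M h L x y) :
    (¬ Att G p.tail x ∧ ¬ Att G p.dropLast y) ∨ (¬ Att G p.dropLast x ∧ ¬ Att G p.tail y) := by
  by_cases hp1 : p.length = 1
  · obtain ⟨f, rfl⟩ := List.length_eq_one_iff.1 hp1
    simp [Att]
  have hp2 : 2 ≤ p.length := by have := List.length_pos_of_ne_nil hp.ne; omega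
  have h1 := att_tail_or_dropLast hp2 hax
  have h2 := att_tail_or_dropLast hp2 hay
  have h3 := hp.tail x y hx hy
  have h4 := hp.drop x y hx hy
  tauto

/-- The vertex `z` of the strip system lies in the branch at `v` starting with `u`. -/
def MBranch (J : SimpleGraph W) (M : StripFamily V W) (v u : W) (z : V) : Prop :=
  ∃ y, y ≠ v ∧ nx J v y = u ∧ z ∈ M.edge s(nx J y v, y)

theorem no_triangle (hJ : J.IsTree) {a b c : W} (hab : J.Adj a b) (hbc : J.Adj b c) :
    ¬ J.Adj a c := by
  intro hac
  have h1 := nx_back hJ hab (x := c) (by rw [nx_of_adj hJ hac]; exact hbc.ne)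
  rw [nx_of_adj hJ hbc] at h1
  simp_all

/-! ### Related vertices, and the pyramid lemma for tight paths -/

namespace CrossSystem

theorem exists_branch (C : CrossSystem G J M h L) (v : W) {z : V} (hz : z ∈ M.verts J) :
    ∃ y, y ≠ v ∧ z ∈ M.edge s(nx J y v, y) := by
  simp only [StripFamily.verts, Set.mem_iUnion, exists_prop] at hz
  obtain ⟨e, he, hz⟩ := hz
  obtain ⟨y, hy, rfl⟩ := exists_far C.sys.tree v he
  grind

theorem far_verts (C : CrossSystem G J M h L) {v y : W} (hy : y ≠ v) {z : V}
    (hz : z ∈ M.edge s(nx J y v, y)) : z ∈ M.verts J :=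
  mem_verts_of_edge (far_edge_mem C.sys.tree hy) hz

theorem node_far (C : CrossSystem G J M h L) {v y : W} (hy : y ≠ v) {z : V}
    (hz : z ∈ M.edge s(nx J y v, y)) (hv : z ∈ M.node v) :
    nx J y v = v ∧ y = nx J v y := by
  have := C.node_mem_edge (far_edge_mem C.sys.tree hy) hz hv
  exact mem_far_edge_self C.sys.tree hy this

/-- An edge of the tree lies in one direction at `v` only, and edges in two directions have no
common end except `v`. So a relation across directions must pass through M_v. -/
theorem branch_relJ (C : CrossSystem G J M h L) {v u u' : W} (hu : u ≠ u') {z z' : V}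
    (hz : MBranch J M v u z) (hz' : MBranch J M v u' z') (hr : RelJ J M z z') :
    z ∈ M.node v ∧ z' ∈ M.node v := by
  have hJ := C.sys.tree
  obtain ⟨y, hyv, rfl, hzy⟩ := hz
  obtain ⟨y', hyv', rfl, hzy'⟩ := hz'
  have he := far_edge_mem hJ hyv
  have he' := far_edge_mem hJ hyv'
  rcases hr with ⟨e, he0, h1, h2⟩ | ⟨w, h1, h2⟩
  · have := far_unique hJ hyv hyv' ((C.mem_edge_unique he he0 hzy h1).trans
      (C.mem_edge_unique he0 he' h2 hzy'))
    grind
  · have := branch_edges_meet hJ hyv hyv' hu (C.node_mem_edge he hzy h1)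
      (C.node_mem_edge he' hzy' h2)
    grind

theorem ne_hub (C : CrossSystem G J M h L) {z : V} (hz : z ∈ M.verts J) (c : Bool) : z ≠ h c :=
  fun he => C.hub_notMem c (he ▸ hz)

theorem rel_iff (C : CrossSystem G J M h L) {x y : V} (hx : x ∈ M.verts J) (hy : y ∈ M.verts J) :
    Rel J M h L x y ↔ RelJ J M x y := by
  refine ⟨?_, Or.inl⟩
  rintro (h1 | ⟨c, h1, _⟩ | ⟨c, h1, _⟩)
  · exact h1
  · exact absurd h1 (C.ne_hub hx c)
  · exact absurd h1 (C.ne_hub hy c)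

theorem rel_hub_iff (C : CrossSystem G J M h L) {c : Bool} {y : V} (hy : y ∈ M.verts J) :
    Rel J M h L (h c) y ↔ ∃ t ∈ L c, y ∈ M.node t := by
  have hinj : ∀ d, h c = h d → c = d := fun d he => by
    by_contra hne
    have : d = !c := by revert hne; cases c <;> cases d <;> simp
    exact (C.hubs c).ne (this ▸ he)
  constructor
  · rintro ((⟨e, he, h1, _⟩ | ⟨w, h1, _⟩) | ⟨d, h1, h2 | h2⟩ | ⟨d, h1, _⟩)
    · exact absurd (mem_verts_of_edge he h1) (C.hub_notMem c)
    · exact absurd (C.node_mem_verts h1) (C.hub_notMem c)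
    · exact absurd h2 (C.ne_hub hy d)
    · rwa [hinj d h1]
    · exact absurd h1 (C.ne_hub hy d)
  · intro h1
    exact Or.inr (Or.inl ⟨c, rfl, Or.inr h1⟩)

theorem mBranch_of_pl (C : CrossSystem G J M h L) (hℓ : Selection G J M ℓ) {v x : W} {z : V}
    (hz : z ∈ pl J ℓ v x) : x ≠ v ∧ MBranch J M v (nx J v x) z := by
  have hJ := C.sys.tree
  obtain ⟨h1, y, h2, h3, h4⟩ := inBranch_of_mem_pl hJ hz
  exact ⟨h1, y, h2, h3, hℓ.sub _ _ (far_edge_mem hJ h2) z h4⟩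

theorem mBranch_verts (C : CrossSystem G J M h L) {v u : W} {z : V} (hz : MBranch J M v u z) :
    z ∈ M.verts J := by
  obtain ⟨y, h1, _, h2⟩ := hz
  exact C.far_verts h1 h2

theorem pl_head_iff (C : CrossSystem G J M h L) (hℓ : Selection G J M ℓ) {v x : W} {z : V}
    (hz : z ∈ pl J ℓ v x) : (pl J ℓ v x).head? = some z ↔ z ∈ M.node v := by
  have hJ := C.sys.tree
  have H := C.lineTree hℓ
  have hxv := (inBranch_of_mem_pl hJ hz).1
  have ha := nx_adj hJ hxv
  have hip := H.pl_ip v x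
  rw [H.pl_head hxv]
  rw [pl_cons hJ ℓ hxv] at hz hip
  rcases List.mem_append.1 hz with h1 | h1
  · exact (hℓ.node _ _ ha z h1).symm
  · constructor
    · intro h2
      exact absurd rfl ((IP.append_iff.1 hip).2.2 z (List.mem_of_head? h2) z h1).1
    · intro h2
      obtain ⟨_, y, h3, h4, h5⟩ := C.mBranch_of_pl hℓ h1
      have h6 := C.node_mem_edge (far_edge_mem hJ h3) h5 h2
      have h7 := branch_edges_meet hJ h3 ha.ne (w := v)
        (by rw [h4, nx_of_adj hJ ha.symm]; exact nx_nx_ne hJ hxv) h6 (by simp)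
      exact absurd h7 ha.ne

theorem arm_head_iff (C : CrossSystem G J M h L) (hℓ : Selection G J M ℓ) {v t : W} (htv : t ≠ v)
    {i c : Bool} {z : V} (hz : z ∈ arm J ℓ h i v t c) :
    (arm J ℓ h i v t c).head? = some z ↔ z ∈ M.node v := by
  have hne := (C.lineTree hℓ).pl_ne_nil htv
  have e : (arm J ℓ h i v t c).head? = (pl J ℓ v t).head? := by
    unfold arm; split
    · rfl
    · rw [List.head?_append_of_ne_nil _ hne]
  rw [e]
  rcases mem_arm.1 hz with h1 | ⟨_, rfl⟩
  · exact C.pl_head_iff hℓ h1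
  · refine iff_of_false (fun h1 => ?_) (fun h1 => C.hub_notMem c (C.node_mem_verts h1))
    exact (C.lineTree hℓ).hub_notMem_pl _ _ _ (List.mem_of_head? h1)

theorem arm_core (C : CrossSystem G J M h L) (hℓ : Selection G J M ℓ) {v t : W}
    {i c : Bool} {z : V} (hz : z ∈ arm J ℓ h i v t c) :
    (z ∈ M.verts J ∧ MBranch J M v (nx J v t) z) ∨ (c ≠ i ∧ z = h c) := by
  rcases mem_arm.1 hz with h1 | h1
  · have := (C.mBranch_of_pl hℓ h1).2
    exact Or.inl ⟨C.mBranch_verts this, this⟩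
  grind

/-- The pyramid lemma for the pyramids given by three leaves in different branches. -/
theorem pyr_outcome (C : CrossSystem G J M h L) (hℓ : Selection G J M ℓ)
    (hp : Tight G J M h L p) {i : Bool} {v : W} {t : Fin 3 → W} {c : Fin 3 → Bool}
    (hv : ∀ c, v ∉ L c) (ht : ∀ j, t j ∈ L (c j))
    (hne : ∀ j k, j ≠ k → nx J v (t j) ≠ nx J v (t k))
    (hc : ∀ j k, j ≠ k → c j = i ∨ c k = i) (hpi : ¬ Att G p (h i))
    (hnon : ∃ j k, j ≠ k ∧ ∃ x ∈ arm J ℓ h i v (t j) (c j), ∃ y ∈ arm J ℓ h i v (t k) (c k),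
      Att G p x ∧ Att G p y ∧ ¬ (x ∈ M.node v ∧ y ∈ M.node v)) :
    PyrOutcome G (fun j => arm J ℓ h i v (t j) (c j)) p := by
  have H := C.lineTree hℓ
  have htv : ∀ j, t j ≠ v := fun j h => hv _ (h ▸ ht j)
  have hcore : ∀ j, ∀ z ∈ arm J ℓ h i v (t j) (c j), Core J M h z := by
    intro j z hz
    rcases C.arm_core hℓ hz with h1 | h1
    · exact Or.inl h1.1
    tauto
  -- The hub at the end of an arm is related to nothing on another arm, since the other arms end in
  -- leaves of `L i`, the other class.
  have hubno : ∀ j k, j ≠ k → ∀ y ∈ arm J ℓ h i v (t k) (c k), c j ≠ i →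
      ¬ Rel J M h L (h (c j)) y := by
    intro j k hjk y hy hji hr
    have hki := (hc j k hjk).resolve_left hji
    rcases mem_arm.1 hy with h1 | h1
    · have h2 := C.mBranch_verts (C.mBranch_of_pl hℓ h1).2
      rw [C.rel_hub_iff h2, ← C.hub _ _ h2, H.hub_pl (hv _) h1] at hr
      exact hji (hki ▸ C.disj' hr.1 (ht k))
    · exact h1.1 hki
  have key : ∀ j k, j ≠ k → ∀ x ∈ arm J ℓ h i v (t j) (c j), ∀ y ∈ arm J ℓ h i v (t k) (c k),
      Rel J M h L x y → (arm J ℓ h i v (t j) (c j)).head? = some x ∧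
        (arm J ℓ h i v (t k) (c k)).head? = some y := by
    intro j k hjk x hx y hy hr
    rw [C.arm_head_iff hℓ (htv j) hx, C.arm_head_iff hℓ (htv k) hy]
    rcases C.arm_core hℓ hx with h1 | ⟨h1, rfl⟩
    · rcases C.arm_core hℓ hy with h2 | ⟨h2, rfl⟩
      · exact C.branch_relJ (hne j k hjk) h1.2 h2.2 ((C.rel_iff h1.1 h2.1).1 hr)
      · exact absurd hr.symm (hubno k j hjk.symm x hx h2)
    · exact absurd hr (hubno j k hjk y hy h1)
  refine (H.pyr hv ht hne hc).outcome C.ehf hp.ip hp.ne ?_ ?_ hpi ?_ ?_ ?_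
  · intro j f hf hfj
    exact hp.out f hf (hcore j f hfj)
  · intro hm
    exact hp.out _ hm (Or.inr ⟨i, rfl⟩)
  · obtain ⟨j, k, hjk, x, hx, y, hy, hax, hay, hno⟩ := hnon
    refine ⟨j, k, hjk, x, hx, y, hy, hax, hay, ?_⟩
    rwa [C.arm_head_iff hℓ (htv j) hx, C.arm_head_iff hℓ (htv k) hy]
  · exact fun j k hjk x hx y hy hax hay =>
      key j k hjk x hx y hy (hp.tail x y (hcore j x hx) (hcore k y hy) hax hay)
  · exact fun j k hjk x hx y hy hax hay =>
      key j k hjk x hx y hy (hp.drop x y (hcore j x hx) (hcore k y hy) hax hay)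

theorem mem_pl_of_mem (C : CrossSystem G J M h L) {v y t : W} (hy : y ≠ v)
    (ht : Beyond J v y t) {z : V} (hz : z ∈ ℓ (nx J y v) y) : z ∈ pl J ℓ v t := by
  have hJ := C.sys.tree
  rw [ht.pl_eq hJ, pl_append hJ ℓ (x := nx J y v) (t := y), pl_adj hJ ℓ (nx_adj hJ hy.symm).symm]
  · simp [hz]
  · intro h1 h2
    rw [nx_of_adj hJ (nx_adj hJ hy.symm).symm]
    exact nx_nx_ne hJ hy.symm

theorem exists_rung_far (C : CrossSystem G J M h L) {v y : W} (hy : y ≠ v) {z : V}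
    (hz : z ∈ M.edge s(nx J y v, y)) : ∃ l, IsRung G M (nx J y v) y l ∧ z ∈ l :=
  C.exists_rung (far_edge_mem C.sys.tree hy) hz

theorem not_leaf_of_dirs (C : CrossSystem G J M h L) {v y y' : W} (hy : y ≠ v) (hy' : y' ≠ v)
    (hne : nx J v y ≠ nx J v y') (c : Bool) : v ∉ L c :=
  C.not_leaf_of_two (nx_adj C.sys.tree hy) (nx_adj C.sys.tree hy') hne c

/-- Three directions at `v`, each with a prescribed rung and a label, extend to leaves and a
selection through these rungs. -/
theorem exists_arms (C : CrossSystem G J M h L) {ℓ₀ : W → W → List V} (h0 : Selection G J M ℓ₀) {v : W} {y : Fin 3 → W} {c : Fin 3 → Bool}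
    {R : Fin 3 → List V} (hy : ∀ j, y j ≠ v) (hne : ∀ j k, j ≠ k → nx J v (y j) ≠ nx J v (y k))
    (hc : ∀ j, y j ∉ L (!(c j))) (hR : ∀ j, IsRung G M (nx J (y j) v) (y j) (R j)) :
    ∃ (ℓ : W → W → List V) (t : Fin 3 → W), Selection G J M ℓ ∧ (∀ j, t j ∈ L (c j)) ∧
      (∀ j, Beyond J v (y j) (t j)) ∧ (∀ j, ℓ (nx J (y j) v) (y j) = R j) ∧
      ∀ w x, (∀ j, s(w, x) ≠ s(nx J (y j) v, y j)) → ℓ w x = ℓ₀ w x := by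
  have hJ := C.sys.tree
  -- Different directions give different edges, so the three changes of the selection do not disturb
  -- one another.
  have hE : ∀ j k, j ≠ k → s(nx J (y j) v, y j) ≠ s(nx J (y k) v, y k) := fun j k hjk he =>
    hne j k hjk (by rw [far_unique hJ (hy j) (hy k) he])
  have hA : ∀ j, J.Adj (nx J (y j) v) (y j) := fun j => (nx_adj hJ (hy j).symm).symm
  obtain ⟨ℓ₁, h1, e1, f1⟩ := C.exists_selection_through h0 (hA 0) (hR 0)
  obtain ⟨ℓ₂, h2, e2, f2⟩ := C.exists_selection_through h1 (hA 1) (hR 1)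
  obtain ⟨ℓ₃, h3, e3, f3⟩ := C.exists_selection_through h2 (hA 2) (hR 2)
  choose t ht1 ht2 using fun j => C.exists_leaf_beyond (hy j) (c j) (hc j)
  refine ⟨ℓ₃, t, h3, ht1, ht2, fun j => ?_, fun w x hwx =>
    (f3 w x (hwx 2)).trans ((f2 w x (hwx 1)).trans (f1 w x (hwx 0)))⟩
  grind

/-- A Helly property. Let x and y lie in different strips, at the edges vu and vu', and share M_v. A
third vertex outside M_v, related to both, would have to lie in both strips, or in one strip and in
the far node of the other, or in both far nodes. The last would make u and u' adjacent and create a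
triangle in the tree; the others contradict the position of the strips. -/
theorem relJ_cases (C : CrossSystem G J M h L) {X : Set V} (hX : X ⊆ M.verts J)
    (hr : ∀ x ∈ X, ∀ y ∈ X, RelJ J M x y) :
    (∃ e ∈ J.edgeSet, X ⊆ M.edge e) ∨ ∃ v, X ⊆ M.node v := by
  have hJ := C.sys.tree
  by_contra hcon
  push Not at hcon
  obtain ⟨hE, hN⟩ := hcon
  have hne : X.Nonempty := by
    by_contra h
    rw [Set.not_nonempty_iff_eq_empty] at h
    obtain ⟨v⟩ := hJ.connected.nonempty
    exact hN v (by simp [h])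
  obtain ⟨x, hx⟩ := hne
  have edge_of : ∀ z ∈ X, ∃ e ∈ J.edgeSet, z ∈ M.edge e := fun z hz => by
    simpa [StripFamily.verts] using hX hz
  obtain ⟨e, he, hxe⟩ := edge_of x hx
  obtain ⟨y, hy, hye⟩ := Set.not_subset.1 (hE e he)
  obtain ⟨v, hxv, hyv⟩ := (hr x hx y hy).resolve_left fun ⟨f, hf, h1, h2⟩ =>
    hye (C.mem_edge_unique hf he h1 hxe ▸ h2)
  obtain ⟨z, hz, hzv⟩ := Set.not_subset.1 (hN v)
  obtain ⟨u, hvu, hxu⟩ := C.exists_edge_of_node hxv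
  obtain ⟨u', hvu', hyu'⟩ := C.exists_edge_of_node hyv
  have huu : u ≠ u' := by
    rintro rfl
    exact hye (C.mem_edge_unique he hvu hxe hxu ▸ hyu')
  have step : ∀ {w : W} {a : V}, J.Adj v w → a ∈ M.edge s(v, w) → RelJ J M a z →
      z ∈ M.edge s(v, w) ∨ z ∈ M.node w := by
    rintro w a hvw ha (⟨f, hf, h1, h2⟩ | ⟨b, h1, h2⟩)
    · exact Or.inl (C.mem_edge_unique hf hvw h1 ha ▸ h2)
    · rcases Sym2.mem_iff.1 (C.node_mem_edge hvw ha h1) with rfl | rfl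
      · grind
      grind
  have h1 := step hvu hxu (hr x hx z hz)
  have h2 := step hvu' hyu' (hr y hy z hz)
  have key : ∀ {w w' : W}, J.Adj v w → J.Adj v w' → w ≠ w' → z ∈ M.edge s(v, w) →
      z ∉ M.node w' := by
    intro w w' h1 h2 h3 h4 h5
    rcases Sym2.mem_iff.1 (C.node_mem_edge h1 h4 h5) with h | h
    · grind
    grind
  rcases h1 with h1 | h1 <;> rcases h2 with h2 | h2
  · have := C.mem_edge_unique hvu hvu' h1 h2
    grind
  · grind
  · grind
  · obtain ⟨w, hw, hzw⟩ := C.exists_edge_of_node h1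
    rcases Sym2.mem_iff.1 (C.node_mem_edge hw hzw h2) with h | h
    · exact huu h.symm
    · exact no_triangle hJ hvu (h ▸ hw) hvu'

end CrossSystem

theorem forall_ne_fin3 {P : Fin 3 → Fin 3 → Prop} (hs : ∀ i j, P i j → P j i) (h01 : P 0 1)
    (h02 : P 0 2) (h12 : P 1 2) : ∀ i j, i ≠ j → P i j := by grind

/-- Arms as lists omit the apex, so a list of k vertices is a constituent path of length k, and a
one-vertex arm is the path of length one. -/
theorem Pyr.hasShortPyramid {a : V} {S : Fin 3 → List V} (hS : Pyr G a S)
    (h0 : (S 0).length = 1) (h1 : 2 ≤ (S 1).length) (h2 : 2 ≤ (S 2).length) :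
    HasShortPyramid G a := by
  have key : ∀ i, ∃ b, (S i).head? = some b ∧ ∃ p : G.Walk a b, IsInducedPath G p ∧
      p.support = a :: (S i).reverse := by
    intro i
    obtain ⟨b, l, e⟩ := List.exists_cons_of_ne_nil (hS.ne i)
    refine ⟨b, by rw [e]; rfl, ?_⟩
    have hip : IP G (a :: (S i).reverse) := by
      refine ⟨by simpa using hS.notMem i, fun y hy => ?_, (hS.ip i).reverse⟩
      rw [List.head?_reverse]
      exact hS.apex i y (by simpa using hy)
    refine hip.exists_walk rfl ?_
    grind
  choose b hb p hp hs using key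
  have mem : ∀ i x, x ∈ (p i).support ↔ x = a ∨ x ∈ S i := by grind
  have hbm : ∀ i, b i ∈ S i := fun i => List.mem_of_head? (hb i)
  have len : ∀ i, (p i).length = (S i).length := by
    intro i
    have := congrArg List.length (hs i)
    grind
  refine ⟨b, p, fun i he => hS.notMem i (he ▸ hbm i), fun i j hij => ?_, fun i => (hp i).1,
    fun i j hij x hx hy => ?_, ⟨1, 2, by decide, by grind, by grind⟩,
    fun i j x hx y hy hxy => ?_, 0, by grind⟩
  · exact (hS.cross i j hij _ (hbm i) _ (hbm j)).2.2 ⟨hb i, hb j⟩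
  · rw [mem] at hx hy
    by_contra hxa
    exact (hS.cross i j hij x (hx.resolve_left hxa) x (hy.resolve_left hxa)).1 rfl
  · by_cases hij : i = j
    · subst hij
      exact Or.inl ⟨i, (hp i).2 x hx y hy hxy⟩
    by_cases hxa : x = a
    · exact Or.inl ⟨j, (hp j).2 x ((mem j x).2 (Or.inl hxa)) y hy hxy⟩
    by_cases hya : y = a
    · exact Or.inl ⟨i, (hp i).2 x hx y ((mem i y).2 (Or.inl hya)) hxy⟩
    rw [mem] at hx hy
    have := (hS.cross i j hij x (hx.resolve_left hxa) y (hy.resolve_left hya)).2.1 hxy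
    grind

/-- The vertices of `M_t`, for a leaf `t` attached to the first hub, are not in the other end of
their strip. -/
def Nondeg (J : SimpleGraph W) (M : StripFamily V W) (L : Bool → Set W) : Prop :=
  ∀ s t, J.Adj s t → t ∈ L true → ∀ x ∈ M.node s, x ∉ M.node t

/-! ### No vertex of M_t, for t in `α`, lies in the other end of its strip -/

namespace CrossSystem

open Classical in
/-- A label compatible with `u`. -/
noncomputable def label (L : Bool → Set W) (i : Bool) (u : W) : Bool := if u ∈ L (!i) then !i else i

theorem label_spec (C : CrossSystem G J M h L) (i : Bool) (u : W) : u ∉ L (!(label L i u)) := by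
  unfold label
  split
  · rename_i h1
    intro h2
    rw [Bool.not_not] at h2
    exact C.disj i u h2 h1
  · assumption

theorem label_eq {i : Bool} {u : W} (hu : u ∉ L (!i)) : label L i u = i := if_neg hu

theorem exists_rung_adj (C : CrossSystem G J M h L) {u v : W} (huv : J.Adj u v) :
    ∃ l, IsRung G M u v l := by
  obtain ⟨z, hz, _⟩ := C.exists_node_mem huv
  obtain ⟨l, hl, _⟩ := C.exists_rung huv hz
  exact ⟨l, hl⟩

theorem exists_rung_dir (C : CrossSystem G J M h L) {v u : W} (hvu : J.Adj v u) :
    ∃ l, IsRung G M (nx J u v) u l := by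
  rw [nx_of_adj C.sys.tree hvu.symm]
  exact C.exists_rung_adj hvu

/-- Two adjacent leaves would be the whole tree, which has at least three vertices. -/
theorem nbr_not_leaf (C : CrossSystem G J M h L) {s t : W} (hst : J.Adj s t) {d : Bool}
    (ht : t ∈ L d) (c : Bool) : s ∉ L c := by
  have hJ := C.sys.tree
  intro hs
  obtain ⟨w, hw⟩ : ∃ w, w ≠ s ∧ w ≠ t := by
    have h3 := C.sys.three_le
    have := C.finite
    have h2 : ({s, t} : Set W).ncard ≤ 2 := (Set.ncard_insert_le s {t}).trans (by simp)
    by_contra hcon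
    push Not at hcon
    have : (Set.univ : Set W) ⊆ {s, t} := fun w _ => by tauto
    have h4 := Set.ncard_le_ncard this (Set.toFinite _)
    rw [Set.ncard_univ] at h4
    omega
  have h1 := C.leaf_unique hs hst (nx_adj hJ hw.1)
  have h2 : w ≠ nx J s w := by grind
  have h3 := nx_adj hJ h2
  have h4 := nx_nx_ne hJ hw.1
  rw [← h1] at h3 h4
  exact h4 (C.leaf_unique ht h3 hst.symm)

theorem exists_third_nbr (C : CrossSystem G J M h L) {v u u' : W} (hu : J.Adj v u)
    (hu' : J.Adj v u') (hne : u ≠ u') : ∃ w, J.Adj v w ∧ w ≠ u ∧ w ≠ u' := by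
  obtain ⟨u₁, u₂, h1, h2, h3, h4, h5⟩ := C.exists_two (C.not_leaf_of_two hu hu' hne) hu
  grind

/-- A vertex in both ends of the strip is a rung by itself and gives an arm of length one at apex `h
true`, with centre `s`. The other two arms are longer: `t` is the only neighbour of `s` in `L true`,
so each of them either goes on past the neighbour of `s` or ends in `h false`. At most one does the
latter, because `s` has at most one neighbour in `L false`. -/
theorem nondeg (C : CrossSystem G J M h L) (hsp : ¬ HasShortPyramid G (h true)) :
    Nondeg J M L := by
  intro s t hst ht x hxs hxt
  have hJ := C.sys.tree
  obtain ⟨u', hsu', hxu'⟩ := C.exists_edge_of_node hxs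
  have hxe : x ∈ M.edge s(s, t) := by
    rcases Sym2.mem_iff.1 (C.node_mem_edge hsu' hxu' hxt) with h | h
    · simp_all
    · rwa [h]
  have hs := C.nbr_not_leaf hst ht
  obtain ⟨u₁, u₂, h1, h2, h3, h4, h5⟩ := C.exists_two hs hst
  have hR : IsRung G M s t [x] := ⟨by simp, IP.singleton x, by simpa using hxe,
    by simpa using hxs, by simpa using hxt⟩
  obtain ⟨R₁, hR₁⟩ := C.exists_rung_dir h1
  obtain ⟨R₂, hR₂⟩ := C.exists_rung_dir h2
  have hdir : ∀ i j : Fin 3, i ≠ j →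
      nx J s ((![t, u₁, u₂] : Fin 3 → W) i) ≠ nx J s ((![t, u₁, u₂] : Fin 3 → W) j) :=
    forall_ne_fin3 (fun i j hij => hij.symm)
      (by simpa [nx_of_adj hJ, hst, h1] using h3.symm)
      (by simpa [nx_of_adj hJ, hst, h2] using h4.symm) (by simpa [nx_of_adj hJ, h1, h2] using h5)
  obtain ⟨ℓ₀, h0⟩ := C.exists_selection
  obtain ⟨ℓ, t', hℓ, ht', hb, hR', -⟩ := C.exists_arms h0 (v := s) (y := ![t, u₁, u₂])
    (c := ![true, label L true u₁, label L true u₂]) (R := ![[x], R₁, R₂])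
    (by intro j; fin_cases j <;> simp [hst.ne', h1.ne', h2.ne']) hdir
    (by intro j; fin_cases j <;> simp [C.label_spec]; exact C.disj true t ht)
    (by
      intro j
      fin_cases j
      · simpa [nx_of_adj hJ, hst.symm] using hR
      · exact hR₁
      · exact hR₂)
  have hnx : ∀ j, nx J s (t' j) = nx J s ((![t, u₁, u₂] : Fin 3 → W) j) := fun j =>
    (hb j).nx_eq hJ (by fin_cases j <;> simp [hst.ne', h1.ne', h2.ne'])
  have hP := (C.lineTree hℓ).pyr (i := true) (v := s) (t := t')
    (c := ![true, label L true u₁, label L true u₂]) hs ht'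
    (fun i j hij => by grind)
    (forall_ne_fin3 (fun i j hij => hij.symm) (by simp) (by simp) (by
      by_contra hcon
      simp only [Matrix.cons_val_one, Matrix.cons_val_zero, Matrix.cons_val, not_or] at hcon
      have e1 : u₁ ∈ L false := by
        by_contra h; exact hcon.1 (label_eq h)
      have e2 : u₂ ∈ L false := by
        by_contra h; exact hcon.2 (label_eq h)
      exact h5 (C.one false s ⟨h1, e1⟩ ⟨h2, e2⟩)))
  have long : ∀ j : Fin 3, j ≠ 0 → ∀ u, u = (![t, u₁, u₂] : Fin 3 → W) j → J.Adj s u → u ≠ t →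
      ∀ c, c = (![true, label L true u₁, label L true u₂] : Fin 3 → Bool) j →
      2 ≤ (arm J ℓ h true s (t' j) c).length := by
    intro j hj u hu hsu hut c hc
    have hne : t' j ≠ s := (hb j).ne (by rw [← hu]; exact hsu.ne')
    have hl := List.length_pos_of_ne_nil ((C.lineTree hℓ).pl_ne_nil hne)
    unfold arm
    split
    · rename_i hct
      have e : nx J s (t' j) = u := by rw [hnx, ← hu, nx_of_adj hJ hsu]
      rw [pl_cons hJ ℓ hne, e]
      have h7 := ht' j
      rw [← hc, hct] at h7
      have h6 : t' j ≠ u := by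
        rintro h
        rw [h] at h7
        exact hut (C.one true s ⟨hsu, h7⟩ ⟨hst, ht⟩)
      have h8 := List.length_pos_of_ne_nil ((C.lineTree hℓ).pl_ne_nil h6)
      have h9 := List.length_pos_of_ne_nil (hℓ.ne s u hsu)
      grind
    grind
  refine hsp (hP.hasShortPyramid ?_ (long 1 (by decide) u₁ rfl h1 h3 _ rfl)
    (long 2 (by decide) u₂ rfl h2 h4 _ rfl))
  have ht0 : t' 0 = t := by
    rcases hb 0 with h6 | h6
    · exact h6
    · by_contra hne
      exact h6 ((nx_of_adj hJ hst.symm).trans (C.leaf_unique ht (nx_adj hJ hne) hst.symm).symm)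
  have e0 := hR' 0
  simp only [Matrix.cons_val_zero, nx_of_adj hJ hst.symm] at e0
  simp [arm, ht0, pl_adj hJ ℓ hst, e0]

end CrossSystem

/-- The path `p` attaches to `M_v` in the strips at `vu` and `vu'`. -/
def Spread (G : SimpleGraph V) (J : SimpleGraph W) (M : StripFamily V W) (p : List V)
    (v u u' : W) : Prop :=
  u ≠ u' ∧ J.Adj v u ∧ J.Adj v u' ∧ (∃ b ∈ M.node v, b ∈ M.edge s(v, u) ∧ Att G p b) ∧
    ∃ b ∈ M.node v, b ∈ M.edge s(v, u') ∧ Att G p b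

/-- The strip system is maximal. -/
def MaxVerts (G : SimpleGraph V) (J : SimpleGraph W) (M : StripFamily V W) (h : Bool → V)
    (L : Bool → Set W) : Prop :=
  ∀ M' : StripFamily V W, CrossSystem G J M' h L → ¬ M.verts J ⊂ M'.verts J

theorem att_append {p q : List V} {z : V} : Att G (p ++ q) z ↔ Att G p z ∨ Att G q z := by
  simp [Att, or_and_right, exists_or]

theorem Bool.eq_not_of_ne {a b : Bool} (hab : a ≠ b) : a = !b := by
  revert hab; cases a <;> cases b <;> simp

/-! ### Pyramids with prescribed rungs, and attachments confined to leaf strips -/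

namespace CrossSystem

theorem mBranch_node (C : CrossSystem G J M h L) {v u : W} {z : V} (hz : MBranch J M v u z)
    (hv : z ∈ M.node v) : J.Adj v u ∧ z ∈ M.edge s(v, u) := by
  obtain ⟨y, h1, rfl, h2⟩ := hz
  obtain ⟨h3, h4⟩ := C.node_far h1 h2 hv
  refine ⟨nx_adj C.sys.tree h1, ?_⟩
  grind

theorem mBranch_adj (C : CrossSystem G J M h L) {v u : W} (hvu : J.Adj v u) {z : V}
    (hz : z ∈ M.edge s(v, u)) : MBranch J M v u z :=
  ⟨u, hvu.ne', nx_of_adj C.sys.tree hvu, by rwa [nx_of_adj C.sys.tree hvu.symm]⟩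

/-- Two vertices in different strips are separated by some vertex of the tree, which is an end of
the first strip. -/
theorem exists_split (C : CrossSystem G J M h L) {x y : V} (hx : x ∈ M.verts J)
    (hy : y ∈ M.verts J) (hne : ¬ ∃ e ∈ J.edgeSet, x ∈ M.edge e ∧ y ∈ M.edge e) :
    ∃ v u w, J.Adj v u ∧ w ≠ v ∧ u ≠ nx J v w ∧ x ∈ M.edge s(v, u) ∧
      y ∈ M.edge s(nx J w v, w) := by
  have hJ := C.sys.tree
  simp only [StripFamily.verts, Set.mem_iUnion, exists_prop] at hx
  obtain ⟨e, he, hx⟩ := hx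
  induction e with
  | _ a b =>
  have hab : J.Adj a b := he
  obtain ⟨w, hw, hyw⟩ := C.exists_branch a hy
  by_cases hb : nx J a w = b
  · have hwb : w ≠ b := by
      rintro rfl
      exact hne ⟨_, he, hx, by rwa [nx_of_adj hJ hab.symm] at hyw⟩
    refine ⟨b, a, w, hab.symm, hwb, ?_, by grind, ?_⟩
    · have := nx_nx_ne hJ hw
      grind
    · have := nx_pred hJ hw (by grind)
      grind
  grind

theorem arm_of_rung (C : CrossSystem G J M h L) {v y t : W} (hy : y ≠ v) (hb : Beyond J v y t)
    {R : List V} (hR : ℓ (nx J y v) y = R) {i c : Bool} {z : V} (hz : z ∈ R) :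
    z ∈ arm J ℓ h i v t c :=
  mem_arm.2 (Or.inl (C.mem_pl_of_mem hy hb (hR ▸ hz)))

/-- The pyramid lemma for three directions at `v` with prescribed rungs and labels. -/
theorem triple (C : CrossSystem G J M h L) {ℓ₀ : W → W → List V} (h0 : Selection G J M ℓ₀)
    (hp : Tight G J M h L p) {i : Bool} {v : W}
    {y : Fin 3 → W} {c : Fin 3 → Bool} {R : Fin 3 → List V} (hpi : ¬ Att G p (h i))
    (hy : ∀ j, y j ≠ v) (hne : ∀ j k, j ≠ k → nx J v (y j) ≠ nx J v (y k))
    (hc : ∀ j, y j ∉ L (!(c j))) (hci : ∀ j k, j ≠ k → c j = i ∨ c k = i)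
    (hR : ∀ j, IsRung G M (nx J (y j) v) (y j) (R j))
    (hnon : ∃ j k, j ≠ k ∧ ∃ x, (x ∈ R j ∨ (c j ≠ i ∧ x = h (c j))) ∧ ∃ z ∈ R k,
      Att G p x ∧ Att G p z ∧ ¬ (x ∈ M.node v ∧ z ∈ M.node v)) :
    ∃ (ℓ : W → W → List V) (t : Fin 3 → W), Selection G J M ℓ ∧ (∀ j, t j ∈ L (c j)) ∧
      (∀ j, Beyond J v (y j) (t j)) ∧ (∀ j, ℓ (nx J (y j) v) (y j) = R j) ∧
      (∀ w x, (∀ j, s(w, x) ≠ s(nx J (y j) v, y j)) → ℓ w x = ℓ₀ w x) ∧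
      Pyr G (h i) (fun j => arm J ℓ h i v (t j) (c j)) ∧
      PyrOutcome G (fun j => arm J ℓ h i v (t j) (c j)) p := by
  have hJ := C.sys.tree
  obtain ⟨ℓ, t, h1, h2, h3, h4, h5⟩ := C.exists_arms h0 hy hne hc hR
  have hv := C.not_leaf_of_dirs (hy 0) (hy 1) (hne 0 1 (by decide))
  have hnx : ∀ j, nx J v (t j) = nx J v (y j) := fun j => (h3 j).nx_eq hJ (hy j)
  have hne' : ∀ j k, j ≠ k → nx J v (t j) ≠ nx J v (t k) := fun j k hjk => by grind
  refine ⟨ℓ, t, h1, h2, h3, h4, h5, (C.lineTree h1).pyr hv h2 hne' hci,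
    C.pyr_outcome h1 hp hv h2 hne' hci hpi ?_⟩
  obtain ⟨j, k, hjk, x, hx, z, hz, hr⟩ := hnon
  refine ⟨j, k, hjk, x, ?_, z, C.arm_of_rung (hy k) (h3 k) (h4 k) hz, hr⟩
  rcases hx with hx | hx
  · exact C.arm_of_rung (hy j) (h3 j) (h4 j) hx
  · exact mem_arm.2 (Or.inr hx)

theorem spread_of_base (C : CrossSystem G J M h L) (hℓ : Selection G J M ℓ) {v : W} {i : Bool}
    {t : Fin 3 → W} {c : Fin 3 → Bool} (htv : ∀ j, t j ≠ v) {k l : Fin 3}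
    (hne : nx J v (t k) ≠ nx J v (t l)) (hk : OnlyBase G p (arm J ℓ h i v (t k) (c k)))
    (hl : OnlyBase G p (arm J ℓ h i v (t l) (c l))) :
    Spread G J M p v (nx J v (t k)) (nx J v (t l)) := by
  have key : ∀ j, OnlyBase G p (arm J ℓ h i v (t j) (c j)) →
      ∃ b ∈ M.node v, b ∈ M.edge s(v, nx J v (t j)) ∧ Att G p b := by
    rintro j ⟨⟨b, hb, hab⟩, hob⟩
    have h1 := (C.arm_head_iff hℓ (htv j) hb).1 (hob b hb hab)
    rcases C.arm_core hℓ hb with h2 | ⟨_, rfl⟩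
    · exact ⟨b, h1, (C.mBranch_node h2.2 h1).2, hab⟩
    · exact absurd (C.node_mem_verts h1) (C.hub_notMem _)
  exact ⟨hne, nx_adj C.sys.tree (htv k), nx_adj C.sys.tree (htv l), key k hk, key l hl⟩

theorem onlyBase_node (C : CrossSystem G J M h L) (hℓ : Selection G J M ℓ) {v t : W} {i c : Bool}
    (htv : t ≠ v) (hb : OnlyBase G p (arm J ℓ h i v t c)) {z : V}
    (hz : z ∈ arm J ℓ h i v t c) (ha : Att G p z) : z ∈ M.node v :=
  (C.arm_head_iff hℓ htv hz).1 (hb.2 z hz ha)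

theorem arm_last (C : CrossSystem G J M h L) (hℓ : Selection G J M ℓ) {v t : W} {i c : Bool}
    {z : V} (hz : z ∈ arm J ℓ h i v t c)
    (hl : (arm J ℓ h i v t c).getLast? = some z) :
    (c = i ∧ z ∈ M.node t) ∨ (c ≠ i ∧ z = h c) := by
  unfold arm at hl hz
  split at hl
  · rename_i hci
    rw [if_pos hci] at hz
    refine Or.inl ⟨hci, ?_⟩
    have hr := (C.lineTree hℓ).pl_reverse v t
    have := C.pl_head_iff hℓ (v := t) (x := v) (z := z) (by grind)
    grind
  grind

/-- An arm with only one vertex. -/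
theorem arm_single (C : CrossSystem G J M h L) (hℓ : Selection G J M ℓ) {v t : W} {i c : Bool}
    (htv : t ≠ v) (hl : (arm J ℓ h i v t c).length < 2) :
    c = i ∧ J.Adj v t ∧ ∃ z, ℓ v t = [z] ∧ arm J ℓ h i v t c = [z] := by
  have hJ := C.sys.tree
  have h1 := nx_adj hJ htv
  have h2 := List.length_pos_of_ne_nil (hℓ.ne _ _ h1)
  unfold arm at hl ⊢
  split at hl
  · rename_i hci
    rw [if_pos hci]
    rw [pl_cons hJ ℓ htv] at hl ⊢
    have h3 : nx J v t = t := by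
      by_contra h3
      have := List.length_pos_of_ne_nil ((C.lineTree hℓ).pl_ne_nil (Ne.symm h3))
      grind
    rw [h3] at h1 h2 hl ⊢
    rw [pl_self, List.append_nil] at hl ⊢
    obtain ⟨z, hz⟩ := List.length_eq_one_iff.1 (show (ℓ v t).length = 1 by omega)
    grind
  · have := List.length_pos_of_ne_nil ((C.lineTree hℓ).pl_ne_nil htv)
    grind

/-- A leaf edge can occur on a tree path only at an end, and the start `v` is not a leaf. -/
theorem leaf_of_mem_pl (C : CrossSystem G J M h L) (hℓ : Selection G J M ℓ) {v x : W} {z : V}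
    (hv : ∀ c, v ∉ L c) (hz : z ∈ pl J ℓ v x) {s t : W} (hst : J.Adj s t) {c : Bool} (ht : t ∈ L c)
    (hzs : z ∈ M.edge s(s, t)) : x = t := by
  have hJ := C.sys.tree
  have hxv := (inBranch_of_mem_pl hJ hz).1
  induction hn : J.dist v x using Nat.strong_induction_on generalizing v with
  | _ n ih =>
  subst hn
  have ha := nx_adj hJ hxv
  have hd := nx_dist hJ hxv
  rw [pl_cons hJ ℓ hxv] at hz
  rcases List.mem_append.1 hz with h1 | h1
  · have := C.mem_edge_unique ha hst (hℓ.sub _ _ ha z h1) hzs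
    rw [Sym2.eq_iff] at this
    rcases this with ⟨h2, h3⟩ | ⟨h2, _⟩
    · by_contra hxt
      have h4 : x ≠ nx J v x := by grind
      exact nx_nx_ne hJ hxv (C.leaf_unique (h3 ▸ ht) (nx_adj hJ h4) ha.symm)
    grind
  · have h4 := (inBranch_of_mem_pl hJ h1).1
    exact ih _ (by omega) (C.not_leaf_of_two (nx_adj hJ h4) ha.symm (nx_nx_ne hJ hxv)) h1 h4 rfl

/-- The attachments of a tight path are not confined to the strips at the leaves in `L i`. -/
theorem not_leaf_strips (C : CrossSystem G J M h L) (hp : IP G p) (hp0 : p ≠ [])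
    (hout : ∀ f ∈ p, ¬ Core J M h f) {i : Bool} (hpi : ¬ Att G p (h (!i)))
    (hX : ∀ z ∈ M.verts J, Att G p z → ∃ s t, J.Adj s t ∧ t ∈ L i ∧ z ∈ M.edge s(s, t))
    {s t s' t' : W} (hst : J.Adj s t) (hst' : J.Adj s' t') (ht : t ∈ L i) (ht' : t' ∈ L i)
    (hss : s ≠ s') {x y : V} (hx : x ∈ M.edge s(s, t)) (hy : y ∈ M.edge s(s', t'))
    (hax : Att G p x) (hay : Att G p y)
    (h1 : ∀ z ∈ M.edge s(s, t), Att G p z → ¬ Att G p.tail z)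
    (h2 : ∀ z ∈ M.edge s(s', t'), Att G p z → ¬ Att G p.dropLast z) : False := by
  have hJ := C.sys.tree
  have hsn := C.nbr_not_leaf hst ht
  have hsn' := C.nbr_not_leaf hst' ht'
  have dir : ∀ {s t s' : W}, J.Adj s t → t ∈ L i → s' ∉ L i → s ≠ s' → t ≠ nx J s s' := by
    intro s t s' hst ht hs' hss h
    have h3 := nx_nx_ne hJ hss.symm
    rw [← h] at h3
    have h4 : s' ≠ t := fun h4 => hs' (h4 ▸ ht)
    exact h3 (C.leaf_unique ht (nx_adj hJ h4) hst.symm)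
  have d1 := dir hst ht (hsn' i) hss
  have d2 := dir hst' ht' (hsn i) hss.symm
  have a1 := nx_adj hJ hss.symm
  have a2 := nx_adj hJ hss
  obtain ⟨u₃, a3, e3, e3'⟩ := C.exists_third_nbr hst a1 d1
  obtain ⟨u₄, a4, e4, e4'⟩ := C.exists_third_nbr hst' a2 d2
  have hu₃ : u₃ ∉ L (!!i) := by
    rw [Bool.not_not]; exact fun h3 => e3 (C.one i s ⟨a3, h3⟩ ⟨hst, ht⟩)
  have hu₄ : u₄ ∉ L (!!i) := by
    rw [Bool.not_not]; exact fun h3 => e4 (C.one i s' ⟨a4, h3⟩ ⟨hst', ht'⟩)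
  obtain ⟨t₃, ht₃, b3⟩ := C.exists_leaf_beyond a3.ne' (!i) hu₃
  obtain ⟨t₄, ht₄, b4⟩ := C.exists_leaf_beyond a4.ne' (!i) hu₄
  have n3 : nx J s t₃ = u₃ := by rw [b3.nx_eq hJ a3.ne', nx_of_adj hJ a3]
  have n4 : nx J s' t₄ = u₄ := by rw [b4.nx_eq hJ a4.ne', nx_of_adj hJ a4]
  have bs4 : Beyond J s s' t₄ := Or.inr (by grind)
  have bst' : Beyond J s s' t' := Or.inr (by rw [nx_of_adj hJ hst']; exact d2.symm)
  obtain ⟨ℓ₀, hℓ₀⟩ := C.exists_selection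
  obtain ⟨R₁, hR₁, hxR⟩ := C.exists_rung hst hx
  obtain ⟨R₂, hR₂, hyR⟩ := C.exists_rung hst' hy
  obtain ⟨ℓ₁, hℓ₁, f1, -⟩ := C.exists_selection_through hℓ₀ hst hR₁
  obtain ⟨ℓ, hℓ, f2, g2⟩ := C.exists_selection_through hℓ₁ hst' hR₂
  have f1 : ℓ s t = R₁ := by grind
  have H := C.lineTree hℓ
  -- Centre `s` and apex `h (!i)`: one arm is the rung towards `t` followed by `h i`, the second
  -- passes through `s'` and then leaves the direction of `t'`, the third avoids both leaf strips.
  have hP := H.pyr (i := !i) (v := s) (t := ![t, t₄, t₃]) (c := ![i, !i, !i]) hsn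
    (by intro j; fin_cases j <;> simp [ht, ht₄, ht₃])
    (forall_ne_fin3 (fun i j hij => hij.symm)
      (by simpa [nx_of_adj hJ hst, bs4.nx_eq hJ hss.symm] using d1)
      (by simpa [nx_of_adj hJ hst, n3] using e3.symm)
      (by simpa [bs4.nx_eq hJ hss.symm, n3] using e3'.symm))
    (forall_ne_fin3 (fun i j hij => hij.symm) (by simp) (by simp) (by simp))
  obtain ⟨u1, x1, v1, q1, hx1, hu1⟩ := exists_first (P := Att G p) ⟨x, hxR, hax⟩
  obtain ⟨u2, y1, v2, q2, hy1, hu2⟩ := exists_first (P := Att G p) ⟨y, hyR, hay⟩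
  have A0 : arm J ℓ h (!i) s t i = u1 ++ x1 :: (v1 ++ [h i]) := by
    simp [arm, pl_adj hJ ℓ hst, f1, q1]
  have A1 : arm J ℓ h (!i) s t₄ (!i) = pl J ℓ s s' ++ pl J ℓ s' t₄ := by
    simp [arm, bs4.pl_eq hJ]
  have A2 : arm J ℓ h (!i) s t₃ (!i) = pl J ℓ s t₃ := by simp [arm]
  have hD := H.pl_ne_nil hss.symm
  obtain ⟨d, y', hd⟩ : ∃ d y', pl J ℓ s s' = d ++ [y'] :=
    ⟨_, _, (List.dropLast_append_getLast hD).symm⟩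
  obtain ⟨y'', v2'', hd''⟩ := List.exists_cons_of_ne_nil
    (H.pl_ne_nil (b4.ne a4.ne'))
  have hDr : pl J ℓ s' s = y' :: d.reverse := by rw [H.pl_reverse, hd]; simp
  have hnp : ∀ {v x : W} {z : V}, (∀ c, v ∉ L c) → x ∉ L i → z ∈ pl J ℓ v x → ¬ Att G p z := by
    intro v x z hv hxL hz ha
    have hzv := C.mBranch_verts (C.mBranch_of_pl hℓ hz).2
    obtain ⟨s₂, t₂, h3, h4, h5⟩ := hX z hzv ha
    exact hxL (C.leaf_of_mem_pl hℓ hv hz h3 h4 h5 ▸ h4)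
  have ht₃i : t₃ ∉ L i := fun h3 => by have := C.disj _ _ h3; exact this ht₃
  have ht₄i : t₄ ∉ L i := fun h3 => by have := C.disj _ _ h3; exact this ht₄
  -- adjacency between the second rung and the pyramid
  have hR2pl : pl J ℓ s' t' = R₂ := by rw [pl_adj hJ ℓ hst', f2]
  have hR2' : ∀ z ∈ R₂, z ∈ pl J ℓ s t' := fun z hz => by
    rw [bst'.pl_eq hJ, hR2pl]; grind
  have hnhead : ∀ z ∈ R₂, (pl J ℓ s t').head? ≠ some z := by
    intro z hz hh
    have hip := H.pl_ip s t'
    rw [bst'.pl_eq hJ, hR2pl] at hip hh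
    rw [List.head?_append_of_ne_nil _ hD] at hh
    exact ((IP.append_iff.1 hip).2.2 z (List.mem_of_head? hh) z hz).1 rfl
  have ns0 : nx J s t' = nx J s s' := bst'.nx_eq hJ hss.symm
  have c0 : ∀ f ∈ R₂, ∀ z ∈ R₁, f ≠ z ∧ ¬ G.Adj f z := by
    intro f hf z hz
    have := H.pl_cross (v := s) (x := t') (x' := t) (by
      rw [ns0, nx_of_adj hJ hst]; exact d1.symm) (hR2' f hf) (by rwa [pl_adj hJ ℓ hst, f1])
    exact ⟨this.1, fun hh => hnhead f hf (this.2.1 hh).1⟩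
  have c2 : ∀ f ∈ R₂, ∀ z ∈ pl J ℓ s t₃, f ≠ z ∧ ¬ G.Adj f z := by
    intro f hf z hz
    have := H.pl_cross (v := s) (x := t') (x' := t₃) (by grind) (hR2' f hf) hz
    grind
  have c1 : ∀ f ∈ R₂, ∀ z ∈ pl J ℓ s s', f ≠ z ∧ (G.Adj f z ↔ R₂.head? = some f ∧ z = y') := by
    intro f hf z hz
    have := H.pl_cross (v := s') (x := t') (x' := s) (by
      rw [nx_of_adj hJ hst']; exact d2) (by rwa [hR2pl]) (by
      rw [H.pl_reverse]; exact List.mem_reverse.2 hz)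
    rw [hR2pl, hDr] at this
    simpa [eq_comm] using this
  have c1' : ∀ f ∈ R₂, ∀ z ∈ pl J ℓ s' t₄, f ≠ z ∧
      (G.Adj f z ↔ R₂.head? = some f ∧ z = y'') := by
    intro f hf z hz
    have := H.pl_cross (v := s') (x := t') (x' := t₄) (by
      rw [nx_of_adj hJ hst', n4]; exact e4.symm) (by rwa [hR2pl]) hz
    rw [hR2pl, hd''] at this
    simpa [eq_comm] using this
  -- the prolonged path
  have hT : ∀ f ∈ y1 :: u2.reverse, f ∈ R₂ := by
    intro f hf
    rw [q2]; simp at hf ⊢; tauto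
  have hTl : (y1 :: u2.reverse).getLast? = R₂.head? := by
    rw [q2]
    have : y1 :: u2.reverse = (u2 ++ [y1]).reverse := by simp
    rw [this, List.getLast?_reverse]
    rcases u2 <;> rfl
  have hTip : IP G (y1 :: u2.reverse) := by
    have : y1 :: u2.reverse = (u2 ++ [y1]).reverse := by simp
    rw [this]
    exact (hR₂.ip.infix ⟨[], v2, by simp [q2]⟩).reverse
  have hRv : ∀ f ∈ R₂, f ∈ M.verts J := fun f hf => mem_verts_of_edge hst' (hR₂.sub f hf)
  have hy1d : ¬ Att G p.dropLast y1 := h2 y1 (hR₂.sub y1 (by simp [q2])) hy1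
  have hattT : ∀ z, Att G (p ++ y1 :: u2.reverse) z ↔ Att G p z ∨ ∃ f ∈ y1 :: u2.reverse,
      G.Adj f z := by
    intro z; exact att_append
  -- The path is prolonged along the second rung, from the first vertex of the rung that it sees
  -- back to the end at `s'`. The new last vertex sees precisely `y'` and `y''` on the second arm,
  -- the two vertices on either side of `s'`.
  have hp' : IP G (p ++ y1 :: u2.reverse) := by
    rw [IP.append_iff]
    refine ⟨hp, hTip, fun f hf z hz => ⟨?_, ?_⟩⟩
    · rintro rfl
      exact hout f hf (Or.inl (hRv f (hT f hz)))
    · simp only [List.head?_cons, Option.some.injEq]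
      rcases List.mem_cons.1 hz with rfl | hz
      · simp only [and_true]
        constructor
        · intro hfy
          exact (mem_dropLast_or_getLast? hf).resolve_left fun h3 => hy1d ⟨f, h3, hfy⟩
        · intro hfl
          obtain ⟨g, hg, hgy⟩ := hy1
          have := (mem_dropLast_or_getLast? hg).resolve_left fun h3 => hy1d ⟨g, h3, hgy⟩
          grind
      · refine iff_of_false (fun hfz => hu2 z (List.mem_reverse.1 hz) ⟨f, hf, hfz⟩) ?_
        grind
  have hcore : ∀ j : Fin 3, ∀ z ∈ arm J ℓ h (!i) s ((![t, t₄, t₃] : Fin 3 → W) j)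
      ((![i, !i, !i] : Fin 3 → Bool) j), Core J M h z := by
    intro j z hz
    rcases C.arm_core hℓ hz with h3 | h3
    · exact Or.inl h3.1
    · exact Or.inr ⟨_, h3.2⟩
  have hp'S : ∀ j : Fin 3, ∀ f ∈ p ++ y1 :: u2.reverse,
      f ∉ arm J ℓ h (!i) s ((![t, t₄, t₃] : Fin 3 → W) j) ((![i, !i, !i] : Fin 3 → Bool) j) := by
    intro j f hf hfa
    rcases List.mem_append.1 hf with hf | hf
    · exact hout f hf (hcore j f hfa)
    have hfR := hT f hf
    fin_cases j
    · change f ∈ arm J ℓ h (!i) s t i at hfa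
      rcases mem_arm.1 hfa with h3 | ⟨_, h3⟩
      · rw [pl_adj hJ ℓ hst, f1] at h3; grind
      · exact C.ne_hub (hRv f hfR) _ h3
    · change f ∈ arm J ℓ h (!i) s t₄ (!i) at hfa
      grind
    · change f ∈ arm J ℓ h (!i) s t₃ (!i) at hfa
      rw [A2] at hfa
      exact (c2 f hfR f hfa).1 rfl
  obtain ⟨r, hr⟩ : ∃ r, R₂.head? = some r := ⟨_, List.head?_eq_some_head hR₂.ne⟩
  have hrT : r ∈ y1 :: u2.reverse := List.mem_of_getLast? (hTl.trans hr)
  have hTne : y1 :: u2.reverse ≠ [] := by simp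
  have hdT : ∀ z, Att G ((p ++ y1 :: u2.reverse).dropLast) z → Att G p z ∨
      ∃ f ∈ R₂, R₂.head? ≠ some f ∧ G.Adj f z := by
    intro z ha
    rw [List.dropLast_append_of_ne_nil hTne] at ha
    obtain ⟨f, hf, hfz⟩ := ha
    rcases List.mem_append.1 hf with hf | hf
    · exact Or.inl ⟨f, hf, hfz⟩
    · refine Or.inr ⟨f, hT f (List.mem_of_mem_dropLast hf), fun h3 => ?_, hfz⟩
      have h5 := hTip.nodup
      rw [← hTl] at h3
      rw [← List.dropLast_append_getLast hTne, List.nodup_append] at h5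
      grind
  have hx1t : ¬ Att G (p ++ y1 :: u2.reverse).tail x1 := by
    have hx1m : x1 ∈ R₁ := by simp [q1]
    rintro ⟨f, hf, hfx⟩
    rw [List.tail_append_of_ne_nil hp0] at hf
    rcases List.mem_append.1 hf with hf | hf
    · exact h1 x1 (hR₁.sub x1 hx1m) hx1 ⟨f, hf, hfx⟩
    · exact (c0 f (hT f hf) x1 hx1m).2 hfx
  have hu1' : ∀ z ∈ u1, ¬ Att G (p ++ y1 :: u2.reverse) z := by
    intro z hz ha
    rcases (hattT z).1 ha with h3 | ⟨f, hf, h3⟩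
    · exact hu1 z hz h3
    · exact (c0 f (hT f hf) z (by simp [q1, hz])).2 h3
  have hDm : ∀ z ∈ d ++ [y'], z ∈ pl J ℓ s s' := fun z hz => by rwa [hd]
  have o1 := hP.odd_inner C.ehf hp' (by simp) hp'S (i := 0) (j := 1) (by decide) A0
    (show arm J ℓ h (!i) s t₄ (!i) = d ++ y' :: pl J ℓ s' t₄ by rw [A1, hd]; simp)
    ((hattT x1).2 (Or.inl hx1)) hx1t
    ((hattT y').2 (Or.inr ⟨r, hrT, (c1 r (hT r hrT) y' (hDm _ (by simp))).2.2 ⟨hr, rfl⟩⟩))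
    (fun ha => by
      rcases hdT _ ha with h3 | ⟨f, hf, hfr, h3⟩
      · exact hnp hsn (hsn' i) (hDm y' (by simp)) h3
      · exact hfr ((c1 f hf y' (hDm _ (by simp))).2.1 h3).1) hu1'
    (fun z hz ha => by
      rcases (hattT z).1 ha with h3 | ⟨f, hf, h3⟩
      · exact hnp hsn (hsn' i) (hDm z (by simp [hz])) h3
      · have := ((c1 f (hT f hf) z (hDm _ (by simp [hz]))).2.1 h3).2
        subst this
        have hnd := (H.pl_ip s s').nodup
        rw [hd, List.nodup_append] at hnd
        exact hnd.2.2 z hz z (by simp) rfl)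
  have hy''m : y'' ∈ pl J ℓ s' t₄ := by simp [hd'']
  have o2 := hP.odd_mix C.ehf hp' (by simp) hp'S (i := 0) (j := 1) (l := 2) (by
      intro hm
      rcases List.mem_append.1 hm with h3 | h3
      · exact hout _ h3 (Or.inr ⟨_, rfl⟩)
      · exact C.hub_notMem _ (hRv _ (hT _ h3)))
    (by
      intro ha
      rcases (hattT _).1 ha with h3 | ⟨f, hf, h3⟩
      · exact hpi h3
      · have hfR := hT f hf
        have := (H.hub_pl (c := !i) (v := s') (x := t') (hsn' _) (by rwa [hR2pl])).1 h3.symm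
        exact C.disj i t' ht' this.1)
    (by decide) (by decide) (by decide) A0
    (show arm J ℓ h (!i) s t₄ (!i) = pl J ℓ s s' ++ y'' :: v2'' by rw [A1, hd''])
    ((hattT x1).2 (Or.inl hx1)) hx1t
    ((hattT y'').2 (Or.inr ⟨r, hrT, (c1' r (hT r hrT) y'' hy''m).2.2 ⟨hr, rfl⟩⟩))
    (fun ha => by
      rcases hdT _ ha with h3 | ⟨f, hf, hfr, h3⟩
      · exact hnp hsn' ht₄i hy''m h3
      grind) hu1'
    (fun z hz ha => by
      have hzm : z ∈ pl J ℓ s' t₄ := by simp [hd'', hz]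
      rcases (hattT z).1 ha with h3 | ⟨f, hf, h3⟩
      · exact hnp hsn' ht₄i hzm h3
      · have := ((c1' f (hT f hf) z hzm).2.1 h3).2
        subst this
        have hnd := H.pl_ip s' t₄
        rw [hd''] at hnd
        exact hnd.1 hz)
    (fun z hz ha => by
      change z ∈ arm J ℓ h (!i) s t₃ (!i) at hz
      rw [A2] at hz
      rcases (hattT z).1 ha with h3 | ⟨f, hf, h3⟩
      · exact hnp hsn ht₃i hz h3
      · exact (c2 f (hT f hf) z hz).2 h3) (by simp) hD
  -- The cycle through the base uses `y'` and the mixed cycle uses `y''`. Together they would give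
  -- the second and third arms different parities.
  have o3 := hP.odd_len C.ehf (i := 1) (j := 2) (by decide)
  have hl : (arm J ℓ h (!i) s t₄ (!i)).length = d.length + 1 + (v2''.length + 1) := by
    rw [A1, hd, hd'']; simp; omega
  simp only [Matrix.cons_val_one, Matrix.cons_val_zero, Matrix.cons_val] at o1 o2 o3
  rw [hl] at o3
  rw [Nat.odd_iff] at *
  omega

end CrossSystem

/-- The vertex `z` belongs to the strip at a leaf in `L c`. -/
def LeafStrip (J : SimpleGraph W) (M : StripFamily V W) (L : Bool → Set W) (c : Bool) (z : V) :
    Prop := ∃ s t, J.Adj s t ∧ t ∈ L c ∧ z ∈ M.edge s(s, t)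

/-- The path `p` attaches to `M_v` in two strips, and to a vertex outside `M_v` of the branch at
`v` towards a third neighbour `u`. -/
def Hit (G : SimpleGraph V) (J : SimpleGraph W) (M : StripFamily V W) (p : List V)
    (v u : W) : Prop :=
  (∃ z, MBranch J M v u z ∧ Att G p z ∧ z ∉ M.node v) ∧
    ∃ u₁ u₂, u₁ ≠ u ∧ u₂ ≠ u ∧ Spread G J M p v u₁ u₂

/-! ### Tight paths that see no hub: finding a `Hit` -/

namespace CrossSystem

/-- The pyramid lemma when `p` has no edges to the hubs. -/
theorem triple_plain (C : CrossSystem G J M h L) {ℓ₀ : W → W → List V} (h0 : Selection G J M ℓ₀)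
    (hp : Tight G J M h L p) (hh : ∀ c, ¬ Att G p (h c)) {i : Bool} {v : W}
    {y : Fin 3 → W} {c : Fin 3 → Bool} {R : Fin 3 → List V}
    (hy : ∀ j, y j ≠ v) (hne : ∀ j k, j ≠ k → nx J v (y j) ≠ nx J v (y k))
    (hc : ∀ j, y j ∉ L (!(c j))) (hci : ∀ j k, j ≠ k → c j = i ∨ c k = i)
    (hR : ∀ j, IsRung G M (nx J (y j) v) (y j) (R j))
    (hnon : ∃ j k, j ≠ k ∧ ∃ x ∈ R j, ∃ z ∈ R k,
      Att G p x ∧ Att G p z ∧ ¬ (x ∈ M.node v ∧ z ∈ M.node v)) :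
    ∃ (ℓ : W → W → List V) (t : Fin 3 → W), Selection G J M ℓ ∧ (∀ j, t j ∈ L (c j)) ∧
      (∀ j, Beyond J v (y j) (t j)) ∧ (∀ j, ℓ (nx J (y j) v) (y j) = R j) ∧
      (∀ w x, (∀ j, s(w, x) ≠ s(nx J (y j) v, y j)) → ℓ w x = ℓ₀ w x) ∧
      ((∃ j k l, j ≠ k ∧ j ≠ l ∧ k ≠ l ∧
        (∃ z, MBranch J M v (nx J v (y j)) z ∧ Att G p z ∧ z ∉ M.node v) ∧
        Spread G J M p v (nx J v (y k)) (nx J v (y l)) ∧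
        ∀ m, m ≠ j → ∀ z ∈ pl J ℓ v (t m), Att G p z → z ∈ M.node v) ∨
      ∃ j k l, j ≠ k ∧ j ≠ l ∧ k ≠ l ∧ c j = i ∧
        (∃ x ∈ M.node (t j), x ∈ pl J ℓ v (t j) ∧ Att G p x ∧
          ∀ z ∈ pl J ℓ v (t j), Att G p z → z = x) ∧
        (2 ≤ (arm J ℓ h i v (t j) (c j)).length → PairAtt G p (arm J ℓ h i v (t k) (c k))) ∧
        ∀ z ∈ pl J ℓ v (t l), ¬ Att G p z) := by
  have hJ := C.sys.tree
  obtain ⟨ℓ, t, h1, h2, h3, h4, h5, h6, h7⟩ := C.triple h0 hp (hh i) hy hne hc hci hR (by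
    obtain ⟨j, k, hjk, x, hx, z, hz, hr⟩ := hnon
    exact ⟨j, k, hjk, x, Or.inl hx, z, hz, hr⟩)
  have hnx : ∀ j, nx J v (t j) = nx J v (y j) := fun j => (h3 j).nx_eq hJ (hy j)
  have htv : ∀ j, t j ≠ v := fun j => (h3 j).ne (hy j)
  refine ⟨ℓ, t, h1, h2, h3, h4, h5, ?_⟩
  rcases h7 with ⟨j, ⟨z, hz, haz, hzn⟩, hb⟩ | ⟨j, k, l, hjk, hjl, hkl, hE, hP, -, hl⟩
  · left
    obtain ⟨k, l, hjk, hjl, hkl⟩ : ∃ k l : Fin 3, j ≠ k ∧ j ≠ l ∧ k ≠ l := by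
      clear hb hzn hz; revert j; decide
    refine ⟨j, k, l, hjk, hjl, hkl, ⟨z, ?_, haz, ?_⟩, ?_, ?_⟩
    · rcases C.arm_core h1 hz with h8 | ⟨_, rfl⟩
      · grind
      grind
    · rw [← C.arm_head_iff h1 (htv j) hz]; exact hzn
    · have := C.spread_of_base h1 (i := i) htv (k := k) (l := l)
        (by grind) (hb k hjk.symm) (hb l hjl.symm)
      grind
    · intro m hm z hz
      exact C.onlyBase_node h1 (htv m) (hb m hm) (mem_arm.2 (Or.inl hz))
  · right
    obtain ⟨⟨x, hx, hax⟩, hx2⟩ := hE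
    have hl1 := hx2 x hx hax
    have key : ∀ z ∈ pl J ℓ v (t j), Att G p z → z = x := fun z hz haz => by
      have h9 := hx2 z (mem_arm.2 (Or.inl hz)) haz
      grind
    rcases C.arm_last h1 hx hl1 with ⟨h8, h9⟩ | ⟨_, rfl⟩
    · exact ⟨j, k, l, hjk, hjl, hkl, h8, ⟨x, h9, (mem_arm.1 hx).resolve_right fun h => h.1 h8,
        hax, key⟩, hP, fun z hz => hl z (mem_arm.2 (Or.inl hz))⟩
    grind

theorem strips_disjoint (C : CrossSystem G J M h L) {i : Bool} {s t s' t' : W} (hst : J.Adj s t)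
    (hst' : J.Adj s' t') (ht : t ∈ L i) (ht' : t' ∈ L i) (hss : s ≠ s') {x y : V}
    (hx : x ∈ M.edge s(s, t)) (hy : y ∈ M.edge s(s', t')) : ¬ RelJ J M x y := by
  have htt : t ≠ t' := by
    rintro rfl
    exact hss (C.leaf_unique ht hst.symm hst'.symm)
  have h1 := C.nbr_not_leaf hst ht i
  have h2 := C.nbr_not_leaf hst' ht' i
  rintro (⟨e, he, h5, h6⟩ | ⟨w, h5, h6⟩)
  · have := (C.mem_edge_unique hst he hx h5).trans (C.mem_edge_unique he hst' h6 hy)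
    grind
  · have h7 := C.node_mem_edge hst hx h5
    have h8 := C.node_mem_edge hst' hy h6
    grind

/-- If all attachments were in leaf strips of `L i`, an unrelated pair would lie in two strips with
different inner ends, since each inner end has at most one neighbour in `L i`. Orienting the path by
this pair leads to `not_leaf_strips`. -/
theorem exists_not_leafStrip (C : CrossSystem G J M h L) (hp : Tight G J M h L p) {i : Bool}
    (hpi : ¬ Att G p (h (!i))) {x y : V} (hx : x ∈ M.verts J) (hy : y ∈ M.verts J)
    (hax : Att G p x) (hay : Att G p y) (hxy : ¬ RelJ J M x y) :
    ∃ z ∈ M.verts J, Att G p z ∧ ¬ LeafStrip J M L i z := by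
  by_contra hcon
  push Not at hcon
  obtain ⟨s, t, hst, ht, hxs⟩ := hcon x hx hax
  obtain ⟨s', t', hst', ht', hys⟩ := hcon y hy hay
  have hss : s ≠ s' := by
    rintro rfl
    have := C.one i s ⟨hst, ht⟩ ⟨hst', ht'⟩
    subst this
    exact hxy (Or.inl ⟨_, hst, hxs, hys⟩)
  have main : ∀ p : List V, Tight G J M h L p → ¬ Att G p (h (!i)) →
      (∀ z ∈ M.verts J, Att G p z → LeafStrip J M L i z) → Att G p x → Att G p y →
      ¬ Att G p.tail x → ¬ Att G p.dropLast y → False := by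
    intro p hp hpi hcon hax hay h1 h2
    have core : ∀ {z}, z ∈ M.verts J → Core J M h z := fun hz => Or.inl hz
    have hnr : ∀ {z z'}, z ∈ M.edge s(s, t) → z' ∈ M.edge s(s', t') → ¬ Rel J M h L z z' := by
      intro z z' hz hz'
      rw [C.rel_iff (mem_verts_of_edge hst hz) (mem_verts_of_edge hst' hz')]
      exact C.strips_disjoint hst hst' ht ht' hss hz hz'
    have key : ∀ z ∈ M.edge s(s, t), ∀ z' ∈ M.edge s(s', t'), Att G p z → Att G p z' →
        (2 ≤ p.length → Att G p.dropLast z → ¬ Att G p.tail z →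
          ¬ Att G p.tail z ∧ ¬ Att G p.dropLast z') ∧
        (2 ≤ p.length → Att G p.tail z' → ¬ Att G p.dropLast z' →
          ¬ Att G p.tail z ∧ ¬ Att G p.dropLast z') := by
      intro z hz z' hz' ha ha'
      have := hp.ends (core (mem_verts_of_edge hst hz)) (core (mem_verts_of_edge hst' hz')) ha ha'
        (hnr hz hz')
      tauto
    refine C.not_leaf_strips hp.ip hp.ne hp.out hpi hcon hst hst' ht ht' hss hxs hys hax hay
      (fun z hz ha => ?_) (fun z hz ha => ?_)
    · by_cases hl : 2 ≤ p.length
      · exact ((key z hz y hys ha hay).2 hl ((att_tail_or_dropLast hl hay).resolve_right h2) h2).1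
      · rintro ⟨f, hf, -⟩
        have := List.length_pos_of_mem hf
        grind
    · by_cases hl : 2 ≤ p.length
      · exact ((key x hxs z hz hax ha).1 hl ((att_tail_or_dropLast hl hax).resolve_left h1) h1).2
      · rintro ⟨f, hf, -⟩
        have := List.length_pos_of_mem hf
        grind
  rcases hp.ends (Or.inl hx) (Or.inl hy) hax hay (by rwa [C.rel_iff hx hy]) with ⟨h1, h2⟩ | ⟨h1, h2⟩
  · grind
  · refine main p.reverse hp.reverse (by rwa [Att.reverse_iff])
      (by simpa only [Att.reverse_iff] using hcon) (by rwa [Att.reverse_iff])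
      (by rwa [Att.reverse_iff]) ?_ ?_
    · rwa [List.tail_reverse, Att.reverse_iff]
    · rwa [List.dropLast_reverse, Att.reverse_iff]

/-- If the only attachment of `p` in a rung of the strip at a leaf `t` is the end in `M_t`, then
all other attachments are close. -/
theorem unique_end (C : CrossSystem G J M h L) (hp : Tight G J M h L p)
    (hh : ∀ c, ¬ Att G p (h c)) {i : Bool} {s t : W} (hst : J.Adj s t) (ht : t ∈ L (!i))
    {R₀ : List V} (hR₀ : IsRung G M s t R₀) {x' : V} (hx' : x' ∈ R₀) (hax' : Att G p x')
    (huniq : ∀ z ∈ R₀, Att G p z → z = x') (hx's : x' ∉ M.node s) {y₂ : W} (hy₂ : y₂ ≠ s)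
    (hd : nx J s y₂ ≠ t) (hyL : y₂ ∉ L (!i)) {x₂ : V} (hx₂ : x₂ ∈ M.edge s(nx J y₂ s, y₂))
    (hax₂ : Att G p x₂) : x₂ ∈ M.node s ∧
      ((∃ u₃, u₃ ≠ t ∧ Spread G J M p s (nx J s y₂) u₃) ∨
        (J.Adj s y₂ ∧ y₂ ∈ L i ∧ IsRung G M s y₂ [x₂])) := by
  have hJ := C.sys.tree
  have a2 := nx_adj hJ hy₂
  obtain ⟨u₃, a3, e3, e3'⟩ := C.exists_third_nbr hst a2 hd.symm
  have hu₃ : u₃ ∉ L (!i) := fun h3 => e3 (C.one (!i) s ⟨a3, h3⟩ ⟨hst, ht⟩)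
  obtain ⟨R₂, hR₂, hxR₂⟩ := C.exists_rung_far hy₂ hx₂
  obtain ⟨R₃, hR₃⟩ := C.exists_rung_dir a3
  obtain ⟨ℓ₀, hℓ₀⟩ := C.exists_selection
  have hti : t ∉ L (!!i) := C.disj _ _ ht
  have hr0 : IsRung G M (nx J t s) t R₀ := by rwa [nx_of_adj hJ hst.symm]
  -- The arm towards `t` is continued by the hub `h (!i)`, which is not seen. So this arm is not met
  -- in its end, and in the second outcome the end that is met belongs to another arm.
  obtain ⟨ℓ, t', hℓ, ht', hb, hR, -, hout⟩ := C.triple_plain hℓ₀ hp hh (i := i) (v := s)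
    (y := ![t, y₂, u₃]) (c := ![!i, i, i]) (R := ![R₀, R₂, R₃])
    (by intro j; fin_cases j <;> simp [hst.ne', hy₂, a3.ne'])
    (forall_ne_fin3 (fun i j hij => hij.symm) (by simpa [nx_of_adj hJ hst] using hd.symm)
      (by simpa [nx_of_adj hJ hst, nx_of_adj hJ a3] using e3.symm)
      (by simpa [nx_of_adj hJ a3] using e3'.symm))
    (by
      intro j
      fin_cases j
      · exact hti
      · exact hyL
      · exact hu₃)
    (forall_ne_fin3 (fun i j hij => hij.symm) (by simp) (by simp) (by simp))
    (by
      intro j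
      fin_cases j
      · exact hr0
      · exact hR₂
      · exact hR₃)
    ⟨0, 1, by decide, x', hx', x₂, hxR₂, hax', hax₂, fun hxx => hx's hxx.1⟩
  have ht0 : t' 0 = t := by
    rcases hb 0 with h6 | h6
    · exact h6
    · by_contra hne
      exact h6 ((nx_of_adj hJ hst.symm).trans (C.leaf_unique ht (nx_adj hJ hne) hst.symm).symm)
  have e0 : ℓ s t = R₀ := by
    have := hR 0
    simpa [nx_of_adj hJ hst.symm] using this
  have p0 : pl J ℓ s (t' 0) = R₀ := by rw [ht0, pl_adj hJ ℓ hst, e0]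
  have m2 : x₂ ∈ pl J ℓ s (t' 1) := C.mem_pl_of_mem hy₂ (hb 1) (by
    have := hR 1
    simp only [Matrix.cons_val_one, Matrix.cons_val_zero] at this
    rwa [this])
  rcases hout with ⟨j, k, l, hjk, hjl, hkl, -, hS, hB⟩ | ⟨j, k, l, hjk, hjl, hkl, hci, hE, hP, hl⟩
  · have hj : j = 0 := by grind
    subst hj
    refine ⟨hB 1 (by decide) x₂ m2 hax₂, Or.inl ?_⟩
    have hkl' : (k = 1 ∧ l = 2) ∨ (k = 2 ∧ l = 1) := by omega
    rcases hkl' with ⟨rfl, rfl⟩ | ⟨rfl, rfl⟩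
    · exact ⟨u₃, e3, by simpa [nx_of_adj hJ a3] using hS⟩
    · refine ⟨u₃, e3, ?_⟩
      have : Spread G J M p s u₃ (nx J s y₂) := by simpa [nx_of_adj hJ a3] using hS
      exact ⟨this.1.symm, this.2.2.1, this.2.1, this.2.2.2.2, this.2.2.2.1⟩
  · have h0l : l ≠ 0 := by grind
    have h1l : l ≠ 1 := by grind
    have h0j : j ≠ 0 := by grind
    obtain ⟨rfl, rfl⟩ : j = 1 ∧ k = 0 := by omega
    -- Two consecutive attachments on the arm of `t` are impossible, as `x'` is its only attachment.
    -- Hence the arm met in its end consists of one vertex.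
    have hlen : (arm J ℓ h i s (t' 1) ((![!i, i, i] : Fin 3 → Bool) 1)).length < 2 := by
      by_contra hlen
      obtain ⟨u, a, b, w, q1, q2, q3, q4, q5⟩ := hP (by omega)
      have hnd : (arm J ℓ h i s (t' 0) ((![!i, i, i] : Fin 3 → Bool) 0)) = R₀ ++ [h (!i)] := by
        simp [arm, p0]
      rw [q1] at hnd
      have mem : ∀ z ∈ u ++ a :: b :: w, Att G p z → z = x' := by grind
      have hb := mem b (by simp) q3
      have hnd2 : (R₀ ++ [h (!i)]).Nodup := by
        rw [List.nodup_append]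
        refine ⟨hR₀.ip.nodup, by simp, fun z hz z' hz' => ?_⟩
        rw [List.mem_singleton] at hz'
        rw [hz']
        exact C.ne_hub (mem_verts_of_edge hst (hR₀.sub z hz)) _
      grind
    obtain ⟨-, q1, z, q2, q3⟩ := C.arm_single hℓ ((hb 1).ne hy₂) hlen
    have hz : pl J ℓ s (t' 1) = [z] := by rw [pl_adj hJ ℓ q1, q2]
    have hty : t' 1 = y₂ := by
      by_contra hne
      have h9 := (hb 1).dist_eq hJ hy₂
      have h10 := hJ.connected.pos_dist_of_ne hy₂.symm
      have h12 := hJ.connected.pos_dist_of_ne (Ne.symm hne)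
      have h13 : J.dist s (t' 1) = 1 := SimpleGraph.dist_eq_one_iff_adj.2 q1
      omega
    rw [hty] at q1 q2
    have hr : IsRung G M s y₂ [x₂] := by
      have := hℓ.isRung q1
      grind
    have hyi := ht' 1
    rw [hty] at hyi
    exact ⟨(hr.fst x₂ (by simp)).2 rfl, Or.inr ⟨q1, hyi, hr⟩⟩

end CrossSystem

theorem fin3_ne_zero : ∀ {k : Fin 3}, k ≠ 0 → k = 1 ∨ k = 2 := by decide

theorem fin3_ne_one : ∀ {k l : Fin 3}, k ≠ 1 → l ≠ 1 → k ≠ l → (k = 0 ∧ l = 2) ∨ (k = 2 ∧ l = 0) := by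
  decide

theorem fin3_eq_of_ne : ∀ {j k l : Fin 3}, j ≠ k → j ≠ l → k ≠ l → j ≠ 1 → l ≠ 0 → l ≠ 1 →
    j = 0 ∧ k = 1 := by decide

theorem fin3_mem : ∀ {j l : Fin 3}, j ≠ l → l ≠ 0 → l ≠ 1 → j = 0 ∨ j = 1 := by decide

theorem sym2_ne {W : Type*} {a b c d : W} (h1 : a ≠ c ∨ b ≠ d) (h2 : a ≠ d ∨ b ≠ c) :
    s(a, b) ≠ s(c, d) := by grind

theorem Spread.symm {p : List V} {v u u' : W} (hS : Spread G J M p v u u') :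
    Spread G J M p v u' u :=
  ⟨hS.1.symm, hS.2.2.1, hS.2.1, hS.2.2.2.2, hS.2.2.2.1⟩

namespace CrossSystem

theorem triple_plain_vec (C : CrossSystem G J M h L) {ℓ₀ : W → W → List V}
    (h0 : Selection G J M ℓ₀) (hp : Tight G J M h L p) (hh : ∀ c, ¬ Att G p (h c)) (i : Bool)
    {v y₀ y₁ y₂ : W} {c₀ c₁ c₂ : Bool} {R₀ R₁ R₂ : List V}
    (hy₀ : y₀ ≠ v) (hy₁ : y₁ ≠ v) (hy₂ : y₂ ≠ v) (h01 : nx J v y₀ ≠ nx J v y₁)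
    (h02 : nx J v y₀ ≠ nx J v y₂) (h12 : nx J v y₁ ≠ nx J v y₂)
    (hc₀ : y₀ ∉ L (!c₀)) (hc₁ : y₁ ∉ L (!c₁)) (hc₂ : y₂ ∉ L (!c₂))
    (k01 : c₀ = i ∨ c₁ = i) (k02 : c₀ = i ∨ c₂ = i) (k12 : c₁ = i ∨ c₂ = i)
    (hR₀ : IsRung G M (nx J y₀ v) y₀ R₀) (hR₁ : IsRung G M (nx J y₁ v) y₁ R₁)
    (hR₂ : IsRung G M (nx J y₂ v) y₂ R₂) {x z : V} (hx : x ∈ R₀) (hz : z ∈ R₁)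
    (hax : Att G p x) (haz : Att G p z) (hxz : ¬ (x ∈ M.node v ∧ z ∈ M.node v)) :
    ∃ (ℓ : W → W → List V) (t : Fin 3 → W), Selection G J M ℓ ∧
      (∀ j, t j ∈ L ((![c₀, c₁, c₂] : Fin 3 → Bool) j)) ∧
      (Beyond J v y₀ (t 0) ∧ Beyond J v y₁ (t 1) ∧ Beyond J v y₂ (t 2)) ∧
      (ℓ (nx J y₀ v) y₀ = R₀ ∧ ℓ (nx J y₁ v) y₁ = R₁ ∧ ℓ (nx J y₂ v) y₂ = R₂) ∧
      (∀ w x, s(w, x) ≠ s(nx J y₀ v, y₀) → s(w, x) ≠ s(nx J y₁ v, y₁) →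
        s(w, x) ≠ s(nx J y₂ v, y₂) → ℓ w x = ℓ₀ w x) ∧
      ((∃ j k l, j ≠ k ∧ j ≠ l ∧ k ≠ l ∧
        (∃ z, MBranch J M v (nx J v ((![y₀, y₁, y₂] : Fin 3 → W) j)) z ∧ Att G p z ∧
          z ∉ M.node v) ∧
        Spread G J M p v (nx J v ((![y₀, y₁, y₂] : Fin 3 → W) k))
          (nx J v ((![y₀, y₁, y₂] : Fin 3 → W) l)) ∧
        ∀ m, m ≠ j → ∀ z ∈ pl J ℓ v (t m), Att G p z → z ∈ M.node v) ∨
      ∃ j k l, j ≠ k ∧ j ≠ l ∧ k ≠ l ∧ (![c₀, c₁, c₂] : Fin 3 → Bool) j = i ∧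
        (∃ x ∈ M.node (t j), x ∈ pl J ℓ v (t j) ∧ Att G p x ∧
          ∀ z ∈ pl J ℓ v (t j), Att G p z → z = x) ∧
        (2 ≤ (arm J ℓ h i v (t j) ((![c₀, c₁, c₂] : Fin 3 → Bool) j)).length →
          PairAtt G p (arm J ℓ h i v (t k) ((![c₀, c₁, c₂] : Fin 3 → Bool) k))) ∧
        ∀ z ∈ pl J ℓ v (t l), ¬ Att G p z) := by
  obtain ⟨ℓ, t, h1, h2, h3, h4, h5, h6⟩ := C.triple_plain h0 hp hh (i := i) (v := v)
    (y := ![y₀, y₁, y₂]) (c := ![c₀, c₁, c₂]) (R := ![R₀, R₁, R₂])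
    (by intro j; fin_cases j <;> assumption)
    (forall_ne_fin3 (fun i j hij => hij.symm) h01 h02 h12)
    (by intro j; fin_cases j <;> assumption)
    (forall_ne_fin3 (fun i j hij => hij.symm) k01 k02 k12)
    (by intro j; fin_cases j <;> assumption) ⟨0, 1, by decide, x, hx, z, hz, hax, haz, hxz⟩
  refine ⟨ℓ, t, h1, h2, ⟨h3 0, h3 1, h3 2⟩, ⟨h4 0, h4 1, h4 2⟩, fun w x q0 q1 q2 => h5 w x ?_, h6⟩
  intro j; fin_cases j <;> assumption

theorem beyond_leaf (C : CrossSystem G J M h L) {s t t' : W} (hst : J.Adj s t) {c : Bool}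
    (ht : t ∈ L c) (hb : Beyond J s t t') : t' = t := by
  have hJ := C.sys.tree
  rcases hb with h6 | h6
  · exact h6
  · by_contra hne
    exact h6 ((nx_of_adj hJ hst.symm).trans (C.leaf_unique ht (nx_adj hJ hne) hst.symm).symm)

theorem far_leaf (C : CrossSystem G J M h L) {v y t : W} (hvt : J.Adj v t) {c : Bool}
    (ht : t ∈ L c) (hy : nx J v y = t) : y = t := by
  have hJ := C.sys.tree
  have hyv := ne_of_nx_eq hvt hy
  by_contra hne
  refine nx_nx_ne hJ hyv ?_
  rw [hy]
  exact C.leaf_unique ht (nx_adj hJ hne) hvt.symm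

theorem not_leafStrip_far (C : CrossSystem G J M h L) {v y : W} (hy : y ≠ v) {z : V} {c : Bool}
    (hz : z ∈ M.edge s(nx J y v, y)) (hn : ¬ LeafStrip J M L c z) : y ∉ L c :=
  fun hyc => hn ⟨_, y, (nx_adj C.sys.tree hy.symm).symm, hyc, hz⟩

theorem far_ne_leaf (C : CrossSystem G J M h L) {v y t : W} (hvt : J.Adj v t) {c : Bool}
    (ht : t ∈ L c) {z : V} (hz : z ∈ M.edge s(nx J y v, y)) (hn : z ∉ M.edge s(v, t)) :
    nx J v y ≠ t := by
  intro h1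
  rw [C.far_leaf hvt ht h1, nx_of_adj C.sys.tree hvt.symm] at hz
  exact hn hz

theorem pl_leaf (C : CrossSystem G J M h L) {s t t' : W} (hst : J.Adj s t) {c : Bool}
    (ht : t ∈ L c) (hb : Beyond J s t t') : pl J ℓ s t' = ℓ s t := by
  rw [C.beyond_leaf hst ht hb, pl_adj C.sys.tree ℓ hst]

/-- The pyramid with apex `h false` is handled by `unique_end`. Its exceptional case, a one-vertex
rung at a leaf of `L false`, is treated with apex `h true`: the arm is then this vertex followed by
`h false`, which is not seen, so it cannot contain a pair of consecutive attachments. -/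
theorem exists_hit_of_unique (C : CrossSystem G J M h L) (hp : Tight G J M h L p)
    (hh : ∀ c, ¬ Att G p (h c)) (hnd : Nondeg J M L) {z : V} (hz : z ∈ M.verts J)
    (haz : Att G p z) (hzn : ¬ LeafStrip J M L true z)
    {s t : W} (hst : J.Adj s t) (ht : t ∈ L true)
    {R₀ : List V} (hR₀ : IsRung G M s t R₀) {x' : V} (hx' : x' ∈ R₀) (hax' : Att G p x')
    (huniq : ∀ z ∈ R₀, Att G p z → z = x') (hxt : x' ∈ M.node t) :
    ∃ v u, Hit G J M p v u := by
  have hJ := C.sys.tree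
  have hx's : x' ∉ M.node s := fun hs => hnd s t hst ht x' hs hxt
  obtain ⟨y₂, hy₂, hzy⟩ := C.exists_branch s hz
  have hyL := C.not_leafStrip_far hy₂ hzy hzn
  have hd : nx J s y₂ ≠ t := C.far_ne_leaf hst ht hzy fun hz => hzn ⟨s, t, hst, ht, hz⟩
  have hit0 : ∃ z, MBranch J M s t z ∧ Att G p z ∧ z ∉ M.node s :=
    ⟨x', C.mBranch_adj hst (hR₀.sub x' hx'), hax', hx's⟩
  obtain ⟨-, ⟨u₃, h1, h2⟩ | ⟨h1, h2, h3⟩⟩ := C.unique_end hp hh (i := false) hst ht hR₀ hx' hax'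
    huniq hx's hy₂ hd hyL hzy haz
  · exact ⟨s, t, hit0, _, _, hd, h1, h2⟩
  obtain ⟨u₃, a3, e3, e3'⟩ := C.exists_third_nbr hst h1 (by grind)
  obtain ⟨R₃, hR₃⟩ := C.exists_rung_dir a3
  obtain ⟨ℓ₀, hℓ₀⟩ := C.exists_selection
  have hr0 : IsRung G M (nx J t s) t R₀ := by rwa [nx_of_adj hJ hst.symm]
  have hr1 : IsRung G M (nx J y₂ s) y₂ [z] := by rwa [nx_of_adj hJ h1.symm]
  have nt := nx_of_adj hJ hst
  have n3 := nx_of_adj hJ a3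
  have ny := nx_of_adj hJ h1
  obtain ⟨ℓ, t', hℓ, ht', ⟨b0, b1, b2⟩, ⟨r0, r1, r2⟩, -, hout⟩ := C.triple_plain_vec hℓ₀ hp hh true
    (v := s) (c₀ := true) (c₁ := false) (c₂ := true) hst.ne' hy₂ a3.ne'
    (by grind) (by grind) (by grind)
    (C.disj _ _ ht) (C.disj _ _ h2) (fun h5 => e3' (C.one false s ⟨a3, h5⟩ ⟨h1, h2⟩))
    (by simp) (by simp) (by simp) hr0 hr1 hR₃ hx' (List.mem_singleton.2 rfl) hax' haz
    (fun hxx => hx's hxx.1)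
  have p0 : pl J ℓ s (t' 0) = R₀ := by
    rw [C.pl_leaf hst ht b0, ← r0, nx_of_adj hJ hst.symm]
  have p1 : pl J ℓ s (t' 1) = [z] := by
    rw [C.pl_leaf h1 h2 b1, ← r1, nx_of_adj hJ h1.symm]
  rcases hout with ⟨j, k, l, hjk, hjl, hkl, -, hS, hB⟩ | ⟨j, k, l, hjk, hjl, hkl, hci, hE, hP, hl⟩
  · have hj : j = 0 := by grind
    subst hj
    refine ⟨s, t, hit0, _, _, ?_, ?_, hS⟩
    · rw [← nt]
      have hk := fin3_ne_zero hjk.symm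
      rcases hk with rfl | rfl
      · exact (by rw [nt]; exact hd : nx J s y₂ ≠ nx J s t)
      simp_all
    · rw [← nt]
      have hk := fin3_ne_zero hjl.symm
      rcases hk with rfl | rfl
      · exact (by rw [nt]; exact hd : nx J s y₂ ≠ nx J s t)
      simp_all
  · exfalso
    have h0l : l ≠ 0 := by grind
    have h1l : l ≠ 1 := by grind
    have h0j : j ≠ 1 := by rintro rfl; simp at hci
    obtain ⟨rfl, rfl⟩ := fin3_eq_of_ne hjk hjl hkl h0j h0l h1l
    have hlen : 2 ≤ R₀.length := by
      by_contra hlen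
      have := List.length_pos_of_ne_nil hR₀.ne
      obtain ⟨a, rfl⟩ := List.length_eq_one_iff.1 (show R₀.length = 1 by omega)
      rw [List.mem_singleton] at hx'
      exact hx's ((hR₀.fst x' (by simp [hx'])).2 (by simp [hx']))
    obtain ⟨u, a, b, w, q1, q2, q3, q4, q5⟩ := hP (by simpa [arm, p0] using hlen)
    have hb : b = h false := by
      have e : arm J ℓ h true s (t' 1) false = [z, h false] := by simp [arm, p1]
      change arm J ℓ h true s (t' 1) false = _ at q1
      rw [e] at q1
      rcases u with _ | ⟨q, u⟩
      · grind
      grind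
    grind

set_option maxHeartbeats 800000 in
-- Otherwise both members of each unrelated pair lie in leaf strips of `L false`. Let z be an
-- attachment in no such strip, related to both x and y. Then x, z share one node and y, z share an
-- adjacent one, so z is a one-vertex rung. Pyramids at these two nodes show that x and y lie in
-- their leaf nodes, and `h false`, x, z, y is a hole of length four.
theorem exists_nonrel_not_both (C : CrossSystem G J M h L) (hp : Tight G J M h L p)
    (hh : ∀ c, ¬ Att G p (h c)) : ∃ x y, x ∈ M.verts J ∧ y ∈ M.verts J ∧ Att G p x ∧ Att G p y ∧
      ¬ RelJ J M x y ∧ ¬ LeafStrip J M L false y := by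
  have hJ := C.sys.tree
  obtain ⟨x, y, hx, hy, hax, hay, hxy⟩ := hp.non
  have hx : x ∈ M.verts J := hx.resolve_right fun ⟨c, hc⟩ => hh c (hc ▸ hax)
  have hy : y ∈ M.verts J := hy.resolve_right fun ⟨c, hc⟩ => hh c (hc ▸ hay)
  rw [C.rel_iff hx hy] at hxy
  by_contra hcon
  push Not at hcon
  have hyL := hcon x y hx hy hax hay hxy
  have hxL := hcon y x hy hx hay hax fun hr => hxy hr.symm
  obtain ⟨z, hz, haz, hzn⟩ := C.exists_not_leafStrip hp (i := false) (hh _) hx hy hax hay hxy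
  have hrx : RelJ J M x z := by grind
  have hry : RelJ J M y z := by grind
  obtain ⟨s, w, hsw, hw, hxs⟩ := hxL
  obtain ⟨s', w', hsw', hw', hys⟩ := hyL
  have key : ∀ {s w : W} {x : V}, J.Adj s w → w ∈ L false → x ∈ M.edge s(s, w) → RelJ J M x z →
      x ∈ M.node s ∧ z ∈ M.node s := by
    intro s w x hsw hw hxs hr
    rcases hr with ⟨e, he, h1, h2⟩ | ⟨a, h1, h2⟩
    · exact absurd ⟨s, w, hsw, hw, C.mem_edge_unique hsw he hxs h1 ▸ h2⟩ hzn
    · rcases Sym2.mem_iff.1 (C.node_mem_edge hsw hxs h1) with rfl | rfl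
      · grind
      · obtain ⟨b, hb, hzb⟩ := C.exists_edge_of_node h2
        exact absurd ⟨b, a, hb.symm, hw, by grind⟩ hzn
  obtain ⟨hxs1, hzs⟩ := key hsw hw hxs hrx
  obtain ⟨hys1, hzs'⟩ := key hsw' hw' hys hry
  have hss : s ≠ s' := by
    rintro rfl
    exact hxy (Or.inr ⟨s, hxs1, hys1⟩)
  have hadj : J.Adj s s' := by
    obtain ⟨b, hb, hzb⟩ := C.exists_edge_of_node hzs
    rcases Sym2.mem_iff.1 (C.node_mem_edge hb hzb hzs') with h1 | h1
    · grind
    · rwa [h1]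
  have hze : z ∈ M.edge s(s, s') := by
    obtain ⟨b, hb, hzb⟩ := C.exists_edge_of_node hzs
    rcases Sym2.mem_iff.1 (C.node_mem_edge hb hzb hzs') with h1 | h1
    · grind
    · rwa [h1]
  have hzr : IsRung G M s s' [z] := ⟨by simp, IP.singleton z, by simpa using hze,
    by simpa using hzs, by simpa using hzs'⟩
  -- if one of the two rungs is long, then we find an unrelated pair
  have main : ∀ {s w s' w' : W} {x y : V}, J.Adj s w → w ∈ L false → x ∈ M.edge s(s, w) →
      x ∈ M.node s → J.Adj s' w' → w' ∈ L false → y ∈ M.edge s(s', w') → y ∈ M.node s' →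
      Att G p x → Att G p y → J.Adj s s' → IsRung G M s s' [z] → x ∈ M.node w := by
    intro s w s' w' x y hsw hw hxs hxs1 hsw' hw' hys hys1 hax hay hadj hzr
    have hss := hadj.ne
    by_contra hxw
    obtain ⟨R₁, hR₁, hx1⟩ := C.exists_rung hsw hxs
    obtain ⟨R₂, hR₂, hy2⟩ := C.exists_rung hsw' hys
    have hs'n := C.nbr_not_leaf hsw' hw'
    have hsn := C.nbr_not_leaf hsw hw
    have hws' : w ≠ s' := fun h1 => hs'n false (h1 ▸ hw)
    have hw's : w' ≠ s := fun h1 => hsn false (h1 ▸ hw')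
    obtain ⟨u₃, a3, e3, e3'⟩ := C.exists_third_nbr hsw hadj hws'
    obtain ⟨R₃, hR₃⟩ := C.exists_rung_dir a3
    obtain ⟨ℓ₁, hℓ₁⟩ := C.exists_selection
    obtain ⟨ℓ₀, hℓ₀, hz0, -⟩ := C.exists_selection_through hℓ₁ hadj hzr
    have nw := nx_of_adj hJ hsw
    have n3 := nx_of_adj hJ a3
    have nw' : nx J w' s = s' := by
      have h1 := nx_adj hJ hw's.symm
      exact C.leaf_unique hw' h1 hsw'.symm
    have nsw' : nx J s w' = s' := by
      have := nx_btw hJ (v := s) (x := s') (t := w') hss.symm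
        (by rw [nx_of_adj hJ hadj.symm, nx_of_adj hJ hsw']; exact hw's.symm)
      rw [this.1, nx_of_adj hJ hadj]
    -- Centre `s`, with the rung of `x` as one arm and `z` followed by the rung of `y` as another.
    -- The base outcome gives an attachment in the third direction, unrelated to `y` and in no leaf
    -- strip of `L false`. In the end outcome either `x` would be the leaf end, or `z` and `y` would
    -- be two attachments on an arm that has only one.
    obtain ⟨ℓ, t', hℓ, ht', ⟨b0, b1, b2⟩, ⟨r0, r1, r2⟩, hag, hout⟩ := C.triple_plain_vec hℓ₀ hp hh
      false (v := s) (y₀ := w) (y₁ := w') (y₂ := u₃) (c₀ := false) (c₁ := false)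
      (c₂ := label L false u₃) hsw.ne' hw's a3.ne'
      (by grind) (by grind)
      (by grind)
      (C.disj _ _ hw) (C.disj _ _ hw') (C.label_spec _ _)
      (by simp) (by simp) (by simp) (by rwa [nx_of_adj hJ hsw.symm]) (by rwa [nw']) hR₃ hx1 hy2
      hax hay (fun hxy => by
        have := C.node_mem_edge hsw' hys hxy.2
        grind)
    have p0 : pl J ℓ s (t' 0) = R₁ := by
      rw [C.pl_leaf hsw hw b0, ← r0, nx_of_adj hJ hsw.symm]
    have p1 : pl J ℓ s (t' 1) = z :: R₂ := by
      have hw1 : t' 1 = w' := by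
        rcases b1 with h1 | h1
        · exact h1
        · by_contra hne
          rw [nw'] at h1
          exact h1 (C.leaf_unique hw' hsw'.symm (nx_adj hJ hne))
      rw [hw1, pl_cons hJ ℓ hw's, nsw', pl_adj hJ ℓ hsw', hag, hz0]
      · rw [← r1, nw']; rfl
      · rw [nx_of_adj hJ hsw.symm]
        exact sym2_ne (Or.inr hws'.symm) (Or.inl hsw.ne)
      · rw [nw']
        exact sym2_ne (Or.inl hss) (Or.inl hw's.symm)
      · rw [nx_of_adj hJ a3.symm, ne_eq, Sym2.eq_iff]
        grind
    have hys' : y ∉ M.node s := fun hys2 => by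
      have := C.node_mem_edge hsw' hys hys2
      grind
    have mx : x ∈ pl J ℓ s (t' 0) := by rwa [p0]
    have my : y ∈ pl J ℓ s (t' 1) := by rw [p1]; exact List.mem_cons_of_mem _ hy2
    rcases hout with ⟨j, k, l, hjk, hjl, hkl, -, hS, hB⟩ |
      ⟨j, k, l, hjk, hjl, hkl, hci, hE, hP, hl⟩
    · have hj : j = 1 := by grind
      subst hj
      obtain ⟨b, hb1, hb2, hab⟩ : ∃ b ∈ M.node s, b ∈ M.edge s(s, u₃) ∧ Att G p b := by
        have hkl' := fin3_ne_one hjk.symm hjl.symm hkl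
        rcases hkl' with ⟨rfl, rfl⟩ | ⟨rfl, rfl⟩
        · simpa [n3] using hS.2.2.2.2
        · simpa [n3] using hS.2.2.2.1
      have hbn : ¬ LeafStrip J M L false b := by
        rintro ⟨a, t, hat, ht, hb3⟩
        have := C.mem_edge_unique a3 hat hb2 hb3
        rw [Sym2.eq_iff] at this
        rcases this with ⟨_, h1⟩ | ⟨h1, _⟩
        · exact e3 (C.one false s ⟨a3, h1 ▸ ht⟩ ⟨hsw, hw⟩)
        · exact hsn false (h1 ▸ ht)
      refine hbn (hcon y b (mem_verts_of_edge hsw' hys) (mem_verts_of_edge a3 hb2) hay hab ?_)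
      intro hr
      have := C.branch_relJ (v := s) (u := s') (u' := u₃) e3'.symm
        ⟨w', hw's, nsw', by rwa [nw']⟩ (C.mBranch_adj a3 hb2) hr
      exact hys' this.1
    · have h0l : l ≠ 0 := by rintro rfl; exact hl x mx hax
      have h1l : l ≠ 1 := by rintro rfl; exact hl y my hay
      obtain ⟨x₁, hx₁t, hx₁m, -, hx₁u⟩ := hE
      have hj := fin3_mem hjl h0l h1l
      rcases hj with rfl | rfl
      · have h1 := hx₁u x mx hax
        rw [C.beyond_leaf hsw hw b0, ← h1] at hx₁t
        exact hxw hx₁t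
      · have h1 := hx₁u y my hay
        have hip := (C.lineTree hℓ).pl_ip s (t' 1)
        rw [p1] at hip
        exact hip.1 (by grind)
  have hxw := main hsw hw hxs hxs1 hsw' hw' hys hys1 hax hay hadj hzr
  have hyw := main hsw' hw' hys hys1 hsw hw hxs hxs1 hay hax hadj.symm (by simpa using hzr.reverse)
  have hws' : w ≠ s' := fun h1 => C.nbr_not_leaf hsw' hw' false (h1 ▸ hw)
  have hw's : w' ≠ s := fun h1 => C.nbr_not_leaf hsw hw false (h1 ▸ hw')
  have hww : w ≠ w' := by
    rintro rfl
    exact hss (C.leaf_unique hw hsw.symm hsw'.symm)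
  have hxz : G.Adj x z := (C.sys.adj_iff s w s' hsw hadj hws' x hxs z hze).2 ⟨hxs1, hzs⟩
  have hyz : G.Adj y z := (C.sys.adj_iff s' w' s hsw' hadj.symm hw's y hys z
    (by rwa [Sym2.eq_swap])).2 ⟨hys1, hzs'⟩
  have hxy' : ¬ G.Adj x y := C.sys.anticomplete s w s' w' hsw hsw' hss hw's.symm hws' hww x hxs y hys
  have hbx : G.Adj (h false) x := (C.hub false x hx).2 ⟨w, hw, hxw⟩
  have hby : G.Adj (h false) y := (C.hub false y hy).2 ⟨w', hw', hyw⟩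
  have hbz : ¬ G.Adj (h false) z := by
    rw [C.hub false z hz]
    rintro ⟨t, ht, hzt⟩
    rcases Sym2.mem_iff.1 (C.node_mem_edge hadj hze hzt) with rfl | rfl
    · exact C.nbr_not_leaf hsw hw _ ht
    · exact C.nbr_not_leaf hsw' hw' _ ht
  have hip : IP G [x, z, y] := by
    refine ⟨?_, ?_, ?_, ?_, IP.singleton y⟩
    · simp only [List.mem_cons, List.not_mem_nil, or_false, not_or]
      exact ⟨hxz.ne, fun he => hxy (he ▸ Or.inl ⟨_, hsw, hxs, hxs⟩)⟩
    · simp only [List.mem_cons, List.not_mem_nil, or_false, List.head?_cons, Option.some.injEq]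
      rintro a (rfl | rfl)
      · simpa using hxz
      grind
    · simpa using hyz.ne'
    · simp [hyz.symm]
  -- The hole of length four.
  have := odd_cone C.ehf (x := h false) hip (by
    simp only [List.mem_cons, List.not_mem_nil, or_false, not_or]
    exact ⟨hbx.ne, (C.ne_hub hz _).symm, hby.ne⟩) (by simp) (by
    simp only [List.mem_cons, List.not_mem_nil, or_false]
    rintro a (rfl | rfl | rfl)
    · simp [hbx]
    · simp [hbz, hxz.ne, hyz.ne]
    · simp [hby])
  simp at this
  grind

/-- A tight path without edges to the hubs attaches as in `Hit`. -/
theorem exists_hit (C : CrossSystem G J M h L) (hp : Tight G J M h L p)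
    (hh : ∀ c, ¬ Att G p (h c)) (hnd : Nondeg J M L) : ∃ v u, Hit G J M p v u := by
  have hJ := C.sys.tree
  obtain ⟨x, y, hx, hy, hax, hay, hxy, hyL⟩ := C.exists_nonrel_not_both hp hh
  obtain ⟨z, hz, haz, hzL⟩ := C.exists_not_leafStrip hp (i := true) (hh _) hx hy hax hay hxy
  obtain ⟨ℓ₀, hℓ₀⟩ := C.exists_selection
  -- the common end of the argument
  have main : ∀ {v y₀ y₁ u₃ : W} {c₀ : Bool} {x y : V}, y₀ ≠ v → y₁ ≠ v → J.Adj v u₃ →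
      nx J v y₀ ≠ nx J v y₁ → u₃ ≠ nx J v y₀ → u₃ ≠ nx J v y₁ → y₀ ∉ L (!c₀) → y₁ ∉ L false →
      (c₀ = true ∨ u₃ ∉ L false) → x ∈ M.edge s(nx J y₀ v, y₀) →
      y ∈ M.edge s(nx J y₁ v, y₁) → Att G p x → Att G p y → ¬ (x ∈ M.node v ∧ y ∈ M.node v) →
      ∃ v u, Hit G J M p v u := by
    intro v y₀ y₁ u₃ c₀ x y hy₀ hy₁ a3 h01 e0 e1 hc₀ hc₁ hor hxe hye hax hay hxy
    obtain ⟨R₀, hR₀, hx0⟩ := C.exists_rung_far hy₀ hxe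
    obtain ⟨R₁, hR₁, hy1⟩ := C.exists_rung_far hy₁ hye
    obtain ⟨R₃, hR₃⟩ := C.exists_rung_dir a3
    have n3 := nx_of_adj hJ a3
    have hl3 : c₀ = true ∨ label L true u₃ = true := hor.imp_right fun h1 => label_eq h1
    obtain ⟨ℓ, t', hℓ, ht', ⟨b0, b1, b2⟩, ⟨r0, r1, r2⟩, hag, hout⟩ := C.triple_plain_vec hℓ₀ hp hh
      true (v := v) (c₀ := c₀) (c₁ := true) (c₂ := label L true u₃) hy₀ hy₁ a3.ne' h01
      (by grind) (by grind) hc₀ hc₁ (C.label_spec _ _)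
      (by simp) hl3 (by simp) hR₀ hR₁ hR₃ hx0 hy1 hax hay hxy
    rcases hout with ⟨j, k, l, hjk, hjl, hkl, hz, hS, hB⟩ |
      ⟨j, k, l, hjk, hjl, hkl, hci, ⟨x', hx't, hx'm, hax', hx'u⟩, hP, hl⟩
    · have hd := forall_ne_fin3 (P := fun j k => nx J v ((![y₀, y₁, u₃] : Fin 3 → W) j) ≠
        nx J v ((![y₀, y₁, u₃] : Fin 3 → W) k)) (fun i j hij => hij.symm) h01
        (by simpa [n3] using e0.symm) (by simpa [n3] using e1.symm)
      exact ⟨v, _, hz, _, _, hd k j hjk.symm, hd l j hjl.symm, hS⟩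
    · have htv : t' j ≠ v := by
        fin_cases j
        · exact b0.ne hy₀
        · exact b1.ne hy₁
        · exact b2.ne a3.ne'
      have htj := ht' j
      rw [hci] at htj
      have hst := (nx_adj hJ htv.symm).symm
      have hv := C.not_leaf_of_dirs hy₀ hy₁ h01
      have hsub : ∀ z ∈ ℓ (nx J (t' j) v) (t' j), z ∈ pl J ℓ v (t' j) := fun z hz =>
        C.mem_pl_of_mem htv (Or.inl rfl) hz
      have hr := hℓ.isRung hst
      have hx'R : x' ∈ ℓ (nx J (t' j) v) (t' j) := by
        have hh := (C.mBranch_of_pl hℓ hx'm).2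
        obtain ⟨b, hb, hxb⟩ := C.exists_edge_of_node hx't
        have := C.leaf_unique htj hb hst.symm
        subst this
        rw [pl_append hJ ℓ (x := nx J (t' j) v), pl_adj hJ ℓ hst] at hx'm
        · rcases List.mem_append.1 hx'm with h1 | h1
          · have := C.leaf_of_mem_pl hℓ hv h1 hst htj (by rwa [Sym2.eq_swap])
            exact absurd this hst.ne
          · exact h1
        · intro _ _
          rw [nx_of_adj hJ hst]
          exact nx_nx_ne hJ htv.symm
      exact C.exists_hit_of_unique hp hh hnd hz haz hzL hst htj hr hx'R hax'
        (fun z hz ha => hx'u z (hsub z hz) ha) hx't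
  -- If `x` lies in a leaf strip of `L false`, the centre is the inner end of that strip and this
  -- arm alone passes through `h false`. Otherwise the centre separates `x` from `y`, and both
  -- directions extend to leaves of `L true`.
  by_cases hxL : LeafStrip J M L false x
  · obtain ⟨s, w, hsw, hw, hxs⟩ := hxL
    obtain ⟨y₁, hy₁, hye⟩ := C.exists_branch s hy
    have hd : nx J s y₁ ≠ w := C.far_ne_leaf hsw hw hye fun hz => hyL ⟨s, w, hsw, hw, hz⟩
    have hyn := nx_adj hJ hy₁
    obtain ⟨u₃, a3, e3, e3'⟩ := C.exists_third_nbr hsw hyn hd.symm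
    have nw := nx_of_adj hJ hsw
    exact main (c₀ := false) hsw.ne' hy₁ a3 (by grind) (by rwa [nw]) e3'
      (C.disj _ _ hw) (C.not_leafStrip_far hy₁ hye hyL)
      (Or.inr fun h1 => e3 (C.one false s ⟨a3, h1⟩ ⟨hsw, hw⟩))
      (by rwa [nx_of_adj hJ hsw.symm]) hye hax hay fun h1 => hxy (Or.inr ⟨s, h1⟩)
  · obtain ⟨v, u, w, hvu, hwv, hne, hxe, hye⟩ := C.exists_split hx hy fun h1 => hxy (Or.inl h1)
    obtain ⟨u₃, a3, e3, e3'⟩ := C.exists_third_nbr hvu (nx_adj hJ hwv) hne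
    have nu := nx_of_adj hJ hvu
    exact main (c₀ := true) hvu.ne' hwv a3 (by rwa [nu]) (by rwa [nu]) e3'
      (fun h1 => hxL ⟨v, u, hvu, h1, hxe⟩) (C.not_leafStrip_far hwv hye hyL) (Or.inl rfl)
      (by rwa [nx_of_adj hJ hvu.symm]) hye hax hay fun h1 => hxy (Or.inr ⟨v, h1⟩)

end CrossSystem

theorem not_att_tail_iff {p : List V} {z : V} (hp : IP G p) (ha : Att G p z)
    (ht : ¬ Att G p.tail z) {f : V} (hf : f ∈ p) : G.Adj f z ↔ p.head? = some f := by
  obtain ⟨g, hg, hgz⟩ := ha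
  rcases p with _ | ⟨a, p⟩
  · simp at hf
  have key : ∀ f ∈ a :: p, G.Adj f z → f = a := fun f hf hfz => by
    rcases List.mem_cons.1 hf with h1 | h1
    · exact h1
    · exact absurd ⟨f, h1, hfz⟩ ht
  grind

theorem not_att_dropLast_iff {p : List V} {z : V} (hp : IP G p) (ha : Att G p z)
    (ht : ¬ Att G p.dropLast z) {f : V} (hf : f ∈ p) : G.Adj f z ↔ p.getLast? = some f := by
  rw [not_att_tail_iff hp.reverse (Att.reverse_iff.2 ha) (by
    rwa [List.tail_reverse, Att.reverse_iff]) (List.mem_reverse.2 hf), List.head?_reverse]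

/-- The path ends at the last vertex of the rung that it sees, so the remainder of the rung can
follow without chords. -/
theorem ip_splice {p B : List V} {x : V} (hp : IP G p) (hB : IP G (x :: B))
    (hd : ∀ f ∈ p, f ∉ x :: B) (hx : Att G p x) (hx' : ¬ Att G p.tail x)
    (hB' : ∀ z ∈ B, ¬ Att G p z) : IP G (p.reverse ++ x :: B) := by
  refine IP.append_iff.2 ⟨hp.reverse, hB, fun a ha b hb => ?_⟩
  rw [List.mem_reverse] at ha
  refine ⟨fun hab => hd a ha (hab ▸ hb), ?_⟩
  rw [List.getLast?_reverse, List.head?_cons, Option.some.injEq]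
  rcases List.mem_cons.1 hb with rfl | h1
  · simpa using not_att_tail_iff hp hx hx' ha
  · refine ⟨fun hab => absurd ⟨a, ha, hab⟩ (hB' b h1), fun h2 => ?_⟩
    grind

/-- Members of an unrelated pair see opposite ends of a tight path. Since every pair from the two
sets is unrelated, the orientation determined by one pair is right for all. -/
theorem Tight.orient {p : List V} (hp : Tight G J M h L p) {P Q : Set V}
    (hP : ∀ x ∈ P, Core J M h x ∧ Att G p x) (hQ : ∀ x ∈ Q, Core J M h x ∧ Att G p x)
    (hPQ : ∀ x ∈ P, ∀ y ∈ Q, ¬ Rel J M h L x y) (hP0 : P.Nonempty) (hQ0 : Q.Nonempty) :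
    ∃ q, Tight G J M h L q ∧ (∀ f, f ∈ q ↔ f ∈ p) ∧ (∀ x ∈ P, ¬ Att G q.tail x) ∧
      ∀ y ∈ Q, ¬ Att G q.dropLast y := by
  by_cases h2 : 2 ≤ p.length
  swap
  · have h0 : p.tail = [] := List.eq_nil_of_length_eq_zero (by simp; omega)
    have h1 : p.dropLast = [] := List.eq_nil_of_length_eq_zero (by simp; omega)
    exact ⟨p, hp, fun _ => Iff.rfl, by simp [h0, Att], by simp [h1, Att]⟩
  obtain ⟨x₀, hx₀⟩ := hP0
  obtain ⟨y₀, hy₀⟩ := hQ0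
  have key : ∀ q, Tight G J M h L q → (∀ f, f ∈ q ↔ f ∈ p) → q.length = p.length →
      ¬ Att G q.tail x₀ → ¬ Att G q.dropLast y₀ →
      (∀ x ∈ P, ¬ Att G q.tail x) ∧ ∀ y ∈ Q, ¬ Att G q.dropLast y := by
    intro q hq hmem hlen hx hy
    have hatt : ∀ {z}, Att G p z → Att G q z := fun hz => hz.mono fun f hf => (hmem f).2 hf
    have h2 : 2 ≤ q.length := by omega
    refine ⟨fun x hxP => ?_, fun y hyQ => ?_⟩
    · rcases hq.ends (hP x hxP).1 (hQ y₀ hy₀).1 (hatt (hP x hxP).2) (hatt (hQ y₀ hy₀).2)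
        (hPQ x hxP y₀ hy₀) with h1 | h1
      · exact h1.1
      · exact ((att_tail_or_dropLast h2 (hatt (hQ y₀ hy₀).2)).elim h1.2 hy).elim
    · rcases hq.ends (hP x₀ hx₀).1 (hQ y hyQ).1 (hatt (hP x₀ hx₀).2) (hatt (hQ y hyQ).2)
        (hPQ x₀ hx₀ y hyQ) with h1 | h1
      · exact h1.2
      · exact ((att_tail_or_dropLast h2 (hatt (hP x₀ hx₀).2)).elim hx h1.1).elim
  rcases hp.ends (hP x₀ hx₀).1 (hQ y₀ hy₀).1 (hP x₀ hx₀).2 (hQ y₀ hy₀).2 (hPQ x₀ hx₀ y₀ hy₀)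
    with h1 | h1
  · grind
  · refine ⟨p.reverse, hp.reverse, fun _ => List.mem_reverse, key _ hp.reverse
      (fun _ => List.mem_reverse) (by simp) ?_ ?_⟩
    · rw [List.tail_reverse, Att.reverse_iff]
      exact h1.1
    · rw [List.dropLast_reverse, Att.reverse_iff]
      exact h1.2

theorem isStrip_of_rungs {u v : W} (hne : (M.edge s(u, v)).Nonempty)
    (hr : ∀ z ∈ M.edge s(u, v), ∃ l, IsRung G M u v l ∧ z ∈ l) :
    IsStrip G (M.edge s(u, v) ∩ M.node u) (M.edge s(u, v) ∩ M.node v)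
      (M.edge s(u, v) \ (M.node u ∪ M.node v)) := by
  obtain ⟨z, hz⟩ := hne
  obtain ⟨l, hl, -⟩ := hr z hz
  refine ⟨?_, ?_, ?_, ?_, fun z hz => ?_⟩
  · have h1 := List.head?_eq_some_head hl.ne
    exact ⟨_, hl.sub _ (List.head_mem _), (hl.fst _ (List.head_mem _)).2 h1⟩
  · have h1 := List.getLast?_eq_some_getLast hl.ne
    exact ⟨_, hl.sub _ (List.getLast_mem _), (hl.snd _ (List.getLast_mem _)).2 h1⟩
  · grind
  · grind
  · have hz : z ∈ M.edge s(u, v) := by grind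
    obtain ⟨l, hl, hzl⟩ := hr z hz
    exact CrossSystem.IsRung.inRung hl hzl

/-- The strip of the edge `vw` is enlarged by `F`, of which `FV` and `FW` are added to the ends. -/
def StripFamily.enlarge (M : StripFamily V W) (v w : W) (F FV FW : Set V) : StripFamily V W where
  edge e := M.edge e ∪ {f | e = s(v, w) ∧ f ∈ F}
  node x := M.node x ∪ {f | (x = v ∧ f ∈ FV) ∨ (x = w ∧ f ∈ FW)}

namespace CrossSystem

/-- A strip of a system that is maximal cannot be enlarged. -/
theorem enlarge_false (C : CrossSystem G J M h L) (hmax : MaxVerts G J M h L) {v w : W}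
    (hvw : J.Adj v w) {F FV FW : Set V} (hF : F.Nonempty) (hFV : FV ⊆ F) (hFW : FW ⊆ F)
    (hout : ∀ f ∈ F, ¬ Core J M h f)
    (hadj : ∀ x ∈ M.verts J, x ∉ M.edge s(v, w) → ∀ f ∈ F,
      (G.Adj f x ↔ (f ∈ FV ∧ x ∈ M.node v) ∨ (f ∈ FW ∧ x ∈ M.node w)))
    (hrung : ∀ f ∈ F, ∃ l : List V, f ∈ l ∧ l ≠ [] ∧ IP G l ∧
      (∀ z ∈ l, z ∈ F ∨ z ∈ M.edge s(v, w)) ∧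
      (∀ z ∈ l, (z ∈ M.node v ∨ z ∈ FV) ↔ l.head? = some z) ∧
      ∀ z ∈ l, (z ∈ M.node w ∨ z ∈ FW) ↔ l.getLast? = some z)
    (hhub : ∀ c, ∀ f ∈ F, (G.Adj (h c) f ↔ (v ∈ L c ∧ f ∈ FV) ∨ (w ∈ L c ∧ f ∈ FW))) :
    False := by
  have hvw' := hvw.ne
  set M' := M.enlarge v w F FV FW with hM'
  have hFM : ∀ f ∈ F, f ∉ M.verts J := fun f hf hfM => hout f hf (Or.inl hfM)
  have nodeOld : ∀ {x z}, z ∈ M.verts J → (z ∈ M'.node x ↔ z ∈ M.node x) := by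
    intro x z hz
    refine ⟨?_, Or.inl⟩
    rintro (h1 | ⟨-, h1⟩ | ⟨-, h1⟩)
    · exact h1
    · grind
    grind
  have nodeV : ∀ {f}, f ∈ F → (f ∈ M'.node v ↔ f ∈ FV) := by
    intro f hf
    refine ⟨?_, fun h1 => Or.inr (Or.inl ⟨rfl, h1⟩)⟩
    rintro (h1 | ⟨-, h1⟩ | ⟨h1, -⟩)
    · exact absurd (C.node_mem_verts h1) (hFM f hf)
    · exact h1
    grind
  have nodeW : ∀ {f}, f ∈ F → (f ∈ M'.node w ↔ f ∈ FW) := by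
    intro f hf
    refine ⟨?_, fun h1 => Or.inr (Or.inr ⟨rfl, h1⟩)⟩
    rintro (h1 | ⟨h1, -⟩ | ⟨-, h1⟩)
    · exact absurd (C.node_mem_verts h1) (hFM f hf)
    · grind
    · exact h1
  have nodeF : ∀ {x f}, f ∈ F → f ∈ M'.node x → (x = v ∧ f ∈ FV) ∨ (x = w ∧ f ∈ FW) := by
    rintro x f hf (h1 | h1)
    · exact absurd (C.node_mem_verts h1) (hFM f hf)
    · exact h1
  have verts' : ∀ {z}, z ∈ M'.verts J ↔ z ∈ M.verts J ∨ z ∈ F := by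
    intro z
    simp only [StripFamily.verts, Set.mem_iUnion]
    constructor
    · rintro ⟨e, he, h1 | h1⟩
      · grind
      grind
    · rintro (⟨e, he, h1⟩ | h1)
      · tauto
      · exact ⟨s(v, w), hvw, Or.inr ⟨rfl, h1⟩⟩
  have rungOld : ∀ {a b l}, J.Adj a b → IsRung G M a b l → IsRung G M' a b l := by
    intro a b l hab hl
    have hv : ∀ z ∈ l, z ∈ M.verts J := fun z hz => mem_verts_of_edge hab (hl.sub z hz)
    exact ⟨hl.ne, hl.ip, fun z hz => Or.inl (hl.sub z hz),
      fun z hz => (nodeOld (hv z hz)).trans (hl.fst z hz),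
      fun z hz => (nodeOld (hv z hz)).trans (hl.snd z hz)⟩
  have rungNew : ∀ f ∈ F, ∃ l, IsRung G M' v w l ∧ f ∈ l := by
    intro f hf
    obtain ⟨l, hfl, h1, h2, h3, h4, h5⟩ := hrung f hf
    have aux : ∀ z ∈ l, (z ∈ M'.node v ↔ z ∈ M.node v ∨ z ∈ FV) ∧
        (z ∈ M'.node w ↔ z ∈ M.node w ∨ z ∈ FW) := by
      intro z hz
      rcases h3 z hz with h6 | h6
      · have : ∀ {x}, z ∉ M.node x := fun h7 => hFM z h6 (C.node_mem_verts h7)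
        grind
      · have h7 := mem_verts_of_edge hvw h6
        grind
    exact ⟨l, ⟨h1, h2, fun z hz => (h3 z hz).symm.imp_right fun h6 => ⟨rfl, h6⟩,
      fun z hz => (aux z hz).1.trans (h4 z hz), fun z hz => (aux z hz).2.trans (h5 z hz)⟩, hfl⟩
  have anti : ∀ {c d f y}, J.Adj c d → f ∈ F → v ≠ c → v ≠ d → w ≠ c → w ≠ d →
      y ∈ M.edge s(c, d) → ¬ G.Adj f y := by
    intro c d f y hcd hf h1 h2 h3 h4 hy
    rw [hadj y (mem_verts_of_edge hcd hy) (fun h5 => by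
      have := C.mem_edge_unique hcd hvw hy h5
      grind) f hf]
    have key : ∀ {x}, y ∈ M.node x → x = c ∨ x = d := fun h6 => by
      simpa using C.node_mem_edge hcd hy h6
    grind
  have adjN : ∀ {a b c f y}, s(a, b) = s(v, w) → J.Adj a b → J.Adj a c → b ≠ c → f ∈ F →
      y ∈ M.edge s(a, c) → (G.Adj f y ↔ f ∈ M'.node a ∧ y ∈ M'.node a) := by
    intro a b c f y he hab hac hbc hf hy
    have hyv := mem_verts_of_edge hac hy
    have hb : y ∉ M.node b := fun h6 => by
      have := C.node_mem_edge hac hy h6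
      rw [Sym2.mem_iff] at this
      exact this.elim hab.ne' hbc
    rw [hadj y hyv (fun h5 => by
      have := C.mem_edge_unique hac hab hy (he ▸ h5)
      rw [Sym2.eq_iff] at this
      grind) f hf, nodeOld hyv]
    rw [Sym2.eq_iff] at he
    grind
  have hsys : IsStripSystem G J M' := by
    refine ⟨C.sys.tree, C.sys.three_le, ?_, ?_, ?_, ?_, ?_⟩
    · intro e he e' he' hne
      rw [Function.onFun, Set.disjoint_left]
      rintro z (h1 | h1) (h2 | h2)
      · exact hne (C.mem_edge_unique he he' h1 h2)
      · exact hFM z h2.2 (mem_verts_of_edge he h1)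
      · exact hFM z h1.2 (mem_verts_of_edge he' h2)
      grind
    · rintro u z (h1 | ⟨rfl, h1⟩ | ⟨rfl, h1⟩)
      · obtain ⟨x, hx, hz⟩ := C.exists_edge_of_node h1
        exact Set.mem_biUnion hx (Or.inl hz)
      · exact Set.mem_biUnion hvw (Or.inr ⟨rfl, hFV h1⟩)
      · exact Set.mem_biUnion hvw.symm (Or.inr ⟨Sym2.eq_swap, hFW h1⟩)
    · intro a b hab
      obtain ⟨z, hz, -⟩ := C.exists_node_mem hab
      refine isStrip_of_rungs ⟨z, Or.inl hz⟩ ?_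
      rintro z (h1 | ⟨h1, h2⟩)
      · obtain ⟨l, hl, hzl⟩ := C.exists_rung hab h1
        grind
      · obtain ⟨l, hl, hzl⟩ := rungNew z h2
        rw [Sym2.eq_iff] at h1
        rcases h1 with ⟨rfl, rfl⟩ | ⟨rfl, rfl⟩
        · grind
        · exact ⟨_, hl.reverse, List.mem_reverse.2 hzl⟩
    · rintro a b c d hab hcd h1 h2 h3 h4 x (hx | ⟨hx, hxF⟩) y (hy | ⟨hy, hyF⟩)
      · exact C.sys.anticomplete a b c d hab hcd h1 h2 h3 h4 x hx y hy
      · rw [Sym2.eq_iff] at hy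
        intro h5
        rcases hy with ⟨rfl, rfl⟩ | ⟨rfl, rfl⟩
        · exact anti hab hyF h1.symm h3.symm h2.symm h4.symm hx h5.symm
        · exact anti hab hyF h2.symm h4.symm h1.symm h3.symm hx h5.symm
      · grind
      · have := hx.trans hy.symm
        rw [Sym2.eq_iff] at this
        grind
    · rintro a b c hab hac hbc x (hx | ⟨hx, hxF⟩) y (hy | ⟨hy, hyF⟩)
      · rw [nodeOld (mem_verts_of_edge hab hx), nodeOld (mem_verts_of_edge hac hy)]
        exact C.sys.adj_iff a b c hab hac hbc x hx y hy
      · rw [G.adj_comm, adjN hy hac hab hbc.symm hyF hx, and_comm]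
      · exact adjN hx hab hac hbc hxF hy
      · have := hx.trans hy.symm
        rw [Sym2.eq_iff] at this
        grind
  refine hmax M' ⟨C.ehf, C.finite, hsys, C.hubs, C.isLeaf, C.leaf_mem, C.disj, C.deg, C.one,
    fun c hc => ?_, fun c x hx => ?_⟩ ?_
  · rcases verts'.1 hc with h1 | h1
    · exact C.hub_notMem c h1
    · exact hout _ h1 (Or.inr ⟨c, rfl⟩)
  · rcases verts'.1 hx with h1 | h1
    · simp only [nodeOld h1]
      exact C.hub c x h1
    grind
  · refine Set.ssubset_iff_subset_ne.2 ⟨fun z hz => verts'.2 (Or.inl hz), fun heq => ?_⟩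
    obtain ⟨f, hf⟩ := hF
    grind

end CrossSystem

theorem Hit.other {p : List V} {v u₀ : W} (hH : Hit G J M p v u₀) (u : W) :
    ∃ u', u' ≠ u ∧ u' ≠ u₀ ∧ J.Adj v u' ∧ ∃ b ∈ M.node v, b ∈ M.edge s(v, u') ∧ Att G p b := by
  obtain ⟨-, u₁, u₂, h1, h2, h3, h4, h5, h6, h7⟩ := hH
  grind

/-! ### A `Hit` would enlarge a strip -/

namespace CrossSystem

theorem Hit.other_not_mem (C : CrossSystem G J M h L) {v u₀ : W} (hH : Hit G J M p v u₀)
    (c : Bool) :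
    ∃ u', u' ∉ L c ∧ u' ≠ u₀ ∧ J.Adj v u' ∧ ∃ b ∈ M.node v, b ∈ M.edge s(v, u') ∧ Att G p b := by
  obtain ⟨u₁, h1, h2, h3, h4⟩ := hH.other u₀
  obtain ⟨u₂, h5, h6, h7, h8⟩ := hH.other u₁
  by_cases hc : u₁ ∈ L c
  · exact ⟨u₂, fun hc' => h5 (C.one c v ⟨h7, hc'⟩ ⟨h3, hc⟩), h6, h7, h8⟩
  grind

/-- Among three directions at `v`, the apex can be chosen so that at most one is misdirected. -/
theorem exists_apex (C : CrossSystem G J M h L) (y : Fin 3 → W) :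
    ∃ i, ∀ j k, j ≠ k → label L i (y j) = i ∨ label L i (y k) = i := by
  by_contra hcon
  push Not at hcon
  obtain ⟨j, k, hjk, h1, h2⟩ := hcon true
  obtain ⟨j', k', hjk', h1', h2'⟩ := hcon false
  have key : ∀ {i m}, label L i (y m) ≠ i → y m ∈ L (!i) := by
    intro i m hm
    by_contra hy
    exact hm (label_eq hy)
  have d : ∀ {m m'}, label L true (y m) ≠ true → label L false (y m') ≠ false → m ≠ m' := by
    rintro m m' h3 h4 rfl
    have := C.disj' (key h3) (key h4)
    simp at this
  grind

/-- Both outcomes for the pyramid through the three vertices fail: in the first, two arms are met in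
M_v only; in the second, one arm is not met at all. -/
theorem no_three (C : CrossSystem G J M h L) (hp : Tight G J M h L p)
    (hh : ∀ c, ¬ Att G p (h c)) {v u₀ u₁ u₂ : W} {x₀ x₁ x₂ : V} (h01 : u₀ ≠ u₁) (h02 : u₀ ≠ u₂)
    (h12 : u₁ ≠ u₂) (hx₀ : MBranch J M v u₀ x₀) (hx₁ : MBranch J M v u₁ x₁)
    (hx₂ : MBranch J M v u₂ x₂) (a₀ : Att G p x₀) (a₁ : Att G p x₁) (a₂ : Att G p x₂)
    (n₀ : x₀ ∉ M.node v) (n₁ : x₁ ∉ M.node v) : False := by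
  obtain ⟨y₀, hy₀, rfl, hx₀⟩ := hx₀
  obtain ⟨y₁, hy₁, rfl, hx₁⟩ := hx₁
  obtain ⟨y₂, hy₂, rfl, hx₂⟩ := hx₂
  obtain ⟨R₀, hR₀, hx0⟩ := C.exists_rung_far hy₀ hx₀
  obtain ⟨R₁, hR₁, hx1⟩ := C.exists_rung_far hy₁ hx₁
  obtain ⟨R₂, hR₂, hx2⟩ := C.exists_rung_far hy₂ hx₂
  obtain ⟨i, hi⟩ := C.exists_apex ![y₀, y₁, y₂]
  obtain ⟨ℓ₀, hℓ₀⟩ := C.exists_selection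
  obtain ⟨ℓ, t, hℓ, -, ⟨b0, b1, b2⟩, ⟨r0, r1, r2⟩, -, hout⟩ := C.triple_plain_vec hℓ₀ hp hh i
    hy₀ hy₁ hy₂ h01 h02 h12 (C.label_spec i y₀) (C.label_spec i y₁) (C.label_spec i y₂)
    (hi 0 1 (by decide)) (hi 0 2 (by decide)) (hi 1 2 (by decide)) hR₀ hR₁ hR₂ hx0 hx1 a₀ a₁
    (fun hn => n₀ hn.1)
  have m0 : x₀ ∈ pl J ℓ v (t 0) := C.mem_pl_of_mem hy₀ b0 (by rwa [r0])
  have m1 : x₁ ∈ pl J ℓ v (t 1) := C.mem_pl_of_mem hy₁ b1 (by rwa [r1])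
  have m2 : x₂ ∈ pl J ℓ v (t 2) := C.mem_pl_of_mem hy₂ b2 (by rwa [r2])
  grind

/-- Were it outside M_v, then together with the far vertex of the hit and an attachment in a third
direction it would contradict `no_three`. -/
theorem Hit.node (C : CrossSystem G J M h L) (hp : Tight G J M h L p)
    (hh : ∀ c, ¬ Att G p (h c)) {v u₀ u : W} (hH : Hit G J M p v u₀) {y : V}
    (hy : MBranch J M v u y) (hu : u ≠ u₀) (ha : Att G p y) : y ∈ M.node v := by
  by_contra hyv
  obtain ⟨z₀, hz₀, haz, hzn⟩ := hH.1
  obtain ⟨u', h1, h2, h3, b, -, hbe, hab⟩ := hH.other u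
  exact C.no_three hp hh hu.symm h2.symm h1.symm hz₀ hy (C.mBranch_adj h3 hbe) haz ha hab hzn hyv

/-- Attachments in a leaf strip of `L false` lead to further attachments at the end of the strip. -/
theorem exists_att_node (C : CrossSystem G J M h L) (hp : Tight G J M h L p)
    (hh : ∀ c, ¬ Att G p (h c)) (hnd : Nondeg J M L) {s w v u : W} (hsw : J.Adj s w)
    (hw : w ∈ L false) {z : V} (hz : z ∈ M.edge s(s, w)) (haz : Att G p z) (hsv : s ≠ v)
    (hvu : J.Adj v u) (huv : u ≠ nx J v s) (huL : u ∉ L false) {b : V} (hbv : b ∈ M.node v)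
    (hb : b ∈ M.edge s(v, u)) (hab : Att G p b) :
    ∃ x, J.Adj s x ∧ x ≠ nx J s v ∧ x ∉ L false ∧
      ∃ b ∈ M.node s, b ∈ M.edge s(s, x) ∧ Att G p b := by
  have hJ := C.sys.tree
  have hus : u ≠ s := by
    rintro rfl
    exact huv (nx_of_adj hJ hvu).symm
  have hbey : Beyond J s v u := Or.inr (by rw [nx_of_adj hJ hvu]; exact huv.symm)
  have nus : nx J s u = nx J s v := hbey.nx_eq hJ hsv.symm
  have nu : nx J u s = v := nx_back hJ hvu huv
  have hbs : b ∉ M.node s := fun h1 => by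
    have := C.node_mem_edge hvu hb h1
    grind
  have hbe : b ∈ M.edge s(nx J u s, u) := by rwa [nu]
  have hd : nx J s u ≠ w := C.far_ne_leaf hsw hw hbe fun h1 => by
    have := C.mem_edge_unique hvu hsw hb h1
    grind
  obtain ⟨x, a3, e3, e3'⟩ := C.exists_third_nbr hsw (nx_adj hJ hus) hd.symm
  have hxL : x ∉ L false := fun h1 => e3 (C.one false s ⟨a3, h1⟩ ⟨hsw, hw⟩)
  obtain ⟨R₀, hR₀, hz0⟩ := C.exists_rung hsw hz
  obtain ⟨R₁, hR₁, hb1⟩ := C.exists_rung_far hus hbe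
  obtain ⟨R₂, hR₂⟩ := C.exists_rung_dir a3
  obtain ⟨ℓ₀, hℓ₀⟩ := C.exists_selection
  have nw := nx_of_adj hJ hsw
  have n3 := nx_of_adj hJ a3
  obtain ⟨ℓ, t, hℓ, ht, ⟨b0, b1, b2⟩, ⟨r0, r1, r2⟩, -, hout⟩ := C.triple_plain_vec hℓ₀ hp hh true
    (v := s) (c₀ := false) (c₁ := true) (c₂ := true) hsw.ne' hus a3.ne' (by grind)
    (by grind) (by grind) (C.disj _ _ hw) huL hxL
    (by simp) (by simp) (by simp) (by rwa [nx_of_adj hJ hsw.symm]) hR₁ hR₂ hz0 hb1 haz hab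
    (fun hn => hbs hn.2)
  have mz : z ∈ pl J ℓ s (t 0) := C.mem_pl_of_mem hsw.ne' b0 (by rwa [r0])
  have mb : b ∈ pl J ℓ s (t 1) := C.mem_pl_of_mem hus b1 (by rwa [r1])
  rcases hout with ⟨j, k, l, hjk, hjl, hkl, -, hS, hB⟩ |
    ⟨j, k, l, hjk, hjl, hkl, hci, ⟨x', hx't, -, -, hx'u⟩, -, hl⟩
  · have hj : j = 1 := by grind
    subst hj
    refine ⟨x, a3, nus ▸ e3', hxL, ?_⟩
    rcases fin3_ne_one hjk.symm hjl.symm hkl with ⟨rfl, rfl⟩ | ⟨rfl, rfl⟩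
    · simpa [n3] using hS.2.2.2.2
    · simpa [n3] using hS.2.2.2.1
  · exfalso
    have h0l : l ≠ 0 := by grind
    have h1l : l ≠ 1 := by grind
    have hj : j = 1 := (fin3_mem hjl h0l h1l).resolve_left (by rintro rfl; simp at hci)
    subst hj
    -- The end of this arm is the only vertex met on it, so it is `b`. Then `b` lies in M_v and in
    -- the node of a leaf of `L true`, which `Nondeg` excludes.
    have hbt : b ∈ M.node (t 1) := by grind
    have := C.node_mem_edge hvu hb hbt
    rw [Sym2.mem_iff] at this
    have ht1 := ht 1
    rcases this with h1 | h1
    · rw [h1] at ht1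
      exact C.not_leaf_of_two hvu (nx_adj hJ hsv) huv _ ht1
    · rw [h1] at ht1 hbt
      exact hnd v u hvu ht1 b hbv hbt

/-- The attachment on the far side of a `Hit` can be chosen away from the leaves in `L false`. -/
theorem Hit.exists_far (C : CrossSystem G J M h L) (hp : Tight G J M h L p)
    (hh : ∀ c, ¬ Att G p (h c)) (hnd : Nondeg J M L) {v u₀ : W} (hH : Hit G J M p v u₀) {y : W}
    (hy : y ≠ v) (hyu : nx J v y = u₀) {z : V} (hz : z ∈ M.edge s(nx J y v, y)) (haz : Att G p z)
    (hs : y ∈ L false → nx J y v ≠ v) :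
    ∃ y' z', y' ≠ v ∧ nx J v y' = u₀ ∧ z' ∈ M.edge s(nx J y' v, y') ∧ Att G p z' ∧ y' ∉ L false ∧
      (y' = y ∧ z' = z ∨ y' ≠ u₀) := by
  by_cases hyL : y ∈ L false
  swap
  · grind
  have hJ := C.sys.tree
  obtain ⟨u, h1, h2, h3, b, h4, h5, h6⟩ := Hit.other_not_mem C hH false
  have hsv := hs hyL
  have hsy := nx_adj hJ hy.symm
  have hyb : Beyond J v (nx J y v) y := Or.inr fun h7 => by
    have h9 := nx_nx_ne hJ hy.symm
    rw [h7, nx_of_adj hJ hsy.symm] at h9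
    exact h9 rfl
  have hns : nx J v (nx J y v) = u₀ := by rw [← hyu, hyb.nx_eq hJ hsv]
  obtain ⟨x, h7, h8, h9, b', -, hb', hab'⟩ := C.exists_att_node hp hh hnd hsy.symm hyL hz haz hsv h3
    (by grind) h1 h4 h5 h6
  have hxv : x ≠ v := by
    rintro rfl
    exact h8 (nx_of_adj hJ h7).symm
  have hbx : Beyond J v (nx J y v) x := Or.inr (by rw [nx_of_adj hJ h7]; exact h8.symm)
  refine ⟨x, b', hxv, by rw [hbx.nx_eq hJ hsv, hns], ?_, hab', h9, Or.inr ?_⟩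
  · rwa [nx_back hJ h7 h8]
  · intro hx
    have h10 := hbx.dist_eq hJ hsv
    have h11 := hJ.connected.pos_dist_of_ne hsv.symm
    have h12 := hJ.connected.pos_dist_of_ne h7.ne
    have h13 : J.Adj v u₀ := hyu ▸ nx_adj hJ hy
    rw [hx, SimpleGraph.dist_eq_one_iff_adj.2 h13] at h10
    grind

/-- Use the pyramid at `v` with arms through the far vertex `z`, through `y` and through the
attachment `b`. In the first outcome the arm of `y` is met in its base vertex, which is `y`. In the
second, the arm of `y` is the unmet one; the arm of `b` cannot carry two attachments, because all of
them lie in M_v, and it cannot be met in its end, by `Nondeg` if the apex is `h true` and by `hi`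
otherwise. -/
theorem Hit.complete_aux (C : CrossSystem G J M h L) (hp : Tight G J M h L p)
    (hh : ∀ c, ¬ Att G p (h c)) (hnd : Nondeg J M L) {v u₀ u u' y₀ : W} (hH : Hit G J M p v u₀)
    (hu : u ≠ u₀) (hvu : J.Adj v u) {y : V} (hyv : y ∈ M.node v) (hy : y ∈ M.edge s(v, u))
    (hu' : u' ≠ u₀) (huu' : u' ≠ u) (hvu' : J.Adj v u') {b : V} (hbv : b ∈ M.node v)
    (hb : b ∈ M.edge s(v, u')) (hab : Att G p b) (hy₀ : y₀ ≠ v) (hyu : nx J v y₀ = u₀) {z : V}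
    (hz : z ∈ M.edge s(nx J y₀ v, y₀)) (haz : Att G p z) (hzv : z ∉ M.node v) (i : Bool)
    (k01 : y₀ ∉ L (!i) ∨ u ∉ L (!i)) (k02 : y₀ ∉ L (!i) ∨ u' ∉ L (!i))
    (k12 : u ∉ L (!i) ∨ u' ∉ L (!i)) (hi : i = true ∨ u' ∉ L false) : Att G p y := by
  have hJ := C.sys.tree
  by_contra hya
  obtain ⟨R₀, hR₀, hz0⟩ := C.exists_rung_far hy₀ hz
  obtain ⟨R₁, hR₁, hy1⟩ := C.exists_rung hvu hy
  obtain ⟨R₂, hR₂, hb2⟩ := C.exists_rung hvu' hb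
  obtain ⟨ℓ₀, hℓ₀⟩ := C.exists_selection
  have nu := nx_of_adj hJ hvu
  have nu' := nx_of_adj hJ hvu'
  have hd := forall_ne_fin3 (P := fun j k => nx J v ((![y₀, u, u'] : Fin 3 → W) j) ≠
    nx J v ((![y₀, u, u'] : Fin 3 → W) k)) (fun i j hij => hij.symm)
    (by simpa [hyu, nu] using hu.symm) (by simpa [hyu, nu'] using hu'.symm)
    (by simpa [nu, nu'] using huu'.symm)
  have lab : ∀ {a b}, (a ∉ L (!i) ∨ b ∉ L (!i)) → label L i a = i ∨ label L i b = i :=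
    fun h1 => h1.imp label_eq label_eq
  have hne : ∀ j, (![y₀, u, u'] : Fin 3 → W) j ≠ v := by
    intro j; fin_cases j
    exacts [hy₀, hvu.ne', hvu'.ne']
  obtain ⟨ℓ, t, hℓ, ht, hbt, hr, -, hpyr, hout⟩ := C.triple hℓ₀ hp (i := i) (v := v)
    (y := ![y₀, u, u']) (c := fun j => label L i ((![y₀, u, u'] : Fin 3 → W) j))
    (R := ![R₀, R₁, R₂]) (hh i) hne hd (fun j => C.label_spec i _)
    (forall_ne_fin3 (fun i j hij => hij.symm) (lab k01) (lab k02) (lab k12))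
    (by
      intro j; fin_cases j
      · exact hR₀
      · change IsRung G M (nx J u v) u R₁; rwa [nx_of_adj hJ hvu.symm]
      · change IsRung G M (nx J u' v) u' R₂; rwa [nx_of_adj hJ hvu'.symm])
    ⟨0, 2, by decide, z, Or.inl hz0, b, hb2, haz, hab, fun hn => hzv hn.1⟩
  have htv : ∀ j, t j ≠ v := fun j => (hbt j).ne (hne j)
  have hnt : ∀ j, nx J v (t j) = nx J v ((![y₀, u, u'] : Fin 3 → W) j) :=
    fun j => (hbt j).nx_eq hJ (hne j)
  have mz := C.arm_of_rung (hne 0) (hbt 0) (hr 0) (i := i) (c := label L i y₀) (h := h)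
    (show z ∈ (![R₀, R₁, R₂] : Fin 3 → List V) 0 from hz0)
  have my := C.arm_of_rung (hne 1) (hbt 1) (hr 1) (i := i) (c := label L i u) (h := h)
    (show y ∈ (![R₀, R₁, R₂] : Fin 3 → List V) 1 from hy1)
  have mb := C.arm_of_rung (hne 2) (hbt 2) (hr 2) (i := i) (c := label L i u') (h := h)
    (show b ∈ (![R₀, R₁, R₂] : Fin 3 → List V) 2 from hb2)
  rcases hout with ⟨j, hj, hjB⟩ | ⟨j, k, l, hjk, hjl, hkl, hE, hP, hk, hl⟩
  · have hj0 : j = 0 := by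
      by_contra hj0
      exact hzv (C.onlyBase_node hℓ (htv 0) (hjB 0 (Ne.symm hj0)) mz haz)
    subst hj0
    obtain ⟨⟨w, hw, haw⟩, hw'⟩ := hjB 1 (by decide)
    have h1 := hw' w hw haw
    have h2 := (C.arm_head_iff hℓ (htv 1) my).2 hyv
    simp_all
  · have h0l : l ≠ 0 := by rintro rfl; exact hl z mz haz
    have h2l : l ≠ 2 := by rintro rfl; exact hl b mb hab
    have hl1 : l = 1 := by grind
    subst hl1
    rcases fin3_ne_one hjl hkl hjk with ⟨rfl, rfl⟩ | ⟨rfl, rfl⟩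
    · have hlen : 2 ≤ (arm J ℓ h i v (t 0) (label L i y₀)).length := by
        by_contra hlen
        obtain ⟨-, -, x, -, h1⟩ := C.arm_single hℓ (htv 0) (not_le.1 hlen)
        have h2 := mz
        rw [h1, List.mem_singleton] at h2
        exact hzv ((C.arm_head_iff hℓ (htv 0) mz).1 (by rw [h1, h2]; rfl))
      obtain ⟨q, a, d, w, e1, e2, e3, e4, e5⟩ := hP hlen
      have key : ∀ x ∈ arm J ℓ h i v (t 2) (label L i u'), Att G p x →
          (arm J ℓ h i v (t 2) (label L i u')).head? = some x := by
        intro x hx hax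
        rw [C.arm_head_iff hℓ (htv 2) hx]
        rcases C.arm_core hℓ hx with ⟨-, h1⟩ | ⟨-, h1⟩
        · exact Hit.node C hp hh hH h1 (by rw [hnt 2]; simpa [nu'] using hu') hax
        grind
      have m1 : a ∈ arm J ℓ h i v (t 2) (label L i u') := by simp_all
      have m2 : d ∈ arm J ℓ h i v (t 2) (label L i u') := by simp_all
      have h3 := key a m1 e2
      rw [key d m2 e3, Option.some.injEq] at h3
      have h4 := (hpyr.ip 2).nodup
      grind
    · have h1 := hE.2 b mb hab
      rcases C.arm_last hℓ mb h1 with ⟨hci, h2⟩ | ⟨-, h2⟩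
      swap
      · grind
      have ht2 := ht 2
      change t 2 ∈ L (label L i u') at ht2
      rw [hci] at ht2
      have h3 := C.node_mem_edge hvu' hb h2
      rw [Sym2.mem_iff] at h3
      have h3 := h3.resolve_left (htv 2)
      rw [h3] at ht2 h2
      rcases i with _ | _
      · grind
      · exact hnd v u' hvu' ht2 b hbv h2

/-- It remains to choose the apex so that at most one arm is misdirected. The only obstacle is a far
vertex in a leaf strip of `L false` while `u'` is in `L false` too; then the far vertex is replaced
by means of `Hit.exists_far`. -/
theorem Hit.complete (C : CrossSystem G J M h L) (hp : Tight G J M h L p)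
    (hh : ∀ c, ¬ Att G p (h c)) (hnd : Nondeg J M L) {v u₀ u : W} (hH : Hit G J M p v u₀)
    (hu : u ≠ u₀) (hvu : J.Adj v u) {y : V} (hyv : y ∈ M.node v) (hy : y ∈ M.edge s(v, u)) :
    Att G p y := by
  have hJ := C.sys.tree
  obtain ⟨z, ⟨y₀, hy₀, hyu, hz⟩, haz, hzv⟩ := hH.1
  obtain ⟨u', h1, h2, h3, b, h4, h5, h6⟩ := hH.other u
  have hone : ∀ c, u ∉ L c ∨ u' ∉ L c := by
    intro c
    by_contra hcon
    push Not at hcon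
    exact h1 (C.one c v ⟨h3, hcon.2⟩ ⟨hvu, hcon.1⟩)
  have main : ∀ {y₀ z}, y₀ ≠ v → nx J v y₀ = u₀ → z ∈ M.edge s(nx J y₀ v, y₀) → Att G p z →
      z ∉ M.node v → ∀ i, (y₀ ∉ L (!i) ∨ u ∉ L (!i)) → (y₀ ∉ L (!i) ∨ u' ∉ L (!i)) →
      (u ∉ L (!i) ∨ u' ∉ L (!i)) → (i = true ∨ u' ∉ L false) → Att G p y :=
    fun e1 e2 e3 e4 e5 i => Hit.complete_aux C hp hh hnd hH hu hvu hyv hy h2 h1 h3 h4 h5 h6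
      e1 e2 e3 e4 e5 i
  by_cases hy₀L : y₀ ∈ L false
  swap
  · exact main hy₀ hyu hz haz hzv true (Or.inl hy₀L) (Or.inl hy₀L) (hone _) (Or.inl rfl)
  by_cases hu'L : u' ∈ L false
  swap
  · have := C.disj _ _ hy₀L
    grind
  have hs : nx J y₀ v ≠ v := fun h7 => by
    have h8 := nx_adj hJ hy₀.symm
    rw [h7] at h8
    have := nx_of_adj hJ h8.symm
    exact h2 (by rw [← hyu, this]; exact C.one false v ⟨h3, hu'L⟩ ⟨h8.symm, hy₀L⟩)
  obtain ⟨y', z', e1, e2, e3, e4, e5, e6⟩ := Hit.exists_far C hp hh hnd hH hy₀ hyu hz haz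
    (fun _ => hs)
  rcases e6 with ⟨rfl, -⟩ | e6
  · grind
  refine main e1 e2 e3 e4 (fun h7 => ?_) true (Or.inl e5) (Or.inl e5) (hone _) (Or.inl rfl)
  exact e6 (by rw [← e2]; exact (C.node_far e1 e3 h7).2)

/-- The whole of `p` would be a new rung, its last vertex joining M_v and its first vertex joining
M_w. -/
theorem enlarge_path_false (C : CrossSystem G J M h L) (hmax : MaxVerts G J M h L) {v w : W}
    (hvw : J.Adj v w) (hp : IP G p) (hp0 : p ≠ []) (hout : ∀ f ∈ p, ¬ Core J M h f)
    (hX : ∀ x ∈ M.verts J, x ∉ M.edge s(v, w) → Att G p x → x ∈ M.node v ∨ x ∈ M.node w)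
    (hv : ∀ x ∈ M.node v, x ∉ M.edge s(v, w) → Att G p x ∧ ¬ Att G p.dropLast x)
    (hw : ∀ x ∈ M.node w, x ∉ M.edge s(v, w) → Att G p x ∧ ¬ Att G p.tail x)
    (hhub : ∀ c, ∀ f ∈ p, (G.Adj (h c) f ↔
      (v ∈ L c ∧ p.getLast? = some f) ∨ (w ∈ L c ∧ p.head? = some f))) : False := by
  refine C.enlarge_false hmax hvw (F := {f | f ∈ p}) (FV := {f | p.getLast? = some f})
    (FW := {f | p.head? = some f}) (List.exists_mem_of_ne_nil p hp0)
    (fun f hf => List.mem_of_getLast? hf) (fun f hf => List.mem_of_mem_head? hf) hout ?_ ?_ hhub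
  · intro x hx hxe f hf
    constructor
    · intro hfx
      have hax : Att G p x := ⟨f, hf, hfx⟩
      rcases hX x hx hxe hax with h1 | h1
      · exact Or.inl ⟨(not_att_dropLast_iff hp hax (hv x h1 hxe).2 hf).1 hfx, h1⟩
      · exact Or.inr ⟨(not_att_tail_iff hp hax (hw x h1 hxe).2 hf).1 hfx, h1⟩
    · rintro (⟨h2, h1⟩ | ⟨h2, h1⟩)
      · exact (not_att_dropLast_iff hp (hv x h1 hxe).1 (hv x h1 hxe).2 hf).2 h2
      · exact (not_att_tail_iff hp (hw x h1 hxe).1 (hw x h1 hxe).2 hf).2 h2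
  · intro f hf
    have hn : ∀ z ∈ p, ∀ x, z ∉ M.node x := fun z hz x h1 =>
      hout z hz (Or.inl (C.node_mem_verts h1))
    refine ⟨p.reverse, List.mem_reverse.2 hf, by simpa using hp0, hp.reverse,
      fun z hz => Or.inl (List.mem_reverse.1 hz), fun z hz => ?_, fun z hz => ?_⟩
    · grind
    grind

/-- The reverse of `p`, followed by an old rung from the last vertex of it that `p` sees, would be a
new rung. Only the end at `v` gains a vertex. -/
theorem enlarge_splice_false (C : CrossSystem G J M h L) (hmax : MaxVerts G J M h L) {v w : W}
    (hvw : J.Adj v w) (hp : IP G p) (hp0 : p ≠ []) (hout : ∀ f ∈ p, ¬ Core J M h f)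
    (hX : ∀ x ∈ M.verts J, x ∉ M.edge s(v, w) → Att G p x → x ∈ M.node v)
    (hv : ∀ x ∈ M.node v, x ∉ M.edge s(v, w) → Att G p x ∧ ¬ Att G p.dropLast x)
    {z : V} (hz : z ∈ M.edge s(v, w)) (hzv : z ∉ M.node v) (haz : Att G p z)
    (htail : ∀ z ∈ M.edge s(v, w), z ∉ M.node v → Att G p z → ¬ Att G p.tail z)
    (hhub : ∀ c, ∀ f ∈ p, (G.Adj (h c) f ↔ v ∈ L c ∧ p.getLast? = some f)) : False := by
  refine C.enlarge_false hmax hvw (F := {f | f ∈ p}) (FV := {f | p.getLast? = some f})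
    (FW := ∅) (List.exists_mem_of_ne_nil p hp0)
    (fun f hf => List.mem_of_getLast? hf) (Set.empty_subset _) hout ?_ ?_ (by simpa using hhub)
  · intro x hx hxe f hf
    simp only [Set.mem_empty_iff_false, false_and, or_false]
    constructor
    · intro hfx
      have hax : Att G p x := ⟨f, hf, hfx⟩
      have h1 := hX x hx hxe hax
      exact ⟨(not_att_dropLast_iff hp hax (hv x h1 hxe).2 hf).1 hfx, h1⟩
    · rintro ⟨h2, h1⟩
      exact (not_att_dropLast_iff hp (hv x h1 hxe).1 (hv x h1 hxe).2 hf).2 h2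
  · intro f hf
    have hn : ∀ z ∈ p, ∀ x, z ∉ M.node x := fun z hz x h1 =>
      hout z hz (Or.inl (C.node_mem_verts h1))
    obtain ⟨R, hR, hzR⟩ := C.exists_rung hvw hz
    obtain ⟨A, x, B, rfl, hax, hB⟩ := exists_last (P := Att G p) ⟨z, hzR, haz⟩
    have hxe := hR.sub x (by simp)
    have hip := hR.ip
    have hxv : x ∉ M.node v := by
      intro hxv
      obtain ⟨rfl, -⟩ := hip.head?_eq_of_append (List.mem_cons_self) ((hR.fst x (by simp)).1 hxv)
      grind
    have hsub : ∀ {y}, y ∈ x :: B → y ∈ A ++ x :: B := fun hy => List.mem_append_right A hy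
    have hBv : ∀ y ∈ x :: B, y ∉ M.node v := by
      intro y hy hyv
      obtain ⟨-, rfl⟩ := hip.head?_eq_of_append hy ((hR.fst y (hsub hy)).1 hyv)
      exact hxv hyv
    have hpB : ∀ f ∈ p, f ∉ x :: B := fun f hf h1 =>
      hout f hf (Or.inl (mem_verts_of_edge hvw (hR.sub f (hsub h1))))
    refine ⟨p.reverse ++ x :: B, List.mem_append_left _ (List.mem_reverse.2 hf), by simp,
      ip_splice hp hip.right hpB hax (htail x hxe hxv hax) hB, fun y hy => ?_, fun y hy => ?_,
      fun y hy => ?_⟩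
    · rcases List.mem_append.1 hy with h1 | h1
      · grind
      · exact Or.inr (hR.sub y (hsub h1))
    · grind
    · have hl : (p.reverse ++ x :: B).getLast? = (A ++ x :: B).getLast? := by grind
      simp only [Set.mem_empty_iff_false, or_false, hl]
      rcases List.mem_append.1 hy with h1 | h1
      · grind
      · exact hR.snd y (hsub h1)

/-- The far attachment and an attachment in M_v lie in different directions at `w`, so the pyramid
lemma applies there and its first outcome is the wanted hit. In the second outcome either the far
attachment is a leaf end, contrary to `unique_end`, or the attachment in M_v is one, contrary to
`Nondeg`. -/
theorem hit_far_side (C : CrossSystem G J M h L) (hp : Tight G J M h L p)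
    (hh : ∀ c, ¬ Att G p (h c)) (hnd : Nondeg J M L) {v w y : W} (hH : Hit G J M p v w)
    (hvw : J.Adj v w) (hy : y ≠ v) (hyw : nx J v y = w) (hyne : y ≠ w) {z : V}
    (hz : z ∈ M.edge s(nx J y v, y)) (haz : Att G p z) (hyL : y ∉ L false) : Hit G J M p w v := by
  have hJ := C.sys.tree
  have hbw : Beyond J v w y := Or.inr fun h1 => by
    rw [nx_of_adj hJ hvw.symm] at h1
    have := nx_nx_ne hJ hy
    grind
  have hqv : nx J w y ≠ v := by
    have := nx_nx_ne hJ hy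
    rwa [hyw] at this
  have hnyw : nx J y v = nx J y w := hbw.nx_back hJ hyne
  rw [hnyw] at hz
  obtain ⟨u, huL, huw, hvu, b, hbv, hb, hab⟩ := Hit.other_not_mem C hH false
  have nb : ∀ {u : W}, u ≠ w → J.Adj v u → u ≠ w ∧ nx J u w = v ∧ nx J w u = v := by
    intro u huw hvu
    have h1 : Beyond J w v u := Or.inr (by
      rw [nx_of_adj hJ hvw, nx_of_adj hJ hvu]; exact huw.symm)
    refine ⟨huw, ?_, ?_⟩
    · refine nx_back hJ hvu ?_
      rwa [nx_of_adj hJ hvw]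
    · rw [h1.nx_eq hJ hvw.ne, nx_of_adj hJ hvw.symm]
  obtain ⟨-, nuw, nwu⟩ := nb huw hvu
  have hbw' : b ∉ M.node w := fun h1 => by
    have := C.node_mem_edge hvu hb h1
    grind
  obtain ⟨x, a3, e3, e3'⟩ := C.exists_third_nbr (nx_adj hJ hyne) hvw.symm hqv
  obtain ⟨R₀, hR₀, hz0⟩ := C.exists_rung_far hyne hz
  obtain ⟨R₁, hR₁, hb1⟩ := C.exists_rung hvu hb
  obtain ⟨R₂, hR₂⟩ := C.exists_rung_dir a3
  obtain ⟨ℓ₀, hℓ₀⟩ := C.exists_selection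
  have n3 := nx_of_adj hJ a3
  obtain ⟨ℓ, t, hℓ, ht, ⟨b0, b1, b2⟩, ⟨r0, r1, r2⟩, -, hout⟩ := C.triple_plain_vec hℓ₀ hp hh true
    (v := w) (c₀ := true) (c₁ := true) (c₂ := label L true x) hyne huw a3.ne'
    (by rwa [nwu]) (by grind) (by grind)
    hyL huL (C.label_spec true x) (by simp) (by simp) (by simp) hR₀ (by rwa [nuw]) hR₂ hz0 hb1 haz
    hab (fun hn => hbw' hn.2)
  have mz : z ∈ pl J ℓ w (t 0) := C.mem_pl_of_mem hyne b0 (by rwa [r0])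
  have mb : b ∈ pl J ℓ w (t 1) := C.mem_pl_of_mem huw b1 (by rwa [r1])
  rcases hout with ⟨j, k, l, hjk, hjl, hkl, hz', hS, hB⟩ |
    ⟨j, k, l, hjk, hjl, hkl, hci, ⟨x', hx't, -, -, hx'u⟩, -, hl⟩
  · have hj : j = 1 := by grind
    subst hj
    have hS' : Spread G J M p w (nx J w y) x := by
      rcases fin3_ne_one hjk.symm hjl.symm hkl with ⟨rfl, rfl⟩ | ⟨rfl, rfl⟩
      · simpa [n3] using hS
      · simpa [n3] using hS.symm
    exact ⟨by simp_all, _, _, hqv, e3', hS'⟩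
  · exfalso
    have h0l : l ≠ 0 := by grind
    have h1l : l ≠ 1 := by grind
    rcases fin3_mem hjl h0l h1l with rfl | rfl
    · have ht0 : t 0 ∈ L true := ht 0
      have hzt : z ∈ M.node (t 0) := by grind
      have hty : t 0 = y := by
        rcases b0 with h1 | h1
        · exact h1
        · have h2 := C.node_mem_edge (far_edge_mem hJ hyne) hz hzt
          rw [Sym2.mem_iff] at h2
          refine h2.resolve_left fun h3 => h1 ?_
          rw [h3]
          exact (nx_of_adj hJ (nx_adj hJ hyne.symm)).symm
      rw [hty] at ht0 hzt
      have hsy := (nx_adj hJ hyne.symm).symm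
      obtain ⟨u', hu'L, hu'w, hvu', b', hb'v, hb', hab'⟩ := Hit.other_not_mem C hH true
      have hsv : v ≠ nx J y w := fun h1 => by grind
      have hvs : nx J v (nx J y w) = w := by
        by_cases hsw : nx J y w = w
        · rw [hsw]; exact nx_of_adj hJ hvw
        · have h2 : Beyond J v (nx J y w) y := Or.inr fun h3 => by
            rw [nx_of_adj hJ hsy] at h3
            have h4 := nx_nx_ne hJ hy.symm
            grind
          exact (h2.nx_eq hJ hsv.symm).symm.trans hyw
      have hu's : u' ≠ nx J y w := by
        intro h1
        rw [← h1, nx_of_adj hJ hvu'] at hvs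
        exact hu'w hvs
      have hback : nx J u' (nx J y w) = v := nx_back hJ hvu' (by grind)
      have hb'e : b' ∈ M.edge s(nx J u' (nx J y w), u') := by rwa [hback]
      have h5 := C.unique_end hp hh (i := false) hsy ht0 hR₀ hz0 haz
        (fun a ha haa => by
          have := hx'u a (C.mem_pl_of_mem hyne b0 (by rwa [r0])) haa
          grind)
        (fun h1 => hnd _ y hsy ht0 z h1 hzt) hu's
        (C.far_ne_leaf hsy ht0 hb'e fun h1 => by
          have := C.mem_edge_unique hvu' hsy hb' h1
          grind) hu'L hb'e hab'
      have h6 := C.node_mem_edge hvu' hb' h5.1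
      grind
    · have hbt : b ∈ M.node (t 1) := by grind
      have := C.node_mem_edge hvu hb hbt
      rw [Sym2.mem_iff] at this
      have ht1 : t 1 ∈ L true := ht 1
      rcases this with h1 | h1
      · rw [h1] at ht1
        exact C.not_leaf_of_two hvu hvw huw _ ht1
      · rw [h1] at ht1 hbt
        tauto

/-- In a maximal system there is no tight path without edges to the hubs. -/
theorem tight_att_hub (C : CrossSystem G J M h L) (hmax : MaxVerts G J M h L)
    (hnd : Nondeg J M L) (hp : Tight G J M h L p) : ∃ c, Att G p (h c) := by
  by_contra hcon
  push Not at hcon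
  have hh := hcon
  have hJ := C.sys.tree
  obtain ⟨v, w, hH⟩ := C.exists_hit hp hh hnd
  have hvw : J.Adj v w := by
    obtain ⟨z, ⟨y, hy, rfl, -⟩, -⟩ := hH.1
    exact nx_adj hJ hy
  obtain ⟨u, -, huw, hvu, b, hbv, hb, hab⟩ := hH.other w
  have hvL := C.not_leaf_of_two hvu hvw huw
  -- what happens on the side of a hit
  have side : ∀ {v w : W}, J.Adj v w → Hit G J M p v w →
      (∀ x ∈ M.verts J, ¬ MBranch J M v w x → Att G p x → x ∈ M.node v) ∧
      ∀ x ∈ M.node v, x ∉ M.edge s(v, w) → Core J M h x ∧ Att G p x := by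
    intro v w hvw hH
    constructor
    · intro x hx hxe hax
      obtain ⟨y, hy, hxy⟩ := C.exists_branch v hx
      refine Hit.node C hp hh hH ⟨y, hy, rfl, hxy⟩ (fun h1 => hxe ⟨y, hy, h1, hxy⟩) hax
    · intro x hxv hxe
      obtain ⟨u, hu, hxu⟩ := C.exists_edge_of_node hxv
      refine ⟨Or.inl (C.node_mem_verts hxv), Hit.complete C hp hh hnd hH ?_ hu hxv hxu⟩
      grind
  obtain ⟨s1, s2⟩ := side hvw hH
  have branchOut : ∀ {v w : W} {x : V}, J.Adj v w → x ∈ M.node v → x ∉ M.edge s(v, w) →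
      ∃ u, u ≠ w ∧ J.Adj v u ∧ x ∈ M.edge s(v, u) := by
    intro v w x hvw hxv hxe
    obtain ⟨u, hu, hxu⟩ := C.exists_edge_of_node hxv
    grind
  have hbe : b ∉ M.edge s(v, w) := fun h1 => huw (by
    have := C.mem_edge_unique hvu hvw hb h1
    grind)
  -- If all attachments towards `w` are in the strip at `v w`, the path is spliced into a rung of
  -- it. If one lies beyond, there is also a hit at `w` towards `v`, and the path itself is a new
  -- rung.
  by_cases hcase : ∀ z, MBranch J M v w z → Att G p z → z ∈ M.edge s(v, w)
  · obtain ⟨z, hz, haz, hzv⟩ := hH.1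
    obtain ⟨q, hq, hqp, hq1, hq2⟩ := hp.orient
      (P := {z | z ∈ M.edge s(v, w) ∧ z ∉ M.node v ∧ Att G p z})
      (Q := {x | x ∈ M.node v ∧ x ∉ M.edge s(v, w)})
      (fun x hx => ⟨Or.inl (mem_verts_of_edge hvw hx.1), hx.2.2⟩) (fun x hx => s2 x hx.1 hx.2)
      (by
        rintro x ⟨hx1, hx2, -⟩ y ⟨hy1, hy2⟩ hr
        rw [C.rel_iff (mem_verts_of_edge hvw hx1) (C.node_mem_verts hy1)] at hr
        obtain ⟨u, huw, hvu, hyu⟩ := branchOut hvw hy1 hy2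
        exact hx2 (C.branch_relJ huw.symm (C.mBranch_adj hvw hx1) (C.mBranch_adj hvu hyu) hr).1)
      ⟨z, hcase z hz haz, hzv, haz⟩ ⟨b, hbv, hbe⟩
    have hatt : ∀ {z}, Att G q z ↔ Att G p z := fun {z} =>
      ⟨fun h1 => h1.mono fun f hf => (hqp f).1 hf, fun h1 => h1.mono fun f hf => (hqp f).2 hf⟩
    refine C.enlarge_splice_false hmax hvw hq.ip hq.ne hq.out (fun x hx hxe hax => ?_)
      (fun x hxv hxe => ⟨hatt.2 (s2 x hxv hxe).2, hq2 x ⟨hxv, hxe⟩⟩) (hcase z hz haz) hzv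
      (hatt.2 haz) (fun z hz hzv haz => hq1 z ⟨hz, hzv, hatt.1 haz⟩) (fun c f hf => ?_)
    · grind
    · refine ⟨fun h1 => absurd (hatt.1 ⟨f, hf, h1.symm⟩) (hh c), fun h1 => absurd h1.1 (hvL c)⟩
  · push Not at hcase
    obtain ⟨z, ⟨y, hy, hyw, hzy⟩, haz, hze⟩ := hcase
    have hyne : ∀ {y z}, nx J v y = w → z ∈ M.edge s(nx J y v, y) → z ∉ M.edge s(v, w) → y ≠ w := by
      rintro y z hyw hz hze rfl
      rw [nx_of_adj hJ hvw.symm] at hz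
      exact hze hz
    obtain ⟨y', z', h1, h2, h3, h4, h5, h6⟩ := Hit.exists_far C hp hh hnd hH hy hyw hzy haz
      (fun _ h1 => hze (by
        have h2 := nx_adj hJ hy.symm
        rw [h1] at h2
        rw [nx_of_adj hJ h2.symm] at hyw
        grind))
    have hy'w : y' ≠ w := by grind
    have hH' := C.hit_far_side hp hh hnd hH hvw h1 h2 hy'w h3 h4 h5
    obtain ⟨s1', s2'⟩ := side hvw.symm hH'
    rw [Sym2.eq_swap] at s2'
    obtain ⟨u', -, hu'v, hwu', b', hb'w, hb', hab'⟩ := hH'.other v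
    have hb'e : b' ∉ M.edge s(v, w) := fun h1 => hu'v (by
      rw [Sym2.eq_swap] at h1
      have := C.mem_edge_unique hwu' hvw.symm hb' h1
      rwa [Sym2.congr_right] at this)
    obtain ⟨q, hq, hqp, hq1, hq2⟩ := hp.orient
      (P := {x | x ∈ M.node w ∧ x ∉ M.edge s(v, w)})
      (Q := {x | x ∈ M.node v ∧ x ∉ M.edge s(v, w)})
      (fun x hx => s2' x hx.1 hx.2) (fun x hx => s2 x hx.1 hx.2)
      (by
        rintro x ⟨hx1, hx2⟩ y ⟨hy1, hy2⟩ hr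
        rw [C.rel_iff (C.node_mem_verts hx1) (C.node_mem_verts hy1)] at hr
        obtain ⟨u, huw, hvu, hyu⟩ := branchOut hvw hy1 hy2
        obtain ⟨u', huv', hwu', hxu'⟩ := branchOut hvw.symm hx1 (by rwa [Sym2.eq_swap])
        have hb : Beyond J w v u := Or.inr (by
          rw [nx_of_adj hJ hvw, nx_of_adj hJ hvu]; exact huw.symm)
        have hyB : MBranch J M w v y := ⟨u, huw, by
          rw [hb.nx_eq hJ hvw.ne, nx_of_adj hJ hvw.symm], by
          rwa [nx_back hJ hvu (by rwa [nx_of_adj hJ hvw])]⟩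
        have := (C.branch_relJ huv' (C.mBranch_adj hwu' hxu') hyB hr).2
        have h7 := C.node_mem_edge hvu hyu this
        rw [Sym2.mem_iff] at h7
        exact h7.elim hvw.ne' huw.symm)
      ⟨b', hb'w, hb'e⟩ ⟨b, hbv, hbe⟩
    have hatt : ∀ {z}, Att G q z ↔ Att G p z := fun {z} =>
      ⟨fun h1 => h1.mono fun f hf => (hqp f).1 hf, fun h1 => h1.mono fun f hf => (hqp f).2 hf⟩
    have hwL := C.not_leaf_of_two hwu' hvw.symm hu'v
    refine C.enlarge_path_false hmax hvw hq.ip hq.ne hq.out (fun x hx hxe hax => ?_)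
      (fun x hxv hxe => ⟨hatt.2 (s2 x hxv hxe).2, hq2 x ⟨hxv, hxe⟩⟩)
      (fun x hxv hxe => ⟨hatt.2 (s2' x hxv hxe).2, hq1 x ⟨hxv, hxe⟩⟩) (fun c f hf => ?_)
    · have hax := hatt.1 hax
      by_cases hB : MBranch J M v w x
      · refine Or.inr (s1' x hx (fun hB' => ?_) hax)
        obtain ⟨y, hy, hyw, hxy⟩ := hB
        obtain ⟨y', hy', hyw', hxy'⟩ := hB'
        have e := C.mem_edge_unique (far_edge_mem hJ hy) (far_edge_mem hJ hy') hxy hxy'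
        have hyw2 := hyne hyw hxy hxe
        have hbw : Beyond J v w y := Or.inr fun h1 => by
          rw [nx_of_adj hJ hvw.symm] at h1
          have := nx_nx_ne hJ hy
          grind
        rw [hbw.nx_back hJ hyw2] at e
        have := far_unique hJ hyw2 hy' e
        subst this
        have h8 := nx_nx_ne hJ hy
        grind
      grind
    · refine ⟨fun h1 => absurd (hatt.1 ⟨f, hf, h1.symm⟩) (hh c), ?_⟩
      grind

end CrossSystem

/-! ### Tree paths closed by hubs -/

namespace LineTree

theorem pl_hub_ip (H : LineTree G J h L ℓ) {c : Bool} {v t : W} (hv : v ∉ L c) (ht : t ∈ L c) :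
    IP G (pl J ℓ v t ++ [h c]) := by
  refine IP.append_iff.2 ⟨H.pl_ip v t, IP.singleton _, fun x hx y hy => ?_⟩
  rw [List.mem_singleton] at hy
  subst hy
  refine ⟨fun h1 => H.hub_notMem_pl c v t (h1 ▸ hx), ?_⟩
  rw [G.adj_comm, H.hub_pl hv hx]
  simp [ht]

theorem hub_pl_of_leaf (H : LineTree G J h L ℓ) {c : Bool} {w s t : W} (hw : w ∈ L c)
    (hws : J.Adj w s) (hs : s ∉ L c) (htw : t ≠ w) {z : V} (hz : z ∈ pl J ℓ w t) :
    G.Adj (h c) z ↔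
      (pl J ℓ w t).head? = some z ∨ (t ∈ L c ∧ (pl J ℓ w t).getLast? = some z) := by
  have hJ := H.tree
  have hn : nx J w t = s := H.leaf c w hw _ _ (nx_adj hJ htw) hws
  rw [H.pl_head htw, hn]
  by_cases hts : t = s
  · subst hts
    rw [pl_adj hJ ℓ hws] at hz ⊢
    rw [H.hub c w t hws z hz]
    simp [hw, hs]
  have hp : pl J ℓ w t = ℓ w s ++ pl J ℓ s t := by rw [pl_cons hJ ℓ htw, hn]
  have hlast : (pl J ℓ w t).getLast? = (pl J ℓ s t).getLast? := by
    rw [hp, List.getLast?_append]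
    obtain ⟨a, ha⟩ := Option.isSome_iff_exists.1
      (List.getLast?_isSome.2 (H.pl_ne_nil (v := s) hts))
    simp [ha]
  have hnd := (H.pl_ip w t).nodup
  rw [hp, List.nodup_append] at hnd
  have hz' := hz
  rw [hp, List.mem_append] at hz'
  rw [hlast]
  rcases hz' with h1 | h1
  · rw [H.hub c w s hws z h1]
    grind
  · rw [H.hub_pl hs h1]
    have : (ℓ w s).head? ≠ some z := fun h2 =>
      hnd.2.2 z (List.mem_of_mem_head? h2) z h1 rfl
    simp [this]

end LineTree

/-- A tight path from the hub `h i` into the system, with no edges to the other hub. -/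
structure HubPath (G : SimpleGraph V) (J : SimpleGraph W) (M : StripFamily V W) (h : Bool → V)
    (L : Bool → Set W) (i : Bool) (p : List V) : Prop where
  tight : Tight G J M h L p
  hub : Att G p (h i)
  hub' : ¬ Att G p (h (!i))
  hub_tail : ¬ Att G p.tail (h i)
  drop : ∀ x ∈ M.verts J, Att G p.dropLast x → ∃ t ∈ L i, x ∈ M.node t
  exists_att : ∃ x ∈ M.verts J, Att G p x ∧ ¬ LeafStrip J M L i x

/-! ### Tight paths that see exactly one hub -/

namespace CrossSystem

theorem leafStrip_of_node (C : CrossSystem G J M h L) {t : W} (ht : t ∈ L i) {x : V}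
    (hx : x ∈ M.node t) : LeafStrip J M L i x := by
  obtain ⟨s, hs, hxs⟩ := C.exists_edge_of_node hx
  exact ⟨s, t, hs.symm, ht, by grind⟩

/-- The orientation puts the hub at the first vertex and every attachment outside the leaf nodes of
`h i` at the last. If no attachment avoided the leaf strips of `L i`, all would lie in one such
strip, and the path would be spliced into it at the hub end, enlarging the system. -/
theorem exists_hubPath (C : CrossSystem G J M h L) (hmax : MaxVerts G J M h L)
    (hnd : Nondeg J M L) (hp : Tight G J M h L p) (hc : ¬ Att G p (h (!i))) :
    ∃ q, HubPath G J M h L i q ∧ ∀ f, f ∈ q ↔ f ∈ p := by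
  have ho : Att G p (h i) := by
    obtain ⟨d, hd⟩ := C.tight_att_hub hmax hnd hp
    by_cases hdi : d = i
    · rwa [← hdi]
    · rw [Bool.eq_not_of_ne hdi] at hd
      grind
  obtain ⟨y, hy, hay, hyn⟩ : ∃ y ∈ M.verts J, Att G p y ∧ ¬ ∃ t ∈ L i, y ∈ M.node t := by
    obtain ⟨x, y, hx, hy, hax, hay, hxy⟩ := hp.non
    have aux : ∀ {x y}, Core J M h y → Att G p x → Att G p y → (∃ c, x = h c) →
        ¬ Rel J M h L x y → ∃ y ∈ M.verts J, Att G p y ∧ ¬ ∃ t ∈ L i, y ∈ M.node t := by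
      rintro x y hy hax hay ⟨d, rfl⟩ hxy
      have hdi : d = i := by
        by_contra hdi
        exact hc (Bool.eq_not_of_ne hdi ▸ hax)
      subst hdi
      rcases hy with hy | ⟨d', rfl⟩
      · exact ⟨y, hy, hay, fun h1 => hxy ((C.rel_hub_iff hy).2 h1)⟩
      · have hdi : d' = d := by
          by_contra hdi
          exact hc (Bool.eq_not_of_ne hdi ▸ hay)
        exact absurd (Or.inr (Or.inl ⟨d, rfl, Or.inl (by rw [hdi])⟩)) hxy
    rcases hx with hx | hx
    · rcases hy with hy | hy
      · rw [C.rel_iff hx hy] at hxy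
        obtain ⟨z, hz, haz, hzn⟩ := C.exists_not_leafStrip hp hc hx hy hax hay hxy
        exact ⟨z, hz, haz, fun ⟨t, ht, hzt⟩ => hzn (C.leafStrip_of_node ht hzt)⟩
      · exact aux (Or.inl hx) hay hax hy fun h1 => hxy h1.symm
    grind
  obtain ⟨q, hq, hqp, hq1, hq2⟩ := hp.orient (P := {h i})
    (Q := {x | x ∈ M.verts J ∧ Att G p x ∧ ¬ ∃ t ∈ L i, x ∈ M.node t})
    (by rintro x rfl; tauto) (fun x hx => ⟨Or.inl hx.1, hx.2.1⟩)
    (by rintro x rfl z ⟨hz, -, hzn⟩ hr; exact hzn ((C.rel_hub_iff hz).1 hr)) ⟨_, rfl⟩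
    ⟨y, hy, hay, hyn⟩
  have hatt : ∀ {z}, Att G q z ↔ Att G p z := fun {z} =>
    ⟨fun h1 => h1.mono fun f hf => (hqp f).1 hf, fun h1 => h1.mono fun f hf => (hqp f).2 hf⟩
  have hdrop : ∀ x ∈ M.verts J, Att G q.dropLast x → ∃ t ∈ L i, x ∈ M.node t := by
    intro x hx hax
    by_contra hn
    exact hq2 x ⟨hx, hatt.1 hax.of_dropLast, hn⟩ hax
  refine ⟨q, ⟨hq, hatt.2 ho, fun h1 => hc (hatt.1 h1), hq1 _ rfl, hdrop, ?_⟩, hqp⟩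
  by_contra hcon
  push Not at hcon
  obtain ⟨s, t, hst, ht, hys⟩ := hcon y hy (hatt.2 hay)
  have hall : ∀ x ∈ M.verts J, Att G q x → x ∈ M.edge s(t, s) := by
    intro x hx hax
    obtain ⟨s', t', hst', ht', hxs⟩ := hcon x hx hax
    rw [Sym2.eq_swap]
    have hr : RelJ J M x y := by
      by_contra hr
      obtain ⟨z, hz, haz, hzn⟩ := C.exists_not_leafStrip hp hc hx hy (hatt.1 hax) hay hr
      grind
    by_cases hss : s' = s
    · subst hss
      rwa [C.one i s' ⟨hst, ht⟩ ⟨hst', ht'⟩]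
    · exact absurd hr (C.strips_disjoint hst' hst ht' ht hss hxs hys)
  have hyt : y ∉ M.node t := fun h1 => hyn ⟨t, ht, h1⟩
  refine C.enlarge_splice_false hmax hst.symm hq.ip.reverse (by simpa using hq.ne)
    (fun f hf => hq.out f (List.mem_reverse.1 hf))
    (fun x hx hxe hax => absurd (hall x hx (Att.reverse_iff.1 hax)) hxe) (fun x hxt hxe => ?_)
    (by grind) hyt (Att.reverse_iff.2 (hatt.2 hay)) (fun z hz hzt haz h1 => ?_)
    (fun d f hf => ?_)
  · obtain ⟨s', hs', hxs⟩ := C.exists_edge_of_node hxt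
    rw [C.leaf_unique ht hs' hst.symm] at hxs
    grind
  · rw [List.tail_reverse, Att.reverse_iff] at h1
    have hzv := mem_verts_of_edge (J := J) hst.symm hz
    obtain ⟨t', ht', hzt'⟩ := hdrop z hzv h1
    have := C.node_mem_edge (e := s(t, s)) hst.symm hz hzt'
    rw [Sym2.mem_iff] at this
    rcases this with h2 | h2
    · grind
    · exact C.nbr_not_leaf hst ht i (h2 ▸ ht')
  · rw [List.mem_reverse] at hf
    rw [List.getLast?_reverse]
    by_cases hdi : d = i
    · subst hdi
      simp only [ht, true_and]
      rw [G.adj_comm]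
      exact not_att_tail_iff hq.ip (hatt.2 ho) (hq1 _ rfl) hf
    · rw [Bool.eq_not_of_ne hdi]
      refine ⟨fun h1 => absurd (hatt.1 ⟨f, hf, h1.symm⟩) hc, fun h1 => absurd h1.1 (C.disj _ _ ht)⟩

/-- The two hubs and `y` close `p` to an odd cycle, so `p` has even length. A tree path from `s` to
a leaf of `h i`, in a direction other than `w` and not met by `p`, would then give an even hole. To
find one: `p.dropLast` reaches the node of at most one leaf `t₀` of `L i`, and towards any other
leaf the attachments are related to `y`, so they lie in M_s and require `y` in M_s as well. -/
theorem hub_end_false (C : CrossSystem G J M h L) (hℓ : Selection G J M ℓ)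
    (H : HubPath G J M h L i p) {s w t : W} {y : V} (hsw : J.Adj s w) (hw : w ∈ L (!i))
    (hy : y ∈ ℓ s w) (hyw : y ∈ M.node w) (hay : Att G p y)
    (huniq : ∀ z ∈ ℓ s w, Att G p z → z = y) (ht : t ∈ L (!i)) (hts : t ≠ s)
    (htw : nx J s t ≠ w) (hun : ∀ z ∈ pl J ℓ s t, ¬ Att G p z) : False := by
  have hJ := C.sys.tree
  have T := C.lineTree hℓ
  have hye := hℓ.sub s w hsw y hy
  have hyv := mem_verts_of_edge hsw hye
  have hs := C.nbr_not_leaf hsw hw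
  have hwi : w ∉ L i := by simpa using C.disj _ _ hw
  have hoc : G.Adj (h i) (h (!i)) := C.hubs i
  have hyo : ¬ G.Adj (h i) y := fun h1 => by
    obtain ⟨t', ht', h2⟩ := (C.hub i y hyv).1 h1
    have := C.node_mem_edge hsw hye h2
    grind
  have hyc : G.Adj (h (!i)) y := (C.hub _ y hyv).2 ⟨w, hw, hyw⟩
  have hyd : ¬ Att G p.dropLast y := fun h1 => hyo ((C.hub i y hyv).2 (H.drop y hyv h1))
  have hpl : ∀ v t, ∀ f ∈ p, f ∉ pl J ℓ v t := fun v t f hf h1 =>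
    H.tight.out f hf (Or.inl (C.mBranch_verts (C.mBranch_of_pl hℓ h1).2))
  have hph : ∀ c, ∀ f ∈ p, f ≠ h c := fun c f hf h1 => H.tight.out f hf (Or.inr ⟨c, h1⟩)
  have hyne : ∀ c, y ≠ h c := C.ne_hub hyv
  -- The cycle formed by `p`, `y`, `h (!i)` and `h i`.
  have k3 : Odd (p.length + 3) := by
    refine odd_cycle C.ehf (Q := [y, h (!i), h i]) H.tight.ip ?_ ?_ H.tight.ne (by simp) ?_ ?_ ?_
    · refine ⟨by simp [hyne], ?_, ⟨by simp [hoc.ne'], by simp [hoc.symm], IP.singleton _⟩⟩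
      simp only [List.mem_cons, List.not_mem_nil, or_false, List.head?_cons, Option.some.injEq]
      rintro a (rfl | rfl)
      · simp [hyc.symm]
      · simp [hoc.ne', G.adj_comm y, hyo]
    · simp only [List.mem_cons, List.not_mem_nil, or_false, not_or]
      exact fun f hf => ⟨fun h1 => H.tight.out f hf (Or.inl (h1 ▸ hyv)), hph _ f hf, hph _ f hf⟩
    · simp only [List.mem_cons, List.not_mem_nil, or_false]
      rintro z (rfl | rfl | rfl) haz
      exacts [Or.inl rfl, absurd haz H.hub', Or.inr rfl]
    · grind
    · rintro z hz
      simp only [List.getLast?_cons_cons, List.getLast?_singleton, Option.some.injEq] at hz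
      exact hz ▸ ⟨H.hub, H.hub_tail⟩
  have k2 : 2 ≤ p.length := by grind
  have hyt : Att G p.tail y := (att_tail_or_dropLast k2 hay).resolve_right hyd
  -- all leaves but one are out of reach of the initial part
  obtain ⟨t₀, ht₀⟩ : ∃ t₀, ∀ t ∈ L i, t ≠ t₀ → ∀ x ∈ M.node t, ¬ Att G p.dropLast x := by
    by_cases hex : ∃ t ∈ L i, ∃ x ∈ M.node t, Att G p.dropLast x
    swap
    · exact ⟨w, fun t ht _ x hx hax => hex ⟨t, ht, x, hx, hax⟩⟩
    obtain ⟨t₀, ht₀, x₀, hx₀, hax₀⟩ := hex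
    refine ⟨t₀, fun t ht hne x hx hax => ?_⟩
    have hr := H.tight.drop x x₀ (Or.inl (C.node_mem_verts hx)) (Or.inl (C.node_mem_verts hx₀))
      hax hax₀
    rw [C.rel_iff (C.node_mem_verts hx) (C.node_mem_verts hx₀)] at hr
    obtain ⟨s, hs, hxs⟩ := C.exists_edge_of_node hx
    obtain ⟨s', hs', hxs'⟩ := C.exists_edge_of_node hx₀
    by_cases hss : s = s'
    · subst hss
      exact hne (C.one i s ⟨hs.symm, ht⟩ ⟨hs'.symm, ht₀⟩)
    · rw [Sym2.eq_swap] at hxs hxs'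
      exact C.strips_disjoint hs.symm hs'.symm ht ht₀ hss hxs hxs' hr
  have att : ∀ {t}, t ∈ L i → t ≠ t₀ → nx J s t ≠ w → ∀ z ∈ pl J ℓ s t, Att G p z →
      (z ∈ M.node s ∧ y ∈ M.node s) ∧ ¬ Att G p.dropLast z := by
    intro t ht htt htw z hz haz
    have hzB := (C.mBranch_of_pl hℓ hz).2
    have hzv := C.mBranch_verts hzB
    have hd : ¬ Att G p.dropLast z := by
      intro h1
      obtain ⟨t', ht', hzt⟩ := H.drop z hzv h1
      obtain ⟨s', hs', hzs⟩ := C.exists_edge_of_node hzt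
      rw [Sym2.eq_swap] at hzs
      have := C.leaf_of_mem_pl hℓ hs hz hs'.symm ht' hzs
      grind
    have hr := H.tight.tail z y (Or.inl hzv) (Or.inl hyv)
      ((att_tail_or_dropLast k2 haz).resolve_right hd) hyt
    rw [C.rel_iff hzv hyv] at hr
    exact ⟨C.branch_relJ htw hzB (C.mBranch_adj hsw hye) hr, hd⟩
  have hys' : y ∈ ℓ w s := by rw [hℓ.rev s w hsw]; grind
  have hhy := (hℓ.node w s hsw.symm y hys').1 hyw
  have plw : ∀ {t}, t ≠ s → nx J s t ≠ w → t ≠ w ∧ nx J w t = s ∧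
      pl J ℓ w t = ℓ w s ++ pl J ℓ s t := by
    intro t hts htw
    have h1 : t ≠ w := by
      rintro rfl
      exact htw (nx_of_adj hJ hsw)
    have h2 : nx J w t = s := C.leaf_unique hw (nx_adj hJ h1) hsw.symm
    exact ⟨h1, h2, by rw [pl_cons hJ ℓ h1, h2]⟩
  have leafne : ∀ {t}, t ∈ L i → t ≠ s := fun ht h1 => hs _ (h1 ▸ ht)
  -- an unmet path from `s` to the leaves of `h i` gives the contradiction
  have close : ∀ {t}, t ∈ L i → nx J s t ≠ w → ¬ ∀ z ∈ pl J ℓ s t, ¬ Att G p z := by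
    intro t ht htw hun
    obtain ⟨h1, h2, h3⟩ := plw (leafne ht) htw
    have hip := T.pl_hub_ip hwi ht
    have hhead : (pl J ℓ w t).head? = some y := by rw [T.pl_head h1, h2, hhy]
    have hne : pl J ℓ w t ≠ [] := T.pl_ne_nil h1
    have hhead' : (pl J ℓ w t ++ [h i]).head? = some y := by rw [List.head?_append, hhead]; rfl
    have hlen := List.length_pos_of_ne_nil hne
    have o1 := odd_cycle C.ehf H.tight.ip hip (fun f hf h4 => by grind) H.tight.ne (by simp; omega)
      (fun z hz haz => by
        rcases List.mem_append.1 hz with h5 | h5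
        · rw [h3, List.mem_append] at h5
          rcases h5 with h5 | h5
          · rw [hℓ.rev s w hsw, List.mem_reverse] at h5
            grind
          grind
        · exact Or.inr (by simp [List.mem_singleton.1 h5]))
      (fun z hz => by grind)
      (fun z hz => by
        simp only [List.getLast?_append, List.getLast?_singleton, Option.some_or,
          Option.some.injEq] at hz
        exact hz ▸ ⟨H.hub, H.hub_tail⟩)
    have o2 := odd_cone C.ehf (x := h (!i)) hip (fun h4 => by
        rcases List.mem_append.1 h4 with h5 | h5
        · exact T.hub_notMem_pl _ _ _ h5
        grind) (by simp; omega) (fun z hz => by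
        rcases List.mem_append.1 hz with h5 | h5
        · rw [T.hub_pl_of_leaf hw hsw.symm (hs _) h1 h5, hhead', hhead]
          have : z ≠ h i := fun h6 => T.hub_notMem_pl i _ _ (h6 ▸ h5)
          simp [C.disj _ _ ht, this.symm]
        · rw [List.mem_singleton.1 h5]
          simp [hoc.symm])
    grind
  by_cases hys : y ∈ M.node s
  swap
  · obtain ⟨u₁, u₂, h1, h2, h3, h4, h5⟩ := C.exists_two hs hsw
    have leaf : ∀ {u}, J.Adj s u → u ≠ w → ∃ t ∈ L i, nx J s t = u := by
      intro u hu huw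
      obtain ⟨t, ht, hb⟩ := C.exists_leaf_beyond (v := s) hu.ne' i
        (fun h6 => huw (C.one _ s ⟨hu, h6⟩ ⟨hsw, hw⟩))
      exact ⟨t, ht, by rw [hb.nx_eq hJ hu.ne', nx_of_adj hJ hu]⟩
    grind
  have hr := nx_adj hJ hts
  obtain ⟨t₁, ht₁, hb₁⟩ := C.exists_leaf_beyond (v := s) hr.ne' i
    (fun h6 => htw (C.one _ s ⟨hr, h6⟩ ⟨hsw, hw⟩))
  have hn₁ : nx J s t₁ = nx J s t := by rw [hb₁.nx_eq hJ hr.ne', nx_of_adj hJ hr]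
  -- If the leaf `t₁` of `L i` in the direction of `t` is not `t₀`, an attachment towards it would
  -- be in M_s, hence on the path towards `t`, which is not met.
  by_cases h6 : t₁ = t₀
  swap
  · refine close ht₁ (hn₁ ▸ htw) fun z hz haz => ?_
    have h7 := (att ht₁ h6 (hn₁ ▸ htw) z hz haz).1.1
    rw [← C.pl_head_iff hℓ hz, T.pl_head (leafne ht₁), hn₁, ← T.pl_head hts] at h7
    exact hun z (List.mem_of_mem_head? h7) haz
  obtain ⟨u, hu, huw, hur⟩ := C.exists_third_nbr hsw hr htw.symm
  obtain ⟨t₂, ht₂, hb₂⟩ := C.exists_leaf_beyond (v := s) hu.ne' i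
    (fun h6 => huw (C.one _ s ⟨hu, h6⟩ ⟨hsw, hw⟩))
  have hn₂ : nx J s t₂ = u := by rw [hb₂.nx_eq hJ hu.ne', nx_of_adj hJ hu]
  have ht₂₀ : t₂ ≠ t₀ := fun h7 => hur (by grind)
  refine close ht₂ (hn₂ ▸ huw) fun z hz haz => ?_
  obtain ⟨⟨hzs, -⟩, hzd⟩ := att ht₂ ht₂₀ (hn₂ ▸ huw) z hz haz
  have hzB := (C.mBranch_of_pl hℓ hz).2
  have hzv := C.mBranch_verts hzB
  rw [hn₂] at hzB
  have hzu := (C.mBranch_node hzB hzs).2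
  have hyz : G.Adj y z := (C.sys.adj_iff s w u hsw hu huw.symm y hye z hzu).2 ⟨hys, hzs⟩
  have hzc : ¬ G.Adj (h (!i)) z := fun h1 => by
    obtain ⟨t', ht', h2⟩ := (C.hub _ z hzv).1 h1
    have := C.node_mem_edge hu hzu h2
    rw [Sym2.mem_iff] at this
    rcases this with rfl | rfl
    exacts [hs _ ht', huw (C.one _ s ⟨hu, ht'⟩ ⟨hsw, hw⟩)]
  have hzne : ∀ c, z ≠ h c := C.ne_hub hzv
  -- If `h i` sees `z`, then `y`, `z`, `h i`, `h (!i)` is a hole of length four. Otherwise `z`, the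
  -- unmet path to `t` and the two hubs close with `p` to a cycle of even length.
  by_cases hzo : G.Adj (h i) z
  · have := odd_cone C.ehf (x := h (!i)) (l := [y, z, h i]) ⟨by simp [hyz.ne, hyne], by
        simp [hyz.symm, hzne, G.adj_comm y, hyo], ⟨by simp [hzne], by simp [hzo.symm],
        IP.singleton _⟩⟩ (by simp [(hyne _).symm, (hzne _).symm, hoc.ne']) (by simp) (by
        simp only [List.mem_cons, List.not_mem_nil, or_false]
        rintro a (rfl | rfl | rfl)
        · simp [hyc]
        · simp [hzc, hyz.ne, (hzne i).symm]
        · simp [hoc.symm])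
    simp at this
    exact absurd this (by decide)
  obtain ⟨h1, h2, h3⟩ := plw hts htw
  have hsingle : ℓ w s = [y] := by
    have hlast : (ℓ w s).getLast? = some y := by
      rw [← T.head_last hsw.symm]
      exact (hℓ.node s w hsw y hy).1 hys
    have hnd := (hℓ.ip w s hsw.symm).nodup
    rcases hl : ℓ w s with _ | ⟨a, l⟩
    · grind
    grind
  have hl := List.length_pos_of_ne_nil (T.pl_ne_nil (v := s) hts)
  have o1 := odd_cone C.ehf (x := h (!i)) (T.pl_ip w t) (T.hub_notMem_pl _ _ _)
    (by rw [h3, hsingle]; simp; omega)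
    (fun a ha => by rw [T.hub_pl_of_leaf hw hsw.symm (hs _) h1 ha]; simp [ht])
  rw [h3, hsingle] at o1
  have hip : IP G ((z :: pl J ℓ s t) ++ [h (!i)]) := by
    refine ⟨?_, ?_, T.pl_hub_ip (hs _) ht⟩
    · intro h4
      rcases List.mem_append.1 h4 with h5 | h5
      · grind
      · exact hzne _ (List.mem_singleton.1 h5)
    · intro a ha
      have hd : (pl J ℓ s t ++ [h (!i)]).head? = (pl J ℓ s t).head? := by
        rw [List.head?_append, Option.or_of_isSome]
        simpa using T.pl_ne_nil (v := s) hts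
      change _ ↔ (pl J ℓ s t ++ [h (!i)]).head? = _
      rw [hd]
      rcases List.mem_append.1 ha with h5 | h5
      · rw [(T.pl_cross (by grind) hz h5).2, C.pl_head_iff hℓ hz]
        simp [hzs]
      · rw [List.mem_singleton.1 h5, G.adj_comm]
        refine iff_of_false hzc fun h6 => ?_
        exact T.hub_notMem_pl _ _ _ (List.mem_of_mem_head? h6)
  have hip2 : IP G ((z :: pl J ℓ s t ++ [h (!i)]) ++ [h i]) := by
    refine IP.append_iff.2 ⟨hip, IP.singleton _, fun a ha b hb => ?_⟩
    rw [List.mem_singleton] at hb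
    subst hb
    simp only [List.getLast?_append, List.getLast?_singleton, Option.some_or, List.head?_cons,
      and_true, Option.some.injEq]
    rcases List.mem_append.1 ha with h5 | h5
    · have hac : a ≠ h (!i) ∧ a ≠ h i ∧ ¬ G.Adj (h i) a := by
        rcases List.mem_cons.1 h5 with rfl | h5
        · grind
        · refine ⟨fun h6 => T.hub_notMem_pl _ _ _ (h6 ▸ h5),
            fun h6 => T.hub_notMem_pl _ _ _ (h6 ▸ h5), ?_⟩
          rw [T.hub_pl (hs _) h5]
          grind
      exact ⟨hac.2.1, by rw [G.adj_comm]; grind⟩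
    · rw [List.mem_singleton.1 h5]
      exact ⟨hoc.ne', by simp [hoc.symm]⟩
  have o2 := odd_cycle C.ehf H.tight.ip hip2 (fun f hf h4 => by grind)
    H.tight.ne (by simp) (fun a ha haa => by
      simp only [List.cons_append, List.append_assoc, List.mem_cons, List.mem_append,
        List.not_mem_nil, or_false] at ha
      rcases ha with rfl | ha | rfl | ha
      · exact Or.inl (by simp)
      · grind
      · exact absurd haa H.hub'
      grind)
    (fun a ha => by simp at ha; exact ha ▸ ⟨haz, hzd⟩)
    (fun a ha => by
      simp only [List.getLast?_append, List.getLast?_singleton, Option.some_or,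
        Option.some.injEq] at ha
      exact ha ▸ ⟨H.hub, H.hub_tail⟩)
  grind

end CrossSystem

/-- The direction `u₀` is reserved for a pyramid arm that ends in `h i`, and `u₁`, `u₂` for arms
that end in leaves of `L (!i)`; the conditions on membership say that these arms can be extended
accordingly. -/
def Fan (G : SimpleGraph V) (J : SimpleGraph W) (M : StripFamily V W) (L : Bool → Set W) (i : Bool)
    (p : List V) (v u₀ : W) : Prop :=
  J.Adj v u₀ ∧ u₀ ∉ L (!i) ∧
    ∃ u₁ u₂, u₁ ≠ u₀ ∧ u₂ ≠ u₀ ∧ u₁ ∉ L i ∧ u₂ ∉ L i ∧ Spread G J M p v u₁ u₂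

theorem Fan.other {v u₀ : W} (hF : Fan G J M L i p v u₀) (u : W) :
    ∃ u', u' ≠ u ∧ u' ≠ u₀ ∧ u' ∉ L i ∧ J.Adj v u' ∧
      ∃ b ∈ M.node v, b ∈ M.edge s(v, u') ∧ Att G p b := by
  obtain ⟨-, -, u₁, u₂, h1, h2, l1, l2, h3, h4, h5, h6, h7⟩ := hF
  grind

/-! ### Where a path from a hub attaches -/

namespace CrossSystem

theorem att_dropLast_hub (C : CrossSystem G J M h L) (H : HubPath G J M h L i p) {x : V}
    (hx : x ∈ M.verts J) (hn : ¬ LeafStrip J M L i x) : ¬ Att G p.dropLast x := fun h1 => by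
  obtain ⟨t, ht, hxt⟩ := H.drop x hx h1
  exact hn (C.leafStrip_of_node ht hxt)

/-- The apex is `h (!i)`, which is not seen, and the first arm ends in `h i`, which is. So the first
arm is never met in its base only, and the first outcome is a fan. In the second outcome either the
first arm is met in its end `h i` alone, and having at least two vertices forces a consecutive pair
on another arm, or another arm is met in its end only, which `hub_end_false` excludes. -/
theorem hub_triple (C : CrossSystem G J M h L) (H : HubPath G J M h L i p) {v y₁ y₂ y₃ : W}
    {R₁ R₂ R₃ : List V} (hy₁ : y₁ ≠ v) (hy₂ : y₂ ≠ v) (hy₃ : y₃ ≠ v) (h12 : nx J v y₁ ≠ nx J v y₂)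
    (h13 : nx J v y₁ ≠ nx J v y₃) (h23 : nx J v y₂ ≠ nx J v y₃) (l1 : y₁ ∉ L (!i)) (l2 : y₂ ∉ L i)
    (l3 : y₃ ∉ L i) (hR₁ : IsRung G M (nx J y₁ v) y₁ R₁) (hR₂ : IsRung G M (nx J y₂ v) y₂ R₂)
    (hR₃ : IsRung G M (nx J y₃ v) y₃ R₃) {z : V} (hz : z ∈ R₂ ∨ z ∈ R₃) (haz : Att G p z) :
    ∃ ℓ t₁ t₂ t₃, Selection G J M ℓ ∧ (∀ x ∈ R₁, x ∈ pl J ℓ v t₁) ∧ (∀ x ∈ R₂, x ∈ pl J ℓ v t₂) ∧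
      (∀ x ∈ R₃, x ∈ pl J ℓ v t₃) ∧ ℓ (nx J y₂ v) y₂ = R₂ ∧ t₂ ∈ L (!i) ∧
      (Beyond J v y₂ t₂ ∧ Beyond J v y₃ t₃) ∧
      ((Fan G J M L i p v (nx J v y₁) ∧ OnlyBase G p (pl J ℓ v t₂) ∧ OnlyBase G p (pl J ℓ v t₃)) ∨
        (∀ x ∈ pl J ℓ v t₁, ¬ Att G p x) ∧
          (PairAtt G p (pl J ℓ v t₂) ∧ (∀ x ∈ pl J ℓ v t₃, ¬ Att G p x) ∨
            PairAtt G p (pl J ℓ v t₃) ∧ ∀ x ∈ pl J ℓ v t₂, ¬ Att G p x)) := by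
  have hJ := C.sys.tree
  obtain ⟨ℓ₀, hℓ₀⟩ := C.exists_selection
  have hii : i ≠ !i := by cases i <;> simp
  have hy : ∀ j, (![y₁, y₂, y₃] : Fin 3 → W) j ≠ v := by
    intro j; fin_cases j <;> assumption
  have hnon : ∀ {z}, z ∈ M.verts J ∨ True → ¬ (h i ∈ M.node v ∧ z ∈ M.node v) := fun _ hn =>
    C.hub_notMem i (C.node_mem_verts hn.1)
  obtain ⟨ℓ, t, hℓ, ht, hbt, hr, -, hpyr, hout⟩ := C.triple hℓ₀ H.tight (i := !i) (v := v)
    (y := ![y₁, y₂, y₃]) (c := ![i, !i, !i]) (R := ![R₁, R₂, R₃]) H.hub' hy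
    (forall_ne_fin3 (fun i j hij => hij.symm) h12 h13 h23)
    (by intro j; fin_cases j <;> simpa)
    (forall_ne_fin3 (fun i j hij => hij.symm) (Or.inr rfl) (Or.inr rfl) (Or.inr rfl))
    (by intro j; fin_cases j <;> assumption)
    (by
      rcases hz with hz | hz
      · exact ⟨0, 1, by decide, h i, Or.inr ⟨hii, rfl⟩, z, hz, H.hub, haz, hnon (Or.inr trivial)⟩
      · exact ⟨0, 2, by decide, h i, Or.inr ⟨hii, rfl⟩, z, hz, H.hub, haz, hnon (Or.inr trivial)⟩)
  have T := C.lineTree hℓ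
  have htv : ∀ j, t j ≠ v := fun j => (hbt j).ne (hy j)
  have hnt : ∀ j, nx J v (t j) = nx J v ((![y₁, y₂, y₃] : Fin 3 → W) j) :=
    fun j => (hbt j).nx_eq hJ (hy j)
  have e0 : arm J ℓ h (!i) v (t 0) i = pl J ℓ v (t 0) ++ [h i] := if_neg hii
  have e : ∀ s, arm J ℓ h (!i) v s (!i) = pl J ℓ v s := fun s => if_pos rfl
  -- an arm that is met only at its end contradicts parity
  have kill : ∀ {w t}, w ∈ L (!i) → t ∈ L (!i) → w ≠ v → t ≠ v → nx J v w ≠ nx J v t →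
      OnlyEnd G p (pl J ℓ v w) → ¬ ∀ x ∈ pl J ℓ v t, ¬ Att G p x := by
    intro w t hw ht hwv htv hne ⟨⟨y, hy, hay⟩, hend⟩ hun
    have hsw := (nx_adj hJ hwv.symm).symm
    have hback := nx_nx_ne hJ hwv.symm
    generalize hs : nx J w v = s at hsw hback
    have hp : pl J ℓ v w = pl J ℓ v s ++ ℓ s w := pl_concat hJ ℓ hsw fun _ => hback.symm
    have hlast := hend y hy hay
    have hnd := (T.pl_ip v w).nodup
    rw [hp, List.nodup_append] at hnd
    rw [hp, List.getLast?_append, Option.or_of_isSome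
      (List.getLast?_isSome.2 (T.ne s w hsw))] at hlast
    have hyl := List.mem_of_getLast? hlast
    have huniq : ∀ z ∈ pl J ℓ v w, Att G p z → z = y := fun z hz haz =>
      Option.some.inj ((hend z hz haz).symm.trans (hend y hy hay))
    have hts : t ≠ s := fun h1 => C.nbr_not_leaf hsw hw _ (h1 ▸ ht)
    refine C.hub_end_false hℓ H hsw hw hyl (((hℓ.isRung hsw).snd y hyl).2 hlast) hay
      (fun z hz => huniq z (by grind)) ht hts ?_ ?_
    · by_cases hsv : s = v
      · subst hsv
        rw [← nx_of_adj hJ hsw]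
        exact hne.symm
      · have hb : Beyond J v s w := Or.inr (by rw [nx_of_adj hJ hsw]; exact hback)
        have hb' : Beyond J s v t := Or.inr (by rw [← hb.nx_eq hJ hsv]; exact hne)
        rw [hb'.nx_eq hJ (Ne.symm hsv)]
        exact hback
    · intro z hz haz
      by_cases hsv : s = v
      · grind
      have hb : Beyond J v s w := Or.inr (by rw [nx_of_adj hJ hsw]; exact hback)
      have hb' : Beyond J s v t := Or.inr (by rw [← hb.nx_eq hJ hsv]; exact hne)
      rw [hb'.pl_eq hJ, List.mem_append, T.pl_reverse v s, List.mem_reverse] at hz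
      grind
  refine ⟨ℓ, t 0, t 1, t 2, hℓ, fun x hx => C.mem_pl_of_mem hy₁ (hbt 0) 
      (by rwa [show ℓ (nx J y₁ v) y₁ = R₁ from hr 0]),
    fun x hx => C.mem_pl_of_mem hy₂ (hbt 1) 
      (by rwa [show ℓ (nx J y₂ v) y₂ = R₂ from hr 1]),
    fun x hx => C.mem_pl_of_mem hy₃ (hbt 2) 
      (by rwa [show ℓ (nx J y₃ v) y₃ = R₃ from hr 2]), hr 1, ht 1,
    ⟨hbt 1, hbt 2⟩, ?_⟩
  have hd : nx J v (t 1) ≠ nx J v (t 2) := by rw [hnt 1, hnt 2]; exact h23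
  rcases hout with ⟨j, -, hB⟩ | ⟨j, k, l, hjk, hjl, hkl, hE, hP, -, hl⟩
  · have hj : j = 0 := by
      by_contra hj
      have h1 := (hB 0 (Ne.symm hj)).2 (h i) (by simp [e0]) H.hub
      change (arm J ℓ h (!i) v (t 0) i).head? = _ at h1
      rw [e0, List.head?_append, Option.or_of_isSome
        (by simpa using T.pl_ne_nil (htv 0))] at h1
      exact T.hub_notMem_pl _ _ _ (List.mem_of_mem_head? h1)
    subst hj
    have B1 := hB 1 (by decide)
    have B2 := hB 2 (by decide)
    refine Or.inl ⟨⟨nx_adj hJ hy₁, fun h1 => l1 ?_, nx J v y₂, nx J v y₃, h12.symm, h13.symm,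
      fun h1 => l2 ?_, fun h1 => l3 ?_, ?_⟩, by rw [← e]; exact B1, by rw [← e]; exact B2⟩
    · rwa [C.far_leaf (nx_adj hJ hy₁) h1 rfl]
    · rwa [C.far_leaf (nx_adj hJ hy₂) h1 rfl]
    · rwa [C.far_leaf (nx_adj hJ hy₃) h1 rfl]
    · have := C.spread_of_base hℓ (i := !i) (c := ![i, !i, !i]) htv hd B1 B2
      rwa [hnt 1, hnt 2] at this
  · have hl0 : l ≠ 0 := by
      rintro rfl
      exact hl (h i) (by simp [e0]) H.hub
    have hj : (j = 0 ∧ k = 1 ∧ l = 2) ∨ (j = 0 ∧ k = 2 ∧ l = 1) ∨ (j = 1 ∧ l = 2) ∨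
        (j = 2 ∧ l = 1) := by
      clear hE hP hl
      revert j k l
      decide
    have hend0 : ∀ {q : List V}, OnlyEnd G p (arm J ℓ h (!i) v (t 0) i) →
        ∀ x ∈ pl J ℓ v (t 0), ¬ Att G p x := by
      intro q hE x hx hax
      have h1 := hE.2 x (by simp [e0, hx]) hax
      rw [e0, List.getLast?_concat, Option.some.injEq] at h1
      exact T.hub_notMem_pl _ _ _ (h1 ▸ hx)
    have hlen : 2 ≤ (arm J ℓ h (!i) v (t 0) i).length := by
      have := List.length_pos_of_ne_nil (T.pl_ne_nil (htv 0))
      rw [e0, List.length_append]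
      simp; omega
    rcases hj with ⟨rfl, rfl, rfl⟩ | ⟨rfl, rfl, rfl⟩ | ⟨rfl, rfl⟩ | ⟨rfl, rfl⟩
    · simp_all
    · simp_all
    · exact absurd (by rw [← e]; exact hl)
        (kill (ht 1) (ht 2) (htv 1) (htv 2) hd (by rw [← e]; exact hE))
    · exact absurd (by rw [← e]; exact hl)
        (kill (ht 2) (ht 1) (htv 2) (htv 1) hd.symm (by rw [← e]; exact hE))

theorem onlyBase_mem (C : CrossSystem G J M h L) (hℓ : Selection G J M ℓ) {v t : W}
    (hB : OnlyBase G p (pl J ℓ v t)) {z : V} (hz : z ∈ pl J ℓ v t) :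
    Att G p z ↔ z ∈ M.node v := by
  rw [← C.pl_head_iff hℓ hz]
  refine ⟨hB.2 z hz, fun h1 => ?_⟩
  obtain ⟨⟨w, hw, haw⟩, hB⟩ := hB
  grind

/-- For an attachment in a leaf strip of `L i` the centre is moved to the inner end of that strip; a
fan there would put an attachment in M_v into the wrong node. In all other cases the attachment can
be placed on one of the two arms of a pyramid at `v` which are met in their bases. -/
theorem fan_node (C : CrossSystem G J M h L) (H : HubPath G J M h L i p) {v u₀ u : W}
    (hF : Fan G J M L i p v u₀) (hL : ∀ t ∈ L i, J.Adj v t → t = u₀) {z : V}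
    (hz : MBranch J M v u z) (hu : u ≠ u₀) (haz : Att G p z) : z ∈ M.node v := by
  have hJ := C.sys.tree
  by_contra hzv
  obtain ⟨y, hy, rfl, hzy⟩ := hz
  obtain ⟨u', h1, h2, h3, h4, b, hbv, hb, hab⟩ := hF.other (nx J v y)
  obtain ⟨R₂, hR₂, hb2⟩ := C.exists_rung h4 hb
  have nu' := nx_of_adj hJ h4
  by_cases hyL : y ∈ L i
  · have hsy := (nx_adj hJ hy.symm).symm
    generalize hs : nx J y v = s at hzy hsy
    have hsv : s ≠ v := by
      rintro rfl
      have h5 := hL y hyL hsy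
      exact hu (by rw [nx_of_adj hJ hsy, h5])
    have hbs : Beyond J v s y := Or.inr (by
      rw [nx_of_adj hJ hsy, ← hs]
      exact nx_nx_ne hJ hy.symm)
    have hvs : nx J v s = nx J v y := (hbs.nx_eq hJ hsv).symm
    have hb' : Beyond J s v u' := Or.inr (by grind)
    have hus : u' ≠ s := by grind
    have nus : nx J u' s = v := nx_back hJ h4 (by grind)
    have nsu : nx J s u' = nx J s v := hb'.nx_eq hJ hsv.symm
    have hq : nx J s u' ≠ y := by
      rw [nsu, ← hs]
      exact nx_nx_ne hJ hy.symm
    have nsy := nx_of_adj hJ hsy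
    obtain ⟨x, hx, hxy, hxq⟩ := C.exists_third_nbr hsy (nx_adj hJ hus) hq.symm
    have nsx := nx_of_adj hJ hx
    obtain ⟨R₁, hR₁, hz1⟩ := C.exists_rung hsy hzy
    obtain ⟨R₃, hR₃⟩ := C.exists_rung_dir hx
    obtain ⟨ℓ, t₁, t₂, t₃, hℓ, m1, m2, m3, -, -, -, ⟨-, hB, -⟩ | ⟨hun, -⟩⟩ := C.hub_triple H
      hsy.ne' hus hx.ne' (by grind) (by grind)
      (by grind) (C.disj _ _ hyL) h3
      (fun h5 => hxy (C.one i s ⟨hx, h5⟩ ⟨hsy, hyL⟩)) (by rwa [nx_of_adj hJ hsy.symm])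
      (by rwa [nus]) hR₃ (Or.inl hb2) hab
    · have h6 := C.node_mem_edge h4 hb ((C.onlyBase_mem hℓ hB (m2 b hb2)).1 hab)
      grind
    grind
  · obtain ⟨R₁, hR₁⟩ := C.exists_rung_dir hF.1
    obtain ⟨R, hR, hzR⟩ := C.exists_rung_far hy hzy
    have nu₀ := nx_of_adj hJ hF.1
    obtain ⟨ℓ, t₁, t₂, t₃, hℓ, m1, m2, m3, -, -, -, ⟨-, hB, -⟩ | ⟨-, ⟨-, hun⟩ | ⟨-, hun⟩⟩⟩ :=
      C.hub_triple H hF.1.ne' hy h4.ne' (by grind) (by grind)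
        (by grind) hF.2.1 hyL h3 hR₁ hR (by rwa [nx_of_adj hJ h4.symm])
        (Or.inl hzR) haz
    · exact hzv ((C.onlyBase_mem hℓ hB (m2 z hzR)).1 haz)
    · grind
    grind

/-- The path leaving `v` has only one vertex in M_v. -/
theorem pairAtt_false (C : CrossSystem G J M h L) (hℓ : Selection G J M ℓ) {v t : W}
    (hP : PairAtt G p (pl J ℓ v t)) (hall : ∀ z ∈ pl J ℓ v t, Att G p z → z ∈ M.node v) : False := by
  obtain ⟨a, x, y, b, e, hx, hy, -, -⟩ := hP
  have mx : x ∈ pl J ℓ v t := by simp [e]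
  have my : y ∈ pl J ℓ v t := by simp [e]
  have h1 := (C.pl_head_iff hℓ mx).2 (hall x mx hx)
  rw [(C.pl_head_iff hℓ my).2 (hall y my hy), Option.some.injEq] at h1
  have h2 := ((C.lineTree hℓ).pl_ip v t).nodup
  grind

theorem fan_complete (C : CrossSystem G J M h L) (H : HubPath G J M h L i p) {v u₀ u : W}
    (hF : Fan G J M L i p v u₀) (hL : ∀ t ∈ L i, J.Adj v t → t = u₀) {y : V} (hu : u ≠ u₀)
    (hvu : J.Adj v u) (hyv : y ∈ M.node v) (hy : y ∈ M.edge s(v, u)) : Att G p y := by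
  have hJ := C.sys.tree
  obtain ⟨u', h1, h2, h3, h4, b, hbv, hb, hab⟩ := hF.other u
  obtain ⟨R₁, hR₁⟩ := C.exists_rung_dir hF.1
  obtain ⟨R₂, hR₂, hy2⟩ := C.exists_rung hvu hy
  obtain ⟨R₃, hR₃, hb3⟩ := C.exists_rung h4 hb
  have nu₀ := nx_of_adj hJ hF.1
  have nu := nx_of_adj hJ hvu
  have nu' := nx_of_adj hJ h4
  obtain ⟨ℓ, t₁, t₂, t₃, hℓ, m1, m2, m3, -, -, hb, ⟨-, hB, -⟩ | ⟨-, ⟨-, hun⟩ | ⟨hP, hun⟩⟩⟩ :=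
    C.hub_triple H hF.1.ne' hvu.ne' h4.ne' (by grind)
      (by grind) (by grind) hF.2.1
      (fun h5 => hu (hL u h5 hvu)) h3 hR₁ (by rwa [nx_of_adj hJ hvu.symm])
      (by rwa [nx_of_adj hJ h4.symm]) (Or.inr hb3) hab
  · exact (C.onlyBase_mem hℓ hB (m2 y hy2)).2 hyv
  · grind
  · refine absurd hP fun hP => C.pairAtt_false hℓ hP fun z hz haz => ?_
    refine C.fan_node H hF hL (C.mBranch_of_pl hℓ hz).2 ?_ haz
    rw [hb.2.nx_eq hJ h4.ne', nu']
    exact h2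

/-- The path attaches exactly to the node `v`. -/
def _root_.TreeStrip.NodeAttach (G : SimpleGraph V) (J : SimpleGraph W) (M : StripFamily V W)
    (L : Bool → Set W) (i : Bool) (p : List V) : Prop :=
  ∃ v, (∀ c, v ∉ L c) ∧ (∀ t ∈ L i, ¬ J.Adj v t) ∧ (∀ x ∈ M.verts J, Att G p x ↔ x ∈ M.node v) ∧
    ∀ x ∈ M.node v, ¬ Att G p.dropLast x

/-- The path attaches exactly to two consecutive vertices of some line tree. -/
def _root_.TreeStrip.EdgeAttach (G : SimpleGraph V) (J : SimpleGraph W) (M : StripFamily V W)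
    (L : Bool → Set W) (i : Bool) (p : List V) : Prop :=
  ∃ v u ℓ A x y B, Selection G J M ℓ ∧ J.Adj v u ∧ (∀ c, v ∉ L c) ∧ u ∉ L i ∧
    ℓ v u = A ++ x :: y :: B ∧ Att G p x ∧ Att G p y ∧ ¬ Att G p.dropLast x ∧
    ¬ Att G p.dropLast y ∧ ∀ a b, J.Adj a b → ∀ z ∈ ℓ a b, Att G p z → z = x ∨ z = y

/-- If `v` has a leaf neighbour in `L i`, that leaf can serve as `u₀`, and `p` would be a new rung
of its strip. If not, the direction reserved for the hub can be exchanged for another one, and the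
two resulting fans together control all directions at `v`. -/
theorem nodeAttach_of_fan (C : CrossSystem G J M h L) (hmax : MaxVerts G J M h L)
    (H : HubPath G J M h L i p) {v u₀ : W} (hF : Fan G J M L i p v u₀) : NodeAttach G J M L i p := by
  have hJ := C.sys.tree
  obtain ⟨u₁, u₂, n1, n2, l1, l2, hne, a1, a2, ⟨b₁, hb₁v, hb₁, hab₁⟩, b₂, hb₂v, hb₂, hab₂⟩ := hF.2.2
  have hv := C.not_leaf_of_two a1 a2 hne
  have hnotstrip : ∀ {x u}, x ∈ M.node v → J.Adj v u → x ∈ M.edge s(v, u) → u ∉ L i →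
      ¬ LeafStrip J M L i x := by
    rintro x u - hvu hxu hu ⟨s, t, hst, ht, hxs⟩
    have := C.mem_edge_unique hvu hst hxu hxs
    grind
  by_cases hex : ∃ t ∈ L i, J.Adj v t
  · obtain ⟨t, ht, hvt⟩ := hex
    have hF' : Fan G J M L i p v t := ⟨hvt, C.disj _ _ ht, u₁, u₂, fun h1 => l1 (h1 ▸ ht),
      fun h1 => l2 (h1 ▸ ht), l1, l2, hne, a1, a2, ⟨b₁, hb₁v, hb₁, hab₁⟩, b₂, hb₂v, hb₂, hab₂⟩
    have hL : ∀ t' ∈ L i, J.Adj v t' → t' = t := fun t' ht' hvt' => C.one i v ⟨hvt', ht'⟩ ⟨hvt, ht⟩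
    refine (C.enlarge_path_false hmax hvt H.tight.ip H.tight.ne H.tight.out (fun x hx hxe hax => ?_)
      (fun x hxv hxe => ?_) (fun x hxt hxe => ?_) (fun c f hf => ?_)).elim
    · obtain ⟨y, hy, hxy⟩ := C.exists_branch v hx
      by_cases hyt : nx J v y = t
      · have := C.far_leaf hvt ht hyt
        subst this
        rw [nx_of_adj hJ hvt.symm] at hxy
        grind
      · exact Or.inl (C.fan_node H hF' hL ⟨y, hy, rfl, hxy⟩ hyt hax)
    · obtain ⟨u, hu, hxu⟩ := C.exists_edge_of_node hxv
      have hut : u ≠ t := by grind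
      exact ⟨C.fan_complete H hF' hL hut hu hxv hxu, C.att_dropLast_hub H (C.node_mem_verts hxv)
        (hnotstrip hxv hu hxu fun h1 => hut (hL u h1 hu))⟩
    · obtain ⟨u, hu, hxu⟩ := C.exists_edge_of_node hxt
      rw [C.leaf_unique ht hu hvt.symm, Sym2.eq_swap] at hxu
      grind
    · by_cases hci : c = i
      · subst hci
        simp only [ht, true_and, hv, false_and, false_or]
        rw [G.adj_comm]
        exact not_att_tail_iff H.tight.ip H.hub H.hub_tail hf
      · rw [Bool.eq_not_of_ne hci]
        refine ⟨fun h1 => absurd ⟨f, hf, h1.symm⟩ H.hub', ?_⟩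
        rintro (h1 | h1)
        exacts [absurd h1.1 (hv _), absurd h1.1 (C.disj _ _ ht)]
  · push Not at hex
    have hL : ∀ u t, t ∈ L i → J.Adj v t → t = u := fun u t ht hvt => absurd hvt (hex t ht)
    have hL' : ∀ {u}, J.Adj v u → u ∉ L i := fun hu h1 => hex _ h1 hu
    -- the direction of the hub arm can be changed
    obtain ⟨w₁, hw₁, w₁u, w₁L⟩ : ∃ w₁, J.Adj v w₁ ∧ w₁ ≠ u₀ ∧ w₁ ∉ L (!i) := by
      by_cases h1 : u₁ ∈ L (!i)
      · exact ⟨u₂, a2, n2, fun h2 => hne (C.one _ v ⟨a1, h1⟩ ⟨a2, h2⟩)⟩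
      grind
    obtain ⟨w₂, w₂w, w₂u, w₂L, hw₂, b, hbv, hb, hab⟩ := hF.other w₁
    have hF₁ : Fan G J M L i p v w₁ := by
      obtain ⟨R₁, hR₁⟩ := C.exists_rung_dir hw₁
      obtain ⟨R₂, hR₂⟩ := C.exists_rung_dir hF.1
      obtain ⟨R₃, hR₃, hb3⟩ := C.exists_rung hw₂ hb
      have e1 := nx_of_adj hJ hw₁
      have e2 := nx_of_adj hJ hF.1
      have e3 := nx_of_adj hJ hw₂
      obtain ⟨ℓ, t₁, t₂, t₃, hℓ, m1, m2, m3, -, -, hb, ⟨hFan, -⟩ | ⟨-, ⟨-, hun⟩ | ⟨hP, hun⟩⟩⟩ :=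
        C.hub_triple H hw₁.ne' hF.1.ne' hw₂.ne' (by rwa [e1, e2]) (by grind)
          (by grind) w₁L (hL' hF.1) w₂L hR₁ hR₂
          (by rwa [nx_of_adj hJ hw₂.symm]) (Or.inr hb3) hab
      · rwa [e1] at hFan
      · grind
      · refine (C.pairAtt_false hℓ hP fun z hz haz => ?_).elim
        refine C.fan_node H hF (hL u₀) (C.mBranch_of_pl hℓ hz).2 ?_ haz
        rw [hb.2.nx_eq hJ hw₂.ne', e3]
        exact w₂u
    refine ⟨v, hv, hex, fun x hx => ⟨fun hax => ?_, fun hxv => ?_⟩, fun x hxv => ?_⟩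
    · obtain ⟨y, hy, hxy⟩ := C.exists_branch v hx
      by_cases hyu : nx J v y = u₀
      · exact C.fan_node H hF₁ (hL w₁) ⟨y, hy, rfl, hxy⟩ (by grind) hax
      · exact C.fan_node H hF (hL u₀) ⟨y, hy, rfl, hxy⟩ hyu hax
    · obtain ⟨u, hu, hxu⟩ := C.exists_edge_of_node hxv
      by_cases huu : u = u₀
      · exact C.fan_complete H hF₁ (hL w₁) (huu ▸ w₁u.symm) hu hxv hxu
      · exact C.fan_complete H hF (hL u₀) huu hu hxv hxu
    · obtain ⟨u, hu, hxu⟩ := C.exists_edge_of_node hxv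
      exact C.att_dropLast_hub H (C.node_mem_verts hxv) (hnotstrip hxv hu hxu (hL' hu))

/-- Two attachments in different directions give a `Fan`. -/
theorem fan_of_two (C : CrossSystem G J M h L) (H : HubPath G J M h L i p) {s y w : W} {a b : V}
    (hsy : J.Adj s y) (ha : a ∈ M.edge s(s, y)) (haa : Att G p a) (hws : w ≠ s)
    (hne : y ≠ nx J s w) (hwL : w ∉ L i) (hb : b ∈ M.edge s(nx J w s, w)) (hab : Att G p b) :
    ∃ v u, Fan G J M L i p v u := by
  have hJ := C.sys.tree
  obtain ⟨x, hx, hxy, hxw⟩ := C.exists_third_nbr hsy (nx_adj hJ hws) hne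
  obtain ⟨Ra, hRa, ha'⟩ := C.exists_rung hsy ha
  obtain ⟨Rb, hRb, hb'⟩ := C.exists_rung_far hws hb
  obtain ⟨Rx, hRx⟩ := C.exists_rung_dir hx
  have ny := nx_of_adj hJ hsy
  have nx' := nx_of_adj hJ hx
  have hRa' : IsRung G M (nx J y s) y Ra := by rwa [nx_of_adj hJ hsy.symm]
  -- The third direction carries the hub arm if the labels allow it; the remaining case lets the
  -- direction of `y` carry it.
  have base : x ∉ L (!i) → y ∉ L i → ∃ v u, Fan G J M L i p v u := by
    intro hxL hyL
    obtain ⟨ℓ, t₁, t₂, t₃, hℓ, m1, m2, m3, -, -, -, ⟨hFan, -⟩ | ⟨-, ⟨-, hun⟩ | ⟨-, hun⟩⟩⟩ :=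
      C.hub_triple H hx.ne' hsy.ne' hws (by rwa [nx', ny]) (by rwa [nx']) (by rwa [ny]) hxL hyL hwL
        hRx hRa' hRb (Or.inl ha') haa
    · grind
    · grind
    grind
  by_cases hxL : x ∈ L i
  · exact base (C.disj _ _ hxL) fun h1 => hxy (C.one i s ⟨hx, hxL⟩ ⟨hsy, h1⟩)
  by_cases hyL : y ∈ L (!i)
  · exact base (fun h1 => hxy (C.one _ s ⟨hx, h1⟩ ⟨hsy, hyL⟩)) (by simpa using C.disj _ _ hyL)
  obtain ⟨ℓ, t₁, t₂, t₃, hℓ, m1, m2, m3, -, -, -, ⟨hFan, -⟩ | ⟨hun, -⟩⟩ :=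
    C.hub_triple H hsy.ne' hws hx.ne' (by rwa [ny]) (by grind)
      (by grind) hyL hwL hxL hRa' hRb hRx (Or.inl hb') hab
  · grind
  grind

/-- A path from a hub into a maximal system attaches in one of two ways. -/
theorem hubPath_attach (C : CrossSystem G J M h L) (hmax : MaxVerts G J M h L)
    (H : HubPath G J M h L i p) : NodeAttach G J M L i p ∨ EdgeAttach G J M L i p := by
  have hJ := C.sys.tree
  by_cases hfan : ∃ v u, Fan G J M L i p v u
  · obtain ⟨v, u, hF⟩ := hfan
    exact Or.inl (C.nodeAttach_of_fan hmax H hF)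
  right
  obtain ⟨y, hy, hay, hyL⟩ := H.exists_att
  obtain ⟨v, u, hvu, hv, hye⟩ : ∃ v u, J.Adj v u ∧ (∀ c, v ∉ L c) ∧ y ∈ M.edge s(v, u) := by
    simp only [StripFamily.verts, Set.mem_iUnion] at hy
    obtain ⟨e, he, hye⟩ := hy
    induction e using Sym2.ind with | _ a b =>
    by_cases ha : ∃ c, a ∈ L c
    · obtain ⟨c, hc⟩ := ha
      exact ⟨b, a, SimpleGraph.Adj.symm he, C.nbr_not_leaf (SimpleGraph.Adj.symm he) hc,
        by grind⟩
    · exact ⟨a, b, he, fun c hc => ha ⟨c, hc⟩, hye⟩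
  have huL : u ∉ L i := fun h1 => hyL ⟨v, u, hvu, h1, hye⟩
  -- Without a fan, all attachments lie in one strip.
  have hall : ∀ x ∈ M.verts J, Att G p x → x ∈ M.edge s(v, u) := by
    intro x hx hax
    by_contra hxe
    obtain ⟨v', u', w, h1, h2, h3, h4, h5⟩ := C.exists_split hx hy fun ⟨e, he, hxe', hye'⟩ =>
      hxe (C.mem_edge_unique hvu he hye hye' ▸ hxe')
    exact hfan (C.fan_of_two H h1 h4 hax h2 h3 (C.not_leafStrip_far h2 h5 hyL) h5 hay)
  obtain ⟨a, b, ha, hb, hau, hbu, hab⟩ := C.exists_two hv hvu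
  -- Since `v` has at most one neighbour in each class, two further directions can be named so that
  -- the first may carry the hub arm and the second leads to a leaf of `L (!i)`.
  obtain ⟨y₁, y₃, d1, d3, d1u, d3u, d13, L1, L3⟩ : ∃ y₁ y₃, J.Adj v y₁ ∧ J.Adj v y₃ ∧ y₁ ≠ u ∧
      y₃ ≠ u ∧ y₁ ≠ y₃ ∧ y₁ ∉ L (!i) ∧ y₃ ∉ L i := by
    have key : ∀ c, a ∉ L c ∨ b ∉ L c := by
      intro c
      by_contra hcon
      push Not at hcon
      exact hab (C.one c v ⟨ha, hcon.1⟩ ⟨hb, hcon.2⟩)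
    by_cases h1 : a ∈ L i
    · exact ⟨a, b, ha, hb, hau, hbu, hab, C.disj _ _ h1, (key i).resolve_left (not_not.2 h1)⟩
    · by_cases h2 : b ∈ L (!i)
      · exact ⟨a, b, ha, hb, hau, hbu, hab, (key _).resolve_right (not_not.2 h2),
          by simpa using C.disj _ _ h2⟩
      grind
  obtain ⟨R₁, hR₁⟩ := C.exists_rung_dir d1
  obtain ⟨R₂, hR₂, hy2⟩ := C.exists_rung hvu hye
  obtain ⟨R₃, hR₃⟩ := C.exists_rung_dir d3
  have e1 := nx_of_adj hJ d1
  have e2 := nx_of_adj hJ hvu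
  have e3 := nx_of_adj hJ d3
  obtain ⟨ℓ, t₁, t₂, t₃, hℓ, m1, m2, m3, r2, ht₂, ⟨hb2, -⟩, ⟨hFan, -⟩ | ⟨-, ⟨hP, -⟩ | ⟨-, hun⟩⟩⟩ :=
    C.hub_triple H d1.ne' hvu.ne' d3.ne' (by rwa [e1, e2]) (by rwa [e1, e3])
      (by grind) L1 huL L3 hR₁ (by rwa [nx_of_adj hJ hvu.symm]) hR₃
      (Or.inl hy2) hay
  · grind
  swap
  · grind
  rw [nx_of_adj hJ hvu.symm] at r2
  obtain ⟨A, x₀, x₁, B, hpl, hx₀, hx₁, hA, hB⟩ := hP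
  have hpe := hb2.pl_eq hJ ℓ
  rw [pl_adj hJ ℓ hvu] at hpe
  have inr : ∀ z ∈ pl J ℓ v t₂, Att G p z → z ∈ ℓ v u := by
    intro z hz haz
    have hzv := C.mBranch_verts (C.mBranch_of_pl hℓ hz).2
    rw [hpe, List.mem_append] at hz
    refine hz.resolve_right fun h1 => ?_
    obtain ⟨q1, q2⟩ := C.mBranch_of_pl hℓ h1
    have h2 : nx J u t₂ ≠ v := by
      rcases hb2 with h3 | h3
      · grind
      · rw [nx_of_adj hJ hvu.symm] at h3
        exact h3.symm
    obtain ⟨y', f1, f2, f3⟩ := q2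
    have f4 := C.mem_edge_unique (far_edge_mem hJ f1) hvu f3 (hall z hzv haz)
    have h5 : u ∈ s(nx J y' u, y') := by rw [f4]; simp
    obtain ⟨f5, f6⟩ := mem_far_edge_self hJ f1 h5
    grind
  have i0 := inr x₀ (by simp [hpl]) hx₀
  have i1 := inr x₁ (by simp [hpl]) hx₁
  have hstrip : ∀ z ∈ ℓ v u, ¬ LeafStrip J M L i z := by
    rintro z hz ⟨s, t, hst, ht, hzs⟩
    have := C.mem_edge_unique hvu hst (hℓ.sub v u hvu z hz) hzs
    grind
  have hdrop : ∀ z ∈ ℓ v u, ¬ Att G p.dropLast z := fun z hz =>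
    C.att_dropLast_hub H (mem_verts_of_edge hvu (hℓ.sub v u hvu z hz)) (hstrip z hz)
  -- The pair is consecutive on the whole tree path and both members lie in the rung at `v u`, so
  -- they are consecutive within this rung.
  obtain ⟨B', hB'⟩ : ∃ B', ℓ v u = A ++ x₀ :: x₁ :: B' := by
    have h1 : (A ++ [x₀, x₁]) ++ B = ℓ v u ++ pl J ℓ u t₂ := by grind
    rcases List.append_eq_append_iff.1 h1 with ⟨q, h2, h3⟩ | ⟨q, h2, h3⟩
    · grind
    · rcases List.eq_nil_or_concat q with rfl | ⟨q', c, rfl⟩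
      · grind
      · have h4 : c = x₁ := by
          have := congrArg List.getLast? h2
          grind
        have h5 := ((C.lineTree hℓ).pl_ip v t₂).nodup
        grind
  refine ⟨v, u, ℓ, A, x₀, x₁, B', hℓ, hvu, hv, huL, hB', hx₀, hx₁, hdrop _ i0, hdrop _ i1, ?_⟩
  intro c d hcd z hz haz
  have hze := hℓ.sub c d hcd z hz
  have hzc := C.mem_edge_unique hcd hvu hze (hall z (mem_verts_of_edge hcd hze) haz)
  have hzl : z ∈ ℓ v u := by
    rw [Sym2.eq_iff] at hzc
    rcases hzc with ⟨rfl, rfl⟩ | ⟨rfl, rfl⟩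
    · exact hz
    · rwa [hℓ.rev d c hvu, List.mem_reverse] at hz
  grind

end CrossSystem

end Context

/-! ### Adding one vertex to a tree -/

section Extensions

variable {U U' : Type*}

/-- `J'` arises from `J` by adding one vertex `q`, with neighbours `Q`. -/
structure Ext (J : SimpleGraph U) (J' : SimpleGraph U') (σ : U → U') (q : U') (Q : Set U) :
    Prop where
  inj : Function.Injective σ
  ne : ∀ u, σ u ≠ q
  cov : ∀ x, x = q ∨ ∃ u, x = σ u
  adj : ∀ u v, J'.Adj (σ u) (σ v) ↔ J.Adj u v
  adj_new : ∀ u, J'.Adj q (σ u) ↔ u ∈ Q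

theorem exists_ext {n : ℕ} (e : U ≃ Fin n) (J : SimpleGraph U) (Q : Set U) :
    ∃ (J' : SimpleGraph (Fin (n + 1))) (σ : U → Fin (n + 1)) (q : Fin (n + 1)), Ext J J' σ q Q := by
  have hinj : Function.Injective fun u => (e u).castSucc :=
    (Fin.castSucc_injective n).comp e.injective
  have hne : ∀ u, (e u).castSucc ≠ Fin.last n := fun u => (Fin.castSucc_lt_last _).ne
  refine ⟨SimpleGraph.fromRel fun x y => (∃ u v, x = (e u).castSucc ∧ y = (e v).castSucc ∧
    J.Adj u v) ∨ (x = Fin.last n ∧ ∃ u ∈ Q, y = (e u).castSucc), fun u => (e u).castSucc,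
    Fin.last n, hinj, hne, fun x => ?_, fun u v => ?_, fun u => ?_⟩
  · rcases Fin.eq_castSucc_or_eq_last x with ⟨y, rfl⟩ | rfl
    · exact Or.inr ⟨e.symm y, by simp⟩
    grind
  · rw [SimpleGraph.fromRel_adj]
    constructor
    · rintro ⟨-, (⟨u', v', h1, h2, h3⟩ | h1) | ⟨u', v', h1, h2, h3⟩ | h1⟩
      · simp_all
      · grind
      · rw [hinj h1, hinj h2]
        exact h3.symm
      grind
    · exact fun h1 => ⟨fun h2 => h1.ne (hinj h2), Or.inl (Or.inl ⟨u, v, rfl, rfl, h1⟩)⟩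
  · rw [SimpleGraph.fromRel_adj]
    constructor
    · rintro ⟨-, (⟨u', v', h1, -⟩ | ⟨-, u', hu', h2⟩) | ⟨u', v', h1, h2, h3⟩ | ⟨h1, -⟩⟩
      · grind
      · rwa [hinj h2]
      · grind
      grind
    grind

variable {J J₀ : SimpleGraph U} {J' : SimpleGraph U'} {σ : U → U'} {q : U'} {Q : Set U}

namespace Ext

theorem edge_cases (X : Ext J J' σ q Q) {e : Sym2 U'} (he : e ∈ J'.edgeSet) :
    (∃ f ∈ J.edgeSet, e = f.map σ) ∨ ∃ u ∈ Q, e = s(q, σ u) := by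
  induction e using Sym2.ind with | _ x y =>
  rw [SimpleGraph.mem_edgeSet] at he
  rcases X.cov x with rfl | ⟨u, rfl⟩ <;> rcases X.cov y with rfl | ⟨v, rfl⟩
  · simp_all
  · exact Or.inr ⟨v, (X.adj_new v).1 he, rfl⟩
  · exact Or.inr ⟨u, (X.adj_new u).1 he.symm, Sym2.eq_swap⟩
  · exact Or.inl ⟨s(u, v), (X.adj u v).1 he, rfl⟩

theorem map_ne (X : Ext J J' σ q Q) (f : Sym2 U) (u : U) : f.map σ ≠ s(q, σ u) := by
  intro h1
  have : q ∈ f.map σ := by rw [h1]; simp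
  obtain ⟨a, -, ha⟩ := Sym2.mem_map.1 this
  exact X.ne a ha

/-- A connected graph with one edge fewer than vertices is a tree. The graph `J₀` is what is kept of
`J`, so the same count covers subdividing, where one edge is lost and two are gained, and adding a
pendant edge. -/
theorem isTree (X : Ext J₀ J' σ q Q) [Finite U] (hJ : J.IsTree) {a : U} (ha : a ∈ Q)
    (hw : ∀ u v, J.Adj u v → J'.Reachable (σ u) (σ v))
    (hE : J₀.edgeSet.ncard + Q.ncard ≤ J.edgeSet.ncard + 1) : J'.IsTree := by
  have hUq : (Set.univ : Set U') = insert q (Set.range σ) := by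
    ext x
    rcases X.cov x with rfl | ⟨u, rfl⟩ <;> simp
  have hfin : Finite U' := by
    rw [← Set.finite_univ_iff, hUq]
    exact (Set.finite_range σ).insert q
  have hcard : Nat.card U' = Nat.card U + 1 := by
    rw [← Set.ncard_univ U', hUq, Set.ncard_insert_of_notMem (by rintro ⟨u, hu⟩; exact X.ne u hu),
      ← Set.image_univ, Set.ncard_image_of_injective _ X.inj, Set.ncard_univ]
  have hconn : J'.Connected := by
    have key : ∀ u v, J'.Reachable (σ u) (σ v) := by
      intro u v
      obtain ⟨w⟩ := hJ.connected.preconnected u v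
      induction w with
      | nil => simp_all
      | cons hadj _ ih => exact (hw _ _ hadj).trans ih
    have key2 : ∀ x, J'.Reachable x (σ a) := by
      intro x
      rcases X.cov x with rfl | ⟨u, rfl⟩
      · exact ((X.adj_new a).2 ha).reachable
      · exact key u a
    have : Nonempty U' := ⟨q⟩
    exact ⟨fun x y => (key2 x).trans (key2 y).symm⟩
  rw [SimpleGraph.isTree_iff_connected_and_card]
  refine ⟨hconn, le_antisymm ?_ hconn.card_vert_le_card_edgeSet_add_one⟩
  have h1 := (SimpleGraph.isTree_iff_connected_and_card.1 hJ).2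
  have h2 : J'.edgeSet ⊆ Sym2.map σ '' J₀.edgeSet ∪ (fun u => s(q, σ u)) '' Q := by
    intro e he
    rcases X.edge_cases he with ⟨f, hf, rfl⟩ | ⟨u, hu, rfl⟩
    · grind
    grind
  have h3 := Set.ncard_le_ncard h2 (Set.toFinite _)
  have h4 := Set.ncard_union_le (Sym2.map σ '' J₀.edgeSet) ((fun u => s(q, σ u)) '' Q)
  have h5 : (Sym2.map σ '' J₀.edgeSet).ncard ≤ _ := Set.ncard_image_le (Set.toFinite _)
  have h6 : ((fun u => s(q, σ u)) '' Q).ncard ≤ _ := Set.ncard_image_le (Set.toFinite _)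
  rw [← Nat.card_coe_set_eq] at h3 hE
  rw [← Nat.card_coe_set_eq J.edgeSet, Nat.card_coe_set_eq J₀.edgeSet] at hE
  omega

end Ext

end Extensions

/-! ### Systems with one rung for each edge -/

section Nets

variable {V U U' : Type*} {G : SimpleGraph V} {h : Bool → V}

/-- A system in which every strip is a single rung; `E` gives the rungs and `N` the nodes. -/
structure Rungs (G : SimpleGraph V) (h : Bool → V) (J : SimpleGraph U) (L : Bool → Set U)
    (E : Sym2 U → Set V) (N : U → Set V) : Prop where
  rung : ∀ u v, J.Adj u v → ∃ l : List V, l ≠ [] ∧ IP G l ∧ (∀ z, z ∈ E s(u, v) ↔ z ∈ l) ∧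
    (∀ z ∈ l, (z ∈ N u ↔ l.head? = some z)) ∧ ∀ z ∈ l, (z ∈ N v ↔ l.getLast? = some z)
  node : ∀ e ∈ J.edgeSet, ∀ z ∈ E e, ∀ n, z ∈ N n → n ∈ e
  cross : ∀ e ∈ J.edgeSet, ∀ f ∈ J.edgeSet, e ≠ f → ∀ y ∈ E e, ∀ z ∈ E f,
    y ≠ z ∧ (G.Adj y z ↔ ∃ n, y ∈ N n ∧ z ∈ N n)
  hub : ∀ c, ∀ e ∈ J.edgeSet, ∀ z ∈ E e, z ≠ h c ∧ (G.Adj (h c) z ↔ ∃ n ∈ L c, z ∈ N n)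

variable {J J₀ : SimpleGraph U} {J' : SimpleGraph U'} {σ : U → U'} {q : U'} {Q : Set U}
  {L : Bool → Set U} {E : Sym2 U → Set V} {N : U → Set V}

theorem Rungs.mono (R : Rungs G h J L E N) (hJ : J₀ ≤ J) : Rungs G h J₀ L E N := by
  have hE : ∀ e ∈ J₀.edgeSet, e ∈ J.edgeSet := fun e he => SimpleGraph.edgeSet_mono hJ he
  exact ⟨fun u v huv => R.rung u v (hJ huv), fun e he => R.node e (hE e he),
    fun e he f hf => R.cross e (hE e he) f (hE f hf), fun c e he => R.hub c e (hE e he)⟩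

def extEdge (J : SimpleGraph U) (σ : U → U') (q : U') (Q : Set U) (E : Sym2 U → Set V)
    (F : U → Set V) (e : Sym2 U') : Set V :=
  {z | (∃ f ∈ J.edgeSet, e = f.map σ ∧ z ∈ E f) ∨ ∃ u ∈ Q, e = s(q, σ u) ∧ z ∈ F u}

def extNode (σ : U → U') (q : U') (N : U → Set V) (Nq : Set V) (x : U') : Set V :=
  {z | (∃ u, x = σ u ∧ z ∈ N u) ∨ (x = q ∧ z ∈ Nq)}

theorem Ext.mem_edge (X : Ext J J' σ q Q) {F : U → Set V} {f : Sym2 U} (hf : f ∈ J.edgeSet) {z : V} :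
    z ∈ extEdge J σ q Q E F (f.map σ) ↔ z ∈ E f := by
  refine ⟨?_, fun h1 => Or.inl ⟨f, hf, rfl, h1⟩⟩
  rintro (⟨g, -, h1, h2⟩ | ⟨u, -, h1, -⟩)
  · rwa [Sym2.map.injective X.inj h1]
  · exact absurd h1 (X.map_ne f u)

theorem Ext.mem_edge_new (X : Ext J J' σ q Q) {F : U → Set V} {u : U} (hu : u ∈ Q) {z : V} :
    z ∈ extEdge J σ q Q E F s(q, σ u) ↔ z ∈ F u := by
  refine ⟨?_, fun h1 => Or.inr ⟨u, hu, rfl, h1⟩⟩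
  rintro (⟨g, -, h1, -⟩ | ⟨v, -, h1, h2⟩)
  · exact absurd h1.symm (X.map_ne g u)
  · rw [Sym2.congr_right] at h1
    rwa [X.inj h1]

theorem Ext.mem_node (X : Ext J J' σ q Q) {Nq : Set V} {u : U} {z : V} :
    z ∈ extNode σ q N Nq (σ u) ↔ z ∈ N u := by
  refine ⟨?_, fun h1 => Or.inl ⟨u, rfl, h1⟩⟩
  rintro (⟨v, h1, h2⟩ | ⟨h1, -⟩)
  · rwa [X.inj h1]
  · exact absurd h1 (X.ne u)

theorem Ext.mem_node_new (X : Ext J J' σ q Q) {Nq : Set V} {z : V} :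
    z ∈ extNode σ q N Nq q ↔ z ∈ Nq := by
  refine ⟨?_, fun h1 => Or.inr ⟨rfl, h1⟩⟩
  rintro (⟨v, h1, -⟩ | ⟨-, h1⟩)
  · exact absurd h1.symm (X.ne v)
  · exact h1

/-- Subdivision and pendant edges are both instances. The new node sets `N₁` agree with `N` on old
vertices, but may contain new ones: a pendant path contributes its last vertex to the node to which
it is attached. -/
theorem Rungs.extend (R : Rungs G h J L E N) (X : Ext J J' σ q Q) {L' : Bool → Set U'}
    {F N₁ : U → Set V} {Nq : Set V}
    (hN : ∀ e ∈ J.edgeSet, ∀ z ∈ E e, z ∉ Nq ∧ ∀ u, (z ∈ N₁ u ↔ z ∈ N u))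
    (hL : ∀ c u, σ u ∈ L' c ↔ u ∈ L c)
    (hrung : ∀ u ∈ Q, ∃ l : List V, l ≠ [] ∧ IP G l ∧ (∀ z, z ∈ F u ↔ z ∈ l) ∧
      (∀ z ∈ l, (z ∈ Nq ↔ l.head? = some z)) ∧ ∀ z ∈ l, (z ∈ N₁ u ↔ l.getLast? = some z))
    (hnode : ∀ u ∈ Q, ∀ z ∈ F u, ∀ n, z ∈ N₁ n → n = u)
    (hold : ∀ u ∈ Q, ∀ z ∈ F u, ∀ e ∈ J.edgeSet, ∀ y ∈ E e,
      y ≠ z ∧ (G.Adj y z ↔ y ∈ N u ∧ z ∈ N₁ u))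
    (hnew : ∀ u ∈ Q, ∀ v ∈ Q, u ≠ v → ∀ y ∈ F u, ∀ z ∈ F v,
      y ≠ z ∧ (G.Adj y z ↔ y ∈ Nq ∧ z ∈ Nq))
    (hhub : ∀ c, ∀ u ∈ Q, ∀ z ∈ F u, z ≠ h c ∧
      (G.Adj (h c) z ↔ (q ∈ L' c ∧ z ∈ Nq) ∨ (u ∈ L c ∧ z ∈ N₁ u))) :
    Rungs G h J' L' (extEdge J σ q Q E F) (extNode σ q N₁ Nq) := by
  have oldnew : ∀ u ∈ Q, ∀ z ∈ F u, ∀ e ∈ J.edgeSet, ∀ y ∈ E e, y ≠ z ∧ (G.Adj y z ↔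
      ∃ n, y ∈ extNode σ q N₁ Nq n ∧ z ∈ extNode σ q N₁ Nq n) := by
    intro u hu z hz e he y hy
    refine ⟨(hold u hu z hz e he y hy).1, (hold u hu z hz e he y hy).2.trans ⟨?_, ?_⟩⟩
    · exact fun h1 => ⟨σ u, X.mem_node.2 (((hN e he y hy).2 u).2 h1.1), X.mem_node.2 h1.2⟩
    · rintro ⟨n, h1, h2⟩
      rcases X.cov n with rfl | ⟨m, rfl⟩
      · exact absurd (X.mem_node_new.1 h1) (hN e he y hy).1
      · rw [X.mem_node] at h1 h2
        grind
  have rungNew : ∀ u ∈ Q, ∃ l : List V, l ≠ [] ∧ IP G l ∧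
      (∀ z, z ∈ extEdge J σ q Q E F s(q, σ u) ↔ z ∈ l) ∧
      (∀ z ∈ l, (z ∈ extNode σ q N₁ Nq q ↔ l.head? = some z)) ∧
      ∀ z ∈ l, (z ∈ extNode σ q N₁ Nq (σ u) ↔ l.getLast? = some z) := by
    intro u hu
    obtain ⟨l, h1, h2, h3, h4, h5⟩ := hrung u hu
    exact ⟨l, h1, h2, fun z => (X.mem_edge_new hu).trans (h3 z),
      fun z hz => X.mem_node_new.trans (h4 z hz), fun z hz => X.mem_node.trans (h5 z hz)⟩
  refine ⟨fun x y hxy => ?_, fun e he z hz n hn => ?_, fun e he f hf hef y hy z hz => ?_,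
    fun c e he z hz => ?_⟩
  · rcases X.cov x with rfl | ⟨u, rfl⟩ <;> rcases X.cov y with rfl | ⟨v, rfl⟩
    · exact absurd hxy (J'.loopless.irrefl _)
    · exact rungNew v ((X.adj_new v).1 hxy)
    · obtain ⟨l, h1, h2, h3, h4, h5⟩ := rungNew u ((X.adj_new u).1 hxy.symm)
      refine ⟨l.reverse, by simpa using h1, h2.reverse, fun z => ?_, fun z hz => ?_, fun z hz => ?_⟩
      · rw [Sym2.eq_swap, h3, List.mem_reverse]
      · rw [h5 z (List.mem_reverse.1 hz), List.head?_reverse]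
      · rw [h4 z (List.mem_reverse.1 hz), List.getLast?_reverse]
    · have huv := (X.adj u v).1 hxy
      obtain ⟨l, h1, h2, h3, h4, h5⟩ := R.rung u v huv
      have hm : ∀ z ∈ l, ∀ w, (z ∈ extNode σ q N₁ Nq (σ w) ↔ z ∈ N w) := fun z hz w =>
        X.mem_node.trans ((hN _ huv z ((h3 z).2 hz)).2 w)
      exact ⟨l, h1, h2, fun z => (X.mem_edge (f := s(u, v)) huv).trans (h3 z),
        fun z hz => (hm z hz u).trans (h4 z hz), fun z hz => (hm z hz v).trans (h5 z hz)⟩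
  · rcases X.edge_cases he with ⟨f, hf, rfl⟩ | ⟨u, hu, rfl⟩
    · rw [X.mem_edge hf] at hz
      rcases X.cov n with rfl | ⟨m, rfl⟩
      · exact absurd (X.mem_node_new.1 hn) (hN f hf z hz).1
      · rw [X.mem_node, (hN f hf z hz).2] at hn
        exact Sym2.mem_map.2 ⟨m, R.node f hf z hz m hn, rfl⟩
    · rw [X.mem_edge_new hu] at hz
      rcases X.cov n with rfl | ⟨m, rfl⟩
      · simp
      · rw [hnode u hu z hz m (X.mem_node.1 hn)]
        simp
  · rcases X.edge_cases he with ⟨e, he', rfl⟩ | ⟨u, hu, rfl⟩ <;>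
      rcases X.edge_cases hf with ⟨f, hf', rfl⟩ | ⟨v, hv, rfl⟩
    · rw [X.mem_edge he'] at hy
      rw [X.mem_edge hf'] at hz
      have h1 := R.cross e he' f hf' (fun h1 => hef (by rw [h1])) y hy z hz
      refine ⟨h1.1, h1.2.trans ⟨fun ⟨n, h2, h3⟩ => ⟨σ n, X.mem_node.2 (((hN e he' y hy).2 n).2 h2),
        X.mem_node.2 (((hN f hf' z hz).2 n).2 h3)⟩, fun ⟨n, h2, h3⟩ => ?_⟩⟩
      rcases X.cov n with rfl | ⟨m, rfl⟩
      · exact absurd (X.mem_node_new.1 h2) (hN e he' y hy).1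
      · rw [X.mem_node] at h2 h3
        grind
    · rw [X.mem_edge he'] at hy
      rw [X.mem_edge_new hv] at hz
      exact oldnew v hv z hz e he' y hy
    · rw [X.mem_edge_new hu] at hy
      rw [X.mem_edge hf'] at hz
      have := oldnew u hu y hy f hf' z hz
      refine ⟨this.1.symm, ?_⟩
      rw [G.adj_comm, this.2]
      simp only [and_comm]
    · have huv : u ≠ v := fun h1 => hef (by rw [h1])
      rw [X.mem_edge_new hu] at hy
      rw [X.mem_edge_new hv] at hz
      have h1 := hnew u hu v hv huv y hy z hz
      refine ⟨h1.1, h1.2.trans ⟨fun h2 => ⟨q, X.mem_node_new.2 h2.1, X.mem_node_new.2 h2.2⟩,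
        fun ⟨n, h2, h3⟩ => ?_⟩⟩
      rcases X.cov n with rfl | ⟨m, rfl⟩
      · exact ⟨X.mem_node_new.1 h2, X.mem_node_new.1 h3⟩
      · rw [X.mem_node] at h2 h3
        grind
  · rcases X.edge_cases he with ⟨e, he', rfl⟩ | ⟨u, hu, rfl⟩
    · rw [X.mem_edge he'] at hz
      have h1 := R.hub c e he' z hz
      refine ⟨h1.1, h1.2.trans ⟨fun ⟨n, h2, h3⟩ => ⟨σ n, (hL c n).2 h2,
        X.mem_node.2 (((hN e he' z hz).2 n).2 h3)⟩, fun ⟨n, h2, h3⟩ => ?_⟩⟩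
      rcases X.cov n with rfl | ⟨m, rfl⟩
      · exact absurd (X.mem_node_new.1 h3) (hN e he' z hz).1
      · rw [X.mem_node] at h3
        exact ⟨m, (hL c m).1 h2, ((hN e he' z hz).2 m).1 h3⟩
    · rw [X.mem_edge_new hu] at hz
      have h1 := hhub c u hu z hz
      refine ⟨h1.1, h1.2.trans ⟨?_, fun ⟨n, h2, h3⟩ => ?_⟩⟩
      · rintro (⟨h2, h3⟩ | ⟨h2, h3⟩)
        · exact ⟨q, h2, X.mem_node_new.2 h3⟩
        · exact ⟨σ u, (hL c u).2 h2, X.mem_node.2 h3⟩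
      · rcases X.cov n with rfl | ⟨m, rfl⟩
        · exact Or.inl ⟨h2, X.mem_node_new.1 h3⟩
        · rw [X.mem_node] at h3
          grind

end Nets

/-! ### Trees with labelled leaves under subdivision and pendant edges -/

section NetTrees

variable {U U' : Type*}

/-- Some walk from `u` to `t` avoids `v`. -/
def Rch (J : SimpleGraph U) (v u t : U) : Prop := ∃ w : J.Walk u t, v ∉ w.support

/-- A tree with labelled leaves, with at least `K` branch-vertices. -/
structure Net (J : SimpleGraph U) (L : Bool → Set U) (K : ℕ) : Prop where
  tree : J.IsTree
  leaf : ∀ t, IsLeaf J t ↔ ∃ c, t ∈ L c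
  disj : ∀ c, ∀ t ∈ L c, t ∉ L (!c)
  nbr : ∀ s t c, J.Adj s t → t ∈ L c → ∀ d, s ∉ L d
  via : ∀ v u u' c, J.Adj v u → J.Adj v u' → u ≠ u' → ∃ t ∈ L c, Rch J v u t ∨ Rch J v u' t
  ne : ∀ c, (L c).Nonempty
  three : 3 ≤ {v | IsLeaf J v}.ncard
  count : K ≤ {v | IsBranchVertex J v}.ncard

variable {J J₀ : SimpleGraph U} {J' : SimpleGraph U'} {σ : U → U'} {q : U'} {Q : Set U}
  {L : Bool → Set U} {K : ℕ}

theorem rch_of_dist (hJ : J.Connected) {v u t : U} (hd : J.dist u t < J.dist v t) :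
    Rch J v u t := by
  classical
  obtain ⟨w, hw⟩ := hJ.exists_walk_length_eq_dist u t
  refine ⟨w, fun hv => ?_⟩
  have h1 := w.length_dropUntil_le_length hv
  have h2 := SimpleGraph.dist_le (w.dropUntil v hv)
  omega

namespace Ext

theorem exists_walk (X : Ext J₀ J' σ q Q) (hs : ∀ u v, J.Adj u v → J₀.Adj u v ∨ (u ∈ Q ∧ v ∈ Q))
    {x y : U} (w : J.Walk x y) : ∃ w' : J'.Walk (σ x) (σ y), ∀ z ∈ w'.support,
      (∃ u ∈ w.support, z = σ u) ∨ (z = q ∧ ∃ u ∈ w.support, ∃ v ∈ w.support, J.Adj u v ∧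
        u ∈ Q ∧ v ∈ Q) := by
  induction w with
  | nil => exact ⟨SimpleGraph.Walk.nil, by simp⟩
  | @cons x m y hxm w ih =>
    obtain ⟨w', hw'⟩ := ih
    have key : ∀ z ∈ w'.support, (∃ u ∈ (SimpleGraph.Walk.cons hxm w).support, z = σ u) ∨
        (z = q ∧ ∃ u ∈ (SimpleGraph.Walk.cons hxm w).support,
          ∃ v ∈ (SimpleGraph.Walk.cons hxm w).support, J.Adj u v ∧ u ∈ Q ∧ v ∈ Q) := by grind
    rcases hs x m hxm with h1 | ⟨h1, h2⟩
    · refine ⟨SimpleGraph.Walk.cons ((X.adj x m).2 h1) w', fun z hz => ?_⟩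
      grind
    · refine ⟨SimpleGraph.Walk.cons ((X.adj_new x).2 h1).symm
        (SimpleGraph.Walk.cons ((X.adj_new m).2 h2) w'), fun z hz => ?_⟩
      rw [SimpleGraph.Walk.support_cons, List.mem_cons, SimpleGraph.Walk.support_cons,
        List.mem_cons] at hz
      rcases hz with rfl | rfl | hz
      · grind
      · exact Or.inr ⟨rfl, x, by simp, m, by simp, hxm, h1, h2⟩
      · exact key z hz

theorem rch (X : Ext J₀ J' σ q Q) (hs : ∀ u v, J.Adj u v → J₀.Adj u v ∨ (u ∈ Q ∧ v ∈ Q))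
    {v u t : U} (h : Rch J v u t) : Rch J' (σ v) (σ u) (σ t) := by
  obtain ⟨w, hw⟩ := h
  obtain ⟨w', hw'⟩ := X.exists_walk hs w
  refine ⟨w', fun h1 => ?_⟩
  rcases hw' _ h1 with ⟨x, hx, hx'⟩ | ⟨h2, -⟩
  · rw [X.inj hx'] at hw
    exact hw hx
  · exact X.ne v h2

theorem rch_new (X : Ext J₀ J' σ q Q) (hs : ∀ u v, J.Adj u v → J₀.Adj u v ∨ (u ∈ Q ∧ v ∈ Q))
    {v u t : U} (h : Rch J v u t) (hv : ∀ x y, J.Adj x y → x ∈ Q → y ∈ Q → x = v ∨ y = v) :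
    Rch J' q (σ u) (σ t) := by
  obtain ⟨w, hw⟩ := h
  obtain ⟨w', hw'⟩ := X.exists_walk hs w
  refine ⟨w', fun h1 => ?_⟩
  rcases hw' _ h1 with ⟨x, -, hx'⟩ | ⟨-, x, hx, y, hy, hxy, hx', hy'⟩
  · exact X.ne x hx'.symm
  grind

theorem rch_cons (X : Ext J₀ J' σ q Q) {v u t : U} (hu : u ∈ Q)
    (h : Rch J' (σ v) (σ u) (σ t)) : Rch J' (σ v) q (σ t) := by
  obtain ⟨w, hw⟩ := h
  refine ⟨SimpleGraph.Walk.cons ((X.adj_new u).2 hu) w, fun h1 => ?_⟩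
  rw [SimpleGraph.Walk.support_cons, List.mem_cons] at h1
  exact h1.elim (X.ne v) hw

theorem nbr_new (X : Ext J J' σ q Q) : J'.neighborSet q = σ '' Q := by
  ext x
  rw [SimpleGraph.mem_neighborSet]
  rcases X.cov x with rfl | ⟨u, rfl⟩
  · simp only [SimpleGraph.irrefl, false_iff]
    rintro ⟨u, -, hu⟩
    exact X.ne u hu
  · rw [X.adj_new, X.inj.mem_set_image]

theorem ncard_new (X : Ext J J' σ q Q) : (J'.neighborSet q).ncard = Q.ncard := by
  rw [X.nbr_new, Set.ncard_image_of_injective _ X.inj]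

theorem ncard_old (X : Ext J J' σ q Q) {u : U} (hu : u ∉ Q) :
    (J'.neighborSet (σ u)).ncard = (J.neighborSet u).ncard := by
  rw [← Set.ncard_image_of_injective _ X.inj]
  congr 1
  ext x
  rw [SimpleGraph.mem_neighborSet]
  rcases X.cov x with rfl | ⟨v, rfl⟩
  · rw [J'.adj_comm, X.adj_new]
    simp only [hu, false_iff]
    rintro ⟨v, -, hv⟩
    exact X.ne v hv
  · rw [X.adj, X.inj.mem_set_image, SimpleGraph.mem_neighborSet]

theorem ncard_end (X : Ext J J' σ q Q) [Finite U] {u : U} (hu : u ∈ Q) :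
    (J'.neighborSet (σ u)).ncard = (J.neighborSet u).ncard + 1 := by
  have hq : q ∉ σ '' J.neighborSet u := by
    rintro ⟨v, -, hv⟩
    exact X.ne v hv
  rw [← Set.ncard_image_of_injective (J.neighborSet u) X.inj,
    ← Set.ncard_insert_of_notMem hq ((Set.toFinite _).image _)]
  congr 1
  ext x
  rw [SimpleGraph.mem_neighborSet, Set.mem_insert_iff]
  rcases X.cov x with rfl | ⟨v, rfl⟩
  · simpa using ((X.adj_new u).2 hu).symm
  · rw [X.adj, X.inj.mem_set_image, SimpleGraph.mem_neighborSet]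
    simp [X.ne v]

theorem finite (X : Ext J J' σ q Q) [Finite U] : Finite U' := by
  have hUq : (Set.univ : Set U') = insert q (Set.range σ) := by
    ext x
    rcases X.cov x with rfl | ⟨u, rfl⟩ <;> simp
  rw [← Set.finite_univ_iff, hUq]
  exact (Set.finite_range σ).insert q

end Ext

theorem deleteEdges_or (J : SimpleGraph U) (a b u v : U) (huv : J.Adj u v) :
    (J.deleteEdges {s(a, b)}).Adj u v ∨ (u ∈ ({a, b} : Set U) ∧ v ∈ ({a, b} : Set U)) := by
  rw [SimpleGraph.deleteEdges_adj]
  grind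

/-- Old vertices keep their degrees and the new one has degree two, so leaves and branch-vertices
are unchanged. Walks are carried over by passing through `q` in place of the subdivided edge. -/
theorem Net.subdivide [Finite U] (T : Net J L K) {a b : U} (hab : J.Adj a b)
    (X : Ext (J.deleteEdges {s(a, b)}) J' σ q {a, b}) : Net J' (fun c => σ '' L c) K := by
  have hfin := X.finite
  have hs := deleteEdges_or J a b
  have hQ : ∀ x y, J.Adj x y → x ∈ ({a, b} : Set U) → y ∈ ({a, b} : Set U) →
      (x = a ∧ y = b) ∨ (x = b ∧ y = a) := by
    rintro x y hxy (rfl | rfl) (rfl | rfl)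
    · simp_all
    · grind
    · grind
    simp_all
  have hdeg : ∀ u, (J'.neighborSet (σ u)).ncard = (J.neighborSet u).ncard := by
    intro u
    have hdel : ∀ x y, s(x, y) = s(a, b) → J.Adj x y →
        (((J.deleteEdges {s(a, b)}).neighborSet x).ncard + 1 = (J.neighborSet x).ncard) := by
      intro x y hxy hadj
      rw [← Set.ncard_sdiff_singleton_add_one (s := J.neighborSet x) (a := y) hadj]
      congr 2
      ext z
      rw [SimpleGraph.mem_neighborSet, SimpleGraph.deleteEdges_adj, ← hxy]
      simp +contextual [hadj.ne]
    by_cases hu : u ∈ ({a, b} : Set U)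
    · rw [X.ncard_end hu]
      rcases hu with rfl | rfl
      · grind
      · exact hdel _ _ Sym2.eq_swap hab.symm
    · rw [X.ncard_old hu]
      congr 1
      ext z
      simp_all
  have hdq : (J'.neighborSet q).ncard = 2 := by
    rw [X.ncard_new, Set.ncard_pair hab.ne]
  have hleaf : ∀ u, IsLeaf J' (σ u) ↔ IsLeaf J u := fun u => by rw [IsLeaf, hdeg, IsLeaf]
  have hvia : ∀ v u u' c, J.Adj v u → J.Adj v u' → u ≠ u' → ∃ t ∈ L c,
      Rch J' (σ v) (σ u) (σ t) ∨ Rch J' (σ v) (σ u') (σ t) := fun v u u' c h1 h2 h3 => by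
    obtain ⟨t, ht, h4⟩ := T.via v u u' c h1 h2 h3
    exact ⟨t, ht, h4.imp (X.rch hs) (X.rch hs)⟩
  have hold : ∀ x y, J'.Adj (σ x) (σ y) → J.Adj x y ∧ s(x, y) ≠ s(a, b) := fun x y hxy => by
    rw [X.adj, SimpleGraph.deleteEdges_adj, Set.mem_singleton_iff] at hxy
    exact hxy
  have hvq : ∀ v u' c, J'.Adj (σ v) q → J'.Adj (σ v) (σ u') → ∃ t ∈ L c,
      Rch J' (σ v) q (σ t) ∨ Rch J' (σ v) (σ u') (σ t) := by
    intro v u' c h1 h2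
    have h1 := (X.adj_new v).1 h1.symm
    obtain ⟨h2, h3⟩ := hold _ _ h2
    obtain ⟨w, hw, hvw, huw⟩ : ∃ w ∈ ({a, b} : Set U), J.Adj v w ∧ w ≠ u' := by
      rcases h1 with rfl | rfl
      · grind
      · exact ⟨a, by simp, hab.symm, fun h4 => h3 (by grind)⟩
    obtain ⟨t, ht, h4⟩ := hvia v w u' c hvw h2 huw
    exact ⟨t, ht, h4.imp_left (X.rch_cons hw)⟩
  refine ⟨X.isTree T.tree (a := a) (by simp) (fun u v huv => ?_) ?_, fun x => ?_, ?_, ?_, ?_,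
    fun c => (T.ne c).image σ, ?_, ?_⟩
  · obtain ⟨w, -⟩ := X.exists_walk hs (SimpleGraph.Walk.cons huv SimpleGraph.Walk.nil)
    exact ⟨w⟩
  · rw [SimpleGraph.edgeSet_deleteEdges, Set.ncard_pair hab.ne,
      ← Set.ncard_sdiff_singleton_add_one (s := J.edgeSet) (a := s(a, b)) hab]
  · rcases X.cov x with rfl | ⟨u, rfl⟩
    · rw [IsLeaf, hdq]
      simp only [OfNat.ofNat_ne_one, false_iff]
      rintro ⟨c, u, -, hu⟩
      exact X.ne u hu
    · rw [hleaf, T.leaf]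
      simp only [X.inj.mem_set_image]
  · rintro c _ ⟨t, ht, rfl⟩ h1
    rw [X.inj.mem_set_image] at h1
    exact T.disj c t ht h1
  · rintro s _ c hst ⟨t, ht, rfl⟩ d ⟨s, hs', rfl⟩
    exact T.nbr s t c (hold _ _ hst).1 ht d hs'
  · intro x y y' c hy hy' hyy
    rcases X.cov x with rfl | ⟨v, rfl⟩
    · rw [← SimpleGraph.mem_neighborSet, X.nbr_new] at hy hy'
      obtain ⟨u, hu, rfl⟩ := hy
      obtain ⟨u', hu', rfl⟩ := hy'
      have huu : u ≠ u' := fun h1 => hyy (by rw [h1])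
      have huv : J.Adj u u' := by
        rcases hu with rfl | rfl <;> rcases hu' with rfl | rfl
        exacts [absurd rfl huu, hab, hab.symm, absurd rfl huu]
      obtain ⟨t, ht⟩ := T.ne c
      have hQ' : ∀ x y, J.Adj x y → x ∈ ({a, b} : Set U) → y ∈ ({a, b} : Set U) →
          (x = u ∨ y = u) ∧ (x = u' ∨ y = u') := by grind
      refine ⟨σ t, ⟨t, ht, rfl⟩, ?_⟩
      -- Adjacent vertices of a tree are never equally far from `t`. A shortest path from the nearer
      -- one avoids the other, hence the subdivided edge and `q`.
      rcases lt_trichotomy (J.dist u t) (J.dist u' t) with h1 | h1 | h1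
      · exact Or.inl (X.rch_new hs (rch_of_dist T.tree.connected h1)
          fun x y h2 h3 h4 => (hQ' x y h2 h3 h4).2)
      · by_cases hn : u' = nx J u t
        · by_cases htu : t = u
          · rw [htu, SimpleGraph.dist_self] at h1
            rw [eq_comm, T.tree.connected.dist_eq_zero_iff] at h1
            grind
          · have := nx_dist T.tree htu
            grind
        · have := dist_of_ne_nx T.tree huv hn
          omega
      · exact Or.inr (X.rch_new hs (rch_of_dist T.tree.connected h1)
          fun x y h2 h3 h4 => (hQ' x y h2 h3 h4).1)
    · rcases X.cov y with rfl | ⟨u, rfl⟩ <;> rcases X.cov y' with rfl | ⟨u', rfl⟩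
      · grind
      · obtain ⟨t, ht, h1⟩ := hvq v u' c hy hy'
        grind
      · obtain ⟨t, ht, h1⟩ := hvq v u c hy' hy
        grind
      · obtain ⟨t, ht, h1⟩ := hvia v u u' c (hold _ _ hy).1 (hold _ _ hy').1
          fun h1 => hyy (by rw [h1])
        exact ⟨σ t, ⟨t, ht, rfl⟩, h1⟩
  · refine T.three.trans ?_
    rw [← Set.ncard_image_of_injective _ X.inj]
    refine Set.ncard_le_ncard ?_ (Set.toFinite _)
    grind
  · refine T.count.trans ?_
    rw [← Set.ncard_image_of_injective _ X.inj]
    refine Set.ncard_le_ncard ?_ (Set.toFinite _)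
    rintro _ ⟨u, hu, rfl⟩
    show IsBranchVertex J' (σ u)
    rw [IsBranchVertex, hdeg]
    exact hu

/-- The vertex `v` is not a leaf, so it stays a branch-vertex or becomes one, and `q` is a new
branch-vertex, being a leaf. At `v` the new direction contains the leaf `q` of class `i`; leaves of
the other class are supplied in every old direction by `hd`. -/
theorem Net.pend [Finite U] (T : Net J L K) {v : U} {i : Bool} (hv : ∀ c, v ∉ L c)
    (hd : ∀ u, J.Adj v u → ∃ t ∈ L (!i), Rch J v u t) (X : Ext J J' σ q {v}) :
    Net J' (fun c => σ '' L c ∪ {x | c = i ∧ x = q}) (K + 1) := by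
  have hfin := X.finite
  have hs : ∀ x y, J.Adj x y → J.Adj x y ∨ (x ∈ ({v} : Set U) ∧ y ∈ ({v} : Set U)) :=
    fun x y hxy => Or.inl hxy
  have hLu : ∀ c u, σ u ∈ (σ '' L c ∪ {x | c = i ∧ x = q}) ↔ u ∈ L c := fun c u => by
    simp [X.inj.mem_set_image, X.ne u]
  have hLq : ∀ c, q ∈ (σ '' L c ∪ {x | c = i ∧ x = q}) ↔ c = i := fun c => by
    simp [X.ne]
  have hdq : (J'.neighborSet q).ncard = 1 := by
    rw [X.ncard_new, Set.ncard_singleton]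
  have hJv : (J.neighborSet v).ncard ≠ 1 := fun h1 => by
    obtain ⟨c, hc⟩ := (T.leaf v).1 h1
    exact hv c hc
  have hJv0 : (J.neighborSet v).ncard ≠ 0 := by
    obtain ⟨t, ht⟩ := T.ne i
    have htv : t ≠ v := fun h1 => hv i (h1 ▸ ht)
    exact ((Set.ncard_pos (Set.toFinite _)).2 ⟨_, nx_adj T.tree htv⟩).ne'
  have hleaf : ∀ u, IsLeaf J' (σ u) ↔ IsLeaf J u := fun u => by
    rw [IsLeaf, IsLeaf]
    by_cases hu : u = v
    · subst hu
      rw [X.ncard_end rfl]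
      omega
    · rw [X.ncard_old hu]
  refine ⟨X.isTree T.tree (a := v) rfl (fun u w huw => ((X.adj u w).2 huw).reachable) ?_,
    fun x => ?_, ?_, ?_, ?_, fun c => ?_, ?_, ?_⟩
  · rw [Set.ncard_singleton]
  · rcases X.cov x with rfl | ⟨u, rfl⟩
    · exact ⟨fun _ => ⟨i, (hLq i).2 rfl⟩, fun _ => hdq⟩
    · rw [hleaf, T.leaf]
      simp only [hLu]
  · intro c x hx
    rcases X.cov x with rfl | ⟨u, rfl⟩
    · grind
    · rw [hLu] at hx ⊢
      exact T.disj c u hx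
  · intro x y c hxy hy d hx
    rcases X.cov x with rfl | ⟨s, rfl⟩ <;> rcases X.cov y with rfl | ⟨t, rfl⟩
    · simp_all
    · rw [X.adj_new, Set.mem_singleton_iff] at hxy
      grind
    · have := (X.adj_new s).1 hxy.symm
      grind
    · rw [hLu] at hx hy
      exact T.nbr s t c ((X.adj s t).1 hxy) hy d hx
  · intro x y y' c hy hy' hyy
    have hvq : ∀ u w, J'.Adj (σ w) q → J'.Adj (σ w) (σ u) →
        ∃ t ∈ (σ '' L c ∪ {x | c = i ∧ x = q}), Rch J' (σ w) q t ∨ Rch J' (σ w) (σ u) t := by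
      intro u w h1 h2
      have h1 := (X.adj_new w).1 h1.symm
      rw [Set.mem_singleton_iff] at h1
      subst h1
      by_cases hc : c = i
      · exact ⟨q, (hLq c).2 hc, Or.inl ⟨SimpleGraph.Walk.nil, by simp [X.ne]⟩⟩
      · rw [Bool.eq_not_of_ne hc]
        obtain ⟨t, ht, h3⟩ := hd u ((X.adj w u).1 h2)
        exact ⟨σ t, (hLu _ t).2 ht, Or.inr (X.rch hs h3)⟩
    rcases X.cov x with rfl | ⟨w, rfl⟩
    · rw [← SimpleGraph.mem_neighborSet, X.nbr_new] at hy hy'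
      grind
    · rcases X.cov y with rfl | ⟨u, rfl⟩ <;> rcases X.cov y' with rfl | ⟨u', rfl⟩
      · grind
      · grind
      · grind
      · obtain ⟨t, ht, h1⟩ := T.via w u u' c ((X.adj _ _).1 hy) ((X.adj _ _).1 hy')
          fun h1 => hyy (by rw [h1])
        exact ⟨σ t, (hLu _ t).2 ht, h1.imp (X.rch hs) (X.rch hs)⟩
  · exact ((T.ne c).image σ).mono Set.subset_union_left
  · refine T.three.trans ?_
    rw [← Set.ncard_image_of_injective _ X.inj]
    refine Set.ncard_le_ncard ?_ (Set.toFinite _)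
    grind
  · refine (Nat.add_le_add_right T.count 1).trans ?_
    rw [← Set.ncard_image_of_injective _ X.inj, ← Set.ncard_insert_of_notMem (a := q)
      (by rintro ⟨u, -, hu⟩; exact X.ne u hu) (Set.toFinite _)]
    refine Set.ncard_le_ncard ?_ (Set.toFinite _)
    rintro _ (rfl | ⟨u, hu, rfl⟩)
    · show (J'.neighborSet _).ncard ≠ 2
      grind
    · show (J'.neighborSet _).ncard ≠ 2
      by_cases huv : u = v
      · subst huv
        rw [X.ncard_end rfl]
        omega
      · rw [X.ncard_old huv]
        exact hu

end NetTrees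

/-! ### The same two operations on the rungs -/

section NetRungs

variable {V U U' : Type*} {G : SimpleGraph V} {h : Bool → V}
  {J : SimpleGraph U} {J' : SimpleGraph U'} {σ : U → U'} {q : U'}
  {L : Bool → Set U} {E : Sym2 U → Set V} {N : U → Set V}

/-- The rung is cut between `A` and `B`. The node of the new vertex consists of the two vertices at
the cut, so that the edge joining them becomes an adjacency inside a node. -/
theorem Rungs.subdivide (R : Rungs G h J L E N) {a b : U} (hab : J.Adj a b)
    (X : Ext (J.deleteEdges {s(a, b)}) J' σ q {a, b}) {A B : List V} (hA : A ≠ []) (hB : B ≠ [])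
    (hip : IP G (A ++ B)) (hE : ∀ z, z ∈ E s(a, b) ↔ z ∈ A ++ B)
    (hNa : ∀ z ∈ A ++ B, (z ∈ N a ↔ (A ++ B).head? = some z))
    (hNb : ∀ z ∈ A ++ B, (z ∈ N b ↔ (A ++ B).getLast? = some z)) :
    Rungs G h J' (fun c => σ '' L c)
      (extEdge (J.deleteEdges {s(a, b)}) σ q {a, b} E
        fun u => {z | (u = a ∧ z ∈ A) ∨ (u = b ∧ z ∈ B)})
      (extNode σ q N {z | A.getLast? = some z ∨ B.head? = some z}) := by
  have hdel : ∀ e ∈ (J.deleteEdges {s(a, b)}).edgeSet, e ∈ J.edgeSet ∧ e ≠ s(a, b) := by simp_all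
  obtain ⟨hipA, hipB, hAB⟩ := IP.append_iff.1 hip
  have side : ∀ u, u ∈ ({a, b} : Set U) → ∃ D D' : List V, D ≠ [] ∧ IP G D ∧
      (∀ z, ((u = a ∧ z ∈ A) ∨ (u = b ∧ z ∈ B)) ↔ z ∈ D) ∧
      (∀ z ∈ D, ((A.getLast? = some z ∨ B.head? = some z) ↔ D.head? = some z)) ∧
      (∀ z ∈ D, z ∈ E s(a, b) ∧ (z ∈ N u ↔ D.getLast? = some z) ∧ ∀ n, z ∈ N n → n = u) := by
    have hn : ∀ z ∈ A ++ B, ∀ n, z ∈ N n → n = a ∨ n = b := fun z hz n hzn =>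
      Sym2.mem_iff.1 (R.node s(a, b) hab z ((hE z).2 hz) n hzn)
    have hbA : ∀ z ∈ A, z ∉ N b := fun z hz hzb => by
      have h1 := (hNb z (List.mem_append_left _ hz)).1 hzb
      rw [List.getLast?_append_of_ne_nil _ hB] at h1
      grind
    have haB : ∀ z ∈ B, z ∉ N a := fun z hz hza => by
      have h1 := (hNa z (List.mem_append_right _ hz)).1 hza
      rw [List.head?_append_of_ne_nil _ hA] at h1
      exact (hAB z (List.mem_of_head? h1) z hz).1 rfl
    rintro u (rfl | rfl)
    · refine ⟨A.reverse, B, by simpa using hA, hipA.reverse, fun z => by simp [hab.ne],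
        fun z hz => ?_, fun z hz => ⟨?_, ?_, fun n hn' => ?_⟩⟩ <;> rw [List.mem_reverse] at hz
      · rw [List.head?_reverse]
        exact or_iff_left fun h1 => (hAB z hz z (List.mem_of_head? h1)).1 rfl
      · grind
      · grind
      grind
    · refine ⟨B, A, hB, hipB, fun z => by simp [hab.ne'],
        fun z hz => ?_, fun z hz => ⟨?_, ?_, fun n hn' => ?_⟩⟩
      · grind
      · grind
      · grind
      grind
  have hLq : ∀ c, q ∉ σ '' L c := by
    rintro c ⟨u, -, hu⟩
    exact X.ne u hu
  refine (R.mono (J.deleteEdges_le _)).extend X (fun e he z hz => ⟨?_, fun u => Iff.rfl⟩)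
    (fun c u => X.inj.mem_set_image) (fun u hu => ?_) (fun u hu z hz => ?_)
    (fun u hu z hz e he y hy => ?_) ?_ fun c u hu z hz => ?_
  · obtain ⟨he, hne⟩ := hdel e he
    have h1 : ∀ z' ∈ A ++ B, z ≠ z' := fun z' hz' =>
      (R.cross e he s(a, b) hab hne z hz z' ((hE z').2 hz')).1
    rintro (h2 | h2)
    · grind
    · exact h1 z (List.mem_append_right _ (List.mem_of_head? h2)) rfl
  · obtain ⟨D, -, h1, h2, h3, h4, h5⟩ := side u hu
    exact ⟨D, h1, h2, h3, h4, fun z hz => (h5 z hz).2.1⟩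
  · grind
  · obtain ⟨D, -, h1, h2, h3, h4, h5⟩ := side u hu
    obtain ⟨h6, -, h7⟩ := h5 z ((h3 z).1 hz)
    obtain ⟨he, hne⟩ := hdel e he
    obtain ⟨h8, h9⟩ := R.cross e he s(a, b) hab hne y hy z h6
    grind
  · have key : ∀ y ∈ A, ∀ z ∈ B, y ≠ z ∧ (G.Adj y z ↔ (A.getLast? = some y ∨ B.head? = some y) ∧
        (A.getLast? = some z ∨ B.head? = some z)) := by grind
    rintro u hu v hv huv y (⟨rfl, hy⟩ | ⟨rfl, hy⟩) z (⟨rfl, hz⟩ | ⟨rfl, hz⟩)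
    · grind
    · exact key y hy z hz
    · have := key z hz y hy
      refine ⟨this.1.symm, ?_⟩
      rw [G.adj_comm, this.2, and_comm]
      rfl
    grind
  · obtain ⟨D, -, h1, h2, h3, h4, h5⟩ := side u hu
    obtain ⟨h6, -, h7⟩ := h5 z ((h3 z).1 hz)
    obtain ⟨h8, h9⟩ := R.hub c s(a, b) hab z h6
    grind

/-- The path becomes the rung of the new edge: its first vertex, which the hub sees, is the end at
the leaf `q`, and its last vertex joins the node of `v`. -/
theorem Rungs.pend (R : Rungs G h J L E N) {v : U} {i : Bool} (hv : ∀ c, v ∉ L c)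
    (X : Ext J J' σ q {v}) {p : List V} (hp0 : p ≠ []) (hp : IP G p)
    (hN : ∀ z ∈ p, ∀ n, z ∉ N n)
    (hE : ∀ z ∈ p, ∀ e ∈ J.edgeSet, ∀ y ∈ E e, y ≠ z ∧
      (G.Adj y z ↔ y ∈ N v ∧ p.getLast? = some z))
    (hh : ∀ c, ∀ z ∈ p, z ≠ h c ∧ (G.Adj (h c) z ↔ c = i ∧ p.head? = some z)) :
    Rungs G h J' (fun c => σ '' L c ∪ {x | c = i ∧ x = q})
      (extEdge J σ q {v} E fun _ => {z | z ∈ p})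
      (extNode σ q (fun u => N u ∪ {z | u = v ∧ p.getLast? = some z}) {z | p.head? = some z}) := by
  have hLu : ∀ c u, σ u ∈ (σ '' L c ∪ {x | c = i ∧ x = q}) ↔ u ∈ L c := fun c u => by
    simp [X.inj.mem_set_image, X.ne u]
  have hLq : ∀ c, q ∈ (σ '' L c ∪ {x | c = i ∧ x = q}) ↔ c = i := fun c => by
    simp [X.ne]
  have hEp : ∀ e ∈ J.edgeSet, ∀ z ∈ E e, z ∉ p := fun e he z hz hzp => (hE z hzp e he z hz).1 rfl
  refine R.extend X (fun e he z hz => ⟨fun h1 => hEp e he z hz (List.mem_of_head? h1), fun u => ?_⟩)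
    hLu ?_ ?_ ?_ ?_ ?_
  · grind
  · grind
  · grind
  · grind
  · grind
  grind

end NetRungs

/-! ### The tree and the rungs given by the strip system -/

section Initial

variable {V W : Type*} {G : SimpleGraph V} {J : SimpleGraph W} {M : StripFamily V W}
  {h : Bool → V} {L : Bool → Set W} {ℓ : W → W → List V}

def rungSet (J : SimpleGraph W) (ℓ : W → W → List V) (e : Sym2 W) : Set V :=
  {z | ∃ u v, e = s(u, v) ∧ J.Adj u v ∧ z ∈ ℓ u v}

theorem mem_rungSet (hℓ : Selection G J M ℓ) {u v : W} (huv : J.Adj u v) {z : V} :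
    z ∈ rungSet J ℓ s(u, v) ↔ z ∈ ℓ u v := by
  refine ⟨?_, fun h1 => ⟨u, v, rfl, huv, h1⟩⟩
  rintro ⟨u', v', h1, h2, h3⟩
  rcases Sym2.eq_iff.1 h1 with ⟨rfl, rfl⟩ | ⟨rfl, rfl⟩
  · exact h3
  · rw [hℓ.rev _ _ huv] at h3
    simpa using h3

namespace CrossSystem

theorem rungs (C : CrossSystem G J M h L) (hℓ : Selection G J M ℓ) :
    Rungs G h J L (rungSet J ℓ) M.node := by
  have hsub : ∀ e, ∀ z ∈ rungSet J ℓ e, z ∈ M.edge e := by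
    rintro _ z ⟨u, v, rfl, h1, h2⟩
    exact hℓ.sub u v h1 z h2
  refine ⟨fun u v huv => ?_, fun e he z hz n hn => C.node_mem_edge he (hsub e z hz) hn,
    fun e he f hf hef y hy z hz => ?_, fun c e he z hz => ?_⟩
  · have hr := hℓ.isRung huv
    exact ⟨ℓ u v, hr.ne, hr.ip, fun z => mem_rungSet hℓ huv, hr.fst, hr.snd⟩
  · have hy := hsub e y hy
    have hz := hsub f z hz
    refine ⟨fun h1 => hef (C.mem_edge_unique he hf hy (h1 ▸ hz)), ?_⟩
    by_cases h1 : ∃ n, n ∈ e ∧ n ∈ f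
    · obtain ⟨n, hne, hnf⟩ := h1
      obtain ⟨u, rfl⟩ := hne
      obtain ⟨v, rfl⟩ := hnf
      have huv : u ≠ v := fun h2 => hef (by rw [h2])
      rw [C.sys.adj_iff n u v he hf huv y hy z hz]
      refine ⟨fun h2 => ⟨n, h2⟩, ?_⟩
      rintro ⟨m, h2, h3⟩
      have h4 := Sym2.mem_iff.1 (C.node_mem_edge he hy h2)
      have h5 := Sym2.mem_iff.1 (C.node_mem_edge hf hz h3)
      grind
    · constructor
      · intro h2
        induction e using Sym2.ind with | _ u v =>
        induction f using Sym2.ind with | _ w x =>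
        exact absurd h2 (C.sys.anticomplete u v w x he hf
          (fun h3 => h1 ⟨u, by simp, by simp [h3]⟩) (fun h3 => h1 ⟨u, by simp, by simp [h3]⟩)
          (fun h3 => h1 ⟨v, by simp, by simp [h3]⟩) (fun h3 => h1 ⟨v, by simp, by simp [h3]⟩)
          y hy z hz)
      · rintro ⟨n, h2, h3⟩
        exact absurd ⟨n, C.node_mem_edge he hy h2, C.node_mem_edge hf hz h3⟩ h1
  · have hz := mem_verts_of_edge he (hsub e z hz)
    exact ⟨C.ne_hub hz c, C.hub c z hz⟩

theorem exists_rch (C : CrossSystem G J M h L) {v u : W} (hu : J.Adj v u) {c : Bool}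
    (hc : u ∉ L (!c)) : ∃ t ∈ L c, Rch J v u t := by
  obtain ⟨t, ht, h1⟩ := C.exists_leaf_beyond hu.ne' c hc
  refine ⟨t, ht, rch_of_dist C.sys.tree.connected ?_⟩
  have h2 := h1.dist_eq C.sys.tree hu.ne'
  have h3 : J.dist v u = 1 := SimpleGraph.dist_eq_one_iff_adj.2 hu
  omega

/-- `J` has no vertex of degree two, so all its vertices count as branch-vertices. -/
theorem net (C : CrossSystem G J M h L) : Net J L (Nat.card W) := by
  have := C.finite
  have hne : Nonempty W := C.sys.tree.connected.nonempty
  have hcard := C.sys.three_le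
  have hnon : Nontrivial W := Finite.one_lt_card_iff_nontrivial.1 (by omega)
  have hdeg : ∀ v, ∃ u, J.Adj v u := fun v => by
    obtain ⟨x, hx⟩ := exists_ne v
    exact ⟨_, nx_adj C.sys.tree hx⟩
  obtain ⟨s, hs⟩ : ∃ s, ∀ c, s ∉ L c := by
    obtain ⟨v⟩ := hne
    obtain ⟨u, hu⟩ := hdeg v
    by_cases h1 : ∃ c, u ∈ L c
    · obtain ⟨c, hc⟩ := h1
      exact ⟨v, C.nbr_not_leaf hu hc⟩
    · exact ⟨u, not_exists.1 h1⟩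
  obtain ⟨u, hu⟩ := hdeg s
  obtain ⟨u₁, u₂, h1, h2, h3, h4, h5⟩ := C.exists_two hs hu
  have hvia : ∀ v u u' c, J.Adj v u → J.Adj v u' → u ≠ u' →
      ∃ t ∈ L c, Rch J v u t ∨ Rch J v u' t := by
    intro v u u' c hu hu' hne
    by_cases h6 : u ∈ L (!c)
    · have h7 : u' ∉ L (!c) := fun h7 => hne (C.one (!c) v ⟨hu, h6⟩ ⟨hu', h7⟩)
      obtain ⟨t, ht, h8⟩ := C.exists_rch hu' h7
      grind
    · obtain ⟨t, ht, h8⟩ := C.exists_rch hu h6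
      grind
  refine ⟨C.sys.tree, fun t => ⟨C.leaf_mem t, fun ⟨c, hc⟩ => C.isLeaf c t hc⟩, C.disj,
    fun s t c hst ht => C.nbr_not_leaf hst ht, hvia, fun c => ?_, ?_, ?_⟩
  · obtain ⟨t, ht, -⟩ := hvia s u u₁ c hu h1 h3.symm
    exact ⟨t, ht⟩
  · have key : ∀ w, J.Adj s w → ∃ t, IsLeaf J t ∧ nx J s t = w := by
      intro w hw
      obtain ⟨c, hc⟩ : ∃ c, w ∉ L (!c) := by
        by_cases h6 : w ∈ L true
        · exact ⟨true, C.disj true w h6⟩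
        simp_all
      obtain ⟨t, ht, h7⟩ := C.exists_leaf_beyond hw.ne' c hc
      exact ⟨t, C.isLeaf c t ht, (h7.nx_eq C.sys.tree hw.ne').trans (nx_of_adj C.sys.tree hw)⟩
    obtain ⟨t, ht, e0⟩ := key u hu
    obtain ⟨t₁, ht₁, e1⟩ := key u₁ h1
    obtain ⟨t₂, ht₂, e2⟩ := key u₂ h2
    have h6 : ({t, t₁, t₂} : Set W).ncard = 3 := by
      rw [Set.ncard_eq_three]
      exact ⟨t, t₁, t₂, fun h => h3 (by grind), fun h => h4 (by grind),
        fun h => h5 (by grind), rfl⟩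
    rw [← h6]
    refine Set.ncard_le_ncard ?_ (Set.toFinite _)
    grind
  · rw [← Set.ncard_univ]
    exact Set.ncard_le_ncard (fun v _ => C.deg v) (Set.toFinite _)

end CrossSystem

end Initial

/-! ### Counting the edges of the shape -/

section ShapeBound

variable {U : Type*} {J : SimpleGraph U} {L : Bool → Set U} {K : ℕ}

/-- A path is split at inner branch-vertices until each piece is a branch. -/
theorem shape_reachable (n : ℕ) : ∀ (u v : {v : U // IsBranchVertex J v}) (p : J.Walk u.1 v.1),
    p.IsPath → p.length ≤ n → (shape J).Reachable u v := by
  classical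
  induction n with
  | zero =>
    intro u v p _ hn
    rw [Subtype.ext (p.eq_of_length_eq_zero (by omega))]
  | succ n ih =>
    intro u v p hp hn
    by_cases huv : u = v
    · rw [huv]
    by_cases hx : ∃ x ∈ p.support, x ≠ u.1 ∧ x ≠ v.1 ∧ IsBranchVertex J x
    · obtain ⟨x, hx, hxu, hxv, hxb⟩ := hx
      have h1 := p.length_takeUntil_lt_length hx hxv
      have h2 := p.length_dropUntil_lt_length hx hxu
      exact (ih u ⟨x, hxb⟩ (p.takeUntil x hx) (hp.takeUntil hx) (by omega)).trans
        (ih ⟨x, hxb⟩ v (p.dropUntil x hx) (hp.dropUntil hx) (by omega))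
    · refine SimpleGraph.Adj.reachable ?_
      rw [shape, SimpleGraph.fromRel_adj]
      exact ⟨huv, Or.inl ⟨fun h1 => huv (Subtype.ext h1), u.2, v.2, p, hp,
        fun y hy hyu hyv hb => hx ⟨y, hy, hyu, hyv, hb⟩⟩⟩

/-- Only the connectedness of the shape is needed: its vertices are the branch-vertices, and a
connected graph has at least one edge fewer than vertices. -/
theorem Net.le_shape [Finite U] (T : Net J L K) : K ≤ (shape J).edgeSet.ncard + 1 := by
  classical
  obtain ⟨t, ht⟩ := T.ne true
  have hb : IsBranchVertex J t := by
    rw [IsBranchVertex, (T.leaf t).2 ⟨true, ht⟩]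
    decide
  have : Nonempty {v : U // IsBranchVertex J v} := ⟨⟨t, hb⟩⟩
  have hc : (shape J).Connected := ⟨fun u v => by
    obtain ⟨p, hp⟩ := (T.tree.connected.preconnected u.1 v.1).exists_isPath
    exact shape_reachable p.length u v p hp le_rfl⟩
  have h1 := hc.card_vert_le_card_edgeSet_add_one
  rw [← Nat.card_coe_set_eq]
  refine T.count.trans (le_trans (le_of_eq ?_) h1)
  tauto

end ShapeBound

/-! ### Subdividing down to an extended tree line-graph -/

section Realize

variable {V U : Type*} {G : SimpleGraph V} {h : Bool → V} {J : SimpleGraph U}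
  {L : Bool → Set U} {E : Sym2 U → Set V} {N : U → Set V} {K : ℕ} {ζ : Sym2 U → V}

theorem exists_comp_nbr (hJ : J.Connected) (v : U)
    (C : (J.induce ({v}ᶜ : Set U)).ConnectedComponent) :
    ∃ u, J.Adj v u ∧ ∀ t (_ : Rch J v u t) (ht : t ∈ ({v}ᶜ : Set U)), ⟨t, ht⟩ ∈ C.supp := by
  classical
  have key : ∀ {u t : U} (w : J.Walk u t) (hw : v ∉ w.support) (hu : u ∈ ({v}ᶜ : Set U))
      (ht : t ∈ ({v}ᶜ : Set U)), (J.induce ({v}ᶜ : Set U)).Reachable ⟨u, hu⟩ ⟨t, ht⟩ :=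
    fun w hw hu ht => ⟨w.induce ({v}ᶜ : Set U) fun x hx hxv => hw (hxv ▸ hx)⟩
  induction C using SimpleGraph.ConnectedComponent.ind with | _ x =>
  obtain ⟨x, hx⟩ := x
  obtain ⟨p, hp⟩ := (hJ.preconnected v x).exists_isPath
  cases p with
  | nil => grind
  | @cons _ u _ hvu w =>
    rw [SimpleGraph.Walk.cons_isPath_iff] at hp
    refine ⟨u, hvu, fun t ⟨w', hw'⟩ ht => ?_⟩
    rw [SimpleGraph.ConnectedComponent.mem_supp_iff, SimpleGraph.ConnectedComponent.eq]
    exact (key w' hw' hvu.ne' ht).symm.trans (key w hp.2 hvu.ne' hx)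

/-- The condition `via` is the component condition phrased by walks, the form that survives changes
of the tree: of two components of the tree minus `v`, one contains a leaf of `L c`. -/
theorem Net.comp_subsingleton (T : Net J L K) (v : U) (c : Bool) :
    {C : (J.induce ({v}ᶜ : Set U)).ConnectedComponent |
      ∀ x ∈ C.supp, x.1 ∉ L c}.Subsingleton := by
  intro C hC C' hC'
  by_contra hne
  obtain ⟨u, hu, h1⟩ := exists_comp_nbr T.tree.connected v C
  obtain ⟨u', hu', h1'⟩ := exists_comp_nbr T.tree.connected v C'
  have huu : u ≠ u' := by
    rintro rfl
    have hr : Rch J v u u := ⟨SimpleGraph.Walk.nil, by simpa using hu.ne⟩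
    exact hne (SimpleGraph.ConnectedComponent.eq_of_common_vertex (h1 u hr hu.ne')
      (h1' u hr hu.ne'))
  have hv : ∀ {u t}, Rch J v u t → t ∈ ({v}ᶜ : Set U) := fun {u t} ⟨w, hw⟩ htv => by
    rw [Set.mem_singleton_iff] at htv
    exact hw (htv ▸ w.end_mem_support)
  obtain ⟨t, ht, hr | hr⟩ := T.via v u u' c hu hu' huu
  · grind
  grind

theorem pl_length (hJ : J.IsTree) {ℓ : U → U → List V} (hℓ : ∀ u v, (ℓ u v).length = 1)
    (v x : U) : (pl J ℓ v x).length = J.dist v x := by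
  induction hn : J.dist v x generalizing v with
  | zero =>
    rw [hJ.connected.dist_eq_zero_iff] at hn
    rw [hn, pl_self]
    rfl
  | succ n ih =>
    have hxv : x ≠ v := by grind
    rw [pl_cons hJ ℓ hxv, List.length_append, hℓ, ih _ (by have := nx_dist hJ hxv; omega)]
    omega

theorem Rungs.node_iff (R : Rungs G h J L E N) (hζ : ∀ e ∈ J.edgeSet, E e = {ζ e}) {e : Sym2 U}
    (he : e ∈ J.edgeSet) {n : U} : ζ e ∈ N n ↔ n ∈ e := by
  refine ⟨R.node e he _ (by grind) n, ?_⟩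
  rintro ⟨m, rfl⟩
  obtain ⟨l, h1, -, h2, h3, -⟩ := R.rung n m he
  rw [hζ _ he] at h2
  obtain ⟨z, l, rfl⟩ := List.exists_cons_of_ne_nil h1
  grind

theorem Net.lineTree (T : Net J L K) (R : Rungs G h J L E N) (hubs : ∀ c, G.Adj (h c) (h (!c)))
    (hζ : ∀ e ∈ J.edgeSet, E e = {ζ e}) : LineTree G J h L fun u v => [ζ s(u, v)] := by
  have hm : ∀ e ∈ J.edgeSet, ζ e ∈ E e := fun e he => by grind
  refine ⟨T.tree, fun c t ht u v hu hv => ?_, T.disj, by simp, fun _ _ _ => IP.singleton _,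
    fun u v _ => by grind, fun u v w x huv hwx hne z hz hz' => ?_,
    fun u v w huv huw hvw x hx y hy => ?_, fun u v w x huv hwx h1 h2 h3 h4 y hy z hz hyz => ?_,
    hubs, fun c u v huv hc => ?_, fun c u v huv x hx => ?_⟩
  · obtain ⟨w, hw⟩ := Set.ncard_eq_one.1 ((T.leaf t).2 ⟨c, ht⟩)
    have h1 : u ∈ J.neighborSet t := hu
    have h2 : v ∈ J.neighborSet t := hv
    grind
  · rw [List.mem_singleton] at hz hz'
    exact (R.cross _ huv _ hwx hne _ (hm _ huv) _ (hm _ hwx)).1 (hz.symm.trans hz')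
  · rw [List.mem_singleton] at hx hy
    subst hx hy
    simp only [List.head?_cons, and_self, iff_true]
    refine (R.cross _ huv _ huw ?_ _ (hm _ huv) _ (hm _ huw)).2.2 ⟨u, ?_, ?_⟩
    · grind
    · exact (R.node_iff hζ huv).2 (by simp)
    · exact (R.node_iff hζ huw).2 (by simp)
  · rw [List.mem_singleton] at hy hz
    subst hy hz
    have hne : s(u, v) ≠ s(w, x) := fun h5 => by grind
    obtain ⟨n, h5, h6⟩ := (R.cross _ huv _ hwx hne _ (hm _ huv) _ (hm _ hwx)).2.1 hyz
    rw [R.node_iff hζ huv, Sym2.mem_iff] at h5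
    rw [R.node_iff hζ hwx, Sym2.mem_iff] at h6
    grind
  · rw [List.mem_singleton] at hc
    exact (R.hub c _ huv _ (hm _ huv)).1 hc.symm
  · rw [List.mem_singleton] at hx
    subst hx
    simp only [List.head?_cons, List.getLast?_singleton, and_true]
    rw [(R.hub c _ huv _ (hm _ huv)).2]
    simp only [R.node_iff hζ (show s(u, v) ∈ J.edgeSet from huv), Sym2.mem_iff]
    grind

/-- The path between leaves of different classes is closed to an odd cycle by the two hubs. -/
theorem LineTree.odd_pl (hG : EvenHoleFree G) {ℓ : U → U → List V} (H : LineTree G J h L ℓ)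
    {c : Bool} {t t' s : U} (ht : t ∈ L c) (hts : J.Adj t s) (hs : s ∉ L c) (ht' : t' ∈ L (!c)) :
    Odd (pl J ℓ t t').length := by
  have htt : t' ≠ t := fun h1 => H.disj c t ht (h1 ▸ ht')
  have hne : pl J ℓ t t' ≠ [] := H.pl_ne_nil htt
  have hct : t' ∉ L c := by simpa using H.disj _ t' ht'
  have := odd_cone (x := h c) hG (H.pl_hub_ip (H.disj c t ht) ht')
    (by
      rw [List.mem_append, List.mem_singleton]
      exact fun h1 => h1.elim (H.hub_notMem_pl c t t') (H.hubs c).ne)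
    (by
      have := List.length_pos_iff.2 hne
      grind) fun z hz => by
      rw [List.head?_append_of_ne_nil _ hne, List.getLast?_append_of_ne_nil _ (by simp)]
      rcases List.mem_append.1 hz with h1 | h1
      · rw [H.hub_pl_of_leaf ht hts hs htt h1]
        have h3 : h (!c) ≠ z := fun h3 => H.hub_notMem_pl _ t t' (h3 ▸ h1)
        simp [hct, h3]
      · rw [List.mem_singleton] at h1
        subst h1
        simpa using H.hubs c
  grind

/-- With one vertex per rung, distances in the tree are lengths of lists. Two leaves of one class
are joined by a path that their hub closes to an odd cycle; for different classes `odd_pl` applies.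
-/
theorem Net.even_dist (hG : EvenHoleFree G) (T : Net J L K) {ℓ : U → U → List V}
    (H : LineTree G J h L ℓ) (hℓ : ∀ u v, (ℓ u v).length = 1) {t₀ t : U} (ht₀ : t₀ ∈ L true)
    {c : Bool} (ht : t ∈ L c) : Even (J.dist t t₀) ↔ c = true := by
  by_cases htt : t = t₀
  · subst htt
    have : c = true := by
      by_contra h1
      exact T.disj c t ht (by grind)
    simp [this]
  have hadj := nx_adj T.tree htt
  have hs : ∀ d, nx J t₀ t ∉ L d := T.nbr _ t₀ true hadj.symm ht₀
  rw [SimpleGraph.dist_comm, ← pl_length T.tree hℓ]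
  cases c with
  | true =>
    have h2 : 2 ≤ (pl J ℓ t₀ t).length := by
      rw [pl_length T.tree hℓ]
      have h3 : J.dist t₀ t ≠ 0 := fun h3 => htt (T.tree.connected.dist_eq_zero_iff.1 h3).symm
      have h4 : J.dist t₀ t ≠ 1 := fun h4 =>
        T.nbr t₀ t _ (SimpleGraph.dist_eq_one_iff_adj.1 h4) ht true ht₀
      omega
    have := odd_cone hG (H.pl_ip t₀ t) (H.hub_notMem_pl true t₀ t) h2
      fun z hz => by rw [H.hub_pl_of_leaf ht₀ hadj (hs true) htt hz]; simp [ht]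
    grind
  | false => simpa using H.odd_pl hG ht₀ hadj (hs true) ht

/-- The bipartition has to be found: a vertex is classified by the parity of its distance from a
fixed leaf of `L true`. By `even_dist` this agrees with the labels on the leaves. -/
theorem Net.contains (hG : EvenHoleFree G) (T : Net J L K) (R : Rungs G h J L E N)
    (hubs : ∀ c, G.Adj (h c) (h (!c))) (hζ : ∀ e ∈ J.edgeSet, E e = {ζ e}) :
    ContainsExtTreeLineGraph J G (h true) (h false) := by
  have H := T.lineTree R hubs hζ
  have hm : ∀ e ∈ J.edgeSet, ζ e ∈ E e := fun e he => by grind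
  obtain ⟨t₀, ht₀⟩ := T.ne true
  have hL : ∀ t, IsLeaf J t → ((Even (J.dist t t₀)) ↔ t ∈ L true) ∧
      (¬ Even (J.dist t t₀) ↔ t ∈ L false) := by
    intro t ht
    obtain ⟨c, hc⟩ := (T.leaf t).1 ht
    have h1 := T.even_dist hG H (fun _ _ => rfl) ht₀ hc
    have h2 := T.disj c t hc
    grind
  refine ⟨{u | Even (J.dist u t₀)}, ⟨T.tree, fun u v huv => ?_, T.three, fun v => ?_,
    fun v => ?_⟩, ?_⟩
  · show Even (J.dist u t₀) ↔ ¬ Even (J.dist v t₀)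
    by_cases h1 : v = nx J u t₀
    · have h2 := nx_dist T.tree (ne_of_nx_eq huv h1.symm)
      grind
    · rw [dist_of_ne_nx T.tree huv h1, Nat.even_add_one, not_not]
  · refine (T.comp_subsingleton v true).anti fun C hC x hx hxL => hC x hx ?_
    have := (T.leaf x.1).2 ⟨_, hxL⟩
    grind
  · refine (T.comp_subsingleton v false).anti fun C hC x hx hxL => hC x hx ?_
    have := (T.leaf x.1).2 ⟨_, hxL⟩
    grind
  have hee : ∀ e ∈ J.edgeSet, ∀ f ∈ J.edgeSet, e ≠ f →
      (G.Adj (ζ e) (ζ f) ↔ ∃ v, v ∈ e ∧ v ∈ f) := by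
    intro e he f hf hef
    rw [(R.cross e he f hf hef _ (hm e he) _ (hm f hf)).2]
    simp only [R.node_iff hζ he, R.node_iff hζ hf]
  have heh : ∀ c, ∀ e ∈ J.edgeSet, (G.Adj (h c) (ζ e) ↔ ∃ v ∈ e, v ∈ L c) := by
    intro c e he
    rw [(R.hub c e he _ (hm e he)).2]
    simp only [R.node_iff hζ he, and_comm]
  have hleaf : ∀ (v : U), ((IsLeaf J v ∧ v ∈ {u | Even (J.dist u t₀)}) ↔ v ∈ L true) ∧
      ((IsLeaf J v ∧ v ∉ {u | Even (J.dist u t₀)}) ↔ v ∈ L false) := fun v =>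
    ⟨⟨fun h1 => (hL v h1.1).1.1 h1.2, fun h1 => by
      have := (T.leaf v).2 ⟨_, h1⟩
      grind⟩, ⟨fun h1 => (hL v h1.1).2.1 h1.2, fun h1 => by
      have := (T.leaf v).2 ⟨_, h1⟩
      grind⟩⟩
  generalize {u | Even (J.dist u t₀)} = A' at hleaf ⊢
  refine ⟨⟨⟨Sum.elim (fun e => ζ e.1) h, ?_⟩, ?_⟩, rfl, rfl⟩
  · rintro (⟨e, he⟩ | c) (⟨f, hf⟩ | d) h1
    · simp only [Sum.elim_inl] at h1
      congr 2
      by_contra hef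
      exact (R.cross e he f hf hef _ (hm e he) _ (hm f hf)).1 h1
    · exact absurd h1 (R.hub d e he _ (hm e he)).1
    · exact absurd h1.symm (R.hub c f hf _ (hm f hf)).1
    · by_contra hcd
      have : d = !c := Bool.eq_not_of_ne fun h2 => hcd (by rw [h2])
      subst this
      exact (hubs c).ne h1
  · rintro (⟨e, he⟩ | c) (⟨f, hf⟩ | d)
    · show G.Adj (ζ e) (ζ f) ↔ _
      rw [lineGraphWithCrossEdge, SimpleGraph.fromRel_adj]
      by_cases hef : e = f
      · subst hef
        simp
      grind
    · show G.Adj (ζ e) (h d) ↔ _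
      rw [G.adj_comm, heh d e he, lineGraphWithCrossEdge, SimpleGraph.fromRel_adj]
      cases d <;> simp [hleaf]
    · show G.Adj (h c) (ζ f) ↔ _
      rw [heh c f hf, lineGraphWithCrossEdge, SimpleGraph.fromRel_adj]
      cases c <;> simp [hleaf]
    · show G.Adj (h c) (h d) ↔ _
      rw [lineGraphWithCrossEdge, SimpleGraph.fromRel_adj]
      cases c <;> cases d <;> simp_all

/-- The rungs are nonempty and pairwise disjoint. This bound makes repeated subdivision stop. -/
theorem Rungs.edge_le [Finite V] (R : Rungs G h J L E N) : J.edgeSet.ncard ≤ Nat.card V := by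
  have h1 : ∀ e : J.edgeSet, ∃ z, z ∈ E e.1 := by
    rintro ⟨e, he⟩
    induction e using Sym2.ind with | _ u v =>
    obtain ⟨l, h1, -, h2, -⟩ := R.rung u v he
    exact ⟨l.head h1, (h2 _).2 (List.head_mem h1)⟩
  choose f hf using h1
  rw [← Nat.card_coe_set_eq]
  refine Nat.card_le_card_of_injective f fun e e' h2 => ?_
  by_contra hne
  exact (R.cross e.1 e.2 e'.1 e'.2 (fun h3 => hne (Subtype.ext h3)) _ (hf e) _ (hf e')).1 h2

/-- As long as some rung has two vertices it is subdivided after its first vertex. Each step adds a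
vertex to the tree, and `k` bounds the number of steps still possible. -/
theorem exists_contains [Finite V] (hG : EvenHoleFree G) (hubs : ∀ c, G.Adj (h c) (h (!c)))
    (k : ℕ) : ∀ {n : ℕ} {J : SimpleGraph (Fin n)} {L : Bool → Set (Fin n)}
    {E : Sym2 (Fin n) → Set V} {N : Fin n → Set V}, Net J L K → Rungs G h J L E N →
    Nat.card V + 2 ≤ n + k → ∃ (n : ℕ) (T : SimpleGraph (Fin n)),
      ContainsExtTreeLineGraph T G (h true) (h false) ∧ K ≤ (shape T).edgeSet.ncard + 1 := by
  induction k with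
  | zero =>
    intro n J L E N T R hn
    have h1 := R.edge_le
    have h2 := (SimpleGraph.isTree_iff_connected_and_card.1 T.tree).2
    rw [Nat.card_coe_set_eq, Nat.card_fin] at h2
    omega
  | succ k ih =>
    intro n J L E N T R hn
    by_cases hs : ∀ e ∈ J.edgeSet, ∃ z, E e = {z}
    · have : Nonempty V := ⟨h true⟩
      choose! ζ hζ using hs
      exact ⟨n, J, T.contains hG R hubs hζ, T.le_shape⟩
    · push Not at hs
      obtain ⟨e, he, hs⟩ := hs
      induction e using Sym2.ind with | _ a b =>
      obtain ⟨l, h1, h2, h3, h4, h5⟩ := R.rung a b he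
      obtain ⟨x, l, rfl⟩ := List.exists_cons_of_ne_nil h1
      have hl : l ≠ [] := by
        rintro rfl
        exact hs x (Set.ext fun z => by simpa using h3 z)
      obtain ⟨J', σ, q, X⟩ := exists_ext (Equiv.refl (Fin n)) (J.deleteEdges {s(a, b)}) {a, b}
      exact ih (T.subdivide he X)
        (R.subdivide he X (A := [x]) (B := l) (by simp) hl h2 h3 h4 h5) (by omega)

end Realize

/-! ### Consequences of the maximality of the shape -/

section EdgeMaximality

variable {V W : Type*} {G : SimpleGraph V} {J : SimpleGraph W} {M : StripFamily V W}
  {h : Bool → V} {L : Bool → Set W} {p : List V} {ℓ : W → W → List V} {i : Bool}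

def MaxEdges (G : SimpleGraph V) (J : SimpleGraph W) (h : Bool → V) : Prop :=
  ∀ (n : ℕ) (T : SimpleGraph (Fin n)), ContainsExtTreeLineGraph T G (h true) (h false) →
    (shape T).edgeSet.ncard ≤ J.edgeSet.ncard

namespace CrossSystem

/-- With `p` as a pendant edge the tree has at least |W| + 1 = |E(J)| + 2 branch-vertices, so the
shape obtained after full subdivision has more than |E(J)| edges. -/
theorem pend_false [Finite V] (C : CrossSystem G J M h L) (hM : MaxEdges G J h)
    {U : Type*} [Finite U] {J' : SimpleGraph U} {L' : Bool → Set U} {E : Sym2 U → Set V}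
    {N : U → Set V} (T : Net J' L' (Nat.card W)) (R : Rungs G h J' L' E N)
    (H : HubPath G J M h L i p) {v : U} (hv : ∀ c, v ∉ L' c)
    (hd : ∀ u, J'.Adj v u → ∃ t ∈ L' (!i), Rch J' v u t)
    (hN : ∀ n, ∀ y ∈ N n, y ∈ M.verts J)
    (hE : ∀ e ∈ J'.edgeSet, ∀ y ∈ E e, y ∈ M.verts J ∧ (Att G p y ↔ y ∈ N v) ∧
      ¬ Att G p.dropLast y) : False := by
  have := C.finite
  have hp := H.tight
  obtain ⟨J₁, σ, q, X⟩ := exists_ext (Finite.equivFin U) J' {v}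
  have hne : ∀ z ∈ p, ∀ y ∈ M.verts J, y ≠ z := fun z hz y hy h1 =>
    hp.out z hz (Or.inl (h1 ▸ hy))
  have R' := R.pend hv X hp.ne hp.ip (fun z hz n hzn => hne z hz z (hN n z hzn) rfl)
    (fun z hz e he y hy => by
      obtain ⟨h1, h2, h3⟩ := hE e he y hy
      refine ⟨hne z hz y h1, ?_⟩
      rw [G.adj_comm, ← h2]
      by_cases h4 : Att G p y
      · rw [not_att_dropLast_iff hp.ip h4 h3 hz]
        simp [h4]
      · exact ⟨fun h5 => absurd ⟨z, hz, h5⟩ h4, fun h5 => absurd h5.1 h4⟩)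
    (i := i) (fun c z hz => ⟨fun h1 => hp.out z hz (Or.inr ⟨c, h1⟩), by
      rw [G.adj_comm]
      by_cases hc : c = i
      · subst hc
        rw [not_att_tail_iff hp.ip H.hub H.hub_tail hz]
        simp
      · refine ⟨fun h1 => absurd ⟨z, hz, ?_⟩ H.hub', fun h1 => absurd h1.1 hc⟩
        rwa [← Bool.eq_not_of_ne hc]⟩)
  obtain ⟨n, T', hT, hK⟩ := exists_contains C.ehf C.hubs (Nat.card V + 2) (T.pend hv hd X) R'
    (by omega)
  have h1 := hM n T' hT
  have h2 := (SimpleGraph.isTree_iff_connected_and_card.1 C.sys.tree).2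
  rw [Nat.card_coe_set_eq] at h2
  omega

/-- If `p` attaches to a node, it is hung there. If it attaches to two consecutive vertices of a
rung, the rung is first cut between them, which makes them the node of a new vertex of the tree. -/
theorem hubPath_false [Finite V] (C : CrossSystem G J M h L) (hmax : MaxVerts G J M h L)
    (hM : MaxEdges G J h) (H : HubPath G J M h L i p) : False := by
  have := C.finite
  have hnode : ∀ n, ∀ y ∈ M.node n, y ∈ M.verts J := fun n y hy => C.node_mem_verts hy
  rcases C.hubPath_attach hmax H with ⟨v, h1, h2, h3, h4⟩ |
    ⟨v, u, ℓ, A, x, y, B, hℓ, hvu, h1, h2, h3, hx, hy, hx', hy', h4⟩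
  · obtain ⟨ℓ, hℓ⟩ := C.exists_selection
    refine C.pend_false hM C.net (C.rungs hℓ) H h1 (fun u hu => C.exists_rch hu ?_) hnode ?_
    · grind
    · rintro e - y ⟨a, b, rfl, hab, hy⟩
      have hyv := mem_verts_of_edge hab (hℓ.sub a b hab y hy)
      exact ⟨hyv, h3 y hyv, fun h5 => h4 y ((h3 y hyv).1 h5.of_dropLast) h5⟩
  · have hr := hℓ.isRung hvu
    have hl : ℓ v u = (A ++ [x]) ++ y :: B := by simp [h3]
    obtain ⟨J', σ, q, X⟩ := exists_ext (Finite.equivFin W) (J.deleteEdges {s(v, u)}) {v, u}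
    have hs := deleteEdges_or J v u
    have hNq : ∀ z, (z ∈ extNode σ q M.node
        {z | (A ++ [x]).getLast? = some z ∨ (y :: B).head? = some z} q) ↔ z = x ∨ z = y :=
      fun z => X.mem_node_new.trans (by simp [eq_comm])
    have hold : ∀ a b, J.Adj a b → ∀ z ∈ ℓ a b, z ∈ M.verts J ∧ (Att G p z ↔ z = x ∨ z = y) ∧
        ¬ Att G p.dropLast z := by
      intro a b hab z hz
      refine ⟨mem_verts_of_edge hab (hℓ.sub a b hab z hz), ⟨h4 a b hab z hz, ?_⟩, fun h5 => ?_⟩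
      · grind
      · rcases h4 a b hab z hz h5.of_dropLast with rfl | rfl
        exacts [hx' h5, hy' h5]
    have hQ : ∀ w ∈ ({v, u} : Set W), ∀ a b, J.Adj a b → a ∈ ({v, u} : Set W) →
        b ∈ ({v, u} : Set W) → a = w ∨ b = w := by
      rintro w hw a b hab (rfl | rfl) (rfl | rfl) <;> rcases hw with rfl | rfl <;>
        first | exact absurd hab (J.loopless.irrefl _) | simp
    refine C.pend_false hM (C.net.subdivide hvu X) ((C.rungs hℓ).subdivide hvu X (by simp)
      (by simp) (hl ▸ hr.ip) (fun z => hl ▸ mem_rungSet hℓ hvu) (hl ▸ hr.fst) (hl ▸ hr.snd)) H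
      (v := q) ?_ (fun w hw => ?_) (fun n z hz => ?_) fun e he z hz => ?_
    · rintro c ⟨w, -, hw⟩
      exact X.ne w hw
    · rw [← SimpleGraph.mem_neighborSet, X.nbr_new] at hw
      obtain ⟨w, hw, rfl⟩ := hw
      obtain ⟨w', hw', hww, hwi⟩ : ∃ w' ∈ ({v, u} : Set W), J.Adj w' w ∧ w ∉ L (!!i) := by
        rw [Bool.not_not]
        rcases hw with rfl | rfl
        exacts [⟨u, by simp, hvu.symm, h1 i⟩, ⟨v, by simp, hvu, h2⟩]
      obtain ⟨t, ht, h5⟩ := C.exists_rch hww hwi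
      exact ⟨σ t, ⟨t, ht, rfl⟩, X.rch_new hs h5 (hQ w' hw')⟩
    · rcases X.cov n with rfl | ⟨w, rfl⟩
      · grind
      · exact hnode w z (X.mem_node.1 hz)
    · rw [hNq]
      rcases hz with ⟨f, -, -, a, b, -, hab, hz⟩ | ⟨w, -, -, hz⟩
      · exact hold a b hab z hz
      grind

/-- Besides the case of a common strip, two leaves could be related through a common neighbour w
with both vertices in M_w. `Nondeg` excludes this for leaves in `L true`, and w has at most one
neighbour in `L false`. -/
theorem leaf_node_unique (C : CrossSystem G J M h L) (hnd : Nondeg J M L) {x y : V} {t t' : W}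
    {c d : Bool} (ht : t ∈ L c) (ht' : t' ∈ L d) (hx : x ∈ M.node t) (hy : y ∈ M.node t')
    (hr : RelJ J M x y) : t = t' := by
  rcases hr with ⟨e, he, hxe, hye⟩ | ⟨w, hxw, hyw⟩
  · by_contra hne
    have := (Sym2.mem_and_mem_iff hne).1 ⟨C.node_mem_edge he hxe hx, C.node_mem_edge he hye hy⟩
    subst this
    exact C.nbr_not_leaf he ht' c ht
  · obtain ⟨s, hs, hxs⟩ := C.exists_edge_of_node hx
    obtain ⟨s', hs', hys⟩ := C.exists_edge_of_node hy
    rcases Sym2.mem_iff.1 (C.node_mem_edge hs hxs hxw) with rfl | rfl <;>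
      rcases Sym2.mem_iff.1 (C.node_mem_edge hs' hys hyw) with rfl | rfl
    · rfl
    · exact absurd ht (C.nbr_not_leaf hs'.symm ht' c)
    · exact absurd ht' (C.nbr_not_leaf hs.symm ht d)
    · cases c
      · cases d
        · exact C.one _ _ ⟨hs.symm, ht⟩ ⟨hs'.symm, ht'⟩
        tauto
      tauto

/-- An unrelated pair of attachments would give a tight path missing `h (!i)`, hence a path as in
`HubPath`. So all attachments are related to the hub `h i`, which puts them in its leaf nodes, and
to each other, which makes the leaf unique. -/
theorem hub_attachments [Finite V] (C : CrossSystem G J M h L) (hmax : MaxVerts G J M h L)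
    (hnd : Nondeg J M L) (hM : MaxEdges G J h) {F : Set V} (hF : (G.induce F).Connected)
    (hout : ∀ f ∈ F, ¬ Core J M h f) (ha : ∃ f ∈ F, G.Adj f (h i))
    (hb : ∀ f ∈ F, ¬ G.Adj f (h (!i))) :
    ∃ t ∈ L i, ∀ x ∈ M.verts J, (∃ f ∈ F, G.Adj f x) → x ∈ M.node t := by
  have hrel : ∀ x y, Core J M h x → Core J M h y → (∃ f ∈ F, G.Adj f x) → (∃ f ∈ F, G.Adj f y) →
      Rel J M h L x y := by
    rintro x y hx hy ⟨f, hf, hfx⟩ ⟨g, hg, hgy⟩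
    by_contra hxy
    obtain ⟨p, hp, hpF⟩ := exists_tight hF hout hx hy hf hg hfx hgy hxy
    obtain ⟨q, hq, -⟩ := C.exists_hubPath (i := i) hmax hnd hp
      fun ⟨f, hf, h1⟩ => hb f (hpF f hf) h1
    exact C.hubPath_false hmax hM hq
  have hmem : ∀ x ∈ M.verts J, (∃ f ∈ F, G.Adj f x) → ∃ t ∈ L i, x ∈ M.node t := fun x hx h1 =>
    (C.rel_hub_iff hx).1 (hrel _ x (Or.inr ⟨i, rfl⟩) (Or.inl hx) ha h1)
  by_cases hX : ∃ x ∈ M.verts J, ∃ f ∈ F, G.Adj f x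
  · obtain ⟨x, hx, hx'⟩ := hX
    obtain ⟨t, ht, hxt⟩ := hmem x hx hx'
    refine ⟨t, ht, fun y hy hy' => ?_⟩
    obtain ⟨t', ht', hyt⟩ := hmem y hy hy'
    rwa [C.leaf_node_unique hnd ht ht' hxt hyt
      ((C.rel_iff hx hy).1 (hrel x y (Or.inl hx) (Or.inl hy) hx' hy'))]
  · have := C.finite
    obtain ⟨t, ht⟩ := C.net.ne i
    grind

end CrossSystem

/-! ### Parities along a path seen by two adjacent vertices -/

section Sectors

variable {V : Type*} {G : SimpleGraph V}

theorem IP.concat {l : List V} {b : V} (hl : IP G l) (hb : b ∉ l)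
    (h : ∀ z ∈ l, (G.Adj z b ↔ l.getLast? = some z)) : IP G (l ++ [b]) := by
  rw [IP.append_iff]
  refine ⟨hl, IP.singleton b, fun x hx y hy => ?_⟩
  grind

open Classical in
-- Consecutive neighbours of `v` bound sectors, and `v` closes each of them to an odd cycle, so each
-- has an odd number of edges. Hence the number of edges of the path and the number of sectors have
-- the same parity.
theorem even_sector (hG : EvenHoleFree G) {v : V} (n : ℕ) : ∀ {x : V} {l : List V}, l.length ≤ n →
    IP G (x :: l) → v ∉ x :: l → G.Adj v x → (∀ z, (x :: l).getLast? = some z → G.Adj v z) →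
    Even ((x :: l).length + (x :: l).countP fun z => G.Adj v z) := by
  induction n with
  | zero =>
    grind
  | succ n ih =>
    intro x l hn hl hv hx hlast
    by_cases hl0 : l = []
    · grind
    obtain ⟨u, z, w, rfl, hz, hu⟩ := exists_first (P := fun z => G.Adj v z) (l := l)
      ⟨l.getLast hl0, List.getLast_mem hl0,
        hlast _ (by grind)⟩
    have h1 : IP G (z :: w) := hl.infix (List.IsSuffix.isInfix ⟨x :: u, by simp⟩)
    have h2 : IP G (x :: u ++ [z]) := hl.infix ⟨[], w, by simp⟩
    have h3 := ih (by simp at hn; omega) h1 (fun h3 => hv (by grind)) hz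
      fun y hy => hlast y (by grind)
    have h4 := odd_cone hG h2 (fun h3 => hv (by simp at h3 ⊢; tauto)) (by simp) fun y hy => by grind
    have h5 : u.countP (fun z => G.Adj v z) = 0 := by
      rw [List.countP_eq_zero]
      simpa using hu
    grind

/-- The path from a neighbour of `a` to a neighbour of `b` is closed to an odd cycle by `b` and `a`.
-/
theorem odd_two_hubs (hG : EvenHoleFree G) {a b x j : V} {u : List V} (hab : G.Adj a b)
    (hl : IP G (x :: u ++ [j])) (ha : a ∉ x :: u ++ [j]) (hb : b ∉ x :: u ++ [j])
    (hax : G.Adj a x) (hau : ∀ z ∈ u, ¬ G.Adj a z) (haj : ¬ G.Adj a j) (hbx : ¬ G.Adj b x)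
    (hbu : ∀ z ∈ u, ¬ G.Adj b z) (hbj : G.Adj b j) : Odd u.length := by
  have h1 := hl.concat hb fun z hz => by
    rw [List.getLast?_append_of_ne_nil _ (by simp), G.adj_comm]
    grind
  have h2 := odd_cone hG h1 (x := a) (by grind) (by simp) fun z hz => by grind
  grind

open Classical in
-- Between consecutive neighbours of `a` there is an even number of vertices. By `odd_two_hubs` the
-- pieces before the first and after the last neighbour of `b` are odd, so the middle piece has an
-- even number of vertices, and by `even_sector` evenly many neighbours of `b`.
theorem even_count_gap (hG : EvenHoleFree G) {a b x z : V} {u : List V} (hab : G.Adj a b)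
    (hl : IP G (x :: u ++ [z])) (ha : a ∉ x :: u ++ [z]) (hb : b ∉ x :: u ++ [z])
    (hno : ∀ y ∈ x :: u ++ [z], ¬ (G.Adj a y ∧ G.Adj b y)) (hax : G.Adj a x) (haz : G.Adj a z)
    (hau : ∀ y ∈ u, ¬ G.Adj a y) : Even (u.countP fun y => G.Adj b y) := by
  by_cases hu : ∃ y ∈ u, G.Adj b y
  · have hodd := odd_cone hG hl ha (by simp) fun y hy => by grind
    have hbx : ¬ G.Adj b x := fun h1 => hno x (by simp) ⟨hax, h1⟩
    have hbz : ¬ G.Adj b z := fun h1 => hno z (by simp) ⟨haz, h1⟩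
    obtain ⟨u₁, j, r, rfl, hj, h1⟩ := exists_first hu
    have h2 := odd_two_hubs hG hab (u := u₁) (j := j) (x := x)
      (hl.infix ⟨[], r ++ [z], by simp⟩) (fun h3 => ha (by grind))
      (fun h3 => hb (by grind)) hax (fun y hy => hau y (by simp [hy]))
      (hau j (by simp)) hbx h1 hj
    obtain ⟨m, j', u₃, h3, hj', h4⟩ := exists_last (P := fun y => G.Adj b y) (l := j :: r)
      ⟨j, by simp, hj⟩
    have hip : IP G (z :: u₃.reverse ++ [j']) := by
      rw [← IP.reverse_iff]
      refine hl.infix ⟨x :: u₁ ++ m, [], ?_⟩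
      simp [h3]
    have hsub : ∀ y ∈ z :: u₃.reverse ++ [j'], y ∈ x :: (u₁ ++ j :: r) ++ [z] := fun y hy => by
      rw [h3]
      simp at hy ⊢
      tauto
    have h5 := odd_two_hubs hG hab hip (fun h5 => ha (hsub _ h5)) (fun h5 => hb (hsub _ h5)) haz
      (fun y hy => hau y (by rw [h3]; simp at hy ⊢; tauto)) (hau j' (by rw [h3]; simp)) hbz
      (fun y hy => h4 y (by simpa using hy)) hj'
    obtain ⟨k, hk⟩ : ∃ k, m ++ [j'] = j :: k := by
      cases m with
      | nil => grind
      | cons y m =>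
        grind
    have h6 : j :: r = (j :: k) ++ u₃ := by grind
    have h7 := even_sector hG k.length (v := b) (x := j) (l := k) le_rfl
      (hl.infix ⟨x :: u₁, u₃ ++ [z], by rw [h6]; simp⟩)
      (fun h7 => hb (by rw [h6]; simp at h7 ⊢; tauto)) hj
      (by grind)
    have h8 : u₁.countP (fun y => G.Adj b y) = 0 := by
      rw [List.countP_eq_zero]
      simpa using h1
    have h9 : u₃.countP (fun y => G.Adj b y) = 0 := by
      rw [List.countP_eq_zero]
      simpa using h4
    grind
  · push Not at hu
    rw [List.countP_eq_zero.2 (by simpa using hu)]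
    exact Even.zero

open Classical in
-- Sum of `even_count_gap` over the gaps between consecutive neighbours of `a`; these neighbours
-- themselves are not seen by `b`.
theorem even_count (hG : EvenHoleFree G) {a b : V} (hab : G.Adj a b) (n : ℕ) :
    ∀ {x : V} {l : List V}, l.length ≤ n → IP G (x :: l) → a ∉ x :: l → b ∉ x :: l →
    (∀ y ∈ x :: l, ¬ (G.Adj a y ∧ G.Adj b y)) → G.Adj a x →
    (∀ z, (x :: l).getLast? = some z → G.Adj a z) →
    Even ((x :: l).countP fun z => G.Adj b z) := by
  have hx0 : ∀ {x : V} {l : List V}, (∀ y ∈ x :: l, ¬ (G.Adj a y ∧ G.Adj b y)) → G.Adj a x →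
      ((x :: l).countP fun z => G.Adj b z) = l.countP fun z => G.Adj b z := fun {x l} hno hx => by grind
  induction n with
  | zero =>
    grind
  | succ n ih =>
    intro x l hn hl ha hb hno hx hlast
    rw [hx0 hno hx]
    by_cases hl0 : l = []
    · grind
    obtain ⟨u, z, w, rfl, hz, hu⟩ := exists_first (P := fun z => G.Adj a z) (l := l)
      ⟨l.getLast hl0, List.getLast_mem hl0,
        hlast _ (by grind)⟩
    have h3 := ih (x := z) (l := w) (by simp at hn; omega) (hl.infix (List.IsSuffix.isInfix ⟨x :: u, by simp⟩))
      (fun h3 => ha (by grind)) (fun h3 => hb (by grind))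
      (fun y hy => hno y (by grind)) hz
      fun y hy => hlast y (by grind)
    have h4 := even_count_gap hG hab (x := x) (u := u) (z := z) (hl.infix ⟨[], w, by simp⟩)
      (fun h3 => ha (by simp at h3 ⊢; tauto)) (fun h3 => hb (by simp at h3 ⊢; tauto))
      (fun y hy => hno y (by simp at hy ⊢; tauto)) hx hz hu
    grind

end Sectors

/-- The three tree paths between three vertices cover each edge twice or not at all. -/
theorem LineTree.even_triangle (H : LineTree G J h L ℓ) (u v w : W) :
    Even ((pl J ℓ u v).length + (pl J ℓ u w).length + (pl J ℓ v w).length) := by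
  have hJ := H.tree
  induction hn : J.dist u v generalizing u with
  | zero =>
    rw [hJ.connected.dist_eq_zero_iff] at hn
    subst hn
    rw [pl_self, Nat.even_iff, List.length_nil]
    omega
  | succ n ih =>
    have hvu : v ≠ u := by grind
    have hadj := nx_adj hJ hvu
    have h1 := ih (nx J u v) (by have := nx_dist hJ hvu; omega)
    rw [pl_cons hJ ℓ hvu, List.length_append]
    by_cases hw : nx J u v = nx J u w
    · have h2 := pl_cons hJ ℓ (ne_of_nx_eq hadj hw.symm)
      grind
    · have h2 := nx_back hJ hadj hw
      have h3 := pl_cons hJ ℓ (ne_of_nx_eq hadj.symm h2)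
      rw [h2, H.rev _ _ hadj] at h3
      grind

/-- The path `p` joins the leaf ends of the rungs of `ℓ` at the leaves `t` and `t'`. -/
structure Link (G : SimpleGraph V) (J : SimpleGraph W) (M : StripFamily V W) (h : Bool → V)
    (ℓ : W → W → List V) (p : List V) (t t' : W) : Prop where
  ip : IP G p
  out : ∀ f ∈ p, ¬ Core J M h f
  att : ∀ z ∈ M.verts J, Att G p z → z ∈ M.node t ∨ z ∈ M.node t'
  fst : ∀ s, J.Adj t s → ∀ z, (ℓ t s).head? = some z → Att G p z ∧ ¬ Att G p.tail z
  snd : ∀ s, J.Adj t' s → ∀ z, (ℓ t' s).head? = some z → Att G p z ∧ ¬ Att G p.dropLast z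

theorem Link.reverse {t t' : W} (K : Link G J M h ℓ p t t') : Link G J M h ℓ p.reverse t' t where
  ip := K.ip.reverse
  out f hf := K.out f (List.mem_reverse.1 hf)
  att z hz hp := (K.att z hz (Att.reverse_iff.1 hp)).symm
  fst s hs z hz := by
    rw [List.tail_reverse, Att.reverse_iff, Att.reverse_iff]
    exact K.snd s hs z hz
  snd s hs z hz := by
    rw [List.dropLast_reverse, Att.reverse_iff, Att.reverse_iff]
    exact K.fst s hs z hz

/-! ### Paths linking two leaves and seeing both hubs -/

namespace CrossSystem

theorem leaf_disj (C : CrossSystem G J M h L) {t t' : W} {c d : Bool} {z : V} (ht : t ∈ L c)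
    (ht' : t' ∈ L d) (hz : z ∈ M.node t) (hz' : z ∈ M.node t') : t = t' := by
  obtain ⟨s, hs, hzs⟩ := C.exists_edge_of_node hz
  rcases Sym2.mem_iff.1 (C.node_mem_edge hs hzs hz') with rfl | rfl
  · rfl
  · exact absurd ht' (C.nbr_not_leaf hs.symm ht d)

theorem exists_nbr (C : CrossSystem G J M h L) {t : W} {c : Bool} (ht : t ∈ L c) :
    ∃ s, J.Adj t s ∧ ∀ d, s ∉ L d := by
  obtain ⟨s, hs⟩ := Set.ncard_eq_one.1 (C.isLeaf c t ht)
  have h1 : s ∈ J.neighborSet t := by rw [hs]; rfl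
  exact ⟨s, h1, C.nbr_not_leaf (J.adj_symm h1) ht⟩

theorem link_head (C : CrossSystem G J M h L) (hℓ : Selection G J M ℓ) {t t' w : W}
    (K : Link G J M h ℓ p t t') (hw : w ≠ t) {z : V} (hz : (pl J ℓ t w).head? = some z) :
    Att G p z ∧ ¬ Att G p.tail z :=
  K.fst _ (nx_adj C.sys.tree hw) z (by rwa [(C.lineTree hℓ).pl_head hw] at hz)

theorem pl_verts (C : CrossSystem G J M h L) (hℓ : Selection G J M ℓ) {v x : W} {z : V}
    (hz : z ∈ pl J ℓ v x) : z ∈ M.verts J := C.mBranch_verts (C.mBranch_of_pl hℓ hz).2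

theorem link_cycle (C : CrossSystem G J M h L) (hℓ : Selection G J M ℓ) {t t' : W} {c d : Bool}
    (ht : t ∈ L c) (ht' : t' ∈ L d) (hne : t ≠ t') (K : Link G J M h ℓ p t t') (hp : p ≠ []) :
    Odd (p.length + (pl J ℓ t t').length) := by
  have H := C.lineTree hℓ
  have hlast : (pl J ℓ t t').getLast? = (pl J ℓ t' t).head? := by
    rw [H.pl_reverse t t', List.head?_reverse]
  have h1 := odd_cycle C.ehf (p := p.reverse) (Q := pl J ℓ t t') K.ip.reverse (H.pl_ip t t')
    (fun f hf hf' => K.out f (List.mem_reverse.1 hf) (Or.inl (C.pl_verts hℓ hf'))) (by simpa)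
    ?_ (fun z hz ha => ?_) (fun z hz => ?_) fun z hz => ?_
  · grind
  · by_contra h2
    obtain ⟨z, hz⟩ : ∃ z, pl J ℓ t t' = [z] := by
      have := List.length_pos_iff.2 (H.pl_ne_nil hne.symm)
      exact List.length_eq_one_iff.1 (by omega)
    have h3 := (C.pl_head_iff hℓ (z := z) (v := t) (x := t') (by simp [hz])).1 (by simp [hz])
    have h4 := (C.pl_head_iff hℓ (z := z) (v := t') (x := t)
      (by simp [H.pl_reverse t t', hz])).1 (by grind)
    exact hne (C.leaf_disj ht ht' h3 h4)
  · rcases K.att z (C.pl_verts hℓ hz) (Att.reverse_iff.1 ha) with h2 | h2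
    · exact Or.inl ((C.pl_head_iff hℓ hz).2 h2)
    · rw [hlast]
      refine Or.inr ((C.pl_head_iff hℓ ?_).2 h2)
      rw [H.pl_reverse t t']
      grind
  · rw [List.dropLast_reverse, Att.reverse_iff, Att.reverse_iff]
    exact C.link_head hℓ K hne.symm hz
  · rw [hlast] at hz
    exact C.link_head hℓ K.reverse hne hz

/-- The initial part `A` of the path, up to a first neighbour of the hub, is closed by the hub and
by the tree path from `t` to a leaf of that hub. -/
theorem link_hub_cycle (C : CrossSystem G J M h L) (hℓ : Selection G J M ℓ) {t t' w : W} {e : Bool}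
    (K : Link G J M h ℓ p t t') (hte : t ∉ L e) (hw : w ∈ L e)
    (hwt : ∀ z ∈ pl J ℓ t w, Att G p z → z ∈ M.node t) {A B : List V} (hAB : p = A ++ B)
    (hA : Att G A (h e)) (hA' : ¬ Att G A.dropLast (h e)) :
    Odd (A.length + (pl J ℓ t w).length + 1) := by
  have H := C.lineTree hℓ
  have hne : w ≠ t := fun h1 => hte (h1 ▸ hw)
  have hA0 : A ≠ [] := by grind
  have hmem : ∀ f ∈ A, f ∈ p := fun f hf => hAB ▸ List.mem_append_left _ hf
  have h1 := odd_cycle C.ehf (p := A.reverse) (Q := pl J ℓ t w ++ [h e])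
    ((hAB ▸ K.ip : IP G (A ++ B)).left).reverse (H.pl_hub_ip hte hw) (fun f hf hf' => ?_)
    (by simpa) ?_ (fun z hz ha => ?_) (fun z hz => ?_) fun z hz => ?_
  · grind
  · rw [List.mem_append, List.mem_singleton] at hf'
    exact K.out f (hmem f (List.mem_reverse.1 hf)) (hf'.imp (C.pl_verts hℓ) fun h2 => ⟨e, h2⟩)
  · have := List.length_pos_iff.2 (H.pl_ne_nil hne (ℓ := ℓ))
    grind
  · rw [List.head?_append_of_ne_nil _ (H.pl_ne_nil hne),
      List.getLast?_append_of_ne_nil _ (by simp)]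
    rcases List.mem_append.1 hz with h2 | h2
    · exact Or.inl ((C.pl_head_iff hℓ h2).2
        (hwt z h2 ((Att.reverse_iff.1 ha).mono hmem)))
    grind
  · rw [List.head?_append_of_ne_nil _ (H.pl_ne_nil hne)] at hz
    rw [List.dropLast_reverse, Att.reverse_iff, Att.reverse_iff]
    obtain ⟨h2, h3⟩ := C.link_head hℓ K hne hz
    obtain ⟨f, A, rfl⟩ := List.exists_cons_of_ne_nil hA0
    refine ⟨⟨f, by simp, ?_⟩, fun h4 => h3 (h4.mono fun g hg => by grind)⟩
    exact (not_att_tail_iff K.ip h2 h3 (hmem f (by simp))).2 (by simp [hAB])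
  · rw [List.getLast?_append_of_ne_nil _ (by simp)] at hz
    simp only [List.getLast?_singleton, Option.some.injEq] at hz
    subst hz
    rw [List.tail_reverse, Att.reverse_iff, Att.reverse_iff]
    grind

/-- The leaf ends of the rungs extend the path `p` of a link. -/
theorem link_ends (C : CrossSystem G J M h L) (hℓ : Selection G J M ℓ) {t t' : W} {c : Bool}
    (ht : t ∈ L c) (K : Link G J M h ℓ p t t') : ∃ x s, IP G (x :: p) ∧ x ∈ M.node t ∧
      J.Adj t s ∧ x ∈ M.edge s(t, s) ∧ ∀ e, G.Adj (h e) x ↔ e = c := by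
  obtain ⟨s, hs, -⟩ := C.exists_nbr ht
  have hr := hℓ.isRung hs
  have hx : (ℓ t s).head? = some ((ℓ t s).head hr.ne) := List.head?_eq_some_head hr.ne
  set x := (ℓ t s).head hr.ne
  have hxm : x ∈ ℓ t s := List.mem_of_head? hx
  obtain ⟨h1, h2⟩ := K.fst s hs x hx
  have hxv := mem_verts_of_edge hs (hr.sub x hxm)
  have hxt := (hr.fst x hxm).2 hx
  refine ⟨x, s, ⟨fun hf => K.out x hf (Or.inl hxv), fun f hf => by
    rw [G.adj_comm, not_att_tail_iff K.ip h1 h2 hf], K.ip⟩, hxt, hs, hr.sub x hxm, fun e => ?_⟩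
  rw [C.hub e x hxv]
  constructor
  · rintro ⟨u, hu, hxu⟩
    exact C.disj' hu (C.leaf_disj hu ht hxu hxt ▸ ht)
  grind

theorem hub_not_mem (K : Link G J M h ℓ p t t') (e : Bool) : h e ∉ p :=
  fun h1 => K.out _ h1 (Or.inr ⟨e, rfl⟩)

open Classical in
-- Two leaves of one class. The cycle through the tree path from `t` to `t'`, and the cycles through
-- `h (!c)` from either end, show that the part of `p` between the first and last neighbours of `h
-- (!c)` has oddly many vertices, hence by `even_sector` oddly many neighbours of `h (!c)`. But
-- `even_count`, applied to `p` prolonged by the two leaf ends that `h c` sees, makes their number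
-- even.
theorem link_same_false (C : CrossSystem G J M h L) (hℓ : Selection G J M ℓ) {t t' : W} {c : Bool}
    (ht : t ∈ L c) (ht' : t' ∈ L c) (hne : t ≠ t') (K : Link G J M h ℓ p t t')
    (hc : Att G p (h (!c))) (hno : ∀ f ∈ p, ¬ (G.Adj (h c) f ∧ G.Adj (h (!c)) f)) : False := by
  have H := C.lineTree hℓ
  have hp : p ≠ [] := by
    rintro rfl
    obtain ⟨f, hf, -⟩ := hc
    simp at hf
  have := C.finite
  obtain ⟨w, hw⟩ := C.net.ne (!c)
  have hwn : ∀ {t t' : W} {p : List V}, t ∈ L c → t' ∈ L c → t ≠ t' → Link G J M h ℓ p t t' →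
      ∀ z ∈ pl J ℓ t w, Att G p z → z ∈ M.node t := by
    intro t t' p ht ht' hne K z hz ha
    rcases K.att z (C.pl_verts hℓ hz) ha with h1 | h1
    · exact h1
    · have h2 := (C.hub c z (C.pl_verts hℓ hz)).2 ⟨t', ht', h1⟩
      obtain ⟨s, hs, hsL⟩ := C.exists_nbr ht
      rw [H.hub_pl_of_leaf ht hs (hsL c) (fun h3 => C.disj c t ht (h3 ▸ hw)) hz] at h2
      rcases h2 with h2 | ⟨h2, -⟩
      · exact absurd (C.leaf_disj ht ht' ((C.pl_head_iff hℓ hz).1 h2) h1) hne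
      · exact absurd hw (C.disj c w h2)
  have hc' : ∃ z ∈ p, G.Adj (h (!c)) z := by
    obtain ⟨f, hf, h1⟩ := hc
    tauto
  obtain ⟨A, g, r, hp1, hg, hA⟩ := exists_first hc'
  obtain ⟨m, g', B, hp2, hg', hB⟩ := exists_last (P := fun z => G.Adj (h (!c)) z) (l := g :: r)
    ⟨g, by simp, hg⟩
  have e1 := C.link_cycle hℓ ht ht' hne K hp
  have e2 := C.link_hub_cycle hℓ K (C.disj c t ht) hw (hwn ht ht' hne K) (A := A ++ [g]) (B := r)
    (by simp [hp1]) ⟨g, by simp, hg.symm⟩ (by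
      rw [List.dropLast_concat]
      rintro ⟨f, hf, h1⟩
      tauto)
  have e3 := C.link_hub_cycle hℓ K.reverse (C.disj c t' ht') hw (hwn ht' ht hne.symm K.reverse)
    (A := B.reverse ++ [g']) (B := (A ++ m).reverse) (by simp [hp1, hp2])
    ⟨g', by simp, hg'.symm⟩ (by
      rw [List.dropLast_concat]
      rintro ⟨f, hf, h1⟩
      exact hB f (List.mem_reverse.1 hf) h1.symm)
  have e4 := H.even_triangle t t' w
  obtain ⟨k, hk⟩ : ∃ k, m ++ [g'] = g :: k := by
    cases m with
    | nil => grind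
    | cons y m =>
      grind
  have hp3 : p = A ++ (g :: k) ++ B := by grind
  have e5 := even_sector C.ehf k.length (v := h (!c)) (x := g) (l := k) le_rfl
    (K.ip.infix ⟨A, B, hp3.symm⟩)
    (fun h7 => hub_not_mem K (!c) (by grind)) hg
    (by grind)
  obtain ⟨x, s, hx, hxt, hs, hxs, hxh⟩ := C.link_ends hℓ ht K
  obtain ⟨y, s', hy, hyt, hs', hys, hyh⟩ := C.link_ends hℓ ht' K.reverse
  have hy : IP G (p ++ [y]) := by simpa using hy.reverse
  have hxy : x ≠ y := fun h1 => hne (C.leaf_disj ht ht' hxt (h1 ▸ hyt))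
  have hl : IP G (x :: (p ++ [y])) := by
    refine ⟨by simpa [hxy] using hx.1, fun z hz => ?_, hy⟩
    rw [List.head?_append_of_ne_nil _ hp]
    rcases List.mem_append.1 hz with h1 | h1
    · exact hx.2.1 z h1
    · rw [List.mem_singleton] at h1
      subst h1
      refine iff_of_false (C.sys.anticomplete t s t' s' hs hs' hne
        (fun h1 => C.nbr_not_leaf hs'.symm ht' c (h1 ▸ ht))
        (fun h1 => C.nbr_not_leaf hs.symm ht c (h1 ▸ ht'))
        (fun h1 => hne (C.one c s ⟨hs.symm, ht⟩ ⟨h1 ▸ hs'.symm, ht'⟩)) x hxs z hys) fun h1 => ?_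
      have := hy.nodup
      rw [List.nodup_append] at this
      exact this.2.2 z (List.mem_of_head? h1) z (by simp) rfl
  have hin : ∀ e, h e ∉ x :: (p ++ [y]) := fun e => by
    have h1 := C.ne_hub (mem_verts_of_edge hs hxs) e
    have h2 := C.ne_hub (mem_verts_of_edge hs' hys) e
    simp [h1.symm, h2.symm, hub_not_mem K e]
  have hcc : (!c) ≠ c := by simp
  have hxc : ¬ G.Adj (h (!c)) x := fun h1 => hcc ((hxh _).1 h1)
  have hyc : ¬ G.Adj (h (!c)) y := fun h1 => hcc ((hyh _).1 h1)
  have e6 := even_count C.ehf (C.hubs c) (p ++ [y]).length le_rfl hl (hin c) (hin _) (fun z hz => by grind) ((hxh c).2 rfl) fun z hz => by grind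
  have h8 : A.countP (fun y => G.Adj (h (!c)) y) = 0 := by
    rw [List.countP_eq_zero]
    simpa using hA
  have h9 : B.countP (fun y => G.Adj (h (!c)) y) = 0 := by
    rw [List.countP_eq_zero]
    simpa using hB
  grind

/-- The part behind the last neighbour of `h c` is closed by `h c` and a tree path from `t'` to some
leaf of `L c` other than `t`; that tree path is odd by `odd_pl`. -/
theorem link_gap (C : CrossSystem G J M h L) (hℓ : Selection G J M ℓ) {t t' : W} {c d : Bool}
    (hd : d = !c) (ht : t ∈ L c) (ht' : t' ∈ L d) (K : Link G J M h ℓ p t t') {A B : List V} {g : V}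
    (hp : p = A ++ g :: B) (hg : G.Adj (h c) g) (hB : ∀ z ∈ B, ¬ G.Adj (h c) z) :
    Even B.length := by
  subst hd
  have H := C.lineTree hℓ
  obtain ⟨s, hs, hsL⟩ := C.exists_nbr ht'
  have ht'c : t' ∉ L c := fun h1 => C.disj c t' h1 ht'
  obtain ⟨u, hu, hut, huL⟩ : ∃ u, J.Adj s u ∧ u ≠ nx J s t ∧ u ∉ L (!c) := by
    obtain ⟨u₁, u₂, h1, h2, h3, h4, h5⟩ := C.exists_two hsL hs.symm
    by_cases h6 : u₁ = nx J s t
    · exact ⟨u₂, h2, fun h7 => h5 (h6.trans h7.symm),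
        fun h7 => h4 (C.one _ s ⟨h2, h7⟩ ⟨hs.symm, ht'⟩)⟩
    · exact ⟨u₁, h1, h6, fun h7 => h3 (C.one _ s ⟨h1, h7⟩ ⟨hs.symm, ht'⟩)⟩
  obtain ⟨w, hw, hb⟩ := C.exists_leaf_beyond hu.ne' c huL
  have hwt : w ≠ t := by
    rintro rfl
    rw [hb.nx_eq C.sys.tree hu.ne', nx_of_adj C.sys.tree hu] at hut
    exact hut rfl
  have h1 := C.link_hub_cycle hℓ K.reverse ht'c hw (fun z hz ha => by
    have hzv := C.pl_verts hℓ hz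
    refine (K.reverse.att z hzv ha).resolve_right fun h2 => ?_
    have h3 := (H.hub_pl ht'c hz).1 ((C.hub c z hzv).2 ⟨t, ht, h2⟩)
    have h4 : z ∈ pl J ℓ w t' := by
      rw [H.pl_reverse t' w]
      grind
    refine hwt (C.leaf_disj hw ht ((C.pl_head_iff hℓ h4).1 ?_) h2)
    rw [H.pl_reverse t' w, List.head?_reverse]
    exact h3.2) (A := B.reverse ++ [g]) (B := A.reverse) (by simp [hp]) ⟨g, by simp, hg.symm⟩ (by
      rw [List.dropLast_concat]
      rintro ⟨f, hf, h1⟩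
      exact hB f (List.mem_reverse.1 hf) h1.symm)
  have h2 := H.odd_pl C.ehf ht' hs (hsL _) (t' := w) (by simpa using hw)
  grind

open Classical in
-- Two leaves of different classes. The link has even length by `link_cycle` and `odd_pl`. With
-- `link_gap` and `even_sector` it follows that `h d` has evenly many neighbours on `p`, but oddly
-- many behind the last neighbour of `h c`, the latter from the path that starts at `h c` itself. By
-- `even_count` the number before that neighbour is even, a contradiction.
theorem link_diff_false (C : CrossSystem G J M h L) (hℓ : Selection G J M ℓ) {t t' : W}
    {c d : Bool} (hd : d = !c) (ht : t ∈ L c) (ht' : t' ∈ L d) (K : Link G J M h ℓ p t t')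
    (hatt : ∀ e, ∃ f ∈ p, G.Adj (h e) f) (hno : ∀ f ∈ p, ¬ (G.Adj (h c) f ∧ G.Adj (h d) f)) :
    False := by
  have H := C.lineTree hℓ
  have hcd : c ≠ d := by simp [hd]
  have hab : G.Adj (h c) (h d) := hd ▸ C.hubs c
  have hp : p ≠ [] := by
    rintro rfl
    simp_all
  obtain ⟨s₀, hs₀, hsL⟩ := C.exists_nbr ht
  have e1 := C.link_cycle hℓ ht ht' (fun h1 => C.disj c t ht (hd ▸ h1 ▸ ht')) K hp
  have e2 := H.odd_pl C.ehf ht hs₀ (hsL c) (hd ▸ ht')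
  obtain ⟨A, g, B, hp1, hg, hB⟩ := exists_last (hatt c)
  obtain ⟨A', g', B', hp2, hg', hA'⟩ := exists_first (hatt d)
  have e3 := C.link_gap hℓ hd ht ht' K hp1 hg hB
  have e4 := C.link_gap hℓ (by simp [hd]) ht' ht K.reverse (A := B'.reverse) (B := A'.reverse)
    (by simp [hp2]) hg' fun z hz => hA' z (List.mem_reverse.1 hz)
  obtain ⟨x, s, hx, hxt, hs, hxs, hxh⟩ := C.link_ends hℓ ht K
  obtain ⟨y, s', hy, hyt, hs', hys, hyh⟩ := C.link_ends hℓ ht' K.reverse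
  have hy : IP G (p ++ [y]) := by simpa using hy.reverse
  have hxv := fun e => C.ne_hub (mem_verts_of_edge hs hxs) e
  have hyv := fun e => C.ne_hub (mem_verts_of_edge hs' hys) e
  have hxd : ¬ G.Adj (h d) x := fun h1 => hcd ((hxh d).1 h1).symm
  have hyc : ¬ G.Adj (h c) y := fun h1 => hcd ((hyh c).1 h1)
  have hgd : ¬ G.Adj (h d) g := fun h1 => hno g (by simp [hp1]) ⟨hg, h1⟩
  have e5 := even_sector C.ehf (v := h d) (x := g') (l := B' ++ [y]) _ le_rfl
    (hy.infix ⟨A', [], by simp [hp2]⟩)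
    (fun h7 => hub_not_mem K d (by grind)) hg' fun z hz => by grind
  have hgB : IP G (g :: B ++ [y]) := hy.infix ⟨A, [], by simp [hp1]⟩
  have hcn : h c ∉ g :: B ++ [y] := fun h7 => hub_not_mem K c (by grind)
  have hdn : h d ∉ g :: B ++ [y] := fun h7 => hub_not_mem K d (by grind)
  have e6 := even_sector C.ehf (v := h d) (x := h c) (l := g :: B ++ [y]) _ le_rfl
    ⟨hcn, fun z hz => by grind, hgB⟩
    (fun h7 => (List.mem_cons.1 h7).elim (fun h8 => hab.ne h8.symm) hdn) hab.symm fun z hz => by grind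
  have hin : ∀ e, h e ∉ x :: (A ++ [g]) := fun e h7 => hub_not_mem K e (by grind)
  have e7 := even_count C.ehf hab (x := x) (l := A ++ [g]) _ le_rfl
    (hx.infix ⟨[], B, by simp [hp1]⟩) (hin c) (hin d) (fun z hz => by grind)
    ((hxh c).2 rfl) fun z hz => by grind
  have h8 : A'.countP (fun y => G.Adj (h d) y) = 0 := by
    rw [List.countP_eq_zero]
    simpa using hA'
  have hyd : G.Adj (h d) y := (hyh d).2 rfl
  have e8 := congrArg (List.countP fun z => G.Adj (h d) z) (hp1.symm.trans hp2)
  have e9 := congrArg List.length hp1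
  have e10 := congrArg List.length hp2
  simp only [List.countP_append, List.countP_cons, List.countP_nil, hxd, hgd, hg', hyd, hab.symm,
    decide_false, decide_true, if_true, Bool.false_eq_true, if_false, List.length_append,
    List.length_cons, List.length_nil, List.length_reverse, h8] at *
  grind

theorem link_false (C : CrossSystem G J M h L) (hℓ : Selection G J M ℓ) {t t' : W} {c d : Bool}
    (ht : t ∈ L c) (ht' : t' ∈ L d) (hne : t ≠ t') (K : Link G J M h ℓ p t t')
    (hatt : ∀ e, ∃ f ∈ p, G.Adj (h e) f)
    (hno : ∀ f ∈ p, ¬ (G.Adj (h true) f ∧ G.Adj (h false) f)) : False := by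
  have hno' : ∀ c, ∀ f ∈ p, ¬ (G.Adj (h c) f ∧ G.Adj (h (!c)) f) := by
    rintro (_ | _) f hf
    exacts [fun h1 => hno f hf h1.symm, hno f hf]
  by_cases hcd : d = c
  · subst hcd
    obtain ⟨f, hf, h1⟩ := hatt (!d)
    exact C.link_same_false hℓ ht ht' hne K ⟨f, hf, h1.symm⟩ (hno' d)
  · have := Bool.eq_not_of_ne hcd
    exact C.link_diff_false hℓ this ht ht' K hatt (this ▸ hno' c)

end CrossSystem

variable {F : Set V}

theorem IP.connected (hp : IP G p) (h0 : p ≠ []) : (G.induce {z | z ∈ p}).Connected := by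
  obtain ⟨w, -, hw⟩ := hp.exists_walk (List.head?_eq_some_head h0)
    (List.getLast?_eq_some_getLast h0)
  rw [← hw]
  exact w.connected_induce_support

/-! ### Connected sets in which no vertex sees both hubs -/

namespace CrossSystem

/-- A set seeing exactly one hub is confined to one leaf node by `hub_attachments`. A set seeing no
hub would contain a tight path excluded by `tight_att_hub`, since vertices of different leaf nodes
are unrelated. -/
theorem hubs_of_two_leaves [Finite V] (C : CrossSystem G J M h L) (hmax : MaxVerts G J M h L)
    (hnd : Nondeg J M L) (hM : MaxEdges G J h) (hF : (G.induce F).Connected)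
    (hout : ∀ f ∈ F, ¬ Core J M h f) {t t' : W} {c d : Bool} (ht : t ∈ L c) (ht' : t' ∈ L d)
    (hne : t ≠ t') {x y : V} (hx : x ∈ M.node t) (hy : y ∈ M.node t') (hfx : ∃ f ∈ F, G.Adj f x)
    (hfy : ∃ f ∈ F, G.Adj f y) (e : Bool) : ∃ f ∈ F, G.Adj f (h e) := by
  have hxv := C.node_mem_verts hx
  have hyv := C.node_mem_verts hy
  by_contra he
  by_cases he' : ∃ f ∈ F, G.Adj f (h (!e))
  · obtain ⟨t₀, ht₀, h1⟩ := C.hub_attachments hmax hnd hM hF hout he' fun f hf h1 =>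
      he ⟨f, hf, by grind⟩
    exact hne ((C.leaf_disj ht ht₀ hx (h1 x hxv hfx)).trans
      (C.leaf_disj ht' ht₀ hy (h1 y hyv hfy)).symm)
  · obtain ⟨f, hf, hfx⟩ := hfx
    obtain ⟨g, hg, hgy⟩ := hfy
    obtain ⟨p, hp, hpF⟩ := exists_tight (L := L) hF hout (Or.inl hxv) (Or.inl hyv) hf hg hfx hgy
      fun h1 => hne (C.leaf_node_unique hnd ht ht' hx hy ((C.rel_iff hxv hyv).1 h1))
    obtain ⟨b, f, hf, hfb⟩ := C.tight_att_hub hmax hnd hp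
    by_cases hb : b = e
    · grind
    · exact he' ⟨f, hpF f hf, Bool.eq_not_of_ne hb ▸ hfb⟩

/-- A shortest path containing `f` and seeing a hub sees only one. Indeed, if it saw both, an end
different from `f` could only be dropped at the cost of losing all hubs, so that end would see both;
hence `f` would be both ends, and it too would see both hubs. Now `hub_attachments` applies to this
path. -/
theorem leaf_of_hub [Finite V] (C : CrossSystem G J M h L) (hmax : MaxVerts G J M h L)
    (hnd : Nondeg J M L) (hM : MaxEdges G J h) (hF : (G.induce F).Connected)
    (hout : ∀ f ∈ F, ¬ Core J M h f) (hno : ∀ f ∈ F, ¬ (G.Adj (h true) f ∧ G.Adj (h false) f))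
    (ha : ∃ c, ∃ f ∈ F, G.Adj f (h c)) {x f : V} (hx : x ∈ M.verts J) (hf : f ∈ F)
    (hfx : G.Adj f x) : ∃ c, ∃ t ∈ L c, x ∈ M.node t := by
  obtain ⟨c, g, hg, hgc⟩ := ha
  obtain ⟨p, hp, hpF, h1, h2⟩ := exists_ip_of_reachable (hF.preconnected ⟨f, hf⟩ ⟨g, hg⟩)
  obtain ⟨p, hp, hpF, ⟨hfp, c, hpc⟩, hmin⟩ := exists_minimal_list
    (P := fun p => f ∈ p ∧ ∃ c, Att G p (h c))
    ⟨p, hp, hpF, List.mem_of_head? h1, c, g, List.mem_of_getLast? h2, hgc⟩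
  have hp0 : p ≠ [] := List.ne_nil_of_mem hfp
  have hc : ¬ Att G p (h (!c)) := by
    intro hpc'
    have hboth : ∀ g ∈ p, ¬ (G.Adj g (h c) ∧ G.Adj g (h (!c))) := by
      intro g hg h3
      have := hno g (hpF g hg)
      simp only [G.adj_comm _ g] at this
      cases c
      exacts [this h3.symm, this h3]
    have key : ∀ q g, IP G q → (∀ z ∈ q, z ∈ p) → q.length < p.length →
        (∀ z ∈ p, z ∈ q ∨ z = g) → g ∈ p → f = g := by
      intro q g hq hqp hlt hcov hg
      by_contra hfg
      have h3 := hmin q hq hqp hlt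
      have h4 : ∀ c, Att G p (h c) → G.Adj g (h c) := by
        rintro c ⟨z, hz, hzc⟩
        rcases hcov z hz with h5 | rfl
        · exact absurd ⟨(hcov f hfp).resolve_right hfg, c, z, h5, hzc⟩ h3
        · exact hzc
      grind
    obtain ⟨z, l, rfl⟩ := List.exists_cons_of_ne_nil hp0
    have h3 := key l z hp.tail (fun y hy => by simp [hy]) (by simp)
      (fun y hy => (List.mem_cons.1 hy).symm) (by simp)
    have h4 := key (z :: l).dropLast ((z :: l).getLast hp0) hp.dropLast
      (fun y hy => List.mem_of_mem_dropLast hy) (by simp) (fun y hy =>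
        (mem_dropLast_or_getLast? hy).imp id fun h5 => by grind) (List.getLast_mem hp0)
    have h5 : l = [] := by
      by_contra h5
      rw [List.getLast_cons h5, h3] at h4
      exact hp.1 (h4 ▸ List.getLast_mem h5)
    subst h5
    obtain ⟨y, hy, hyc⟩ := hpc
    obtain ⟨y', hy', hyc'⟩ := hpc'
    grind
  obtain ⟨t, ht, h3⟩ := C.hub_attachments hmax hnd hM (hp.connected hp0)
    (fun f hf => hout f (hpF f hf)) hpc fun f hf h3 => hc ⟨f, hf, h3⟩
  grind

theorem exists_link_selection (C : CrossSystem G J M h L) {x y : V} {t t' : W} {c d : Bool}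
    (ht : t ∈ L c) (ht' : t' ∈ L d) (hne : t ≠ t') (hx : x ∈ M.node t) (hy : y ∈ M.node t') :
    ∃ ℓ, Selection G J M ℓ ∧ (∀ s, J.Adj t s → (ℓ t s).head? = some x) ∧
      ∀ s, J.Adj t' s → (ℓ t' s).head? = some y := by
  obtain ⟨s, hs, hxs⟩ := C.exists_edge_of_node hx
  obtain ⟨s', hs', hys⟩ := C.exists_edge_of_node hy
  obtain ⟨l, hl, hxl⟩ := C.exists_rung hs hxs
  obtain ⟨l', hl', hyl⟩ := C.exists_rung hs' hys
  obtain ⟨ℓ₀, h0⟩ := C.exists_selection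
  obtain ⟨ℓ₁, h1, h2, -⟩ := C.exists_selection_through h0 hs hl
  obtain ⟨ℓ, h3, h4, h5⟩ := C.exists_selection_through h1 hs' hl'
  refine ⟨ℓ, h3, fun u hu => ?_, fun u hu => ?_⟩
  · rw [C.leaf_unique ht hu hs, h5 t s fun h6 => ?_, h2]
    · exact (hl.fst x hxl).1 hx
    · have : t ∈ s(t', s') := h6 ▸ Sym2.mem_mk_left t s
      rcases Sym2.mem_iff.1 this with rfl | rfl
      exacts [hne rfl, C.nbr_not_leaf hs'.symm ht' c ht]
  · rw [C.leaf_unique ht' hu hs', h4]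
    exact (hl'.fst y hyl).1 hy

/-- A minimal path attached to two leaf nodes sees both hubs by `hubs_of_two_leaves`, and by
minimality all its attachments lie in these two nodes, each reached from one end as `Link` demands.
`link_false` excludes it. -/
theorem single_leaf [Finite V] (C : CrossSystem G J M h L) (hmax : MaxVerts G J M h L)
    (hnd : Nondeg J M L) (hM : MaxEdges G J h) (hF : (G.induce F).Connected)
    (hout : ∀ f ∈ F, ¬ Core J M h f) (hno : ∀ f ∈ F, ¬ (G.Adj (h true) f ∧ G.Adj (h false) f))
    (ha : ∃ c, ∃ f ∈ F, G.Adj f (h c)) :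
    ∃ c, ∃ t ∈ L c, ∀ x ∈ M.verts J, (∃ f ∈ F, G.Adj f x) → x ∈ M.node t := by
  have hleaf : ∀ x ∈ M.verts J, (∃ f ∈ F, G.Adj f x) → ∃ c, ∃ t ∈ L c, x ∈ M.node t :=
    fun x hx ⟨f, hf, hfx⟩ => C.leaf_of_hub hmax hnd hM hF hout hno ha hx hf hfx
  by_contra hcon
  obtain ⟨x, t, c, y, t', d, ht, hx, hfx, ht', hy, hfy, hne⟩ : ∃ x t c y t' d, t ∈ L c ∧
      x ∈ M.node t ∧ (∃ f ∈ F, G.Adj f x) ∧ t' ∈ L d ∧ y ∈ M.node t' ∧ (∃ f ∈ F, G.Adj f y) ∧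
      t ≠ t' := by
    by_contra h1
    refine hcon ?_
    by_cases hX : ∃ x ∈ M.verts J, ∃ f ∈ F, G.Adj f x
    · obtain ⟨x, hx, hfx⟩ := hX
      grind
    · have := C.finite
      obtain ⟨t, ht⟩ := C.net.ne true
      grind
  obtain ⟨f, hf, hfx⟩ := hfx
  obtain ⟨g, hg, hgy⟩ := hfy
  obtain ⟨p, hp, hpF, h1, h2⟩ := exists_ip_of_reachable (hF.preconnected ⟨f, hf⟩ ⟨g, hg⟩)
  let P : List V → Prop := fun p => ∃ x t c y t' d, t ∈ L c ∧ x ∈ M.node t ∧ Att G p x ∧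
    t' ∈ L d ∧ y ∈ M.node t' ∧ Att G p y ∧ t ≠ t'
  obtain ⟨p, hp, hpF, ⟨x, t, c, y, t', d, ht, hx, hpx, ht', hy, hpy, hne⟩, hmin⟩ :=
    exists_minimal_list (P := P) ⟨p, hp, hpF, x, t, c, y, t', d, ht, hx,
      ⟨f, List.mem_of_head? h1, hfx⟩, ht', hy, ⟨g, List.mem_of_getLast? h2, hgy⟩, hne⟩
  have hp0 : p ≠ [] := by
    rintro rfl
    obtain ⟨f, hf, -⟩ := hpx
    simp at hf
  have hlen := List.length_pos_iff.2 hp0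
  have hhub := C.hubs_of_two_leaves hmax hnd hM (hp.connected hp0)
    (fun f hf => hout f (hpF f hf)) ht ht' hne hx hy hpx hpy
  have hnop : ∀ f ∈ p, ¬ (G.Adj (h true) f ∧ G.Adj (h false) f) := fun f hf => hno f (hpF f hf)
  -- A path of one vertex would have a vertex that both hubs see.
  have hp1 : p.tail ≠ [] := by
    intro h3
    obtain ⟨z, hz⟩ := List.length_eq_one_iff.1 (show p.length = 1 by
      have := congrArg List.length h3
      rw [List.length_tail, List.length_nil] at this
      omega)
    subst hz
    obtain ⟨f, hf, hft⟩ := hhub true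
    obtain ⟨g, hg, hgf⟩ := hhub false
    have hf : f = z := by simpa using hf
    have hg : g = z := by simpa using hg
    subst hf hg
    exact hnop g (by simp) ⟨hft.symm, hgf.symm⟩
  have hT : ¬ P p.tail := hmin _ hp.tail (fun z hz => List.mem_of_mem_tail hz)
    (by rw [List.length_tail]; omega)
  have hD : ¬ P p.dropLast := hmin _ hp.dropLast (fun z hz => List.mem_of_mem_dropLast hz)
    (by rw [List.length_dropLast]; omega)
  have hsplit : ∀ z, Att G p z → Att G p.tail z ∨ Att G p.dropLast z := by
    obtain ⟨u, l, rfl⟩ := List.exists_cons_of_ne_nil hp0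
    rintro z ⟨f, hf, hfz⟩
    rcases mem_tail_or_head? hf with h3 | h3
    · exact Or.inl ⟨f, h3, hfz⟩
    · refine Or.inr ⟨f, ?_, hfz⟩
      obtain ⟨w, l', rfl⟩ := List.exists_cons_of_ne_nil (show l ≠ [] from hp1)
      grind
  have fin : ∀ x t c y t' d, t ∈ L c → x ∈ M.node t → Att G p x → t' ∈ L d → y ∈ M.node t' →
      Att G p y → t ≠ t' → ¬ Att G p.tail x → ¬ Att G p.dropLast y → False := by
    intro x t c y t' d ht hx hpx ht' hy hpy hne hxt hyd
    obtain ⟨ℓ, hℓ, hℓx, hℓy⟩ := C.exists_link_selection ht ht' hne hx hy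
    refine C.link_false hℓ ht ht' hne ⟨hp, fun f hf => hout f (hpF f hf), fun z hz hpz => ?_,
      fun s hs z hz => ?_, fun s hs z hz => ?_⟩
      (fun e => (hhub e).imp fun f hf => ⟨hf.1, hf.2.symm⟩) hnop
    · obtain ⟨e, t₀, ht₀, hz₀⟩ := hleaf z hz (hpz.imp fun f hf => ⟨hpF f hf.1, hf.2⟩)
      rcases hsplit z hpz with h3 | h3
      · refine Or.inr (by_contra fun h4 => hT ⟨z, t₀, e, y, t', d, ht₀, hz₀, h3, ht', hy,
          (hsplit y hpy).resolve_right hyd, fun h5 => h4 (h5 ▸ hz₀)⟩)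
      · refine Or.inl (by_contra fun h4 => hD ⟨z, t₀, e, x, t, c, ht₀, hz₀, h3, ht, hx,
          (hsplit x hpx).resolve_left hxt, fun h5 => h4 (h5 ▸ hz₀)⟩)
    · rw [hℓx s hs, Option.some.injEq] at hz
      grind
    · rw [hℓy s hs, Option.some.injEq] at hz
      grind
  by_cases hxt : Att G p.tail x
  · have hyt : ¬ Att G p.tail y := fun h3 => hT ⟨x, t, c, y, t', d, ht, hx, hxt, ht', hy, h3, hne⟩
    exact fin y t' d x t c ht' hy hpy ht hx hpx hne.symm hyt fun h3 =>
      hD ⟨x, t, c, y, t', d, ht, hx, h3, ht', hy, (hsplit y hpy).resolve_left hyt, hne⟩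
  · exact fin x t c y t' d ht hx hpx ht' hy hpy hne hxt fun h3 =>
      hD ⟨x, t, c, y, t', d, ht, hx, (hsplit x hpx).resolve_left hxt, ht', hy, h3, hne⟩

end CrossSystem

/-! ### Escaping from a vertex to the strip system off a closed neighbourhood -/

theorem IsExternal.of_walk {S : Set V} {c x y : V} (hx : x ∈ S \ closedNbhd G c) (p : G.Walk y x)
    (hp : ∀ z ∈ p.support, G.Adj c z → z = y) : IsExternal G S c y := by
  classical
  exact ⟨x, hx, p.bypass, p.bypass_isPath, fun z hz => hp z (p.support_bypass_subset_support hz)⟩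

theorem exists_walk_of_induce {D : Set V} {f x : D} (hr : (G.induce D).Reachable f x) :
    ∃ p : G.Walk f.1 x.1, ∀ y ∈ p.support, y ∈ D := by
  obtain ⟨l, hl, hD, h1, h2⟩ := exists_ip_of_reachable hr
  obtain ⟨p, -, hp⟩ := hl.exists_walk h1 h2
  exact ⟨p, hp ▸ hD⟩

/-- The path is stopped just before it first enters `S`. -/
theorem exists_escape {S D : Set V} {f x : D} (hr : (G.induce D).Reachable f x) (hf : f.1 ∉ S)
    (hx : x.1 ∈ S) : ∃ F : Set V, (G.induce F).Connected ∧ f.1 ∈ F ∧ F ⊆ D ∧ (∀ z ∈ F, z ∉ S) ∧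
      ∃ y ∈ S, y ∈ D ∧ ∃ g ∈ F, G.Adj g y := by
  obtain ⟨p, hp, hpD, h1, h2⟩ := exists_ip_of_reachable hr
  obtain ⟨u, y, r, rfl, hy, hu⟩ := exists_first (P := (· ∈ S)) (l := p)
    ⟨x.1, List.mem_of_getLast? h2, hx⟩
  have hu0 : u ≠ [] := by grind
  rw [List.head?_append_of_ne_nil _ hu0] at h1
  refine ⟨{z | z ∈ u}, hp.left.connected hu0, List.mem_of_head? h1, fun z hz => hpD z (by simp_all),
    hu, y, hy, hpD y (by simp), u.getLast hu0, List.getLast_mem hu0, ?_⟩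
  exact ((IP.append_iff.1 hp).2.2 _ (List.getLast_mem hu0) y (by simp)).2.2
    ⟨List.getLast?_eq_some_getLast hu0, rfl⟩

/-- The vertex `f` may itself be a neighbour of `a`; splendidness then provides the first step out
of N[a], and afterwards the connectedness of the non-neighbours is used. -/
theorem Splendid.exists_escape {a : V} (ha : Splendid G a) {S : Set V} {x f : V} (hx : x ∈ S)
    (hxa : x ∉ closedNbhd G a) (hf : f ∉ S) (hfa : f ≠ a) :
    ∃ F : Set V, (G.induce F).Connected ∧ f ∈ F ∧ (∀ z ∈ F, z = f ∨ z ∉ closedNbhd G a) ∧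
      (∀ z ∈ F, z ∉ S) ∧ ∃ y ∈ S, y ∉ closedNbhd G a ∧ ∃ g ∈ F, G.Adj g y := by
  have hle : (closedNbhd G a)ᶜ ⊆ insert f (closedNbhd G a)ᶜ := Set.subset_insert _ _
  have hr : ∀ w : ((closedNbhd G a)ᶜ : Set V),
      (G.induce (insert f (closedNbhd G a)ᶜ)).Reachable ⟨w.1, hle w.2⟩ ⟨x, hle hxa⟩ := fun w =>
    (ha.connected.preconnected w ⟨x, hxa⟩).map (G.induceHomOfLE hle).toHom
  have hfr : (G.induce (insert f (closedNbhd G a)ᶜ)).Reachable ⟨f, Set.mem_insert _ _⟩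
      ⟨x, hle hxa⟩ := by
    by_cases h1 : G.Adj a f
    · obtain ⟨w, hw, hfw⟩ := ha.nbr f h1
      exact (SimpleGraph.Adj.reachable (show (G.induce _).Adj ⟨f, _⟩ ⟨w, hle hw⟩ from hfw)).trans
        (hr ⟨w, hw⟩)
    · exact hr ⟨f, fun h2 => h2.elim hfa h1⟩
  obtain ⟨F, h1, h2, h3, h4, y, hy, hyD, hg⟩ := TreeStrip.exists_escape hfr hf hx
  grind

/-- If there were no escape, the vertices reachable from `f` off N[b] and the remaining ones would
form the two sides of a full star cutset. -/
theorem exists_escape_of_not_cutset {b : V} (hb : ¬ HasFullStarCutset G b) {S : Set V} {x f : V}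
    (hx : x ∈ S) (hxb : x ∉ closedNbhd G b) (hf : f ∉ S) (hfb : f ∉ closedNbhd G b) :
    ∃ F : Set V, (G.induce F).Connected ∧ f ∈ F ∧ F ⊆ (closedNbhd G b)ᶜ ∧
      (∀ z ∈ F, z ∉ S) ∧ ∃ y ∈ S, y ∉ closedNbhd G b ∧ ∃ g ∈ F, G.Adj g y := by
  refine exists_escape (f := ⟨f, hfb⟩) (x := ⟨x, hxb⟩) ?_ hf hx
  by_contra hr
  let R : Set V := {w | ∃ hw : w ∈ (closedNbhd G b)ᶜ,
    (G.induce (closedNbhd G b)ᶜ).Reachable ⟨f, hfb⟩ ⟨w, hw⟩}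
  refine hb ⟨R, (closedNbhd G b)ᶜ \ R, ⟨f, hfb, SimpleGraph.Reachable.refl _⟩,
    ⟨x, hxb, fun ⟨_, h1⟩ => hr h1⟩, Set.disjoint_sdiff_right,
    Set.union_sdiff_cancel fun w hw => hw.1, ?_⟩
  rintro y ⟨hy, hyr⟩ z ⟨hz, hzr⟩ hyz
  exact hzr ⟨hz, hyr.trans (SimpleGraph.Adj.reachable (show (G.induce _).Adj ⟨y, hy⟩ ⟨z, hz⟩ from hyz))⟩

namespace CrossSystem

theorem not_adj_hub (C : CrossSystem G J M h L) {t : W} {c d : Bool} (ht : t ∈ L c) {x : V}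
    (hx : x ∈ M.node t) (hcd : d ≠ c) : ¬ G.Adj (h d) x := fun h1 => by
  obtain ⟨u, hu, hxu⟩ := (C.hub d x (C.node_mem_verts hx)).1 h1
  exact hcd (C.disj' (C.leaf_disj hu ht hxu hx ▸ hu) ht)

theorem exists_far_vertex (C : CrossSystem G J M h L) (d : Bool) :
    ∃ x ∈ M.verts J, x ∉ closedNbhd G (h d) := by
  have := C.finite
  obtain ⟨t, ht⟩ := C.net.ne (!d)
  obtain ⟨s, hs, -⟩ := C.exists_nbr ht
  obtain ⟨x, -, hx⟩ := C.exists_node_mem hs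
  have hxv := C.node_mem_verts hx
  exact ⟨x, hxv, fun h1 => h1.elim (C.ne_hub hxv d) (C.not_adj_hub ht hx (by simp))⟩

theorem node_leaf_subset (C : CrossSystem G J M h L) {t : W} {c : Bool} (ht : t ∈ L c) :
    ∃ e ∈ J.edgeSet, M.node t ⊆ M.edge e := by
  obtain ⟨s, hs, -⟩ := C.exists_nbr ht
  refine ⟨s(t, s), hs, fun x hx => ?_⟩
  obtain ⟨u, hu, hxu⟩ := C.exists_edge_of_node hx
  rwa [C.leaf_unique ht hs hu]

/-- Both sets contain `f`, so their union is connected and `single_leaf` applies to it. The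
attachment `y` that `h d` does not see decides to which hub the leaf belongs. -/
theorem single_leaf_far [Finite V] (C : CrossSystem G J M h L) (hmax : MaxVerts G J M h L)
    (hnd : Nondeg J M L) (hM : MaxEdges G J h) {F₁ F₂ : Set V} (h1 : (G.induce F₁).Connected)
    (h2 : (G.induce F₂).Connected) {f : V} (hf₁ : f ∈ F₁) (hf₂ : f ∈ F₂)
    (hout : ∀ g, g ∈ F₁ ∨ g ∈ F₂ → ¬ Core J M h g)
    (hno : ∀ g, g ∈ F₁ ∨ g ∈ F₂ → ¬ (G.Adj (h true) g ∧ G.Adj (h false) g))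
    {c : Bool} (hc : G.Adj f (h c)) {d : Bool} {y : V} (hy : y ∈ M.verts J)
    (hyd : ¬ G.Adj (h d) y) (hgy : ∃ g ∈ F₂, G.Adj g y) :
    ∃ t ∈ L (!d), ∀ x ∈ M.verts J, (∃ g, (g ∈ F₁ ∨ g ∈ F₂) ∧ G.Adj g x) → x ∈ M.node t := by
  obtain ⟨e, t, ht, h3⟩ := C.single_leaf (F := F₁ ∪ F₂) hmax hnd hM
    (SimpleGraph.induce_union_connected h1.preconnected h2.preconnected ⟨f, hf₁, hf₂⟩) hout hno ⟨c, f, Or.inl hf₁, hc⟩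
  obtain ⟨g, hg, hgy⟩ := hgy
  have h4 : e ≠ d := by
    rintro rfl
    exact hyd ((C.hub e y hy).2 ⟨t, ht, h3 y hy ⟨g, Or.inr hg, hgy⟩⟩)
  exact ⟨t, Bool.eq_not_of_ne h4 ▸ ht, h3⟩

end CrossSystem

end EdgeMaximality

end TreeStrip

theorem mainTheorem5 {V W : Type*} [Finite V] (G : SimpleGraph V) (hG : EvenHoleFree G)
    (a b : V) (hab : G.Adj a b) (ha : Splendid G a)
    (J : SimpleGraph W) (M : StripFamily V W) (α β : Set W)
    (hopt : IsOptimal G a b J M α β)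
    (Z Y : Set V) (hZ : Z = commonNbrs G a b) (hY : Y = majorVerts G (M.verts J) a b) :
    (∀ v ∈ M.verts J, (∃ z ∈ Z \ Y, G.Adj v z) → ∃ t ∈ β, v ∈ M.node t) ∧
    (∀ s t, J.Adj s t → t ∈ α → M.node s ∩ M.node t = ∅) ∧
    (∀ F X : Set V, IsSmall G (M.verts J) a b F → X = attachments G (M.verts J) F →
      (¬ HasFullStarCutset G b → ∀ f ∈ F, ¬ G.Adj a f) ∧
      (Anticomplete G F ({b} ∪ (Z \ Y)) →
        (∃ e ∈ J.edgeSet, X ⊆ M.edge e) ∨ (∃ t, t ∉ α ∧ X ⊆ M.node t)) ∧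
      ((∃ c ∈ {b} ∪ (Z \ Y), ∃ f ∈ F, G.Adj c f) → ∃ t ∈ β, X ⊆ M.node t)) := by
  obtain ⟨n, T, -, ⟨iso⟩⟩ := hopt.exists_tree
  have hW : Finite W := Finite.of_equiv _ iso.symm.toEquiv
  have hE := hopt.crossEdge
  let h : Bool → V := fun c => cond c a b
  let L : Bool → Set W := fun c => cond c α β
  have C : CrossSystem G J M h L := by
    have hleaf : ∀ t, (t ∈ α ∨ t ∈ β) ↔ IsLeaf J t := fun t => Set.ext_iff.1 hE.union t
    refine ⟨hG, hW, hopt.system, ?_, ?_, fun t ht => ?_, ?_, hE.degree_ne_two, ?_, ?_, ?_⟩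
    · rintro (_ | _)
      exacts [hab.symm, hab]
    · grind
    · rcases (hleaf t).2 ht with h1 | h1
      exacts [⟨true, h1⟩, ⟨false, h1⟩]
    · rintro (_ | _) t ht ht'
      exacts [Set.disjoint_left.1 hE.disjoint ht' ht, Set.disjoint_left.1 hE.disjoint ht ht']
    · rintro (_ | _) s
      exacts [hE.right s, hE.left s]
    · rintro (_ | _) h1 <;> rw [StripFamily.verts, Set.mem_iUnion₂] at h1 <;>
        obtain ⟨e, he, h2⟩ := h1
      exacts [(hE.notMem e he).2 h2, (hE.notMem e he).1 h2]
    · rintro (_ | _) x hx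
      exacts [hE.adj_right x hx, hE.adj_left x hx]
  have hmax : MaxVerts G J M h L := fun M' C' => hopt.verts_max M' α β C'.sys
    ⟨hab, hE.union, hE.disjoint, C'.deg, C'.sys.three_le, C'.one true, C'.one false,
      fun e he => ⟨fun h1 => C'.hub_notMem true (CrossSystem.mem_verts_of_edge he h1),
        fun h1 => C'.hub_notMem false (CrossSystem.mem_verts_of_edge he h1)⟩,
      C'.hub true, C'.hub false⟩
  have hM : MaxEdges G J h := hopt.edges_max
  have hnd := C.nondeg ha.noShortPyramid
  obtain ⟨xa, hxa, hxa'⟩ := C.exists_far_vertex true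
  obtain ⟨xb, hxb, hxb'⟩ := C.exists_far_vertex false
  -- Every common neighbour is a-external because `a` is splendid. So a common neighbour that is not
  -- major fails to be b-external.
  have hminor : ∀ z ∈ Z \ Y, ¬ IsExternal G (M.verts J) b z := by
    rintro z ⟨hz, hzY⟩ hzb
    rw [hZ] at hz
    rw [hY] at hzY
    refine hzY ⟨hz, ?_, hzb⟩
    obtain ⟨w, hw, hzw⟩ := ha.nbr z hz.1
    obtain ⟨p, hp⟩ := exists_walk_of_induce (ha.connected.preconnected ⟨w, hw⟩ ⟨xa, hxa'⟩)
    exact IsExternal.of_walk ⟨hxa, hxa'⟩ (SimpleGraph.Walk.cons hzw p) fun y hy hay =>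
      (List.mem_cons.1 hy).resolve_right fun hy => hp y hy (Or.inr hay)
  -- A walk from such a vertex to V(M) that meets neighbours of `b` at its two ends only must
  -- therefore end in a neighbour of `b`.
  have hnb : ∀ z ∈ Z \ Y, ∀ v ∈ M.verts J, ∀ p : G.Walk z v,
      (∀ y ∈ p.support, G.Adj b y → y = z ∨ y = v) → ∃ t ∈ β, v ∈ M.node t := by
    intro z hz v hv p hp
    rw [← hE.adj_right v hv]
    by_contra hbv
    exact hminor z hz (IsExternal.of_walk ⟨hv, fun h1 => h1.elim (C.ne_hub hv false) hbv⟩ p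
      fun y hy hby => (hp y hy hby).resolve_right fun h1 => hbv (h1 ▸ hby))
  refine ⟨fun v hv ⟨z, hz, hvz⟩ => hnb z hz v hv hvz.symm.toWalk (by simp), fun s t hst ht => ?_,
    fun F X hF hX => ?_⟩
  · exact Set.eq_empty_iff_forall_notMem.2 fun x hx => hnd s t hst ht x hx.1 hx.2
  have hFS : ∀ f ∈ F, f ∉ commonNbrs G a b ∧ f ∉ M.verts J := fun f hf =>
    ⟨fun h1 => Set.disjoint_left.1 hF.disjoint hf (Or.inl h1),
      fun h1 => Set.disjoint_left.1 hF.disjoint hf (Or.inr h1)⟩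
  have hout : ∀ f ∈ F, ¬ Core J M h f := by
    rintro f hf (h1 | ⟨_ | _, rfl⟩)
    exacts [(hFS f hf).2 h1, hF.right_notMem hf, hF.left_notMem hf]
  have hXv : ∀ x ∈ X, x ∈ M.verts J ∧ ∃ f ∈ F, G.Adj f x := by
    intro x hx
    rw [hX] at hx
    obtain ⟨hx, f, hf, h1⟩ := hx
    tauto
  have hba : b ∈ closedNbhd G a := Or.inr hab
  have hab' : a ∈ closedNbhd G b := Or.inr hab.symm
  refine ⟨fun hcut f hf haf => ?_, fun hFb => ?_, fun hFb => ?_⟩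
  · have hfb : f ∉ closedNbhd G b := by
      rintro (rfl | h1)
      exacts [hF.right_notMem hf, (hFS f hf).1 ⟨haf, h1⟩]
    obtain ⟨F₁, c1, f1, n1, s1, y, hy, hyb, g, hg, hgy⟩ :=
      exists_escape_of_not_cutset hcut hxb hxb' (hFS f hf).2 hfb
    obtain ⟨F₂, c2, f2, n2, s2, y', hy', hya, hg'⟩ :=
      ha.exists_escape hxa hxa' (hFS f hf).2 haf.ne'
    -- `F₁` escapes off N[b] and `F₂` off N[a] apart from `f`, so no vertex of their union sees both
    -- hubs. The attachment `y'`, not seen by `a`, puts the leaf in `β`; then `y` is seen by `b`,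
    -- although `F₁` was chosen to reach a vertex that `b` does not see.
    obtain ⟨t, ht, h1⟩ := C.single_leaf_far hmax hnd hM c1 c2 f1 f2 (c := true) (d := true)
      (by
        rintro g (hg | hg) (h1 | ⟨_ | _, rfl⟩)
        · exact s1 g hg h1
        · exact n1 hg (Or.inl rfl)
        · exact n1 hg hab'
        · exact s2 g hg h1
        · exact (n2 _ hg).elim (fun h1 => hfb (Or.inl h1.symm)) fun h1 => h1 hba
        · exact (n2 _ hg).elim (fun h1 => haf.ne h1) fun h1 => h1 (Or.inl rfl))
      (by
        rintro g (hg | hg) ⟨h1, h2⟩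
        · exact n1 hg (Or.inr h2)
        · rcases n2 g hg with rfl | h3
          exacts [hfb (Or.inr h2), h3 (Or.inr h1)])
      haf.symm hy' (fun h1 => hya (Or.inr h1)) hg'
    exact hyb (Or.inr ((C.hub false y hy).2 ⟨t, ht, h1 y hy ⟨g, Or.inl hg, hgy⟩⟩))
  · have hb : ∀ f ∈ F, ¬ G.Adj f b := fun f hf => hFb f hf b (Or.inl rfl)
    by_cases haF : ∃ f ∈ F, G.Adj f a
    · obtain ⟨t, ht, h1⟩ := C.hub_attachments (i := true) hmax hnd hM hF.connected hout haF hb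
      obtain ⟨e, he, h2⟩ := C.node_leaf_subset ht
      grind
    · have hrel : ∀ x ∈ X, ∀ y ∈ X, RelJ J M x y := by
        intro x hx y hy
        by_contra hxy
        obtain ⟨hxv, f, hf, hfx⟩ := hXv x hx
        obtain ⟨hyv, g, hg, hgy⟩ := hXv y hy
        obtain ⟨p, hp, hpF⟩ := exists_tight (L := L) hF.connected hout (Or.inl hxv) (Or.inl hyv)
          hf hg hfx hgy fun h1 => hxy ((C.rel_iff hxv hyv).1 h1)
        obtain ⟨_ | _, k, hk, hkh⟩ := C.tight_att_hub hmax hnd hp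
        exacts [hb k (hpF k hk) hkh, haF ⟨k, hpF k hk, hkh⟩]
      rcases C.relJ_cases (fun x hx => (hXv x hx).1) hrel with h1 | ⟨v, hv⟩
      · exact Or.inl h1
      -- The node of a leaf lies in one strip, so a leaf in `α` leads to the first alternative.
      · by_cases hvα : v ∈ α
        · obtain ⟨e, he, h2⟩ := C.node_leaf_subset (c := true) hvα
          grind
        grind
  · by_cases hbF : ∃ f ∈ F, G.Adj f b
    · obtain ⟨f, hf, hfb⟩ := hbF
      have hfa : f ∉ closedNbhd G a := by
        rintro (rfl | h1)
        exacts [hF.left_notMem hf, (hFS f hf).1 ⟨h1, hfb.symm⟩]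
      obtain ⟨F₂, c2, f2, n2, s2, y, hy, hya, hg⟩ :=
        ha.exists_escape hxa hxa' (hFS f hf).2 fun h1 => hfa (Or.inl h1)
      have n2 : ∀ z ∈ F₂, z ∉ closedNbhd G a := fun z hz => (n2 z hz).elim (fun h1 => h1 ▸ hfa) id
      -- Since `f` sees `b` it does not see `a`, so `F` can be enlarged by an escape off N[a]. The
      -- attachment `y` is not seen by `a` and forces the leaf into `β`.
      obtain ⟨t, ht, h1⟩ := C.single_leaf_far hmax hnd hM hF.connected c2 hf f2 (c := false)
        (d := true)
        (by
          rintro g (hg | hg)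
          · exact hout g hg
          · rintro (h1 | ⟨_ | _, rfl⟩)
            exacts [s2 g hg h1, n2 _ hg hba, n2 _ hg (Or.inl rfl)])
        (by
          rintro g (hg | hg) h1
          exacts [(hFS g hg).1 h1, n2 g hg (Or.inr h1.1)])
        hfb hy (fun h1 => hya (Or.inr h1)) hg
      grind
    · obtain ⟨z, hz, f, hf, hzf⟩ := hFb
      have hz : z ∈ Z \ Y := by
        rcases hz with rfl | hz
        exacts [absurd ⟨f, hf, hzf.symm⟩ hbF, hz]
      -- Here `b` sees nothing in `F`, so a walk from `z` through `F` to a vertex of `X` meets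
      -- neighbours of `b` at its ends only.
      have hXβ : ∀ x ∈ X, ∃ t ∈ β, x ∈ M.node t := by
        intro x hx
        obtain ⟨hxv, g, hg, hgx⟩ := hXv x hx
        obtain ⟨p, hp⟩ := exists_walk_of_induce (hF.connected.preconnected ⟨f, hf⟩ ⟨g, hg⟩)
        refine hnb z hz x hxv (SimpleGraph.Walk.cons hzf (p.concat hgx)) fun y hy hby => ?_
        rw [SimpleGraph.Walk.support_cons, List.mem_cons, SimpleGraph.Walk.support_concat,
          List.mem_append, List.mem_singleton] at hy
        rcases hy with rfl | hy | rfl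
        exacts [Or.inl rfl, absurd ⟨y, hp y hy, hby.symm⟩ hbF, Or.inr rfl]
      rcases X.eq_empty_or_nonempty with rfl | ⟨x, hx⟩
      · obtain ⟨t, ht⟩ := C.net.ne false
        grind
      · obtain ⟨t, ht, hxt⟩ := hXβ x hx
        refine ⟨t, ht, fun y hy => ?_⟩
        obtain ⟨t', ht', hyt⟩ := hXβ y hy
        by_contra hyt'
        -- Attachments in two different leaf nodes would force a neighbour of `b` in `F`.
        exact hbF (C.hubs_of_two_leaves (c := false) (d := false) hmax hnd hM hF.connected hout
          ht ht' (fun h1 => hyt' (h1 ▸ hyt)) hxt hyt (hXv x hx).2 (hXv y hy).2 false)
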